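/- **Setting.** Let $d\ge 1$ be an integer, $\frac{d}{d+1}<p\le\infty$, $s\ge 0$, $k\in\mathbb N$ and $\lambda,\rho\in\mathbb R$. Fix $\beta>0$ and a Schwartz function $\chi$ on $\mathbb R^d$ with $\operatorname{supp}\hat\chi\subset\{|\xi|\le 1\}$ and $\sum_{m\in\mathbb Z^d}\hat\chi(\xi-\beta m)=1$ for all $\xi$, where $\hat\chi(\xi)=\int\chi(x)e^{-2\pi i x\cdot\xi}\,dx$. Let $M^{p,1}_{0,s}=M^{p,1}_{0,s}(\mathbb R^d)$ be the (quasi-)Banach space of all tempered distributions $f$ with $$\|f\|_{M^{p,1}_{0,s}}=\sum_{m\in\mathbb Z^d}\big\|f*(e^{2\pi i\beta m\cdot(\,\cdot\,)}\chi)\big\|_{L^p}\,(1+|\beta m|^2)^{s/2}<\infty .$$ Let $f$ be either $p_k(z)=\lambda|z|^{2k}z$ or $e_\rho(z)=\lambda(e^{\rho|z|^2}-1)z$ $(z\in\mathbb C)$, and consider $$u_{tt}-\Delta u+f(u)=0,\qquad u(\cdot,0)=u_0,\qquad u_t(\cdot,0)=u_1. \tag{NLW}$$ A solution in $C([0,T),M^{p,1}_{0,s})$,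 $0<T\le\infty$, is a continuous map $u:[0,T)\to M^{p,1}_{0,s}$ with $u(0)=u_0$ that satisfies (NLW) in the sense of distributions: for every Schwartz function $\varphi$ the function $t\mapsto\langle u(t),\varphi\rangle$ is twice differentiable on $[0,T)$ (one-sidedly at $0$), with derivative $\langle u_1,\varphi\rangle$ at $t=0$ and second derivative $\langle\Delta u(t)-f(u(t)),\varphi\rangle$. **Theorem 1.2.** There is a function $T_0:[0,\infty)^2\to(0,\infty)$, nonincreasing in each variable and depending only on $d,p,s,f$ and on the choice of $(\beta,\chi)$, such that for all $u_0,u_1\in M^{p,1}_{0,s}(\mathbb R^d)$ there is a maximal time $T^*\in(0,\infty]$ with $T^*>T_0\big(\|u_0\|_{M^{p,1}_{0,s}},\|u_1\|_{M^{p,1}_{0,s}}\big)$ and the following properties: 1. (NLW) has a solution $u\in C([0,T^*),M^{p,1}_{0,s}(\mathbb R^d))$; 2. if $v\in C([0,T'),M^{p,1}_{0,s}(\mathbb R^d))$, $0<T'\le\infty$, is any solution of (NLW) with the same data, then $T'\le T^*$ and $v=u$ on $[0,T')$; 3. if $T^*<\infty$, then $\displaystyle\limsup_{t\uparrow T^*}\|u(\cdot,t)\|_{M^{p,1}_{0,s}}=\infty$.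 -/

import Mathlib

open MeasureTheory Filter Topology
open scoped SchwartzMap ENNReal NNReal FourierTransform Laplacian InnerProductSpace

namespace NLW

/-- The Euclidean space `ℝ^d`. -/
abbrev Sp (d : ℕ) : Type := EuclideanSpace ℝ (Fin d)

variable {d : ℕ}

/-! ### Modulation and convolution -/

theorem hasTemperateGrowth_cexp :
    Function.HasTemperateGrowth (fun t : ℝ => Complex.exp ((2 * Real.pi * Complex.I) * t)) := by
  set c : ℂ := 2 * Real.pi * Complex.I with hc
  have key : ∀ n : ℕ, iteratedDeriv n (fun t : ℝ => Complex.exp (c * t))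
      = fun t : ℝ => c ^ n * Complex.exp (c * t) := by
    intro n
    induction n with
    | zero => simp
    | succ n ih =>
      rw [iteratedDeriv_succ, ih]
      funext t
      have h1 : HasDerivAt (fun t : ℝ => c * (t : ℂ)) (c * 1) t :=
        (Complex.ofRealCLM.hasDerivAt (x := t)).const_mul c
      have h2 := (h1.cexp).const_mul (c ^ n)
      rw [h2.deriv]
      ring
  refine ⟨?_, fun n => ⟨0, ‖c‖ ^ n, fun t => ?_⟩⟩
  · exact Complex.contDiff_exp.comp (contDiff_const.mul Complex.ofRealCLM.contDiff)
  · rw [norm_iteratedFDeriv_eq_norm_iteratedDeriv, key n]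
    have : ‖Complex.exp (c * t)‖ = 1 := by
      have : c * t = ((2 * Real.pi * t : ℝ) : ℂ) * Complex.I := by
        rw [hc]; push_cast; ring
      rw [this, Complex.norm_exp_ofReal_mul_I]
    simp [this]

/-- The character `x ↦ e^{2πi ω·x}`. -/
noncomputable def character (ω : Sp d) (x : Sp d) : ℂ :=
  Complex.exp ((2 * Real.pi * Complex.I) * ((⟪ω, x⟫_ℝ : ℝ) : ℂ))

theorem hasTemperateGrowth_character (ω : Sp d) : Function.HasTemperateGrowth (character ω) :=
  hasTemperateGrowth_cexp.comp (innerSL ℝ ω).hasTemperateGrowth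

/-- The modulation `M_ω χ (x) = e^{2πi ω·x} χ(x)` of a Schwartz function. -/
noncomputable def modulate (ω : Sp d) (χ : 𝓢(Sp d, ℂ)) : 𝓢(Sp d, ℂ) :=
  SchwartzMap.smulLeftCLM ℂ (character ω) χ

theorem modulate_apply (ω : Sp d) (χ : 𝓢(Sp d, ℂ)) (x : Sp d) :
    modulate ω χ x = character ω x * χ x := by
  simp [modulate, SchwartzMap.smulLeftCLM_apply_apply (hasTemperateGrowth_character ω)]

/-- The Schwartz function `y ↦ h (x - y)`. -/
noncomputable def reflectAt (x : Sp d) (h : 𝓢(Sp d, ℂ)) : 𝓢(Sp d, ℂ) :=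
  SchwartzMap.compCLMOfAntilipschitz ℂ (g := fun y : Sp d => x - y) (K := 1) (by fun_prop)
    (fun _ _ => by simp [edist_dist, dist_eq_norm, norm_sub_rev]) h

theorem reflectAt_apply (x : Sp d) (h : 𝓢(Sp d, ℂ)) (y : Sp d) :
    reflectAt x h y = h (x - y) := rfl

/-- The convolution `f ∗ h` of a tempered distribution with a Schwartz function; it is the
function `x ↦ ⟨f, h (x - ·)⟩`. -/
noncomputable def conv (f : 𝓢'(Sp d, ℂ)) (h : 𝓢(Sp d, ℂ)) (x : Sp d) : ℂ :=
  f (reflectAt x h)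

/-! ### Modulation spaces -/

/-- The point `β k` of the lattice `β ℤ^d`. -/
noncomputable def latticePoint (β : ℝ) (k : Fin d → ℤ) : Sp d :=
  WithLp.toLp 2 (fun i => β * (k i : ℝ))

/-- The pairs `(β, χ)` used to define modulation spaces: `β > 0`, `supp χ̂ ⊆ {|ξ| ≤ 1}` and
`∑_{k ∈ ℤ^d} χ̂ (ξ - β k) = 1` for every `ξ`. -/
structure IsAdmissibleWindow (β : ℝ) (χ : 𝓢(Sp d, ℂ)) : Prop where
  pos : 0 < β
  support_subset : Function.support (𝓕 χ : 𝓢(Sp d, ℂ)) ⊆ Metric.closedBall 0 1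
  hasSum_one : ∀ ξ : Sp d, HasSum (fun k : Fin d → ℤ => (𝓕 χ : 𝓢(Sp d, ℂ)) (ξ - latticePoint β k)) 1

/-- The (quasi-)norm of `M^{p,1}_{0,s}`,
`‖f‖ = ∑_{k ∈ ℤ^d} ‖f ∗ (M_{βk} χ)‖_{L^p} ⟨β k⟩^s`, with values in `[0, ∞]`. -/
noncomputable def modNorm (β : ℝ) (χ : 𝓢(Sp d, ℂ)) (p : ℝ≥0∞) (s : ℝ) (f : 𝓢'(Sp d, ℂ)) :
    ℝ≥0∞ :=
  ∑' k : Fin d → ℤ, eLpNorm (conv f (modulate (latticePoint β k) χ)) p volume *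
    ENNReal.ofReal ((1 + ‖latticePoint β k‖ ^ 2) ^ (s / 2))

/-- The modulation space `M^{p,1}_{0,s}(ℝ^d)`: all tempered distributions of finite
(quasi-)norm. -/
def modSpace (β : ℝ) (χ : 𝓢(Sp d, ℂ)) (p : ℝ≥0∞) (s : ℝ) : Set 𝓢'(Sp d, ℂ) :=
  {f | modNorm β χ p s f < ∞}

/-! ### The nonlinear wave equation -/

/-- The power nonlinearity `p_k(z) = λ |z|^{2k} z`. -/
noncomputable def powerNL (lam : ℝ) (k : ℕ) (z : ℂ) : ℂ :=
  (lam : ℂ) * ((‖z‖ ^ (2 * k) : ℝ) : ℂ) * z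

/-- The exponential nonlinearity `e_ρ(z) = λ (e^{ρ |z|²} - 1) z`. -/
noncomputable def expNL (lam rho : ℝ) (z : ℂ) : ℂ :=
  (lam : ℂ) * ((Real.exp (rho * ‖z‖ ^ 2) - 1 : ℝ) : ℂ) * z

/-- The tempered distribution `w` is the function `g`: `⟨w, φ⟩ = ∫ g φ` for every Schwartz
function `φ`, the integral being absolutely convergent. -/
def Represents (g : Sp d → ℂ) (w : 𝓢'(Sp d, ℂ)) : Prop :=
  ∀ φ : 𝓢(Sp d, ℂ), Integrable (fun x => g x * φ x) volume ∧ w φ = ∫ x, g x * φ x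

/-- The time interval `[0, T)`, for `T ∈ [0, ∞]`. -/
def timeInterval (T : ℝ≥0∞) : Set ℝ := {t | 0 ≤ t ∧ ENNReal.ofReal t < T}

/-- `u ∈ C(I, M^{p,1}_{0,s})`: all values lie in the space, and `u` is continuous for its
(quasi-)norm. -/
def ContinuousIntoModSpace (β : ℝ) (χ : 𝓢(Sp d, ℂ)) (p : ℝ≥0∞) (s : ℝ) (I : Set ℝ)
    (u : ℝ → 𝓢'(Sp d, ℂ)) : Prop :=
  ∀ t ∈ I, u t ∈ modSpace β χ p s ∧
    Tendsto (fun τ => modNorm β χ p s (u τ - u t)) (𝓝[I] t) (𝓝 0)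

/-- `u` solves `u_tt - Δu + F(u) = 0`, `u(0) = u₀`, `u_t(0) = u₁` on the time interval `I`
(which contains `0`), in the sense of distributions: `u(t)` and `F(u(t))` are functions
that are tempered distributions, here `g t` and `F ∘ g t`; `u_t = v` and `v_t = Δu - F(u)` hold
after testing with any Schwartz function (with one-sided derivatives at `t = 0`). -/
def SolvesNLW (F : ℂ → ℂ) (u₀ u₁ : 𝓢'(Sp d, ℂ)) (I : Set ℝ) (u : ℝ → 𝓢'(Sp d, ℂ)) : Prop :=
  u 0 = u₀ ∧
  ∃ (v w : ℝ → 𝓢'(Sp d, ℂ)) (g : ℝ → Sp d → ℂ),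
    v 0 = u₁ ∧
    ∀ t ∈ I,
      Represents (g t) (u t) ∧ Represents (fun x => F (g t x)) (w t) ∧
      ∀ φ : 𝓢(Sp d, ℂ),
        HasDerivWithinAt (fun τ => u τ φ) (v t φ) I t ∧
        HasDerivWithinAt (fun τ => v τ φ) ((Δ (u t)) φ - w t φ) I t

/-- `u` is a solution in `C([0, T), M^{p,1}_{0,s})` of the Cauchy problem. -/
def IsSolution (β : ℝ) (χ : 𝓢(Sp d, ℂ)) (p : ℝ≥0∞) (s : ℝ) (F : ℂ → ℂ)
    (u₀ u₁ : 𝓢'(Sp d, ℂ)) (T : ℝ≥0∞) (u : ℝ → 𝓢'(Sp d, ℂ)) : Prop :=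
  ContinuousIntoModSpace β χ p s (timeInterval T) u ∧ SolvesNLW F u₀ u₁ (timeInterval T) u

end NLW

namespace NLW

open scoped Convolution

variable {d : ℕ}

/-! The dynamics is solved in the space with `p = ∞`, and the exponent `p` enters only afterwards.
Frequency blocks are band-limited, so Bernstein's inequality (`IsBand.exists_enorm_le`) embeds
`modSpace` into `Alg P`, the bounded continuous functions whose blocks have summable weighted sup
norms (`exists_alg_of_modNorm`, `an_le_modNorm`).

`Alg P` is a Banach algebra. A product of blocks at `βl` and `βm` meets the block at `βk` only if
`‖β(k - l - m)‖ ≤ 3` (`cv_cv_mul_cv_eq_zero`), so norms of products are controlled by discrete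
convolutions (`IsAdmissibleWindow.xn_mul_le`). It is stable under conjugation, and both
nonlinearities are power series in `u` and its conjugate, hence Lipschitz on balls
(`Alg.norm_nl_sub_le`).

The cosine propagator is bounded on `Alg P` without loss of derivatives. Its symbol is an entire
function of `‖ξ‖ ^ 2`, and Cauchy's estimates bound its derivatives along lines uniformly in the
frequency (`norm_iteratedDeriv_cosMul_line_le`). Its kernel on a block therefore has an `L¹` norm
independent of the block (`exists_lw_cosS_le`). The sine propagator is the time integral of the
cosine one, so low frequencies cause no trouble. Abstract Volterra theory gives a maximal solution
in `Alg P` with a lower bound for its lifespan (`exists_maximal_mild`, `exists_mild_of_bound`).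

The solution stays in the space with exponent `p` for as long as it exists in `Alg P`. For this a
Peetre maximal function is used that also takes the supremum over time. For `p ≥ 1` the nonlinearity
is `f * H` with `H` a bounded coefficient, and a weight `e^{-γt}` with `γ` large lets this linear
term be absorbed (`persistence_of_one_le`). For `p < 1` the case `p = 1` comes for free, because
band-limited `L^p` functions lie in `L¹`. Apart from a linear term the nonlinearity is quadratic,
and a product of two `L¹` majorants that are also bounded lies in `L^p` as soon as `p ≥ 1 / 2`
(`persistence_of_lt_one`). The bound `d / (d + 1) < p` with `d ≥ 1` ensures this. The maximal
function is a majorant uniform in time, so continuity follows by dominated convergence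
(`tendsto_modNorm_of_majorant`).

Conversely every distributional solution is mild: each block of its difference from Duhamel's
formula satisfies a second order equation in which the Laplacian is bounded, and Grönwall's
inequality applies (`Alg.eq_duhamel`). This gives uniqueness and maximality. Blow-up in `Alg P`
forces blow-up in the modulation space, since the norm of the former is dominated by that of the
latter. -/

/-- Bounded continuous functions on `ℝ^d`. -/
abbrev BF (d : ℕ) : Type := BoundedContinuousFunction (Sp d) ℂ

/-! ### Convolution operators on bounded continuous functions -/

/-- Convolution of Schwartz functions. -/
noncomputable def sconv (f g : 𝓢(Sp d, ℂ)) : 𝓢(Sp d, ℂ) :=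
  SchwartzMap.convolution (ContinuousLinearMap.mul ℂ ℂ) f g

theorem sconv_coe (f g : 𝓢(Sp d, ℂ)) :
    (sconv f g : Sp d → ℂ) = (f : Sp d → ℂ) ⋆[ContinuousLinearMap.mul ℂ ℂ] g := by
  funext x
  exact SchwartzMap.convolution_apply _ f g x

theorem sconv_apply (f g : 𝓢(Sp d, ℂ)) (x : Sp d) : sconv f g x = ∫ y, f y * g (x - y) := by
  rw [sconv_coe]; rfl

theorem fourier_sconv_apply (f g : 𝓢(Sp d, ℂ)) (ξ : Sp d) :
    (𝓕 (sconv f g) : 𝓢(Sp d, ℂ)) ξ = (𝓕 f : 𝓢(Sp d, ℂ)) ξ * (𝓕 g : 𝓢(Sp d, ℂ)) ξ := by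
  rw [sconv, SchwartzMap.fourier_convolution]; rfl

/-- Fourier inversion. Identities between convolutions, modulations and multipliers are checked by
comparing transforms, where they become pointwise algebra. -/
theorem fourier_injective {f g : 𝓢(Sp d, ℂ)}
    (h : ∀ ξ, (𝓕 f : 𝓢(Sp d, ℂ)) ξ = (𝓕 g : 𝓢(Sp d, ℂ)) ξ) : f = g := by
  have : 𝓕 f = 𝓕 g := SchwartzMap.ext h
  have h2 := congrArg (FourierTransformInv.fourierInv (F := 𝓢(Sp d, ℂ))) this
  rwa [FourierTransform.fourierInv_fourier_eq, FourierTransform.fourierInv_fourier_eq] at h2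

theorem sconv_comm (f g : 𝓢(Sp d, ℂ)) : sconv f g = sconv g f :=
  fourier_injective fun ξ => by rw [fourier_sconv_apply, fourier_sconv_apply, mul_comm]

theorem integrable_mul_bdd (h : 𝓢(Sp d, ℂ)) (g : BF d) :
    Integrable (fun y => h y * g y) volume :=
  h.integrable.mul_bdd (c := ‖g‖) g.continuous.aestronglyMeasurable
    (ae_of_all _ fun y => g.norm_coe_le_norm y)

theorem convExists (h : 𝓢(Sp d, ℂ)) (g : BF d) (x : Sp d) :
    Integrable (fun y => h y * g (x - y)) volume :=
  h.integrable.mul_bdd (c := ‖g‖) (g.continuous.comp (by fun_prop)).aestronglyMeasurable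
    (ae_of_all _ fun y => g.norm_coe_le_norm _)

/-- The convolution of a Schwartz function with a bounded continuous function. -/
noncomputable def cvFun (h : 𝓢(Sp d, ℂ)) (g : BF d) (x : Sp d) : ℂ := ∫ y, h y * g (x - y)

theorem cvFun_eq (h : 𝓢(Sp d, ℂ)) (g : BF d) :
    cvFun h g = (h : Sp d → ℂ) ⋆[ContinuousLinearMap.mul ℂ ℂ] g := rfl

theorem norm_cvFun_le (h : 𝓢(Sp d, ℂ)) (g : BF d) (x : Sp d) :
    ‖cvFun h g x‖ ≤ (∫ y, ‖h y‖) * ‖g‖ := by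
  rw [← integral_mul_const]
  refine norm_integral_le_of_norm_le (h.integrable.norm.mul_const _) (ae_of_all _ fun y => ?_)
  rw [norm_mul]
  gcongr
  exact g.norm_coe_le_norm _

theorem continuous_cvFun (h : 𝓢(Sp d, ℂ)) (g : BF d) : Continuous (cvFun h g) := by
  rw [cvFun_eq]
  refine BddAbove.continuous_convolution_right_of_integrable _ ?_ h.integrable g.continuous
  exact ⟨‖g‖, by rintro _ ⟨y, rfl⟩; exact g.norm_coe_le_norm y⟩

/-- Convolution with a Schwartz function as an operator on bounded continuous functions. -/
noncomputable def cv (h : 𝓢(Sp d, ℂ)) : BF d →L[ℂ] BF d :=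
  LinearMap.mkContinuous
    { toFun := fun g => BoundedContinuousFunction.ofNormedAddCommGroup (cvFun h g)
        (continuous_cvFun h g) _ (norm_cvFun_le h g)
      map_add' := fun g g' => by
        ext x
        simp only [BoundedContinuousFunction.coe_ofNormedAddCommGroup,
          BoundedContinuousFunction.coe_add, Pi.add_apply, cvFun, mul_add]
        exact integral_add (convExists h g x) (convExists h g' x)
      map_smul' := fun c g => by
        ext x
        simp only [BoundedContinuousFunction.coe_ofNormedAddCommGroup,
          BoundedContinuousFunction.coe_smul, cvFun, RingHom.id_apply, smul_eq_mul,
          ← integral_const_mul]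
        congr 1; funext y; ring }
    (∫ y, ‖h y‖)
    (fun g => BoundedContinuousFunction.norm_ofNormedAddCommGroup_le _ (by positivity)
      (norm_cvFun_le h g))

theorem cv_apply (h : 𝓢(Sp d, ℂ)) (g : BF d) (x : Sp d) : cv h g x = ∫ y, h y * g (x - y) := rfl

theorem cv_apply_swap (h : 𝓢(Sp d, ℂ)) (g : BF d) (x : Sp d) :
    cv h g x = ∫ y, g y * h (x - y) := by
  rw [cv_apply]
  rw [← integral_sub_left_eq_self (fun y => h y * g (x - y)) volume x]
  simp [mul_comm]

theorem norm_cv_apply_le (h : 𝓢(Sp d, ℂ)) (g : BF d) : ‖cv h g‖ ≤ (∫ y, ‖h y‖) * ‖g‖ :=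
  (BoundedContinuousFunction.norm_le (by positivity)).2 (norm_cvFun_le h g)

/-- Associativity by Fubini. It allows a block to be rewritten as a wider window convolved with
itself, which reduces operators on blocks to `L¹` bounds for kernels. -/
theorem cv_cv (h h' : 𝓢(Sp d, ℂ)) (g : BF d) : cv h (cv h' g) = cv (sconv h h') g := by
  ext x
  change ((h : Sp d → ℂ) ⋆[ContinuousLinearMap.mul ℂ ℂ] ((h' : Sp d → ℂ) ⋆[ContinuousLinearMap.mul ℂ ℂ] g)) x
    = ((sconv h h' : Sp d → ℂ) ⋆[ContinuousLinearMap.mul ℂ ℂ] g) x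
  rw [sconv_coe]
  symm
  have hg : ∀ y, ‖g y‖ ≤ ‖g‖ := g.norm_coe_le_norm
  apply convolution_assoc (L := ContinuousLinearMap.mul ℂ ℂ) (L₂ := ContinuousLinearMap.mul ℂ ℂ)
    (L₃ := ContinuousLinearMap.mul ℂ ℂ) (L₄ := ContinuousLinearMap.mul ℂ ℂ)
  · intro a b c; simp [mul_assoc]
  · exact h.continuous.aestronglyMeasurable
  · exact h'.continuous.aestronglyMeasurable
  · exact g.continuous.aestronglyMeasurable
  · refine ae_of_all _ fun y => ?_
    exact convExists h h'.toBoundedContinuousFunction y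
  · refine ae_of_all _ fun y => ?_
    refine (convExists h' g y).norm.congr (ae_of_all _ fun z => ?_)
    simp
  · refine h.integrable.norm.mul_bdd (c := (∫ y, ‖h' y‖) * ‖g‖) ?_ (ae_of_all _ fun y => ?_)
    · have hc : Continuous ((fun x => ‖h' x‖) ⋆[ContinuousLinearMap.mul ℝ ℝ] fun x => ‖g x‖) :=
        BddAbove.continuous_convolution_right_of_integrable _
          ⟨‖g‖, by rintro _ ⟨y, rfl⟩; simpa using g.norm_coe_le_norm y⟩ h'.integrable.norm
          g.continuous.norm
      exact (hc.comp (continuous_const.sub continuous_id)).aestronglyMeasurable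
    · rw [← integral_mul_const]
      refine norm_integral_le_of_norm_le (h'.integrable.norm.mul_const _)
        (ae_of_all _ fun z => ?_)
      simp only [ContinuousLinearMap.mul_apply', norm_mul, norm_norm]
      gcongr
      exact g.norm_coe_le_norm _

theorem cv_sub (h h' : 𝓢(Sp d, ℂ)) (g : BF d) : cv (h - h') g = cv h g - cv h' g := by
  ext x
  simp only [cv_apply, BoundedContinuousFunction.coe_sub, Pi.sub_apply, sub_apply, sub_mul]
  exact integral_sub (convExists h g x) (convExists h' g x)

theorem cv_zero (g : BF d) : cv (0 : 𝓢(Sp d, ℂ)) g = 0 := by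
  ext x; simp [cv_apply]

/-! ### Translations, reflections and derivatives of convolutions -/

/-- Translates of a Schwartz function. -/
noncomputable abbrev tr (x : Sp d) (h : 𝓢(Sp d, ℂ)) : 𝓢(Sp d, ℂ) :=
  SchwartzMap.compSubConstCLM ℂ x h

/-- The reflection `y ↦ h (-y)`. -/
noncomputable def refl (h : 𝓢(Sp d, ℂ)) : 𝓢(Sp d, ℂ) := reflectAt 0 h

theorem refl_apply (h : 𝓢(Sp d, ℂ)) (y : Sp d) : refl h y = h (-y) := by
  rw [refl, reflectAt_apply, zero_sub]

theorem reflectAt_eq (x : Sp d) (h : 𝓢(Sp d, ℂ)) : reflectAt x h = tr x (refl h) := by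
  ext y
  simp [reflectAt_apply, refl_apply]

theorem sconv_tr (x : Sp d) (f g : 𝓢(Sp d, ℂ)) : tr x (sconv f g) = sconv f (tr x g) := by
  ext y
  simp only [SchwartzMap.compSubConstCLM_apply, sconv_apply]
  congr 1; funext z; congr 2; abel

theorem tr_sconv (x : Sp d) (f g : 𝓢(Sp d, ℂ)) : tr x (sconv f g) = sconv (tr x f) g := by
  rw [sconv_comm, sconv_tr, sconv_comm]

theorem refl_sconv (f g : 𝓢(Sp d, ℂ)) : refl (sconv f g) = sconv (refl f) (refl g) := by
  ext y
  simp only [refl_apply, sconv_apply]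
  rw [← integral_neg_eq_self]
  congr 1; funext z; congr 2; abel

-- On the Fourier side both expressions carry the same linear symbol. Iterated, this identifies
-- derivatives of a convolution in `integral_jet_tr`.
open LineDeriv in
theorem lineDeriv_sconv (v : Sp d) (f g : 𝓢(Sp d, ℂ)) : ∂_{v} (sconv f g) = sconv f (∂_{v} g) := by
  have hv : (inner ℝ · v : Sp d → ℝ).HasTemperateGrowth := by fun_prop
  refine fourier_injective fun ξ => ?_
  rw [fourier_sconv_apply, SchwartzMap.fourier_lineDerivOp_eq, SchwartzMap.fourier_lineDerivOp_eq]
  simp only [smul_apply, SchwartzMap.smulLeftCLM_apply_apply hv, fourier_sconv_apply,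
    smul_eq_mul, Complex.real_smul]
  ring

open LineDeriv in
theorem iteratedLineDeriv_sconv {n : ℕ} (v : Fin n → Sp d) (f g : 𝓢(Sp d, ℂ)) :
    ∂^{v} (sconv f g) = sconv f (∂^{v} g) := by
  induction n with
  | zero => simp
  | succ n ih => rw [iteratedLineDerivOp_succ_left, ih, lineDeriv_sconv,
      ← iteratedLineDerivOp_succ_left]

/-! ### Tempered distributions as functionals on a Banach space of weighted jets -/

/-- Bounded continuous functions with values in the `n`-linear maps. -/
abbrev MultBF (d n : ℕ) : Type := BoundedContinuousFunction (Sp d) (Sp d [×n]→L[ℝ] ℂ)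

noncomputable instance (n : ℕ) : NormedSpace ℂ (MultBF d n) := BoundedContinuousFunction.instNormedSpace

/-- The space of weighted jets of order `m`. -/
def JetSp (d m : ℕ) : Type := ∀ n : Fin (m + 1), MultBF d n

noncomputable instance (m : ℕ) : NormedAddCommGroup (JetSp d m) :=
  Pi.normedAddCommGroup (G := fun n : Fin (m + 1) => MultBF d n)

noncomputable instance (m : ℕ) : NormedSpace ℂ (JetSp d m) :=
  Pi.normedSpace (E := fun n : Fin (m + 1) => MultBF d n)

instance (m : ℕ) : CompleteSpace (JetSp d m) :=
  inferInstanceAs (CompleteSpace (∀ n : Fin (m + 1), MultBF d n))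

/-- Evaluation of a jet in its `n`-th component. -/
noncomputable def JetSp.comp (m : ℕ) (n : Fin (m + 1)) : JetSp d m →L[ℂ] MultBF d n :=
  ContinuousLinearMap.proj (R := ℂ) (φ := fun n : Fin (m + 1) => MultBF d n) n

theorem JetSp.norm_le_iff {m : ℕ} (a : JetSp d m) {C : ℝ} (hC : 0 ≤ C) :
    ‖a‖ ≤ C ↔ ∀ n, ‖JetSp.comp m n a‖ ≤ C :=
  pi_norm_le_iff_of_nonneg (G := fun n : Fin (m + 1) => MultBF d n) hC

/-- The weighted derivative `(1 + ‖y‖)^m D^n φ (y)`, `n ≤ m`, as a bounded continuous function. -/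
noncomputable def jetComp (m : ℕ) (n : Fin (m + 1)) (φ : 𝓢(Sp d, ℂ)) : MultBF d n :=
  BoundedContinuousFunction.ofNormedAddCommGroup
    (fun y => (1 + ‖y‖) ^ m • iteratedFDeriv ℝ n φ y)
    (by
      have := (φ.smooth n).continuous_iteratedFDeriv (m := n) le_rfl
      fun_prop)
    (2 ^ m * (Finset.Iic (m, m)).sup (fun m => SchwartzMap.seminorm ℝ m.1 m.2) φ)
    (fun y => by
      rw [norm_smul, Real.norm_of_nonneg (by positivity)]
      exact SchwartzMap.one_add_le_sup_seminorm_apply (m := (m, m)) le_rfl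
        (Nat.lt_succ_iff.1 n.2) φ y)

theorem jetComp_apply (m : ℕ) (φ : 𝓢(Sp d, ℂ)) (n : Fin (m + 1)) (y : Sp d) :
    jetComp m n φ y = (1 + ‖y‖) ^ m • iteratedFDeriv ℝ n φ y := rfl

/-- The weighted derivatives `(1 + ‖y‖)^m D^n φ (y)`, `n ≤ m`. -/
noncomputable def jet (m : ℕ) : 𝓢(Sp d, ℂ) →ₗ[ℂ] JetSp d m where
  toFun φ n := jetComp m n φ
  map_add' φ φ' := by
    refine funext fun n => ?_
    change jetComp m n (φ + φ') = jetComp m n φ + jetComp m n φ'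
    refine BoundedContinuousFunction.ext fun y => ?_
    simp only [jetComp_apply, BoundedContinuousFunction.coe_add, Pi.add_apply]
    rw [FunLike.coe_add, iteratedFDeriv_add_apply (φ.smooth _).contDiffAt (φ'.smooth _).contDiffAt,
      smul_add]
  map_smul' c φ := by
    refine funext fun n => ?_
    change jetComp m n (c • φ) = c • jetComp m n φ
    refine BoundedContinuousFunction.ext fun y => ?_
    rw [jetComp_apply, BoundedContinuousFunction.smul_apply, jetComp_apply]
    rw [FunLike.coe_smul, iteratedFDeriv_const_smul_apply (φ.smooth _).contDiffAt, smul_comm]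

theorem comp_jet (m : ℕ) (φ : 𝓢(Sp d, ℂ)) (n : Fin (m + 1)) :
    JetSp.comp m n (jet m φ) = jetComp m n φ := rfl

theorem norm_le_jet (m : ℕ) (φ : 𝓢(Sp d, ℂ)) (n : Fin (m + 1)) (y : Sp d) :
    (1 + ‖y‖) ^ m * ‖iteratedFDeriv ℝ n φ y‖ ≤ ‖jet m φ‖ := by
  have h1 := ((jetComp m n φ).norm_coe_le_norm y).trans
    ((JetSp.norm_le_iff (jet m φ) (norm_nonneg _)).1 le_rfl n)
  rwa [jetComp_apply, norm_smul, Real.norm_of_nonneg (by positivity)] at h1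

/-- The zeroth component already determines the function. Hence a functional on Schwartz functions
descends to the range of `jet`. -/
theorem jet_injective (m : ℕ) : Function.Injective (jet (d := d) m) := by
  refine (injective_iff_map_eq_zero _).2 fun φ h => ?_
  ext y
  have := norm_le_jet m φ 0 y
  rw [h, norm_zero] at this
  have h2 : 0 < (1 + ‖y‖) ^ m := by positivity
  have h3 : ‖iteratedFDeriv ℝ (0 : Fin (m + 1)) φ y‖ = ‖φ y‖ :=
    norm_iteratedFDeriv_zero
  rw [h3] at this
  have h4 : ‖φ y‖ ≤ 0 := by
    by_contra hc
    push Not at hc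
    nlinarith [mul_pos h2 hc]
  simpa using h4

/-- Continuity gives a bound by finitely many seminorms, and one jet order dominates all of them. -/
theorem exists_bound_jet (f : 𝓢'(Sp d, ℂ)) : ∃ (m : ℕ) (C : ℝ), 0 ≤ C ∧ ∀ φ, ‖f φ‖ ≤ C * ‖jet m φ‖ := by
  let fl : 𝓢(Sp d, ℂ) →ₗ[ℂ] ℂ :=
    { toFun := fun φ => f φ, map_add' := map_add f, map_smul' := map_smul f }
  obtain ⟨s, C, -, hC⟩ := Seminorm.bound_of_continuous (schwartz_withSeminorms ℂ (Sp d) ℂ)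
    ((normSeminorm ℂ ℂ).comp fl) (continuous_norm.comp (map_continuous f))
  obtain ⟨m, hm⟩ : ∃ m : ℕ, ∀ i ∈ s, i.1 ≤ m ∧ i.2 ≤ m :=
    ⟨s.sup (fun i => max i.1 i.2), fun i hi => by
      have := Finset.le_sup (f := fun i : ℕ × ℕ => max i.1 i.2) hi
      exact ⟨(le_max_left _ _).trans this, (le_max_right _ _).trans this⟩⟩
  refine ⟨m, C, C.2, fun φ => (hC φ).trans ?_⟩
  simp only [smul_apply, NNReal.smul_def, smul_eq_mul]
  gcongr
  refine Seminorm.finset_sup_apply_le (norm_nonneg _) fun i hi => ?_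
  refine SchwartzMap.seminorm_le_bound ℂ _ _ _ (norm_nonneg _) fun y => ?_
  refine le_trans ?_ (norm_le_jet m φ ⟨i.2, Nat.lt_succ_iff.2 (hm i hi).2⟩ y)
  gcongr
  calc ‖y‖ ^ i.1 ≤ (1 + ‖y‖) ^ i.1 := by gcongr; linarith
    _ ≤ (1 + ‖y‖) ^ m := pow_le_pow_right₀ (by linarith [norm_nonneg y]) (hm i hi).1

/-- Hahn–Banach. A tempered distribution thus factors through a Banach space, where Bochner
integrals commute with continuous functionals. -/
theorem exists_extension_jet (f : 𝓢'(Sp d, ℂ)) : ∃ (m : ℕ)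
    (F : StrongDual ℂ (JetSp d m)),
    ∀ φ, F (jet m φ) = f φ := by
  obtain ⟨m, C, hC, h⟩ := exists_bound_jet f
  let fl : 𝓢(Sp d, ℂ) →ₗ[ℂ] ℂ :=
    { toFun := fun φ => f φ, map_add' := map_add f, map_smul' := map_smul f }
  let e := LinearEquiv.ofInjective (jet (d := d) m) (jet_injective m)
  let g : StrongDual ℂ (LinearMap.range (jet (d := d) m)) :=
    LinearMap.mkContinuous (fl ∘ₗ e.symm.toLinearMap) C (fun x => by
      have hx : jet m (e.symm x) = x := congrArg Subtype.val (e.apply_symm_apply x)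
      have := h (e.symm x)
      rw [hx] at this
      exact this)
  obtain ⟨F, hF, -⟩ := exists_extension_norm_eq _ g
  refine ⟨m, F, fun φ => ?_⟩
  have h1 : e.symm ⟨jet m φ, ⟨φ, rfl⟩⟩ = φ := e.symm_apply_apply φ
  rw [hF ⟨jet m φ, ⟨φ, rfl⟩⟩]
  change f (e.symm ⟨jet m φ, ⟨φ, rfl⟩⟩) = f φ
  rw [h1]

theorem iteratedFDeriv_tr (n : ℕ) (x y : Sp d) (h : 𝓢(Sp d, ℂ)) :
    iteratedFDeriv ℝ n (tr x h) y = iteratedFDeriv ℝ n h (y - x) := by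
  have : (tr x h : Sp d → ℂ) = fun y => h (y - x) := rfl
  rw [this, iteratedFDeriv_comp_sub]

theorem norm_jet_tr_le (m : ℕ) (h : 𝓢(Sp d, ℂ)) (x : Sp d) :
    ‖jet m (tr x h)‖ ≤ (1 + ‖x‖) ^ m * ‖jet m h‖ := by
  refine (JetSp.norm_le_iff _ (by positivity)).2 fun n => ?_
  refine (BoundedContinuousFunction.norm_le (by positivity)).2 fun y => ?_
  rw [comp_jet, jetComp_apply, norm_smul, Real.norm_of_nonneg (by positivity), iteratedFDeriv_tr]
  have h1 : 1 + ‖y‖ ≤ (1 + ‖x‖) * (1 + ‖y - x‖) := by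
    have : ‖y‖ ≤ ‖y - x‖ + ‖x‖ := by simpa using norm_add_le (y - x) x
    nlinarith [norm_nonneg x, norm_nonneg (y - x), mul_nonneg (norm_nonneg x) (norm_nonneg (y - x))]
  calc (1 + ‖y‖) ^ m * ‖iteratedFDeriv ℝ n h (y - x)‖
      ≤ ((1 + ‖x‖) * (1 + ‖y - x‖)) ^ m * ‖iteratedFDeriv ℝ n h (y - x)‖ := by gcongr
    _ = (1 + ‖x‖) ^ m * ((1 + ‖y - x‖) ^ m * ‖iteratedFDeriv ℝ n h (y - x)‖) := by
        rw [mul_pow]; ring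
    _ ≤ _ := by gcongr; exact norm_le_jet m h n _

/-- The mean value inequality along a segment costs one derivative, hence the order `m + 1` on the
right. The purpose is continuity of the curve of translated jets. -/
theorem norm_jet_tr_sub_le (m : ℕ) (h : 𝓢(Sp d, ℂ)) (x x' : Sp d) (hx : ‖x' - x‖ ≤ 1) :
    ‖jet m (tr x' h) - jet m (tr x h)‖ ≤ ((2 + ‖x‖) ^ m * ‖jet (m + 1) h‖) * ‖x' - x‖ := by
  refine (JetSp.norm_le_iff _ (by positivity)).2 fun n => ?_
  refine (BoundedContinuousFunction.norm_le (by positivity)).2 fun y => ?_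
  rw [map_sub, comp_jet, comp_jet, BoundedContinuousFunction.coe_sub, Pi.sub_apply, jetComp_apply,
    jetComp_apply]
  refine (le_of_eq (congrArg norm (smul_sub _ _ _).symm)).trans ?_
  rw [norm_smul, Real.norm_of_nonneg (by positivity), iteratedFDeriv_tr, iteratedFDeriv_tr]
  have hpos : 0 < (1 + ‖y‖) ^ m := by positivity
  -- The weight at `y` is comparable, up to the factor `2 + ‖x‖`, to the weight at any point `w` of
  -- the segment; this is where `‖x' - x‖ ≤ 1` is needed.
  have key : ‖iteratedFDeriv ℝ n h (y - x') - iteratedFDeriv ℝ n h (y - x)‖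
      ≤ ((2 + ‖x‖) ^ m * ‖jet (m + 1) h‖ / (1 + ‖y‖) ^ m) * ‖(y - x') - (y - x)‖ := by
    refine (convex_segment (y - x) (y - x')).norm_image_sub_le_of_norm_fderiv_le (𝕜 := ℝ)
      (fun w _ => ?_) (fun w hw => ?_) (left_mem_segment _ _ _) (right_mem_segment _ _ _)
    · exact ((h.smooth (n + 1)).differentiable_iteratedFDeriv (by exact_mod_cast Nat.lt_succ_self _)).differentiableAt
    · rw [norm_fderiv_iteratedFDeriv, le_div_iff₀ hpos]
      have hw1 : ‖w - (y - x)‖ ≤ 1 := by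
        have := norm_sub_le_of_mem_segment hw
        refine this.trans ?_
        rw [show y - x' - (y - x) = -(x' - x) by abel, norm_neg]
        exact hx
      have h1 : 1 + ‖y‖ ≤ (2 + ‖x‖) * (1 + ‖w‖) := by
        have : ‖y‖ ≤ ‖w - (y - x)‖ + ‖w‖ + ‖x‖ := by
          have h2 := norm_add_le (w + x) (-(w - (y - x)))
          rw [show w + x + -(w - (y - x)) = y by abel, norm_neg] at h2
          linarith [norm_add_le w x]
        nlinarith [norm_nonneg x, norm_nonneg w, mul_nonneg (norm_nonneg x) (norm_nonneg w)]
      have h3 := norm_le_jet (m + 1) h ⟨n + 1, by have := n.2; omega⟩ w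
      have h4 : (1 + ‖w‖) ^ m * ‖iteratedFDeriv ℝ (n + 1) h w‖ ≤ ‖jet (m + 1) h‖ := by
        refine le_trans ?_ h3
        gcongr
        · linarith [norm_nonneg w]
        · omega
      calc ‖iteratedFDeriv ℝ (n + 1) h w‖ * (1 + ‖y‖) ^ m
          ≤ ‖iteratedFDeriv ℝ (n + 1) h w‖ * ((2 + ‖x‖) * (1 + ‖w‖)) ^ m := by gcongr
        _ = (2 + ‖x‖) ^ m * ((1 + ‖w‖) ^ m * ‖iteratedFDeriv ℝ (n + 1) h w‖) := by
            rw [mul_pow]; ring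
        _ ≤ _ := by gcongr
  calc _ ≤ (1 + ‖y‖) ^ m * (((2 + ‖x‖) ^ m * ‖jet (m + 1) h‖ / (1 + ‖y‖) ^ m) *
        ‖(y - x') - (y - x)‖) := by gcongr
    _ = _ := by
      rw [show y - x' - (y - x) = -(x' - x) by abel, norm_neg]
      field_simp

theorem continuous_jet_tr (m : ℕ) (h : 𝓢(Sp d, ℂ)) : Continuous fun x => jet m (tr x h) := by
  rw [continuous_iff_continuousAt]
  intro x
  rw [ContinuousAt, tendsto_iff_norm_sub_tendsto_zero]
  refine squeeze_zero' (Eventually.of_forall fun _ => norm_nonneg _) ?_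
    (g := fun x' => ((2 + ‖x‖) ^ m * ‖jet (m + 1) h‖) * ‖x' - x‖) ?_
  · filter_upwards [Metric.closedBall_mem_nhds x one_pos] with x' hx'
    exact norm_jet_tr_sub_le m h x x' (by simpa [dist_eq_norm] using hx')
  · have : Continuous fun x' => ((2 + ‖x‖) ^ m * ‖jet (m + 1) h‖) * ‖x' - x‖ := by fun_prop
    simpa using this.tendsto x

theorem integrable_pow_mul_schwartz (m : ℕ) (φ : 𝓢(Sp d, ℂ)) {C : ℝ} (hC : 0 ≤ C) :
    Integrable (fun x => ‖φ x‖ * ((1 + ‖x‖) ^ m * C)) volume := by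
  have h1 : Function.HasTemperateGrowth (fun x : Sp d => (1 + ‖x‖ ^ 2) ^ m) := by fun_prop
  have h2 := ((SchwartzMap.smulLeftCLM ℂ (fun x : Sp d => (1 + ‖x‖ ^ 2) ^ m) φ).integrable
    (μ := volume)).norm.const_mul (2 ^ m * C)
  refine h2.mono' (by fun_prop) (ae_of_all _ fun x => ?_)
  rw [SchwartzMap.smulLeftCLM_apply_apply h1, norm_smul, norm_mul, norm_mul, norm_norm,
    Real.norm_of_nonneg (by positivity)]
  have h3 : (1 + ‖x‖) ^ m ≤ 2 ^ m * (1 + ‖x‖ ^ 2) ^ m := by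
    rw [← mul_pow]
    gcongr
    nlinarith [sq_nonneg (‖x‖ - 1), norm_nonneg x]
  calc ‖φ x‖ * ((1 + ‖x‖) ^ m * ‖C‖) ≤ ‖φ x‖ * ((2 ^ m * (1 + ‖x‖ ^ 2) ^ m) * ‖C‖) := by gcongr
    _ = _ := by rw [Real.norm_of_nonneg hC, Real.norm_of_nonneg (by positivity)]; ring

theorem integrable_jet_tr (m : ℕ) (φ h : 𝓢(Sp d, ℂ)) :
    Integrable (fun x => φ x • jet m (tr x h)) volume := by
  refine (integrable_pow_mul_schwartz m φ (norm_nonneg (jet m h))).mono'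
    (φ.continuous.smul (continuous_jet_tr m h)).aestronglyMeasurable (ae_of_all _ fun x => ?_)
  rw [norm_smul]
  gcongr
  exact norm_jet_tr_le m h x

/-- Evaluating a jet at a point and on a tuple of vectors is continuous and linear; it turns the
vector integral into the scalar convolution of `φ` with a derivative of `h`. -/
theorem integral_jet_tr (m : ℕ) (φ h : 𝓢(Sp d, ℂ)) :
    ∫ x, φ x • jet m (tr x h) = jet m (sconv φ h) := by
  refine funext fun n => ?_
  refine BoundedContinuousFunction.ext fun y => ContinuousMultilinearMap.ext fun v => ?_
  let ev : JetSp d m →L[ℝ] ℂ :=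
    (ContinuousMultilinearMap.apply ℝ (fun _ : Fin n => Sp d) ℂ v).comp
      ((BoundedContinuousFunction.evalCLM ℝ y).comp ((JetSp.comp m n).restrictScalars ℝ))
  change ev (∫ x, φ x • jet m (tr x h)) = jetComp m n (sconv φ h) y v
  rw [← ContinuousLinearMap.integral_comp_comm ev (integrable_jet_tr m φ h), jetComp_apply]
  have h1 : ∀ x, ev (φ x • jet m (tr x h))
      = (1 + ‖y‖) ^ m • (φ x * (LineDeriv.iteratedLineDerivOp v h : 𝓢(Sp d, ℂ)) (y - x)) := by
    intro x
    change (φ x • jetComp m n (tr x h) y) v = _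
    rw [jetComp_apply, iteratedFDeriv_tr, SchwartzMap.iteratedLineDerivOp_eq_iteratedFDeriv]
    change φ x * ((1 + ‖y‖) ^ m • iteratedFDeriv ℝ n h (y - x) v) = _
    simp only [Complex.real_smul]
    ring
  simp_rw [h1]
  rw [integral_smul, ← sconv_apply, ← iteratedLineDeriv_sconv,
    SchwartzMap.iteratedLineDerivOp_eq_iteratedFDeriv]
  rfl

/-- A tempered distribution commutes with the integral that defines a convolution. -/
theorem distribution_sconv (f : 𝓢'(Sp d, ℂ)) (φ h : 𝓢(Sp d, ℂ)) :
    Integrable (fun x => φ x * f (tr x h)) volume ∧ f (sconv φ h) = ∫ x, φ x * f (tr x h) := by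
  obtain ⟨m, F, hF⟩ := exists_extension_jet f
  have h1 := F.integrable_comp (integrable_jet_tr m φ h)
  have h2 : ∀ x, F (φ x • jet m (tr x h)) = φ x * f (tr x h) := fun x => by
    rw [map_smul, hF, smul_eq_mul]
  simp_rw [h2] at h1
  refine ⟨h1, ?_⟩
  rw [← hF, ← integral_jet_tr, ← ContinuousLinearMap.integral_comp_comm _ (integrable_jet_tr m φ h)]
  simp_rw [h2]

theorem continuous_conv (f : 𝓢'(Sp d, ℂ)) (h : 𝓢(Sp d, ℂ)) : Continuous (conv f h) := by
  obtain ⟨m, F, hF⟩ := exists_extension_jet f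
  have : conv f h = fun x => F (jet m (tr x (refl h))) := by
    funext x
    rw [conv, reflectAt_eq, hF]
  rw [this]
  exact F.continuous.comp (continuous_jet_tr m _)

theorem exists_norm_conv_le (f : 𝓢'(Sp d, ℂ)) (h : 𝓢(Sp d, ℂ)) :
    ∃ (m : ℕ) (C : ℝ), 0 ≤ C ∧ ∀ x, ‖conv f h x‖ ≤ C * (1 + ‖x‖) ^ m := by
  obtain ⟨m, C, hC, hb⟩ := exists_bound_jet f
  refine ⟨m, C * ‖jet m (refl h)‖, by positivity, fun x => ?_⟩
  rw [conv, reflectAt_eq]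
  refine (hb _).trans ?_
  rw [mul_assoc, mul_comm ‖jet m (refl h)‖]
  gcongr
  exact norm_jet_tr_le m _ x

theorem distribution_sconv_refl (f : 𝓢'(Sp d, ℂ)) (φ h : 𝓢(Sp d, ℂ)) :
    Integrable (fun x => φ x * conv f h x) volume ∧
      f (sconv φ (refl h)) = ∫ x, φ x * conv f h x := by
  have := distribution_sconv f φ (refl h)
  simpa only [conv, reflectAt_eq] using this

/-- With `a` the wide window and `b` a block window this is the reproducing formula behind `IsBand`.
-/
theorem conv_sconv (f : 𝓢'(Sp d, ℂ)) (a b : 𝓢(Sp d, ℂ)) (x : Sp d) :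
    Integrable (fun y => a (x - y) * conv f b y) volume ∧
      conv f (sconv a b) x = ∫ y, a (x - y) * conv f b y := by
  have h := distribution_sconv_refl f (reflectAt x a) b
  rw [conv, reflectAt_eq x (sconv a b), refl_sconv, tr_sconv, ← reflectAt_eq]
  exact h

/-! ### Cut-off functions and density of band-limited functions -/

theorem exists_cutoff (d : ℕ) : ∃ θ : 𝓢(Sp d, ℂ), (∀ ξ, ‖ξ‖ ≤ 2 → θ ξ = 1) ∧ (∀ ξ, 3 ≤ ‖ξ‖ → θ ξ = 0) := by
  let b : ContDiffBump (0 : Sp d) := ⟨2, 3, by norm_num, by norm_num⟩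
  have h1 : HasCompactSupport (fun ξ => (b ξ : ℂ)) :=
    b.hasCompactSupport.comp_left (g := fun x : ℝ => (x : ℂ)) (by simp)
  have h2 : ContDiff ℝ (⊤ : ℕ∞) (fun ξ => (b ξ : ℂ)) := Complex.ofRealCLM.contDiff.comp b.contDiff
  refine ⟨h1.toSchwartzMap h2, fun ξ hξ => ?_, fun ξ hξ => ?_⟩
  · simp only [HasCompactSupport.toSchwartzMap_toFun]
    rw [b.one_of_mem_closedBall (by simpa using hξ)]; simp
  · simp only [HasCompactSupport.toSchwartzMap_toFun]
    rw [b.zero_of_le_dist (by simpa [b] using hξ)]; simp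

/-- A Schwartz function equal to `1` on the ball of radius `2` and supported in that of radius `3`. -/
noncomputable def cutoff (d : ℕ) : 𝓢(Sp d, ℂ) := (exists_cutoff d).choose

theorem cutoff_one {ξ : Sp d} (h : ‖ξ‖ ≤ 2) : cutoff d ξ = 1 := (exists_cutoff d).choose_spec.1 ξ h

theorem cutoff_zero {ξ : Sp d} (h : 3 ≤ ‖ξ‖) : cutoff d ξ = 0 := (exists_cutoff d).choose_spec.2 ξ h

theorem hasTemperateGrowth_cutoff_smul (ε : ℝ) :
    Function.HasTemperateGrowth (fun ξ : Sp d => cutoff d (ε • ξ)) :=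
  (cutoff d).hasTemperateGrowth.comp (ε • ContinuousLinearMap.id ℝ (Sp d)).hasTemperateGrowth

/-- For `i ≥ 1` the chain rule produces `ε ^ i ≤ ε`. For `i = 0` the mean value inequality from the
origin, where the cutoff is `1`, produces `ε` at the price of one power of `‖ξ‖`. -/
theorem norm_iteratedFDeriv_cutoff_sub_one_le (i : ℕ) : ∃ K, 0 ≤ K ∧ ∀ ε : ℝ, 0 < ε → ε ≤ 1 → ∀ ξ : Sp d,
    ‖iteratedFDeriv ℝ i (fun ξ => cutoff d (ε • ξ) - 1) ξ‖ ≤ ε * K * (1 + ‖ξ‖) := by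
  have hc : ContDiff ℝ i (fun ξ => cutoff d ξ - 1) := ((cutoff d).smooth i).sub contDiff_const
  rcases Nat.eq_zero_or_pos i with rfl | hi
  · refine ⟨SchwartzMap.seminorm ℝ 0 1 (cutoff d), apply_nonneg _ _, fun ε hε _ ξ => ?_⟩
    rw [norm_iteratedFDeriv_zero]
    have h := convex_univ.norm_image_sub_le_of_norm_fderiv_le (𝕜 := ℝ) (f := cutoff d)
      (fun x _ => (cutoff d).differentiableAt)
      (fun x _ => by
        rw [← norm_iteratedFDeriv_one]
        exact (cutoff d).norm_iteratedFDeriv_le_seminorm ℝ 1 x)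
      (Set.mem_univ (0 : Sp d)) (Set.mem_univ (ε • ξ))
    rw [cutoff_one (ξ := (0 : Sp d)) (by simp), sub_zero, norm_smul, Real.norm_of_nonneg hε.le] at h
    refine h.trans ?_
    have := apply_nonneg (SchwartzMap.seminorm ℝ 0 1) (cutoff d)
    nlinarith [mul_nonneg hε.le this]
  · refine ⟨SchwartzMap.seminorm ℝ 0 i (cutoff d), apply_nonneg _ _, fun ε hε hε1 ξ => ?_⟩
    have h1 := congrFun (iteratedFDeriv_comp_const_smul ε hc) ξ
    rw [h1, norm_smul, norm_pow, Real.norm_of_nonneg hε.le]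
    have h2 : iteratedFDeriv ℝ i (fun ξ => cutoff d ξ - 1) = iteratedFDeriv ℝ i (cutoff d) := by
      funext x
      have := iteratedFDeriv_sub_apply (((cutoff d).smooth i).contDiffAt (x := x))
        (contDiff_const (c := (1 : ℂ)).contDiffAt)
      rw [iteratedFDeriv_const_of_ne hi.ne'] at this
      exact this.trans (sub_zero _)
    rw [h2]
    have h3 := (cutoff d).norm_iteratedFDeriv_le_seminorm ℝ i (ε • ξ)
    have h4 : ε ^ i ≤ ε := by
      simpa using pow_le_pow_of_le_one hε.le hε1 hi
    have h5 := apply_nonneg (SchwartzMap.seminorm ℝ 0 i) (cutoff d)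
    calc ε ^ i * ‖iteratedFDeriv ℝ i (cutoff d) (ε • ξ)‖
        ≤ ε * SchwartzMap.seminorm ℝ 0 i (cutoff d) := by gcongr
      _ ≤ _ := le_mul_of_one_le_right (by positivity) (by linarith [norm_nonneg ξ])

/-- Leibniz' rule with the preceding bounds gives the rate `1 / (n + 1)` in every seminorm; the lost
power of `‖ξ‖` is paid for by the weight of order `k + 1` on `η`. -/
theorem tendsto_cutoff_mul (η : 𝓢(Sp d, ℂ)) :
    Tendsto (fun n : ℕ => SchwartzMap.smulLeftCLM ℂ
      (fun ξ : Sp d => cutoff d ((1 / (n + 1 : ℝ)) • ξ)) η) atTop (𝓝 η) := by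
  rw [(schwartz_withSeminorms ℝ (Sp d) ℂ).tendsto_nhds_atTop]
  rintro ⟨k, l⟩ δ hδ
  choose K hK0 hK using norm_iteratedFDeriv_cutoff_sub_one_le (d := d)
  set B := 2 ^ (k + 1) * (Finset.Iic (k + 1, l)).sup (fun m => SchwartzMap.seminorm ℝ m.1 m.2) η
  have hB : 0 ≤ B := mul_nonneg (by positivity) (apply_nonneg _ _)
  set S := ∑ i ∈ Finset.range (l + 1), (l.choose i : ℝ) * K i * B
  have hS : 0 ≤ S := Finset.sum_nonneg fun i _ => mul_nonneg (mul_nonneg (by positivity) (hK0 i)) hB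
  have key : ∀ n : ℕ, SchwartzMap.seminorm ℝ k l (SchwartzMap.smulLeftCLM ℂ
      (fun ξ : Sp d => cutoff d ((1 / (n + 1 : ℝ)) • ξ)) η - η) ≤ 1 / (n + 1 : ℝ) * S := by
    intro n
    set ε : ℝ := 1 / (n + 1 : ℝ)
    have hε : 0 < ε := by positivity
    have hε1 : ε ≤ 1 := by
      rw [div_le_one (by positivity)]; linarith [(Nat.cast_nonneg n : (0 : ℝ) ≤ n)]
    refine SchwartzMap.seminorm_le_bound ℝ k l _ (by positivity) fun ξ => ?_
    have e1 : (SchwartzMap.smulLeftCLM ℂ (fun ξ : Sp d => cutoff d (ε • ξ)) η - η : 𝓢(Sp d, ℂ))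
        = (fun ξ => (cutoff d (ε • ξ) - 1) * η ξ : Sp d → ℂ) := by
      funext ξ
      rw [sub_apply, SchwartzMap.smulLeftCLM_apply_apply (hasTemperateGrowth_cutoff_smul ε), smul_eq_mul]
      ring
    rw [e1]
    have hc : ContDiff ℝ l (fun ξ : Sp d => cutoff d (ε • ξ) - 1) :=
      (((cutoff d).smooth l).comp (contDiff_const_smul ε)).sub contDiff_const
    have h2 := norm_iteratedFDeriv_mul_le hc (η.smooth l) ξ (n := l) le_rfl
    calc ‖ξ‖ ^ k * _ ≤ ‖ξ‖ ^ k * _ := by gcongr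
      _ = ∑ i ∈ Finset.range (l + 1), ‖ξ‖ ^ k * ((l.choose i : ℝ) *
          ‖iteratedFDeriv ℝ i (fun ξ : Sp d => cutoff d (ε • ξ) - 1) ξ‖ *
            ‖iteratedFDeriv ℝ (l - i) η ξ‖) := Finset.mul_sum _ _ _
      _ ≤ ∑ i ∈ Finset.range (l + 1), ε * ((l.choose i : ℝ) * K i * B) := by
        refine Finset.sum_le_sum fun i _ => ?_
        have h3 : (1 + ‖ξ‖) ^ (k + 1) * ‖iteratedFDeriv ℝ (l - i) η ξ‖ ≤ B :=
          SchwartzMap.one_add_le_sup_seminorm_apply (m := (k + 1, l)) le_rfl (Nat.sub_le _ _) η ξ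
        have h4 := hK i ε hε hε1 ξ
        have h5 : ‖ξ‖ ^ k ≤ (1 + ‖ξ‖) ^ k := by gcongr; linarith
        calc _ ≤ (1 + ‖ξ‖) ^ k * ((l.choose i : ℝ) * (ε * K i * (1 + ‖ξ‖)) *
              ‖iteratedFDeriv ℝ (l - i) η ξ‖) := by gcongr
          _ = ε * ((l.choose i : ℝ) * K i * ((1 + ‖ξ‖) ^ (k + 1) *
              ‖iteratedFDeriv ℝ (l - i) η ξ‖)) := by ring
          _ ≤ _ := by
            have := hK0 i
            gcongr
      _ = ε * S := by rw [Finset.mul_sum]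
  obtain ⟨n₀, hn₀⟩ := exists_nat_gt (S / δ)
  refine ⟨n₀, fun n hn => (key n).trans_lt ?_⟩
  have h1 : (n₀ : ℝ) ≤ n := by exact_mod_cast hn
  rw [div_lt_iff₀ hδ] at hn₀
  rw [div_mul_eq_mul_div, one_mul, div_lt_iff₀ (by positivity)]
  nlinarith

/-- Two tempered distributions that agree on band-limited Schwartz functions are equal. -/
theorem distribution_ext_bandlimited (f g : 𝓢'(Sp d, ℂ))
    (h : ∀ φ : 𝓢(Sp d, ℂ), (∃ R : ℝ, ∀ ξ, R ≤ ‖ξ‖ → (𝓕 φ : 𝓢(Sp d, ℂ)) ξ = 0) → f φ = g φ) :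
    f = g := by
  refine DFunLike.ext _ _ fun φ => ?_
  set u : ℕ → 𝓢(Sp d, ℂ) := fun n => 𝓕⁻ (SchwartzMap.smulLeftCLM ℂ
      (fun ξ : Sp d => cutoff d ((1 / (n + 1 : ℝ)) • ξ)) (𝓕 φ)) with hu
  have hlim : Tendsto u atTop (𝓝 φ) := by
    have h1 := ((FourierTransform.fourierInvCLM ℂ 𝓢(Sp d, ℂ)).continuous.tendsto (𝓕 φ)).comp
      (tendsto_cutoff_mul (𝓕 φ))
    have h2 : FourierTransform.fourierInvCLM ℂ 𝓢(Sp d, ℂ) (𝓕 φ) = φ :=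
      by simp
    rw [h2] at h1
    exact h1
  have h3 : ∀ n, f (u n) = g (u n) := fun n => by
    refine h _ ⟨3 * (n + 1), fun ξ hξ => ?_⟩
    rw [hu, FourierTransform.fourier_fourierInv_eq,
      SchwartzMap.smulLeftCLM_apply_apply (hasTemperateGrowth_cutoff_smul _), cutoff_zero, zero_smul]
    rw [norm_smul, Real.norm_of_nonneg (by positivity), one_div, inv_mul_eq_div,
      le_div_iff₀ (by positivity)]
    exact hξ
  refine tendsto_nhds_unique (((map_continuous f).tendsto φ).comp hlim) ?_
  have := ((map_continuous g).tendsto φ).comp hlim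
  refine this.congr fun n => (h3 n).symm

/-! ### Fourier transforms of modulations and reflections -/

theorem fourier_modulate (ω : Sp d) (χ : 𝓢(Sp d, ℂ)) (ξ : Sp d) :
    (𝓕 (modulate ω χ) : 𝓢(Sp d, ℂ)) ξ = (𝓕 χ : 𝓢(Sp d, ℂ)) (ξ - ω) := by
  rw [SchwartzMap.fourier_coe, SchwartzMap.fourier_coe, Real.fourier_eq, Real.fourier_eq]
  congr 1; funext v
  rw [modulate_apply, character, Circle.smul_def, Circle.smul_def, Real.fourierChar_apply,
    Real.fourierChar_apply, smul_eq_mul, smul_eq_mul, ← mul_assoc, ← Complex.exp_add]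
  congr 2
  rw [inner_sub_right, real_inner_comm v ω]
  push_cast
  ring

theorem fourier_refl (h : 𝓢(Sp d, ℂ)) (ξ : Sp d) :
    (𝓕 (refl h) : 𝓢(Sp d, ℂ)) ξ = (𝓕 h : 𝓢(Sp d, ℂ)) (-ξ) := by
  rw [SchwartzMap.fourier_coe, SchwartzMap.fourier_coe, Real.fourier_eq, Real.fourier_eq,
    ← integral_neg_eq_self]
  congr 1; funext v
  rw [refl_apply, inner_neg_left, inner_neg_right, neg_neg, neg_neg]

theorem norm_modulate (ω : Sp d) (χ : 𝓢(Sp d, ℂ)) (x : Sp d) : ‖modulate ω χ x‖ = ‖χ x‖ := by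
  rw [modulate_apply, norm_mul, character]
  have : (2 * Real.pi * Complex.I) * ((⟪ω, x⟫_ℝ : ℝ) : ℂ) = ((2 * Real.pi * ⟪ω, x⟫_ℝ : ℝ) : ℂ) * Complex.I := by
    push_cast; ring
  rw [this, Complex.norm_exp_ofReal_mul_I, one_mul]

theorem finite_lattice {β : ℝ} (hβ : 0 < β) (R : ℝ) :
    {k : Fin d → ℤ | ‖latticePoint β k‖ ≤ R}.Finite := by
  refine (Set.finite_Icc (fun _ => -⌈R / β⌉) (fun _ => ⌈R / β⌉)).subset fun k hk => ?_
  have h : ∀ i, |(k i : ℝ)| ≤ R / β := fun i => by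
    have h1 : ‖latticePoint β k i‖ ≤ ‖latticePoint β k‖ := PiLp.norm_apply_le _ i
    have h2 : latticePoint β k i = β * k i := rfl
    rw [h2, norm_mul, Real.norm_of_nonneg hβ.le, Real.norm_eq_abs] at h1
    rw [le_div_iff₀ hβ]
    linarith [hk.out]
  refine ⟨fun i => ?_, fun i => ?_⟩
  · have := (abs_le.1 (h i)).1
    have h3 := Int.le_ceil (R / β)
    have : (-⌈R / β⌉ : ℝ) ≤ k i := by linarith
    exact_mod_cast this
  · have := (abs_le.1 (h i)).2
    exact_mod_cast this.trans (Int.le_ceil _)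

/-! ### Bounded functions as distributions -/

/-- The linear form `φ ↦ ∫ g φ` of a bounded continuous function. -/
noncomputable def distLin (g : BF d) : 𝓢(Sp d, ℂ) →ₗ[ℂ] ℂ where
  toFun φ := ∫ x, g x * φ x
  map_add' φ φ' := by
    simp only [add_apply, mul_add]
    have h := fun φ : 𝓢(Sp d, ℂ) => (integrable_mul_bdd φ g).congr
      (ae_of_all _ fun _ => mul_comm _ _)
    exact integral_add (h φ) (h φ')
  map_smul' c φ := by
    simp only [smul_apply, smul_eq_mul, RingHom.id_apply, ← integral_const_mul]
    congr 1; funext x; ring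

theorem norm_distLin_le (g : BF d) (φ : 𝓢(Sp d, ℂ)) :
    ‖distLin g φ‖ ≤ ‖g‖ * ‖SchwartzMap.toLpCLM ℂ ℂ 1 volume φ‖ := by
  rw [SchwartzMap.toLpCLM_apply, SchwartzMap.norm_toLp_one, ← integral_const_mul]
  refine norm_integral_le_of_norm_le (φ.integrable.norm.const_mul _) (ae_of_all _ fun x => ?_)
  rw [norm_mul]
  gcongr
  exact g.norm_coe_le_norm x

theorem continuous_distLin (g : BF d) : Continuous (distLin g) := by
  refine continuous_of_continuousAt_zero (distLin g) ?_
  rw [ContinuousAt, map_zero]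
  refine squeeze_zero_norm (norm_distLin_le g) ?_
  have h2 : Continuous fun φ : 𝓢(Sp d, ℂ) => ‖g‖ * ‖SchwartzMap.toLpCLM ℂ ℂ 1 volume φ‖ := by
    fun_prop
  have h3 := h2.tendsto 0
  rwa [map_zero, norm_zero, mul_zero] at h3

/-- The tempered distribution `φ ↦ ∫ g φ` of a bounded continuous function. -/
noncomputable def distL (g : BF d) : 𝓢'(Sp d, ℂ) :=
  ContinuousLinearMap.toPointwiseConvergenceCLM _ _ _ _
    (⟨distLin g, continuous_distLin g⟩ : 𝓢(Sp d, ℂ) →L[ℂ] ℂ)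

theorem distL_apply (g : BF d) (φ : 𝓢(Sp d, ℂ)) : distL g φ = ∫ x, g x * φ x := rfl

theorem conv_distL (g : BF d) (h : 𝓢(Sp d, ℂ)) (x : Sp d) : conv (distL g) h x = cv h g x := by
  rw [conv, distL_apply, cv_apply_swap]
  rfl

theorem norm_distL_le (g : BF d) (φ : 𝓢(Sp d, ℂ)) : ‖distL g φ‖ ≤ (∫ x, ‖φ x‖) * ‖g‖ := by
  rw [distL_apply, ← integral_mul_const]
  refine norm_integral_le_of_norm_le (φ.integrable.norm.mul_const _) (ae_of_all _ fun x => ?_)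
  rw [norm_mul, mul_comm]
  gcongr
  exact g.norm_coe_le_norm x

theorem integrable_bdd_mul (g : BF d) (φ : 𝓢(Sp d, ℂ)) : Integrable fun x => g x * φ x :=
  (integrable_mul_bdd φ g).congr (ae_of_all _ fun _ => mul_comm _ _)

/-- The value of `distL g` on a fixed test function, as a function of `g`. -/
noncomputable def distEval (φ : 𝓢(Sp d, ℂ)) : BF d →L[ℂ] ℂ :=
  LinearMap.mkContinuous
    { toFun := fun g => distL g φ
      map_add' := fun g g' => by
        simp only [distL_apply, BoundedContinuousFunction.add_apply, add_mul]
        exact integral_add (integrable_bdd_mul g φ) (integrable_bdd_mul g' φ)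
      map_smul' := fun c g => by
        simp only [distL_apply, BoundedContinuousFunction.smul_apply, smul_eq_mul, RingHom.id_apply,
          ← integral_const_mul, mul_assoc] }
    (∫ x, ‖φ x‖) fun g => norm_distL_le g φ

theorem distEval_apply (φ : 𝓢(Sp d, ℂ)) (g : BF d) : distEval φ g = distL g φ := rfl

/-! ### Frequency-uniform decomposition -/

/-- The window `M_{βk} χ`. -/
noncomputable abbrev wav (β : ℝ) (χ : 𝓢(Sp d, ℂ)) (k : Fin d → ℤ) : 𝓢(Sp d, ℂ) :=
  modulate (latticePoint β k) χ

/-- A window whose Fourier transform is `1` on the ball of radius `2`. -/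
noncomputable def fat (d : ℕ) : 𝓢(Sp d, ℂ) := 𝓕⁻ (cutoff d)

theorem fourier_fat : (𝓕 (fat d) : 𝓢(Sp d, ℂ)) = cutoff d := FourierTransform.fourier_fourierInv_eq _

theorem IsAdmissibleWindow.fourier_zero {β : ℝ} {χ : 𝓢(Sp d, ℂ)} (hχ : IsAdmissibleWindow β χ)
    {ξ : Sp d} (h : 1 < ‖ξ‖) : (𝓕 χ : 𝓢(Sp d, ℂ)) ξ = 0 := by
  by_contra h'
  have := hχ.support_subset h'
  simp at this
  linarith

/-- The transform of the wide window is `1` on the ball of radius `2`, and that of `χ` vanishes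
outside the unit ball. Every block is therefore reproduced by a kernel whose modulus does not depend
on `k`. -/
theorem IsAdmissibleWindow.sconv_fat {β : ℝ} {χ : 𝓢(Sp d, ℂ)} (hχ : IsAdmissibleWindow β χ)
    (k : Fin d → ℤ) : sconv (wav β (fat d) k) (wav β χ k) = wav β χ k := by
  refine fourier_injective fun ξ => ?_
  rw [fourier_sconv_apply, fourier_modulate, fourier_modulate, fourier_fat]
  rcases le_or_gt ‖ξ - latticePoint β k‖ 2 with h | h
  · rw [cutoff_one h, one_mul]
  · rw [hχ.fourier_zero (by linarith), mul_zero]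

theorem IsAdmissibleWindow.sum_eq_one {β : ℝ} {χ : 𝓢(Sp d, ℂ)} (hχ : IsAdmissibleWindow β χ) (R : ℝ)
    {ξ : Sp d} (h : ‖ξ‖ ≤ R) : ∑ k ∈ (finite_lattice (d := d) hχ.pos (R + 1)).toFinset,
      (𝓕 χ : 𝓢(Sp d, ℂ)) (ξ - latticePoint β k) = 1 := by
  refine (hasSum_sum_of_ne_finset_zero fun k hk => ?_).unique (hχ.hasSum_one ξ)
  refine hχ.fourier_zero ?_
  simp only [Set.Finite.mem_toFinset, Set.mem_ofPred_eq, not_le] at hk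
  have := norm_sub_norm_le (latticePoint β k) ξ
  rw [norm_sub_rev] at this
  linarith

theorem IsAdmissibleWindow.sconv_refl_wav_eq_zero {β : ℝ} {χ : 𝓢(Sp d, ℂ)} (hχ : IsAdmissibleWindow β χ)
    {R : ℝ} {φ : 𝓢(Sp d, ℂ)} (hφ : ∀ ξ, R ≤ ‖ξ‖ → (𝓕 φ : 𝓢(Sp d, ℂ)) ξ = 0) {k : Fin d → ℤ}
    (hk : R + 1 < ‖latticePoint β k‖) : sconv φ (refl (wav β χ k)) = 0 := by
  refine fourier_injective fun ξ => ?_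
  rw [fourier_sconv_apply, fourier_refl, fourier_modulate]
  have h0 : (𝓕 (0 : 𝓢(Sp d, ℂ)) : 𝓢(Sp d, ℂ)) ξ = 0 := by
    rw [FourierTransform.fourier_zero]; rfl
  rw [h0]
  rcases le_or_gt R ‖ξ‖ with h | h
  · rw [hφ ξ h, zero_mul]
  · rw [hχ.fourier_zero, mul_zero]
    have := norm_sub_norm_le (latticePoint β k) (-ξ)
    rw [norm_neg, norm_sub_rev] at this
    linarith

theorem IsAdmissibleWindow.sum_sconv_refl_wav {β : ℝ} {χ : 𝓢(Sp d, ℂ)} (hχ : IsAdmissibleWindow β χ)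
    {R : ℝ} {φ : 𝓢(Sp d, ℂ)} (hφ : ∀ ξ, R ≤ ‖ξ‖ → (𝓕 φ : 𝓢(Sp d, ℂ)) ξ = 0) :
    ∑ k ∈ (finite_lattice (d := d) hχ.pos (R + 1)).toFinset, sconv φ (refl (wav β χ k)) = φ := by
  refine fourier_injective fun ξ => ?_
  have h1 : (𝓕 (∑ k ∈ (finite_lattice (d := d) hχ.pos (R + 1)).toFinset,
      sconv φ (refl (wav β χ k))) : 𝓢(Sp d, ℂ)) =
      ∑ k ∈ (finite_lattice (d := d) hχ.pos (R + 1)).toFinset, 𝓕 (sconv φ (refl (wav β χ k))) :=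
    map_sum (FourierTransform.fourierCLM ℂ 𝓢(Sp d, ℂ)) _ _
  rw [h1, sum_apply]
  simp only [fourier_sconv_apply, fourier_refl, fourier_modulate]
  rw [← Finset.mul_sum]
  rcases le_or_gt R ‖ξ‖ with h | h
  · rw [hφ ξ h, zero_mul]
  · rw [hχ.sum_eq_one R (by rw [norm_neg]; exact h.le), mul_one]

/-- A band-limited test function meets only finitely many windows and is the finite sum of its
pieces. Testing with such functions avoids any convergence question among distributions, and they
are dense. -/
theorem IsAdmissibleWindow.eq_distL {β : ℝ} {χ : 𝓢(Sp d, ℂ)} (hχ : IsAdmissibleWindow β χ)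
    (f : 𝓢'(Sp d, ℂ)) (b : (Fin d → ℤ) → BF d) (hb : ∀ k x, conv f (wav β χ k) x = b k x)
    (hs : Summable b) : f = distL (∑' k, b k) := by
  refine distribution_ext_bandlimited _ _ fun φ ⟨R, hφ⟩ => ?_
  have h1 : ∀ k, distEval φ (b k) = f (sconv φ (refl (wav β χ k))) := fun k => by
    rw [(distribution_sconv_refl f φ (wav β χ k)).2, distEval_apply, distL_apply]
    refine integral_congr_ae (ae_of_all _ fun x => ?_)
    simp only [hb, mul_comm]
  rw [← distEval_apply, ContinuousLinearMap.map_tsum _ hs]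
  simp only [h1]
  rw [tsum_eq_sum (s := (finite_lattice (d := d) hχ.pos (R + 1)).toFinset), ← map_sum,
    hχ.sum_sconv_refl_wav hφ]
  intro k hk
  rw [hχ.sconv_refl_wav_eq_zero hφ (by simpa using hk), map_zero]

theorem IsAdmissibleWindow.eq_zero_of_conv {β : ℝ} {χ : 𝓢(Sp d, ℂ)} (hχ : IsAdmissibleWindow β χ)
    (f : 𝓢'(Sp d, ℂ)) (hb : ∀ k x, conv f (wav β χ k) x = 0) : f = 0 := by
  rw [hχ.eq_distL f 0 (fun k x => by rw [hb]; rfl) summable_zero]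
  ext φ
  simp [distL_apply]

/-- Smooth functions of compact support are Schwartz functions: bumps give local integrability, and
the fundamental lemma of the calculus of variations gives equality. The function attached to a
solution is thus determined by it. -/
theorem ae_eq_of_represents {g g' : Sp d → ℂ} {w : 𝓢'(Sp d, ℂ)} (h : Represents g w)
    (h' : Represents g' w) : g =ᵐ[volume] g' := by
  have hloc : ∀ {g : Sp d → ℂ}, Represents g w → LocallyIntegrable g := by
    intro g h
    rw [locallyIntegrable_iff]
    intro K hK
    obtain ⟨R, hR⟩ := hK.isBounded.subset_closedBall (0 : Sp d)
    let b : ContDiffBump (0 : Sp d) := ⟨|R| + 1, |R| + 2, by positivity, by linarith⟩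
    have h1 : HasCompactSupport (fun ξ => (b ξ : ℂ)) :=
      b.hasCompactSupport.comp_left (g := fun x : ℝ => (x : ℂ)) (by simp)
    have h2 : ContDiff ℝ (⊤ : ℕ∞) (fun ξ => (b ξ : ℂ)) := Complex.ofRealCLM.contDiff.comp b.contDiff
    refine ((h (h1.toSchwartzMap h2)).1.integrableOn (s := K)).congr_fun (fun x hx => ?_) hK.measurableSet
    simp only [HasCompactSupport.toSchwartzMap_toFun]
    have hx' := hR hx
    rw [mem_closedBall_zero_iff] at hx'
    rw [b.one_of_mem_closedBall (by
      rw [mem_closedBall_zero_iff]; change ‖x‖ ≤ |R| + 1; linarith [le_abs_self R])]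
    simp
  refine ae_eq_of_integral_contDiff_smul_eq (hloc h) (hloc h') fun η hη hc => ?_
  have h1 : HasCompactSupport (fun ξ => (η ξ : ℂ)) := hc.comp_left (g := fun x : ℝ => (x : ℂ)) (by simp)
  have h2 : ContDiff ℝ (⊤ : ℕ∞) (fun ξ => (η ξ : ℂ)) := Complex.ofRealCLM.contDiff.comp hη
  have h3 : ∀ g : Sp d → ℂ, ∫ x, η x • g x = ∫ x, g x * (h1.toSchwartzMap h2) x := fun g => by
    refine integral_congr_ae (ae_of_all _ fun x => ?_)
    simp only [HasCompactSupport.toSchwartzMap_toFun, Complex.real_smul, mul_comm]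
  rw [h3, h3, ← (h _).2, ← (h' _).2]

theorem represents_distL (g : BF d) : Represents g (distL g) := fun φ => ⟨integrable_bdd_mul g φ, rfl⟩

theorem distL_injective {g g' : BF d} (h : distL g = distL g') : g = g' := by
  have h1 := ae_eq_of_represents (represents_distL g) (h ▸ represents_distL g')
  exact DFunLike.coe_injective ((g.continuous.ae_eq_iff_eq volume g'.continuous).1 h1)

theorem IsAdmissibleWindow.eq_tsum_cv {β : ℝ} {χ : 𝓢(Sp d, ℂ)} (hχ : IsAdmissibleWindow β χ) (g : BF d)
    (hs : Summable fun k => cv (wav β χ k) g) : g = ∑' k, cv (wav β χ k) g :=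
  distL_injective (hχ.eq_distL _ _ (fun _ _ => conv_distL _ _ _) hs)

theorem IsAdmissibleWindow.eq_zero_of_cv {β : ℝ} {χ : 𝓢(Sp d, ℂ)} (hχ : IsAdmissibleWindow β χ) {g : BF d}
    (hs : ∀ k, cv (wav β χ k) g = 0) : g = 0 := by
  rw [hχ.eq_tsum_cv g (by simp only [hs]; exact summable_zero)]
  simp [hs]

/-! ### The multiplier `cos (2π t |ξ|)` -/

/-- The entire function with `cosq (w ^ 2) = cos w`. -/
noncomputable def cosq (z : ℂ) : ℂ := Complex.cos (z ^ ((2 : ℕ) : ℂ)⁻¹)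

theorem sq_root (z : ℂ) : (z ^ ((2 : ℕ) : ℂ)⁻¹) ^ 2 = z := Complex.cpow_nat_inv_pow z two_ne_zero

theorem cosq_sq (w : ℂ) : cosq (w ^ 2) = Complex.cos w := by
  rcases sq_eq_sq_iff_eq_or_eq_neg.1 (sq_root (w ^ 2)) with h | h
  · rw [cosq, h]
  · rw [cosq, h, Complex.cos_neg]

theorem cosq_neg (z : ℂ) : cosq (-z) = Complex.cosh (z ^ ((2 : ℕ) : ℂ)⁻¹) := by
  have h : -z = ((z ^ ((2 : ℕ) : ℂ)⁻¹) * Complex.I) ^ 2 := by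
    rw [mul_pow, sq_root, Complex.I_sq]; ring
  rw [h, cosq_sq, Complex.cos_mul_I]

/-- Cosine is even, so the branch of the root is immaterial. The principal branch works on the slit
plane, the root of `-z` with `cosh` works at the other nonzero points, and `0` is a removable
singularity by continuity. -/
theorem differentiable_cosq : Differentiable ℂ cosq := by
  have h1 : ∀ z ∈ Complex.slitPlane, DifferentiableAt ℂ cosq z := fun z hz =>
    Complex.differentiable_cos.differentiableAt.comp z
      (DifferentiableAt.cpow differentiableAt_id (differentiableAt_const _) hz)
  have h2 : ∀ z, z ≠ 0 → DifferentiableAt ℂ cosq z := fun z hz => by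
    by_cases hs : z ∈ Complex.slitPlane
    · exact h1 z hs
    · have hs' : -z ∈ Complex.slitPlane := by
        rw [Complex.mem_slitPlane_iff] at hs ⊢
        push Not at hs
        left
        rcases hs.1.lt_or_eq with h | h
        · simpa using h
        · exact absurd (Complex.ext h hs.2) hz
      have h3 : cosq = fun z => Complex.cosh ((-z) ^ ((2 : ℕ) : ℂ)⁻¹) := by
        funext z
        rw [← cosq_neg, neg_neg]
      rw [h3]
      exact Complex.differentiable_cosh.differentiableAt.comp z
        (DifferentiableAt.cpow differentiableAt_id.neg (differentiableAt_const _) hs')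
  intro z
  rcases eq_or_ne z 0 with rfl | hz
  · refine (Complex.analyticAt_of_differentiable_on_punctured_nhds_of_continuousAt ?_ ?_).differentiableAt
    · exact eventually_nhdsWithin_of_forall fun z hz => h2 z hz
    · refine Complex.continuous_cos.continuousAt.comp ?_
      refine Complex.continuousAt_cpow_const_of_re_pos (by simp) ?_
      norm_num
  · exact h2 z hz

theorem norm_cos_le (w : ℂ) : ‖Complex.cos w‖ ≤ Real.exp |w.im| := by
  rw [Complex.cos, norm_div]
  have h1 : ‖Complex.exp (w * Complex.I)‖ ≤ Real.exp |w.im| := by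
    rw [Complex.norm_exp]; gcongr; simpa using neg_le_abs w.im
  have h2 : ‖Complex.exp (-w * Complex.I)‖ ≤ Real.exp |w.im| := by
    rw [Complex.norm_exp]; gcongr; simpa using le_abs_self w.im
  have h3 := norm_add_le (Complex.exp (w * Complex.I)) (Complex.exp (-w * Complex.I))
  rw [Complex.norm_ofNat]
  linarith

/-- If `w ^ 2 = z` then `2 (Im w) ^ 2 = ‖z‖ - Re z`, and `‖cos w‖ ≤ exp |Im w|`. -/
theorem norm_cosq_le {z : ℂ} {r : ℝ} (hr : 0 ≤ r) (h : ‖z‖ - z.re ≤ 2 * r ^ 2) : ‖cosq z‖ ≤ Real.exp r := by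
  set w := z ^ ((2 : ℕ) : ℂ)⁻¹ with hw
  refine (norm_cos_le w).trans (Real.exp_le_exp.2 (abs_le_of_sq_le_sq ?_ hr))
  rw [← sq_root z, ← hw, norm_pow, ← Complex.normSq_eq_norm_sq, Complex.normSq_apply, sq w, Complex.mul_re] at h
  nlinarith

/-- The multiplier of the cosine propagator. -/
noncomputable def cosMul (t : ℝ) (ξ : Sp d) : ℂ := cosq (((2 * Real.pi * t) ^ 2 * ‖ξ‖ ^ 2 : ℝ) : ℂ)

theorem cosMul_eq (t : ℝ) (ξ : Sp d) : cosMul t ξ = (Real.cos (2 * Real.pi * t * ‖ξ‖) : ℂ) := by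
  rw [cosMul, ← mul_pow, Complex.ofReal_pow, cosq_sq, Complex.ofReal_cos]

theorem norm_cosMul_le (t : ℝ) (ξ : Sp d) : ‖cosMul t ξ‖ ≤ 1 := by
  rw [cosMul_eq, Complex.norm_real]
  exact Real.abs_cos_le_one _

theorem iteratedDeriv_comp_ofReal {H : ℂ → ℂ} (hH : Differentiable ℂ H) (n : ℕ) :
    iteratedDeriv n (fun x : ℝ => H x) = fun x : ℝ => iteratedDeriv n H x := by
  induction n with
  | zero => simp
  | succ n ih =>
    rw [iteratedDeriv_succ, ih, iteratedDeriv_succ]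
    funext x
    have h : DifferentiableAt ℂ (iteratedDeriv n H) x :=
      (hH.contDiff (n := ⊤)).differentiable_iteratedDeriv n (by
        exact_mod_cast WithTop.coe_lt_top (n : ℕ∞)) x
    exact h.hasDerivAt.comp_ofReal.deriv

theorem contDiff_comp_ofReal {H : ℂ → ℂ} (hH : Differentiable ℂ H) {n : WithTop ℕ∞} :
    ContDiff ℝ n (fun x : ℝ => H x) :=
  ((hH.contDiff (n := n)).restrict_scalars ℝ).comp Complex.ofRealCLM.contDiff

/-- Cauchy's estimate on unit circles centred on the real line. -/
theorem norm_iteratedDeriv_comp_ofReal_le {H : ℂ → ℂ} (hH : Differentiable ℂ H) (n : ℕ) (x : ℝ) {C : ℝ}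
    (h : ∀ z : ℂ, ‖z - x‖ = 1 → ‖H z‖ ≤ C) :
    ‖iteratedDeriv n (fun x : ℝ => H x) x‖ ≤ n.factorial * C := by
  rw [iteratedDeriv_comp_ofReal hH]
  have := Complex.norm_iteratedDeriv_le_of_forall_mem_sphere_norm_le n (c := (x : ℂ)) one_pos hH.diffContOnCl
    (fun z hz => h z (by simpa [dist_eq_norm] using hz))
  simpa using this

theorem hasTemperateGrowth_cosMul (t : ℝ) : Function.HasTemperateGrowth (cosMul (d := d) t) := by
  set a : ℝ := (2 * Real.pi * t) ^ 2 with ha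
  have ha0 : 0 ≤ a := sq_nonneg _
  set H : ℂ → ℂ := fun z => cosq (a * z) with hHdef
  have hH : Differentiable ℂ H := differentiable_cosq.comp ((differentiable_const _).mul differentiable_id)
  have h1 : cosMul (d := d) t = (fun x : ℝ => H x) ∘ (fun ξ : Sp d => ‖ξ‖ ^ 2) := by
    funext ξ
    simp [cosMul, hHdef, ha]
  rw [h1]
  have ho : IsOpen (Set.Ioi (-1 : ℝ)) := isOpen_Ioi
  refine Function.HasTemperateGrowth.comp' (t := Set.Ioi (-1 : ℝ)) ?_ ho.uniqueDiffOn
    (contDiff_comp_ofReal hH).contDiffOn (fun N => ?_) (by fun_prop)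
  · rintro _ ⟨ξ, rfl⟩
    have : (0 : ℝ) ≤ ‖ξ‖ ^ 2 := by positivity
    simp only [Set.mem_Ioi]; linarith
  -- On the unit circle about a real `x > -1` one has `‖z‖ - Re z ≤ 4`, so `norm_cosq_le` applies
  -- with `r ^ 2 = 2 * a`. The half-line starts at `-1` rather than `0` so as to be an open set
  -- containing all values of `‖ξ‖ ^ 2`.
  · refine ⟨0, N.factorial * Real.exp (Real.sqrt (2 * a)), by positivity, fun n hn x hx => ?_⟩
    rw [iteratedFDerivWithin_of_isOpen n ho hx, norm_iteratedFDeriv_eq_norm_iteratedDeriv, pow_zero, mul_one]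
    refine (norm_iteratedDeriv_comp_ofReal_le hH n x (C := Real.exp (Real.sqrt (2 * a))) fun z hz => ?_).trans ?_
    · refine norm_cosq_le (Real.sqrt_nonneg _) ?_
      rw [Real.sq_sqrt (by positivity), norm_mul, Complex.norm_real, Real.norm_of_nonneg ha0,
        Complex.re_ofReal_mul]
      have h3 : ‖z‖ ≤ |x| + 1 := by
        have := norm_sub_norm_le z (x : ℂ)
        rw [Complex.norm_real, Real.norm_eq_abs] at this
        linarith
      have h4 := (Complex.abs_re_le_norm (z - x)).trans hz.le
      rw [Complex.sub_re, Complex.ofReal_re] at h4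
      have h5 := (abs_le.1 h4).1
      have h6 : |x| ≤ x + 2 := abs_le.2 ⟨by linarith [hx.out], by linarith⟩
      have : ‖z‖ - z.re ≤ 4 := by linarith
      nlinarith
    · gcongr

/-- Adding a nonnegative constant to a square cannot increase the imaginary part of the root: `Re w
* Im w = Re ζ * Im ζ`, whereas a larger `|Im w|` would force a larger `|Re w|`. -/
theorem abs_im_le_of_sq_eq {w ζ : ℂ} {B : ℝ} (hB : 0 ≤ B) (h : w ^ 2 = ζ ^ 2 + B) : |w.im| ≤ |ζ.im| := by
  have h1 := congrArg Complex.re h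
  have h2 := congrArg Complex.im h
  simp only [sq, Complex.mul_re, Complex.mul_im, Complex.add_re, Complex.add_im, Complex.ofReal_re,
    Complex.ofReal_im] at h1 h2
  refine sq_le_sq.1 ?_
  by_contra! hlt
  have h3 : ζ.re ^ 2 < w.re ^ 2 := by nlinarith
  have h4 : w.re ^ 2 * w.im ^ 2 = ζ.re ^ 2 * ζ.im ^ 2 := by
    have : w.re * w.im = ζ.re * ζ.im := by linarith
    rw [← mul_pow, ← mul_pow, this]
  nlinarith [sq_nonneg ζ.re, sq_nonneg ζ.im]

/-- Along the line the squared norm is `(η + a) ^ 2 + B` with `B ≥ 0`, a polynomial in `η`, so the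
symbol extends to an entire function. On unit circles about real points the imaginary part is at
most `1`, which yields `exp (2π|t|)` uniformly in `ξ`. -/
theorem norm_iteratedDeriv_cosMul_line_le (t : ℝ) (ξ e : Sp d) (he : ‖e‖ = 1) (n : ℕ) (η : ℝ) :
    ‖iteratedDeriv n (fun η : ℝ => cosMul t (ξ + η • e)) η‖ ≤ n.factorial * Real.exp (2 * Real.pi * |t|) := by
  set a : ℝ := ⟪ξ, e⟫_ℝ with ha
  set B : ℝ := ‖ξ‖ ^ 2 - a ^ 2 with hB
  have hB0 : 0 ≤ B := by
    have h1 := abs_real_inner_le_norm ξ e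
    rw [he, mul_one] at h1
    have := sq_le_sq.2 (h1.trans (le_abs_self _))
    linarith
  set H : ℂ → ℂ := fun z => cosq (((2 * Real.pi * t : ℝ) : ℂ) ^ 2 * ((z + a) ^ 2 + B)) with hHdef
  have hH : Differentiable ℂ H := differentiable_cosq.comp (by fun_prop)
  have h1 : (fun η : ℝ => cosMul t (ξ + η • e)) = fun η : ℝ => H η := by
    funext η
    rw [cosMul, hHdef, norm_add_sq_real, inner_smul_right, norm_smul, he, ← ha]
    congr 1
    rw [mul_one, Real.norm_eq_abs, sq_abs, hB]
    push_cast
    ring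
  rw [h1]
  refine norm_iteratedDeriv_comp_ofReal_le hH n η fun z hz => ?_
  set w := (((2 * Real.pi * t : ℝ) : ℂ) ^ 2 * ((z + a) ^ 2 + B)) ^ ((2 : ℕ) : ℂ)⁻¹ with hw
  refine (norm_cos_le w).trans (Real.exp_le_exp.2 ?_)
  have h2 : w ^ 2 = (((2 * Real.pi * t : ℝ) : ℂ) * (z + a)) ^ 2 + (((2 * Real.pi * t) ^ 2 * B : ℝ) : ℂ) := by
    rw [hw, sq_root]; push_cast; ring
  refine (abs_im_le_of_sq_eq (by positivity) h2).trans ?_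
  rw [Complex.im_ofReal_mul, abs_mul, abs_mul, abs_mul, abs_two, abs_of_pos Real.pi_pos]
  have h3 := (Complex.abs_im_le_norm (z - η)).trans hz.le
  rw [Complex.sub_im, Complex.ofReal_im, sub_zero] at h3
  rw [Complex.add_im, Complex.ofReal_im, add_zero]
  exact mul_le_of_le_one_right (by positivity) h3

theorem continuous_cosMul (ξ : Sp d) : Continuous fun t : ℝ => cosMul t ξ := by
  simp only [cosMul_eq]
  fun_prop

/-! ### The cosine propagator on Schwartz functions -/

/-- The cosine propagator `cos (t √(-Δ))` on Schwartz functions. -/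
noncomputable def cosS (t : ℝ) (φ : 𝓢(Sp d, ℂ)) : 𝓢(Sp d, ℂ) :=
  SchwartzMap.fourierMultiplierCLM ℂ (cosMul t) φ

theorem fourier_cosS (t : ℝ) (φ : 𝓢(Sp d, ℂ)) (ξ : Sp d) :
    (𝓕 (cosS t φ) : 𝓢(Sp d, ℂ)) ξ = cosMul t ξ * (𝓕 φ : 𝓢(Sp d, ℂ)) ξ := by
  rw [cosS, SchwartzMap.fourierMultiplierCLM_apply, FourierTransform.fourier_fourierInv_eq,
    SchwartzMap.smulLeftCLM_apply_apply (hasTemperateGrowth_cosMul t), smul_eq_mul]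

theorem fourier_laplacian (φ : 𝓢(Sp d, ℂ)) (ξ : Sp d) :
    (𝓕 (Δ φ) : 𝓢(Sp d, ℂ)) ξ = -((2 * Real.pi * ‖ξ‖) ^ 2 : ℝ) * (𝓕 φ : 𝓢(Sp d, ℂ)) ξ := by
  rw [SchwartzMap.laplacian_eq_fourierMultiplierCLM, FourierTransform.fourier_smul,
    SchwartzMap.fourierMultiplierCLM_apply, FourierTransform.fourier_fourierInv_eq, smul_apply,
    SchwartzMap.smulLeftCLM_apply_apply (by fun_prop), Complex.real_smul, Complex.real_smul]
  push_cast
  ring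

theorem sconv_cosS (t : ℝ) (f g : 𝓢(Sp d, ℂ)) : sconv (cosS t f) g = cosS t (sconv f g) :=
  fourier_injective fun ξ => by
    rw [fourier_sconv_apply, fourier_cosS, fourier_cosS, fourier_sconv_apply, mul_assoc]

theorem sconv_laplacian (f g : 𝓢(Sp d, ℂ)) : sconv (Δ f) g = Δ (sconv f g) :=
  fourier_injective fun ξ => by
    rw [fourier_sconv_apply, fourier_laplacian, fourier_laplacian, fourier_sconv_apply, mul_assoc]

theorem cosS_zero (φ : 𝓢(Sp d, ℂ)) : cosS 0 φ = φ :=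
  fourier_injective fun ξ => by
    rw [fourier_cosS, cosMul_eq]; simp

theorem inversion (φ : 𝓢(Sp d, ℂ)) (x : Sp d) :
    φ x = ∫ ξ, Complex.exp ((2 * Real.pi * ⟪ξ, x⟫_ℝ : ℝ) * Complex.I) * (𝓕 φ : 𝓢(Sp d, ℂ)) ξ := by
  conv_lhs => rw [← FourierTransform.fourierInv_fourier_eq (F := 𝓢(Sp d, ℂ)) φ]
  rw [SchwartzMap.fourierInv_coe, Real.fourierInv_eq']
  simp only [smul_eq_mul]

theorem norm_le_integral_fourier (φ : 𝓢(Sp d, ℂ)) (x : Sp d) : ‖φ x‖ ≤ ∫ ξ, ‖(𝓕 φ : 𝓢(Sp d, ℂ)) ξ‖ := by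
  conv_lhs => rw [inversion]
  refine norm_integral_le_of_norm_le (𝓕 φ : 𝓢(Sp d, ℂ)).integrable.norm (ae_of_all _ fun ξ => ?_)
  rw [norm_mul, Complex.norm_exp_ofReal_mul_I, one_mul]

open scoped LineDeriv

/-- Iterated derivatives in a fixed direction. -/
noncomputable def itDer (e : Sp d) (n : ℕ) (φ : 𝓢(Sp d, ℂ)) : 𝓢(Sp d, ℂ) := (fun φ => ∂_{e} φ)^[n] φ

theorem itDer_succ (e : Sp d) (n : ℕ) (φ : 𝓢(Sp d, ℂ)) : itDer e (n + 1) φ = ∂_{e} (itDer e n φ) :=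
  Function.iterate_succ_apply' _ _ _

theorem itDer_apply (e : Sp d) (n : ℕ) (φ : 𝓢(Sp d, ℂ)) (ξ : Sp d) (η : ℝ) :
    itDer e n φ (ξ + η • e) = iteratedDeriv n (fun η : ℝ => φ (ξ + η • e)) η := by
  induction n generalizing η with
  | zero => simp [itDer]
  | succ n ih =>
    rw [itDer_succ, iteratedDeriv_succ]
    have h1 : iteratedDeriv n (fun η : ℝ => φ (ξ + η • e)) = fun η : ℝ => itDer e n φ (ξ + η • e) := by
      funext η; rw [ih]
    rw [h1, SchwartzMap.lineDerivOp_apply_eq_fderiv]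
    have h2 : HasDerivAt (fun η : ℝ => ξ + η • e) e η := by
      simpa using ((hasDerivAt_id η).smul_const e).const_add ξ
    exact (((itDer e n φ).differentiableAt (x := ξ + η • e)).hasFDerivAt.comp_hasDerivAt η h2).deriv.symm

/-- Multiplication by `⟪x, e⟫` corresponds to differentiation of the transform along `e`; the factor
`(2π) ^ n ≥ 1` is discarded. -/
theorem norm_pow_inner_mul_le (φ : 𝓢(Sp d, ℂ)) (e x : Sp d) (n : ℕ) :
    |⟪x, e⟫_ℝ| ^ n * ‖φ x‖ ≤ ∫ ξ, ‖itDer e n (𝓕 φ : 𝓢(Sp d, ℂ)) ξ‖ := by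
  have key : ∀ n (f : 𝓢(Sp d, ℂ)), ‖(𝓕⁻ (itDer e n f) : 𝓢(Sp d, ℂ)) x‖ =
      (2 * Real.pi * |⟪x, e⟫_ℝ|) ^ n * ‖(𝓕⁻ f : 𝓢(Sp d, ℂ)) x‖ := by
    intro n
    induction n with
    | zero => intro f; simp [itDer]
    | succ n ih =>
      intro f
      rw [itDer_succ, SchwartzMap.fourierInv_lineDerivOp_eq, smul_apply,
        SchwartzMap.smulLeftCLM_apply_apply (by fun_prop), norm_smul, norm_smul, ih, pow_succ]
      simp [abs_of_pos Real.pi_pos]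
      ring
  have h1 := key n (𝓕 φ)
  rw [FourierTransform.fourierInv_fourier_eq] at h1
  have h2 := norm_le_integral_fourier (𝓕⁻ (itDer e n (𝓕 φ : 𝓢(Sp d, ℂ))) : 𝓢(Sp d, ℂ)) x
  rw [FourierTransform.fourier_fourierInv_eq, h1] at h2
  refine le_trans ?_ h2
  gcongr
  have := Real.pi_gt_three
  nlinarith [abs_nonneg ⟪x, e⟫_ℝ]

/-- Leibniz' rule on a line, with every binomial coefficient estimated by `2 ^ n` and every
factorial by `n!`. -/
theorem norm_itDer_cosMul_le (t : ℝ) (f : 𝓢(Sp d, ℂ)) (e : Sp d) (he : ‖e‖ = 1) (n : ℕ) (ξ : Sp d) :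
    ‖itDer e n (SchwartzMap.smulLeftCLM ℂ (cosMul t) f) ξ‖ ≤
      2 ^ n * n.factorial * Real.exp (2 * Real.pi * |t|) * ∑ j ∈ Finset.range (n + 1), ‖itDer e j f ξ‖ := by
  have h1 := itDer_apply e n (SchwartzMap.smulLeftCLM ℂ (cosMul t) f) ξ 0
  rw [zero_smul, add_zero] at h1
  have hl : ContDiff ℝ n (fun η : ℝ => ξ + η • e) := by fun_prop
  have h2 : (fun η : ℝ => SchwartzMap.smulLeftCLM ℂ (cosMul t) f (ξ + η • e)) =
      (fun η : ℝ => cosMul t (ξ + η • e)) * (fun η : ℝ => f (ξ + η • e)) := by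
    funext η
    rw [SchwartzMap.smulLeftCLM_apply_apply (hasTemperateGrowth_cosMul t)]; rfl
  have hc : ContDiff ℝ n (fun η : ℝ => cosMul t (ξ + η • e)) :=
    (((hasTemperateGrowth_cosMul t).1.of_le (by exact_mod_cast le_top)).comp hl)
  have hf : ContDiff ℝ n (fun η : ℝ => f (ξ + η • e)) := (f.smooth n).comp hl
  rw [h1, h2, iteratedDeriv_mul hc.contDiffAt hf.contDiffAt, ← Finset.sum_range_reflect, Finset.mul_sum]
  refine norm_sum_le_of_le _ fun j hj => ?_
  have hj' : j ≤ n := by simpa [Nat.lt_succ_iff] using hj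
  have e1 : n + 1 - 1 - j = n - j := by omega
  have e2 : n - (n - j) = j := by omega
  rw [e1, e2, norm_mul, norm_mul, Complex.norm_natCast]
  have h3 := norm_iteratedDeriv_cosMul_line_le t ξ e he (n - j) 0
  have h4 := itDer_apply e j f ξ 0
  rw [zero_smul, add_zero] at h4
  rw [← h4]
  gcongr ?_ * _
  calc (n.choose (n - j) : ℝ) * ‖iteratedDeriv (n - j) (fun η : ℝ => cosMul t (ξ + η • e)) 0‖
      ≤ 2 ^ n * (n.factorial * Real.exp (2 * Real.pi * |t|)) := by
        gcongr
        · exact_mod_cast Nat.choose_le_two_pow _ _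
        · refine h3.trans ?_
          gcongr
          omega
    _ = _ := by ring

/-- The constant in the kernel estimates for the propagator. -/
noncomputable def kerConst (M : ℕ) (φ : 𝓢(Sp d, ℂ)) : ℝ :=
  (∫ ξ, ‖(𝓕 φ : 𝓢(Sp d, ℂ)) ξ‖) + ∑ i : Fin d, ∑ j ∈ Finset.range (M + 1),
    ∫ ξ, ‖itDer (EuclideanSpace.single i 1) j (𝓕 φ : 𝓢(Sp d, ℂ)) ξ‖

theorem kerConst_nonneg (M : ℕ) (φ : 𝓢(Sp d, ℂ)) : 0 ≤ kerConst M φ := by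
  unfold kerConst; positivity

/-- Modulation translates the transform, and the constant is built from translation-invariant
integrals. This makes the propagator bounds uniform over all blocks. -/
theorem kerConst_modulate (M : ℕ) (ω : Sp d) (φ : 𝓢(Sp d, ℂ)) : kerConst M (modulate ω φ) = kerConst M φ := by
  have h : ∀ e j ξ, itDer e j (𝓕 (modulate ω φ) : 𝓢(Sp d, ℂ)) ξ = itDer e j (𝓕 φ : 𝓢(Sp d, ℂ)) (ξ - ω) := by
    intro e j ξ
    have h1 := itDer_apply e j (𝓕 (modulate ω φ) : 𝓢(Sp d, ℂ)) ξ 0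
    have h2 := itDer_apply e j (𝓕 φ : 𝓢(Sp d, ℂ)) (ξ - ω) 0
    rw [zero_smul, add_zero] at h1 h2
    rw [h1, h2]
    congr 1
    funext η
    rw [fourier_modulate]
    congr 1
    abel
  unfold kerConst
  simp only [h, fourier_modulate]
  congr 1
  · exact integral_sub_right_eq_self (fun ξ => ‖(𝓕 φ : 𝓢(Sp d, ℂ)) ξ‖) ω
  · refine Finset.sum_congr rfl fun i _ => Finset.sum_congr rfl fun j _ => ?_
    exact integral_sub_right_eq_self (fun ξ => ‖itDer (EuclideanSpace.single i 1) j (𝓕 φ : 𝓢(Sp d, ℂ)) ξ‖) ω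

theorem exists_one_add_norm_pow_le (d M : ℕ) : ∃ C, 0 ≤ C ∧ ∀ x : Sp d,
    (1 + ‖x‖) ^ M ≤ C * (1 + ∑ i : Fin d, |x i| ^ M) := by
  refine ⟨2 ^ M * (1 + (1 + d) ^ M), by positivity, fun x => ?_⟩
  have h2 : ‖x‖ ^ M ≤ (1 + d) ^ M * (1 + ∑ i : Fin d, |x i| ^ M) := by
    rcases isEmpty_or_nonempty (Fin d) with h | h
    · have hx : x = 0 := Subsingleton.elim _ _
      have : ‖x‖ ^ M ≤ 1 := by rw [hx, norm_zero]; exact pow_le_one₀ le_rfl zero_le_one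
      refine this.trans ?_
      have h0 : (1 : ℝ) ≤ (1 + d) ^ M := one_le_pow₀ (by simp)
      have : 0 ≤ ∑ i : Fin d, |x i| ^ M := by positivity
      nlinarith
    · obtain ⟨i, hi⟩ := Finite.exists_max fun i : Fin d => |x i|
      have h3 : ‖x‖ ≤ (1 + d) * |x i| := by
        have h4 : ‖x‖ ^ 2 ≤ ((1 + d) * |x i|) ^ 2 := by
          rw [EuclideanSpace.norm_sq_eq]
          calc ∑ j, ‖x j‖ ^ 2 ≤ ∑ j : Fin d, |x i| ^ 2 := by
                refine Finset.sum_le_sum fun j _ => ?_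
                rw [Real.norm_eq_abs]; exact pow_le_pow_left₀ (abs_nonneg _) (hi j) 2
            _ = d * |x i| ^ 2 := by simp
            _ ≤ (1 + d) ^ 2 * |x i| ^ 2 := by gcongr; nlinarith [(Nat.cast_nonneg d : (0 : ℝ) ≤ d)]
            _ = _ := by ring
        exact le_of_sq_le_sq h4 (by positivity)
      calc ‖x‖ ^ M ≤ ((1 + d) * |x i|) ^ M := by gcongr
        _ = (1 + d) ^ M * |x i| ^ M := mul_pow _ _ _
        _ ≤ _ := by
          gcongr
          have := Finset.single_le_sum (f := fun i : Fin d => |x i| ^ M) (fun _ _ => by positivity) (Finset.mem_univ i)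
          linarith
  have h1 : (1 + ‖x‖) ^ M ≤ 2 ^ M * (1 + ‖x‖ ^ M) := by
    rcases le_total ‖x‖ 1 with h | h
    · calc (1 + ‖x‖) ^ M ≤ (2 : ℝ) ^ M := by gcongr; linarith
        _ ≤ _ := le_mul_of_one_le_right (by positivity) (by simp)
    · calc (1 + ‖x‖) ^ M ≤ (2 * ‖x‖) ^ M := by gcongr; linarith
        _ = 2 ^ M * ‖x‖ ^ M := mul_pow _ _ _
        _ ≤ _ := by gcongr; linarith
  refine h1.trans ?_
  rw [mul_assoc]
  gcongr
  have : 0 ≤ ∑ i : Fin d, |x i| ^ M := by positivity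
  linarith

/-- Decay of the kernel comes from derivatives of its transform in the coordinate directions, where
the derivatives of the symbol are bounded; the dependence on time is the explicit exponential. -/
theorem exists_norm_cosS_le (d M : ℕ) : ∃ C, 0 ≤ C ∧ ∀ (t : ℝ) (φ : 𝓢(Sp d, ℂ)) (x : Sp d),
    (1 + ‖x‖) ^ M * ‖cosS t φ x‖ ≤ C * Real.exp (2 * Real.pi * |t|) * kerConst M φ := by
  obtain ⟨C, hC0, hC⟩ := exists_one_add_norm_pow_le d M
  refine ⟨C * (2 ^ M * M.factorial), by positivity, fun t φ x => ?_⟩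
  set f : 𝓢(Sp d, ℂ) := 𝓕 φ with hf
  have hF : (𝓕 (cosS t φ) : 𝓢(Sp d, ℂ)) = SchwartzMap.smulLeftCLM ℂ (cosMul t) f := by
    rw [cosS, SchwartzMap.fourierMultiplierCLM_apply, FourierTransform.fourier_fourierInv_eq]
  set L := 2 ^ M * (M.factorial : ℝ) * Real.exp (2 * Real.pi * |t|) with hL
  have hL1 : 1 ≤ L := by
    have h1 : (1 : ℝ) ≤ 2 ^ M := one_le_pow₀ one_le_two
    have h2 : (1 : ℝ) ≤ M.factorial := by exact_mod_cast M.factorial_pos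
    have h3 : 1 ≤ Real.exp (2 * Real.pi * |t|) := Real.one_le_exp (by positivity)
    exact one_le_mul_of_one_le_of_one_le (one_le_mul_of_one_le_of_one_le h1 h2) h3
  have h0 : ‖cosS t φ x‖ ≤ ∫ ξ, ‖f ξ‖ := by
    refine (norm_le_integral_fourier _ x).trans ?_
    refine integral_mono (SchwartzMap.integrable _).norm f.integrable.norm fun ξ => ?_
    simp only [fourier_cosS, norm_mul]
    exact mul_le_of_le_one_left (norm_nonneg _) (norm_cosMul_le t ξ)
  have h1 : ∀ i : Fin d, |x i| ^ M * ‖cosS t φ x‖ ≤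
      L * ∑ j ∈ Finset.range (M + 1), ∫ ξ, ‖itDer (EuclideanSpace.single i 1) j f ξ‖ := fun i => by
    have h2 := norm_pow_inner_mul_le (cosS t φ) (EuclideanSpace.single i 1) x M
    rw [EuclideanSpace.inner_single_right] at h2
    simp only [one_mul, conj_trivial, hF] at h2
    refine h2.trans ?_
    rw [← integral_finsetSum _ fun j _ => (SchwartzMap.integrable _).norm, ← integral_const_mul]
    refine integral_mono (SchwartzMap.integrable _).norm
      ((integrable_finsetSum _ fun j _ => (SchwartzMap.integrable _).norm).const_mul _) fun ξ => ?_
    exact norm_itDer_cosMul_le t f _ (by simp) M ξ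
  calc (1 + ‖x‖) ^ M * ‖cosS t φ x‖ ≤ C * (1 + ∑ i : Fin d, |x i| ^ M) * ‖cosS t φ x‖ := by
        gcongr; exact hC x
    _ = C * (‖cosS t φ x‖ + ∑ i : Fin d, |x i| ^ M * ‖cosS t φ x‖) := by
        rw [← Finset.sum_mul]; ring
    _ ≤ C * (L * (∫ ξ, ‖f ξ‖) + ∑ i : Fin d, L * ∑ j ∈ Finset.range (M + 1),
          ∫ ξ, ‖itDer (EuclideanSpace.single i 1) j f ξ‖) := by
        refine mul_le_mul_of_nonneg_left (add_le_add ?_ (Finset.sum_le_sum fun i _ => h1 i)) hC0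
        exact h0.trans (le_mul_of_one_le_left (by positivity) hL1)
    _ = C * (2 ^ M * M.factorial) * Real.exp (2 * Real.pi * |t|) * kerConst M φ := by
        rw [kerConst, ← Finset.mul_sum, hL]; ring

theorem integrable_one_add_norm_neg_pow {M : ℕ} (hM : d < M) :
    Integrable (fun x : Sp d => ((1 + ‖x‖) ^ M)⁻¹) := by
  have h := integrable_one_add_norm (μ := (volume : Measure (Sp d))) (E := Sp d) (r := M) (by simpa using hM)
  refine h.congr (ae_of_all _ fun x => ?_)
  simp only [Real.rpow_neg (by positivity : 0 ≤ 1 + ‖x‖), Real.rpow_natCast]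

theorem continuous_cosS_uncurry (φ : 𝓢(Sp d, ℂ)) : Continuous fun q : ℝ × Sp d => cosS q.1 φ q.2 := by
  have h : (fun q : ℝ × Sp d => cosS q.1 φ q.2) = fun q => ∫ ξ,
      Complex.exp ((2 * Real.pi * ⟪ξ, q.2⟫_ℝ : ℝ) * Complex.I) * (cosMul q.1 ξ * (𝓕 φ : 𝓢(Sp d, ℂ)) ξ) := by
    funext q
    rw [inversion]
    simp only [fourier_cosS]
  rw [h]
  refine continuous_of_dominated (bound := fun ξ => ‖(𝓕 φ : 𝓢(Sp d, ℂ)) ξ‖) (fun q => ?_) (fun q => ?_)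
    (SchwartzMap.integrable _).norm (ae_of_all _ fun ξ => ?_)
  · refine Continuous.aestronglyMeasurable ?_
    have := (hasTemperateGrowth_cosMul (d := d) q.1).1.continuous
    fun_prop
  · refine ae_of_all _ fun ξ => ?_
    rw [norm_mul, Complex.norm_exp_ofReal_mul_I, one_mul, norm_mul]
    exact mul_le_of_le_one_left (norm_nonneg _) (norm_cosMul_le _ ξ)
  · have := (continuous_cosMul ξ).comp (continuous_fst (X := ℝ) (Y := Sp d))
    simp only [Function.comp_def] at this
    fun_prop

theorem continuous_cosS_apply (φ : 𝓢(Sp d, ℂ)) (x : Sp d) : Continuous fun τ => cosS τ φ x := by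
  have h : Continuous fun τ : ℝ => ((τ, x) : ℝ × Sp d) := by fun_prop
  have h2 := continuous_cosS_uncurry φ
  have h3 := Continuous.comp' h2 h
  exact h3

theorem norm_cosS_le_of_abs_le (φ : 𝓢(Sp d, ℂ)) (M : ℕ) (T : ℝ) : ∃ C, 0 ≤ C ∧ ∀ t, |t| ≤ T → ∀ x,
    ‖cosS t φ x‖ ≤ C * ((1 + ‖x‖) ^ M)⁻¹ := by
  obtain ⟨C, hC0, hC⟩ := exists_norm_cosS_le d M
  refine ⟨C * Real.exp (2 * Real.pi * T) * kerConst M φ, mul_nonneg (by positivity) (kerConst_nonneg _ _),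
    fun t ht x => ?_⟩
  have h0 := kerConst_nonneg M φ
  rw [le_mul_inv_iff₀ (by positivity), mul_comm]
  refine (hC t φ x).trans ?_
  have := Real.pi_pos
  gcongr

/-- Dominated convergence for the kernels. It gives continuity in operator norm, not merely strong
continuity, so the propagator can be integrated as an operator-valued function. -/
theorem tendsto_integral_cosS_sub (φ : 𝓢(Sp d, ℂ)) (t : ℝ) :
    Tendsto (fun τ => ∫ x, ‖cosS τ φ x - cosS t φ x‖) (𝓝 t) (𝓝 0) := by
  obtain ⟨C, hC0, hC⟩ := norm_cosS_le_of_abs_le φ (d + 1) (|t| + 1)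
  have h0 : (0 : ℝ) = ∫ x : Sp d, ‖cosS t φ x - cosS t φ x‖ := by simp
  rw [h0]
  refine tendsto_integral_filter_of_dominated_convergence
    (fun x => C * ((1 + ‖x‖) ^ (d + 1))⁻¹ + C * ((1 + ‖x‖) ^ (d + 1))⁻¹)
    (Eventually.of_forall fun τ => by fun_prop) ?_
    (((integrable_one_add_norm_neg_pow d.lt_succ_self).const_mul C).add
      ((integrable_one_add_norm_neg_pow d.lt_succ_self).const_mul C)) (ae_of_all _ fun x => ?_)
  · filter_upwards [Metric.ball_mem_nhds t one_pos] with τ hτ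
    refine ae_of_all _ fun x => ?_
    rw [norm_norm]
    refine (norm_sub_le _ _).trans (add_le_add (hC τ ?_ x) (hC t (by linarith) x))
    rw [mem_ball_iff_norm, Real.norm_eq_abs] at hτ
    have := abs_add_le (τ - t) t
    rw [sub_add_cancel] at this
    linarith
  · have h1 : Continuous fun τ => ‖cosS τ φ x - cosS t φ x‖ := by
      exact continuous_norm.comp ((continuous_cosS_apply φ x).sub continuous_const)
    exact h1.tendsto t

/-- Taylor's formula with integral remainder for the cosine, a primitive of the integrand being
written down explicitly. -/
theorem integral_sub_mul_cosMul (t : ℝ) (ξ : Sp d) :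
    ∫ τ in (0 : ℝ)..t, ((t - τ : ℝ) : ℂ) * (cosMul τ ξ * -((2 * Real.pi * ‖ξ‖) ^ 2 : ℝ)) = cosMul t ξ - 1 := by
  set a := 2 * Real.pi * ‖ξ‖ with ha
  have h : ∀ τ ∈ Set.uIcc 0 t, HasDerivAt
      (fun τ : ℝ => Real.cos (a * τ) - (t - τ) * (a * Real.sin (a * τ))) (-(t - τ) * (a ^ 2 * Real.cos (a * τ))) τ := by
    intro τ _
    have h1 : HasDerivAt (fun τ : ℝ => a * τ) a τ := by simpa using (hasDerivAt_id τ).const_mul a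
    have h2 := h1.cos.sub (((hasDerivAt_id τ).const_sub t).mul (h1.sin.const_mul a))
    exact h2.congr_deriv (by simp only [id]; ring)
  have h2 := intervalIntegral.integral_eq_sub_of_hasDerivAt h (Continuous.intervalIntegrable (by fun_prop) _ _)
  have h3 : ∀ τ, ((t - τ : ℝ) : ℂ) * (cosMul τ ξ * -(a ^ 2 : ℝ)) = ((-(t - τ) * (a ^ 2 * Real.cos (a * τ)) : ℝ) : ℂ) := by
    intro τ
    rw [cosMul_eq]
    push_cast
    have : (2 * Real.pi * τ * ‖ξ‖ : ℂ) = a * τ := by rw [ha]; push_cast; ring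
    rw [this]; ring
  simp only [h3]
  rw [intervalIntegral.integral_ofReal, h2, cosMul_eq]
  simp only [sub_self, zero_mul, sub_zero, mul_zero, Real.cos_zero, Real.sin_zero]
  push_cast
  congr 2
  rw [ha]; push_cast; ring

/-- The wave equation integrated twice in time. Fubini exchanges the time integral with Fourier
inversion, and nothing is differentiated under an integral sign. -/
theorem cosS_eq_integral (t : ℝ) (φ : 𝓢(Sp d, ℂ)) (x : Sp d) :
    cosS t φ x = φ x + ∫ τ in (0 : ℝ)..t, ((t - τ : ℝ) : ℂ) * cosS τ (Δ φ) x := by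
  set e : Sp d → ℂ := fun ξ => Complex.exp ((2 * Real.pi * ⟪ξ, x⟫_ℝ : ℝ) * Complex.I) with he
  have he1 : ∀ ξ, ‖e ξ‖ = 1 := fun ξ => Complex.norm_exp_ofReal_mul_I _
  have hec : Continuous e := by rw [he]; fun_prop
  have hcm : Continuous fun q : ℝ × Sp d => cosMul q.1 q.2 := by
    simp only [cosMul_eq]; fun_prop
  set f : ℝ → Sp d → ℂ := fun τ ξ => ((t - τ : ℝ) : ℂ) * (e ξ * (cosMul τ ξ * (𝓕 (Δ φ) : 𝓢(Sp d, ℂ)) ξ)) with hf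
  have hfc : Continuous (Function.uncurry f) := by
    have : Function.uncurry f = fun q : ℝ × Sp d => ((t - q.1 : ℝ) : ℂ) * (e q.2 * (cosMul q.1 q.2 * (𝓕 (Δ φ) : 𝓢(Sp d, ℂ)) q.2)) := rfl
    rw [this]
    fun_prop
  have h1 : ∀ τ, ((t - τ : ℝ) : ℂ) * cosS τ (Δ φ) x = ∫ ξ, f τ ξ := fun τ => by
    rw [inversion]
    simp only [fourier_cosS]
    rw [← integral_const_mul]
  simp only [h1]
  have hint : Integrable (Function.uncurry f) ((volume.restrict (Set.uIoc 0 t)).prod volume) := by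
    have : IsFiniteMeasure (volume.restrict (Set.uIoc 0 t)) :=
      ⟨by rw [Measure.restrict_apply_univ, Set.uIoc]; exact measure_Ioc_lt_top⟩
    have hb : Integrable (fun q : ℝ × Sp d => |t| * ‖(𝓕 (Δ φ) : 𝓢(Sp d, ℂ)) q.2‖)
        ((volume.restrict (Set.uIoc 0 t)).prod volume) :=
      Integrable.mul_prod (f := fun _ : ℝ => |t|) (g := fun ξ => ‖(𝓕 (Δ φ) : 𝓢(Sp d, ℂ)) ξ‖)
        (integrable_const _) (SchwartzMap.integrable _).norm
    refine hb.mono' hfc.aestronglyMeasurable ?_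
    have hm : MeasurableSet {q : ℝ × Sp d | q.1 ∈ Set.uIoc 0 t} := measurable_fst measurableSet_uIoc
    have : ∀ᵐ q ∂((volume.restrict (Set.uIoc 0 t)).prod (volume : Measure (Sp d))), q.1 ∈ Set.uIoc 0 t := by
      have := Measure.quasiMeasurePreserving_fst (μ := volume.restrict (Set.uIoc 0 t)) (ν := (volume : Measure (Sp d)))
      exact this.ae (ae_restrict_mem measurableSet_uIoc)
    filter_upwards [this] with q hq
    simp only [Function.uncurry, hf, norm_mul, he1, one_mul, Complex.norm_real, Real.norm_eq_abs]
    have h5 : |t - q.1| ≤ |t| := by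
      rcases Set.mem_uIoc.1 hq with ⟨h, h'⟩ | ⟨h, h'⟩
      · rw [abs_of_nonneg (by linarith), abs_of_nonneg (by linarith)]; linarith
      · rw [abs_of_nonpos (by linarith), abs_of_nonpos (by linarith)]; linarith
    gcongr
    exact mul_le_of_le_one_left (norm_nonneg _) (norm_cosMul_le _ _)
  rw [intervalIntegral_integral_swap hint]
  have h2 : ∀ ξ, ∫ τ in (0 : ℝ)..t, f τ ξ = e ξ * ((cosMul t ξ - 1) * (𝓕 φ : 𝓢(Sp d, ℂ)) ξ) := fun ξ => by
    rw [← integral_sub_mul_cosMul, ← intervalIntegral.integral_mul_const, ← intervalIntegral.integral_const_mul]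
    congr 1
    funext τ
    rw [hf]; simp only [fourier_laplacian]; ring
  simp only [h2]
  rw [inversion, inversion φ]
  simp only [fourier_cosS]
  have hi : ∀ φ : 𝓢(Sp d, ℂ), Integrable fun ξ => e ξ * φ ξ := fun φ =>
    φ.integrable.norm.mono' (by fun_prop) (ae_of_all _ fun ξ => by rw [norm_mul, he1, one_mul])
  have h6 := integral_add (hi (𝓕 φ)) (hi (𝓕 (cosS t φ - φ)))
  have h7 : (𝓕 (cosS t φ - φ) : 𝓢(Sp d, ℂ)) = 𝓕 (cosS t φ) - 𝓕 φ := map_sub (FourierTransform.fourierCLM ℂ 𝓢(Sp d, ℂ)) _ _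
  rw [h7] at h6
  simp only [sub_apply, fourier_cosS] at h6
  refine Eq.trans ?_ (h6.trans ?_)
  · congr 1; funext ξ; ring
  · congr 2; funext ξ; ring

open scoped LineDeriv

/-! ### The cosine propagator as a family of operators -/

theorem norm_cv_sub_cv_le (a b : 𝓢(Sp d, ℂ)) : ‖cv a - cv b‖ ≤ ∫ x, ‖a x - b x‖ := by
  refine ContinuousLinearMap.opNorm_le_bound _ (by positivity) fun g => ?_
  rw [sub_apply, ← cv_sub]
  exact norm_cv_apply_le _ _

theorem continuous_cv_cosS (h : 𝓢(Sp d, ℂ)) : Continuous fun t => cv (cosS t h) := by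
  refine continuous_iff_continuousAt.2 fun t => ?_
  rw [ContinuousAt, tendsto_iff_norm_sub_tendsto_zero]
  exact squeeze_zero (fun _ => norm_nonneg _) (fun τ => norm_cv_sub_cv_le _ _) (tendsto_integral_cosS_sub h t)

theorem hasDerivAt_primitive {E : Type*} [NormedAddCommGroup E] [NormedSpace ℝ E] [CompleteSpace E]
    {f : ℝ → E} (hf : Continuous f) (t : ℝ) : HasDerivAt (fun t => ∫ τ in (0 : ℝ)..t, f τ) (f t) t :=
  (hf.integral_hasStrictDerivAt 0 t).hasDerivAt

/-- Evaluation of a bounded continuous function at a point. -/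
noncomputable def evalBF (x : Sp d) : BF d →L[ℂ] ℂ := BoundedContinuousFunction.evalCLM ℂ x

theorem evalBF_apply (x : Sp d) (g : BF d) : evalBF x g = g x := rfl

theorem continuous_comp_smul_cv (h : 𝓢(Sp d, ℂ)) (t : ℝ) : Continuous fun τ : ℝ => ((t - τ : ℝ) : ℂ) • cv (cosS τ h) :=
  (by fun_prop : Continuous fun τ : ℝ => ((t - τ : ℝ) : ℂ)).smul (continuous_cv_cosS h)

/-- The same identity for operators. Its integrand is continuous in operator norm, so time
derivatives of the propagator follow from the fundamental theorem of calculus. -/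
theorem cv_cosS_eq_integral (h : 𝓢(Sp d, ℂ)) (t : ℝ) :
    cv (cosS t h) = cv h + ∫ τ in (0 : ℝ)..t, ((t - τ : ℝ) : ℂ) • cv (cosS τ (Δ h)) := by
  refine ContinuousLinearMap.ext fun g => BoundedContinuousFunction.ext fun x => ?_
  have hc := continuous_comp_smul_cv (Δ h) t
  rw [add_apply, ContinuousLinearMap.intervalIntegral_apply (hc.intervalIntegrable _ _),
    BoundedContinuousFunction.add_apply, ← evalBF_apply x (∫ τ in (0 : ℝ)..t, _),
    ← ContinuousLinearMap.intervalIntegral_comp_comm _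
      ((hc.clm_apply continuous_const).intervalIntegrable _ _)]
  simp only [smul_apply, evalBF_apply, BoundedContinuousFunction.smul_apply, cv_apply, smul_eq_mul]
  set f : ℝ → Sp d → ℂ := fun τ y => ((t - τ : ℝ) : ℂ) * (cosS τ (Δ h) y * g (x - y)) with hf
  obtain ⟨C, hC0, hC⟩ := norm_cosS_le_of_abs_le (Δ h) (d + 1) |t|
  have hfc : Continuous (Function.uncurry f) := by
    have : Function.uncurry f = fun q : ℝ × Sp d => ((t - q.1 : ℝ) : ℂ) * (cosS q.1 (Δ h) q.2 * g (x - q.2)) := rfl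
    rw [this]
    have := continuous_cosS_uncurry (Δ h)
    fun_prop
  have hint : Integrable (Function.uncurry f) ((volume.restrict (Set.uIoc 0 t)).prod volume) := by
    have : IsFiniteMeasure (volume.restrict (Set.uIoc 0 t)) :=
      ⟨by rw [Measure.restrict_apply_univ, Set.uIoc]; exact measure_Ioc_lt_top⟩
    have hb : Integrable (fun q : ℝ × Sp d => |t| * (C * ((1 + ‖q.2‖) ^ (d + 1))⁻¹ * ‖g‖))
        ((volume.restrict (Set.uIoc 0 t)).prod volume) :=
      Integrable.mul_prod (f := fun _ : ℝ => |t|) (g := fun ξ : Sp d => C * ((1 + ‖ξ‖) ^ (d + 1))⁻¹ * ‖g‖)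
        (integrable_const _) (((integrable_one_add_norm_neg_pow d.lt_succ_self).const_mul C).mul_const _)
    refine hb.mono' hfc.aestronglyMeasurable ?_
    have : ∀ᵐ q ∂((volume.restrict (Set.uIoc 0 t)).prod (volume : Measure (Sp d))), q.1 ∈ Set.uIoc 0 t := by
      have := Measure.quasiMeasurePreserving_fst (μ := volume.restrict (Set.uIoc 0 t)) (ν := (volume : Measure (Sp d)))
      exact this.ae (ae_restrict_mem measurableSet_uIoc)
    filter_upwards [this] with q hq
    simp only [Function.uncurry, hf, norm_mul, Complex.norm_real, Real.norm_eq_abs]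
    have h5 : |t - q.1| ≤ |t| ∧ |q.1| ≤ |t| := by
      rcases Set.mem_uIoc.1 hq with ⟨h, h'⟩ | ⟨h, h'⟩
      · rw [abs_of_nonneg (by linarith), abs_of_nonneg (by linarith), abs_of_nonneg (by linarith)]
        constructor <;> linarith
      · rw [abs_of_nonpos (by linarith), abs_of_nonpos (by linarith), abs_of_nonpos (by linarith)]
        constructor <;> linarith
    refine mul_le_mul h5.1 (mul_le_mul (hC _ h5.2 _) (g.norm_coe_le_norm _) (norm_nonneg _) (by positivity))
      (by positivity) (abs_nonneg _)
  have h1 : ∀ τ, ((t - τ : ℝ) : ℂ) * ∫ y, cosS τ (Δ h) y * g (x - y) = ∫ y, f τ y := fun τ => by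
    rw [← integral_const_mul]
  simp only [h1]
  rw [intervalIntegral_integral_swap hint]
  have h2 : ∀ y, ∫ τ in (0 : ℝ)..t, f τ y = (cosS t h - h) y * g (x - y) := fun y => by
    rw [sub_apply, cosS_eq_integral t h y, add_sub_cancel_left, ← intervalIntegral.integral_mul_const]
    congr 1; funext τ; rw [hf]; ring
  simp only [h2]
  rw [← cv_apply, ← cv_apply, ← cv_apply, cv_sub, BoundedContinuousFunction.sub_apply]
  ring

/-- The sine propagator `sin (t √(-Δ)) / √(-Δ)` composed with convolution by `h`. -/
noncomputable def sinOp (h : 𝓢(Sp d, ℂ)) (t : ℝ) : BF d →L[ℂ] BF d := ∫ τ in (0 : ℝ)..t, cv (cosS τ h)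

theorem sinOp_zero (h : 𝓢(Sp d, ℂ)) : sinOp h 0 = 0 := intervalIntegral.integral_same

theorem hasDerivAt_sinOp (h : 𝓢(Sp d, ℂ)) (t : ℝ) : HasDerivAt (sinOp h) (cv (cosS t h)) t :=
  hasDerivAt_primitive (continuous_cv_cosS h) t

theorem continuous_sinOp (h : 𝓢(Sp d, ℂ)) : Continuous (sinOp h) := by
  exact intervalIntegral.continuous_primitive (fun a b => (continuous_cv_cosS h).intervalIntegrable a b) 0

theorem sinOp_apply (h : 𝓢(Sp d, ℂ)) (t : ℝ) (g : BF d) : sinOp h t g = ∫ τ in (0 : ℝ)..t, cv (cosS τ h) g :=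
  ContinuousLinearMap.intervalIntegral_apply ((continuous_cv_cosS h).intervalIntegrable _ _) _

/-- Differentiation of a double primitive written as a single integral. -/
theorem hasDerivAt_integral_sub_smul {E : Type*} [NormedAddCommGroup E] [NormedSpace ℂ E] [CompleteSpace E]
    {f : ℝ → E} (hf : Continuous f) (t : ℝ) :
    HasDerivAt (fun t => ∫ τ in (0 : ℝ)..t, ((t - τ : ℝ) : ℂ) • f τ) (∫ τ in (0 : ℝ)..t, f τ) t := by
  have h0 : Continuous fun τ : ℝ => (τ : ℂ) • f τ := Complex.continuous_ofReal.smul hf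
  have h1 : (fun t : ℝ => ∫ τ in (0 : ℝ)..t, ((t - τ : ℝ) : ℂ) • f τ) =
      fun t : ℝ => (t : ℂ) • (∫ τ in (0 : ℝ)..t, f τ) - ∫ τ in (0 : ℝ)..t, (τ : ℂ) • f τ := by
    funext t
    have h1 : Continuous fun τ : ℝ => (t : ℂ) • f τ := hf.const_smul _
    have h2 := intervalIntegral.integral_sub (h1.intervalIntegrable (μ := volume) 0 t)
      (h0.intervalIntegrable (μ := volume) 0 t)
    rw [← intervalIntegral.integral_smul, ← h2]
    congr 1; funext τ
    rw [← sub_smul]; push_cast; rfl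
  rw [h1]
  have h2 : HasDerivAt (fun t => ∫ τ in (0 : ℝ)..t, f τ) (f t) t := hasDerivAt_primitive hf t
  have h3 : HasDerivAt (fun t => ∫ τ in (0 : ℝ)..t, (τ : ℂ) • f τ) ((t : ℂ) • f t) t := hasDerivAt_primitive h0 t
  have h4 : HasDerivAt (fun t : ℝ => (t : ℂ)) 1 t := Complex.ofRealCLM.hasDerivAt
  have h5 := (h4.smul h2).sub h3
  refine h5.congr_deriv ?_
  rw [one_smul, add_sub_right_comm, sub_self, zero_add]

theorem hasDerivAt_cv_cosS (h : 𝓢(Sp d, ℂ)) (t : ℝ) :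
    HasDerivAt (fun t => cv (cosS t h)) (sinOp (Δ h) t) t := by
  have h1 : (fun t => cv (cosS t h)) = fun t =>
      cv h + ∫ τ in (0 : ℝ)..t, ((t - τ : ℝ) : ℂ) • cv (cosS τ (Δ h)) := by
    funext t; exact cv_cosS_eq_integral h t
  rw [h1]
  exact (hasDerivAt_integral_sub_smul (continuous_cv_cosS (Δ h)) t).const_add _

/-- The Leibniz rule for convolution in time. -/
theorem hasDerivAt_volterra {E : Type*} [NormedAddCommGroup E] [NormedSpace ℂ E] [CompleteSpace E]
    {K K₁ : ℝ → E →L[ℂ] E} (hK : ∀ r, HasDerivAt K (K₁ r) r) (hK₁ : Continuous K₁) {Φ : ℝ → E}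
    (hΦ : Continuous Φ) (t : ℝ) :
    HasDerivAt (fun t => ∫ σ in (0 : ℝ)..t, K (t - σ) (Φ σ)) (K 0 (Φ t) + ∫ σ in (0 : ℝ)..t, K₁ (t - σ) (Φ σ)) t := by
  have hKc : Continuous K := continuous_iff_continuousAt.2 fun t => (hK t).continuousAt
  -- The two occurrences of `t` are separated into the upper limit `a` and the kernel argument `b`.
  -- Both partial derivatives are continuous, so the derivative on the diagonal is their sum.
  set f : ℝ → ℝ → E := fun a b => ∫ σ in (0 : ℝ)..a, K (b - σ) (Φ σ) with hf
  set f₁ : ℝ → ℝ → ℝ →L[ℝ] E := fun a b => ContinuousLinearMap.toSpanSingleton ℝ (K (b - a) (Φ a)) with hf₁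
  set f₂ : ℝ → ℝ → ℝ →L[ℝ] E := fun a b =>
    ContinuousLinearMap.toSpanSingleton ℝ (∫ σ in (0 : ℝ)..a, K₁ (b - σ) (Φ σ)) with hf₂
  have hc : ∀ b, Continuous fun σ => K (b - σ) (Φ σ) := fun b => by fun_prop
  have hc₁ : ∀ b, Continuous fun σ => K₁ (b - σ) (Φ σ) := fun b => by fun_prop
  have d1 : ∀ a b, HasFDerivAt (fun a => f a b) (f₁ a b) a := fun a b =>
    (hasDerivAt_primitive (hc b) a).hasFDerivAt
  have d2 : ∀ a b, HasFDerivAt (fun b => f a b) (f₂ a b) b := fun a b => by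
    refine HasDerivAt.hasFDerivAt ?_
    have hcp : Continuous fun q : ℝ × ℝ => K₁ (q.1 - q.2) (Φ q.2) := by fun_prop
    obtain ⟨C, hC⟩ := ((isCompact_closedBall b 1).prod (isCompact_uIcc (a := (0 : ℝ)) (b := a))).exists_bound_of_continuousOn
      hcp.continuousOn
    refine (intervalIntegral.hasDerivAt_integral_of_dominated_loc_of_deriv_le
      (F := fun b σ => K (b - σ) (Φ σ)) (F' := fun b σ => K₁ (b - σ) (Φ σ)) (bound := fun _ => C)
      (Metric.closedBall_mem_nhds b one_pos) (Eventually.of_forall fun b => (hc b).aestronglyMeasurable)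
      ((hc b).intervalIntegrable _ _) (hc₁ b).aestronglyMeasurable
      (ae_of_all _ fun σ hσ x hx => hC (x, σ) ⟨hx, Set.uIoc_subset_uIcc hσ⟩)
      intervalIntegrable_const (ae_of_all _ fun σ _ x _ => ?_)).2
    have h1 : HasDerivAt (fun b => b - σ) 1 x := (hasDerivAt_id x).sub_const σ
    have h2 := ((hK (x - σ)).scomp x h1)
    rw [one_smul] at h2
    exact ((ContinuousLinearMap.apply ℂ E (Φ σ)).restrictScalars ℝ).hasFDerivAt.comp_hasDerivAt x h2
  have c1 : Continuous ↿f₁ := by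
    have h1 : Continuous fun v : ℝ × ℝ => K (v.2 - v.1) (Φ v.1) := by fun_prop
    exact (ContinuousLinearMap.toSpanSingletonCLE (𝕜 := ℝ) (E := E)).continuous.comp h1
  have c2 : Continuous ↿f₂ := by
    have h1 : Continuous fun v : ℝ × ℝ => ∫ σ in (0 : ℝ)..v.1, K₁ (v.2 - σ) (Φ σ) := by
      refine intervalIntegral.continuous_parametric_intervalIntegral_of_continuous
        (f := fun (v : ℝ × ℝ) σ => K₁ (v.2 - σ) (Φ σ)) ?_ continuous_fst
      simp only [Function.uncurry_def]
      fun_prop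
    exact (ContinuousLinearMap.toSpanSingletonCLE (𝕜 := ℝ) (E := E)).continuous.comp h1
  have h := (hasStrictFDerivAt_uncurry_coprod (u := (t, t)) (Eventually.of_forall fun v => d1 v.1 v.2)
    (Eventually.of_forall fun v => d2 v.1 v.2) c1.continuousAt c2.continuousAt).hasFDerivAt
  have h3 : HasDerivAt (fun t : ℝ => (t, t)) ((1, 1) : ℝ × ℝ) t := (hasDerivAt_id t).prodMk (hasDerivAt_id t)
  have h4 := HasFDerivAt.comp_hasDerivAt (f := fun t : ℝ => (t, t)) t (by exact h) h3
  refine h4.congr_deriv ?_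
  simp [hf₁, hf₂, Function.HasUncurry.uncurry]

/-! ### Fourier supports of products -/

theorem fourier_tr_eq_zero {z η : Sp d} {a : 𝓢(Sp d, ℂ)} (h : (𝓕 a : 𝓢(Sp d, ℂ)) η = 0) :
    (𝓕 (tr z a) : 𝓢(Sp d, ℂ)) η = 0 := by
  rw [SchwartzMap.fourier_coe, Real.fourier_eq] at h ⊢
  have h1 := integral_sub_right_eq_self (μ := (volume : Measure (Sp d)))
    (fun v : Sp d => Real.fourierChar (-⟪v + z, η⟫_ℝ) • a v) z
  simp only [sub_add_cancel] at h1
  refine Eq.trans h1 ?_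
  simp only [inner_add_left, neg_add, AddChar.map_add_eq_mul, mul_comm _ (Real.fourierChar (-⟪z, η⟫_ℝ)), mul_smul]
  simp only [Circle.smul_def (Real.fourierChar (-⟪z, η⟫_ℝ)), smul_eq_mul]
  rw [integral_const_mul, h, mul_zero]

theorem fourier_fourier (a : 𝓢(Sp d, ℂ)) (x : Sp d) :
    (𝓕 (𝓕 a : 𝓢(Sp d, ℂ)) : 𝓢(Sp d, ℂ)) x = a (-x) := by
  conv_rhs => rw [← FourierTransform.fourierInv_fourier_eq (F := 𝓢(Sp d, ℂ)) a]
  rw [SchwartzMap.fourierInv_coe, Real.fourierInv_eq, SchwartzMap.fourier_coe, Real.fourier_eq]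
  simp only [inner_neg_right]

/-- The product of two Schwartz functions. -/
noncomputable def mulS (a b : 𝓢(Sp d, ℂ)) : 𝓢(Sp d, ℂ) := SchwartzMap.smulLeftCLM ℂ a b

theorem mulS_apply (a b : 𝓢(Sp d, ℂ)) (x : Sp d) : mulS a b x = a x * b x := by
  rw [mulS, SchwartzMap.smulLeftCLM_apply_apply a.hasTemperateGrowth, smul_eq_mul]

theorem fourier_mulS (a b : 𝓢(Sp d, ℂ)) : (𝓕 (mulS a b) : 𝓢(Sp d, ℂ)) = sconv (𝓕 a) (𝓕 b) :=
  fourier_injective fun ξ => by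
    rw [fourier_fourier, mulS_apply, fourier_sconv_apply, fourier_fourier, fourier_fourier]

/-- The transform of a product is a convolution, which lives on the sum of the two balls. -/
theorem fourier_mulS_eq_zero {a b : 𝓢(Sp d, ℂ)} {p q ξ : Sp d} {P Q : ℝ}
    (ha : ∀ η, P < ‖η - p‖ → (𝓕 a : 𝓢(Sp d, ℂ)) η = 0) (hb : ∀ η, Q < ‖η - q‖ → (𝓕 b : 𝓢(Sp d, ℂ)) η = 0)
    (h : P + Q < ‖ξ - p - q‖) : (𝓕 (mulS a b) : 𝓢(Sp d, ℂ)) ξ = 0 := by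
  rw [fourier_mulS, sconv_apply]
  refine integral_eq_zero_of_ae (ae_of_all _ fun η => ?_)
  rcases lt_or_ge P ‖η - p‖ with h1 | h1
  · simp [ha η h1]
  · have : Q < ‖ξ - η - q‖ := by
      have := norm_add_le (η - p) (ξ - η - q)
      rw [show (η - p) + (ξ - η - q) = ξ - p - q by abel] at this
      linarith
    simp [hb _ this]

/-- A product of blocks at `p` and `q` has frequencies within `2` of `p + q`, and the window at `r`
sees only distance `1`. Since `f` and `g` are merely bounded, supports are compared on the side of
test functions: Fubini isolates an integral in `y` which is `distL g` applied to a Schwartz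
convolution with vanishing transform. -/
theorem cv_cv_mul_cv_eq_zero {h a b : 𝓢(Sp d, ℂ)} {r p q : Sp d}
    (hh : ∀ η, 1 < ‖η - r‖ → (𝓕 h : 𝓢(Sp d, ℂ)) η = 0)
    (ha : ∀ η, 1 < ‖η - p‖ → (𝓕 a : 𝓢(Sp d, ℂ)) η = 0)
    (hb : ∀ η, 1 < ‖η - q‖ → (𝓕 b : 𝓢(Sp d, ℂ)) η = 0)
    (hd : 3 < ‖r - p - q‖) (f g : BF d) : cv h (cv a f * cv b g) = 0 := by
  have hφ : ∀ x z : Sp d, ∫ y, a (y - z) * h (x - y) * cv b g y = 0 := by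
    intro x z
    set φ := mulS (tr z a) (reflectAt x h) with hφ
    have h1 := (distribution_sconv_refl (distL g) φ b).2
    have h2 : sconv φ (refl b) = 0 := fourier_injective fun ξ => by
      have h0 : (𝓕 (0 : 𝓢(Sp d, ℂ)) : 𝓢(Sp d, ℂ)) ξ = 0 := by
        rw [FourierTransform.fourier_zero]; rfl
      rw [fourier_sconv_apply, fourier_refl, h0]
      rcases lt_or_ge 1 ‖-ξ - q‖ with h3 | h3
      · rw [hb _ h3, mul_zero]
      · rw [fourier_mulS_eq_zero (p := p) (q := -r) (P := 1) (Q := 1) (fun η hη => fourier_tr_eq_zero (ha η hη))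
          (fun η hη => by
            rw [reflectAt_eq]
            refine fourier_tr_eq_zero ?_
            rw [fourier_refl]
            refine hh _ ?_
            rwa [show -η - r = -(η - -r) by abel, norm_neg]) ?_, zero_mul]
        have := norm_sub_le (ξ - p - -r) (-(-ξ - q))
        rw [show (ξ - p - -r) - (-(-ξ - q)) = r - p - q by abel, norm_neg] at this
        linarith
    rw [h2, map_zero] at h1
    rw [h1]
    refine integral_congr_ae (ae_of_all _ fun y => ?_)
    simp only [hφ, mulS_apply, conv_distL, reflectAt_apply]
    rfl
  ext x
  rw [cv_apply_swap]
  simp only [BoundedContinuousFunction.mul_apply, cv_apply_swap a f]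
  set G := cv b g
  set J : Sp d → Sp d → ℂ := fun y z => f z * (a (y - z) * h (x - y) * G y) with hJ
  have e1 : ∀ y, (∫ z, f z * a (y - z)) * G y * h (x - y) = ∫ z, J y z := fun y => by
    rw [mul_assoc, ← integral_mul_const]
    congr 1; funext z; rw [hJ]; ring
  simp only [e1]
  have hJc : Continuous (Function.uncurry J) := by
    have : Function.uncurry J = fun q : Sp d × Sp d => f q.2 * (a (q.1 - q.2) * h (x - q.1) * G q.1) := rfl
    rw [this]; fun_prop
  have hint : Integrable (Function.uncurry J) (volume.prod volume) := by
    have hb : Integrable (fun q : Sp d × Sp d => (‖f‖ * ‖G‖) * (‖h (x - q.1)‖ * ‖a (q.1 - q.2)‖))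
        (volume.prod volume) := by
      refine Integrable.const_mul ?_ _
      have h1 : Integrable (fun y => ‖h (x - y)‖) := (h.integrable.comp_sub_left x).norm
      have h2 := Integrable.convolution_integrand (L := ContinuousLinearMap.mul ℝ ℝ) (μ := volume) (ν := volume)
        h1 ((refl a).integrable.norm)
      have h3 := h2.swap
      refine h3.congr (ae_of_all _ fun q => ?_)
      simp [refl_apply, Prod.swap]
    refine hb.mono' hJc.aestronglyMeasurable (ae_of_all _ fun q => ?_)
    simp only [Function.uncurry, hJ, norm_mul]
    have h1 := f.norm_coe_le_norm q.2
    have h2 := G.norm_coe_le_norm q.1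
    calc ‖f q.2‖ * (‖a (q.1 - q.2)‖ * ‖h (x - q.1)‖ * ‖G q.1‖)
        = (‖f q.2‖ * ‖G q.1‖) * (‖h (x - q.1)‖ * ‖a (q.1 - q.2)‖) := by ring
      _ ≤ _ := by gcongr
  rw [integral_integral_swap hint]
  have e2 : ∀ z, ∫ y, J y z = 0 := fun z => by
    rw [hJ]; simp only; rw [integral_const_mul, hφ, mul_zero]
  simp [e2]

/-! ### Complex conjugation -/

/-- The complex conjugate of a Schwartz function. -/
noncomputable def conjS (a : 𝓢(Sp d, ℂ)) : 𝓢(Sp d, ℂ) :=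
  SchwartzMap.postcompCLM (𝕜 := ℝ) (Complex.conjCLE : ℂ →L[ℝ] ℂ) a

theorem conjS_apply (a : 𝓢(Sp d, ℂ)) (x : Sp d) : conjS a x = (starRingEnd ℂ) (a x) := rfl

theorem fourier_conjS (a : 𝓢(Sp d, ℂ)) (ξ : Sp d) :
    (𝓕 (conjS a) : 𝓢(Sp d, ℂ)) ξ = (starRingEnd ℂ) ((𝓕 a : 𝓢(Sp d, ℂ)) (-ξ)) := by
  rw [SchwartzMap.fourier_coe, SchwartzMap.fourier_coe, Real.fourier_eq, Real.fourier_eq, ← integral_conj]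
  congr 1; funext v
  rw [conjS_apply, inner_neg_right, neg_neg, Circle.smul_def, Circle.smul_def, smul_eq_mul, smul_eq_mul, map_mul,
    ← Circle.coe_inv_eq_conj, ← AddChar.map_neg_eq_inv]

theorem cv_conjS (a : 𝓢(Sp d, ℂ)) (f : BF d) : cv (conjS a) (star f) = star (cv a f) := by
  ext x
  rw [BoundedContinuousFunction.star_apply, cv_apply, cv_apply, Complex.star_def, ← integral_conj]
  congr 1; funext y
  rw [conjS_apply, map_mul]; rfl

/-! ### Weighted suprema -/

section Weighted

variable {Ω : Type*}

/-- The weighted supremum of a family of bounded functions. -/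
noncomputable def wsup (ν : Ω → Sp d → ℝ≥0∞) (F : Ω → BF d) : ℝ≥0∞ := ⨆ ω, ⨆ y, ν ω y * ‖F ω y‖ₑ

/-- The weight varies by at most a factor `(1 + |y - z|)^N`. -/
def SlowWeight (N : ℕ) (ν : Ω → Sp d → ℝ≥0∞) : Prop :=
  ∀ ω y z, ν ω y ≤ ν ω z * ENNReal.ofReal ((1 + ‖y - z‖) ^ N)

/-- The weighted `L¹` norm of a Schwartz function. -/
noncomputable def lw (N : ℕ) (a : 𝓢(Sp d, ℂ)) : ℝ≥0∞ := ∫⁻ z, ‖a z‖ₑ * ENNReal.ofReal ((1 + ‖z‖) ^ N)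

theorem lw_lt_top (N : ℕ) (a : 𝓢(Sp d, ℂ)) : lw N a < ∞ := by
  have h := (integrable_pow_mul_schwartz N a (zero_le_one)).2
  rw [hasFiniteIntegral_iff_enorm] at h
  refine lt_of_le_of_lt (lintegral_mono fun z => ?_) h
  rw [mul_one, enorm_mul, enorm_norm, Real.enorm_of_nonneg (by positivity)]

theorem lw_modulate (N : ℕ) (ω : Sp d) (a : 𝓢(Sp d, ℂ)) : lw N (modulate ω a) = lw N a := by
  unfold lw
  refine lintegral_congr fun z => ?_
  rw [← ofReal_norm, norm_modulate, ofReal_norm]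

theorem slowWeight_one : SlowWeight 0 (1 : Ω → Sp d → ℝ≥0∞) := fun ω y z => by simp

theorem le_wsup (ν : Ω → Sp d → ℝ≥0∞) (F : Ω → BF d) (ω : Ω) (y : Sp d) : ν ω y * ‖F ω y‖ₑ ≤ wsup ν F :=
  le_iSup_of_le ω (le_iSup (fun y => ν ω y * ‖F ω y‖ₑ) y)

/-- Young's inequality with a weight: moving the weight from `y` to `z` costs `(1 + ‖y - z‖) ^ N`,
which is charged to the kernel. -/
theorem wsup_cv_le {N : ℕ} {ν : Ω → Sp d → ℝ≥0∞} (hν : SlowWeight N ν) (a : 𝓢(Sp d, ℂ)) (F : Ω → BF d) :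
    wsup ν (fun ω => cv a (F ω)) ≤ lw N a * wsup ν F := by
  refine iSup_le fun ω => iSup_le fun y => ?_
  have hm : Measurable fun z => ‖F ω z‖ₑ * ‖a (y - z)‖ₑ :=
    (F ω).continuous.measurable.enorm.mul (a.continuous.measurable.comp (measurable_const.sub measurable_id)).enorm
  calc ν ω y * ‖cv a (F ω) y‖ₑ ≤ ν ω y * ∫⁻ z, ‖F ω z‖ₑ * ‖a (y - z)‖ₑ := by
        gcongr
        rw [cv_apply_swap]
        refine (enorm_integral_le_lintegral_enorm _).trans (le_of_eq (lintegral_congr fun z => ?_))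
        rw [enorm_mul]
    _ = ∫⁻ z, ν ω y * (‖F ω z‖ₑ * ‖a (y - z)‖ₑ) := (lintegral_const_mul _ hm).symm
    _ ≤ ∫⁻ z, ‖a (y - z)‖ₑ * ENNReal.ofReal ((1 + ‖y - z‖) ^ N) * wsup ν F := by
        refine lintegral_mono fun z => ?_
        calc ν ω y * (‖F ω z‖ₑ * ‖a (y - z)‖ₑ)
            ≤ ν ω z * ENNReal.ofReal ((1 + ‖y - z‖) ^ N) * (‖F ω z‖ₑ * ‖a (y - z)‖ₑ) := by
              gcongr; exact hν ω y z
          _ = ‖a (y - z)‖ₑ * ENNReal.ofReal ((1 + ‖y - z‖) ^ N) * (ν ω z * ‖F ω z‖ₑ) := by ring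
          _ ≤ _ := by gcongr; exact le_wsup ν F ω z
    _ = lw N a * wsup ν F := by
        have hm' : Measurable fun z => ‖a (y - z)‖ₑ * ENNReal.ofReal ((1 + ‖y - z‖) ^ N) :=
          (a.continuous.measurable.comp (measurable_const.sub measurable_id)).enorm.mul (by fun_prop)
        rw [lintegral_mul_const _ hm', lw]
        congr 1
        exact lintegral_sub_left_eq_self (fun z => ‖a z‖ₑ * ENNReal.ofReal ((1 + ‖z‖) ^ N)) y

theorem wsup_mul_le (ν ν' : Ω → Sp d → ℝ≥0∞) (F G : Ω → BF d) :
    wsup (ν * ν') (F * G) ≤ wsup ν F * wsup ν' G := by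
  refine iSup_le fun ω => iSup_le fun y => ?_
  simp only [Pi.mul_apply, BoundedContinuousFunction.mul_apply, enorm_mul]
  calc _ = (ν ω y * ‖F ω y‖ₑ) * (ν' ω y * ‖G ω y‖ₑ) := by ring
    _ ≤ _ := mul_le_mul' (le_wsup _ _ _ _) (le_wsup _ _ _ _)

theorem wsup_add_le (ν : Ω → Sp d → ℝ≥0∞) (F G : Ω → BF d) : wsup ν (F + G) ≤ wsup ν F + wsup ν G := by
  refine iSup_le fun ω => iSup_le fun y => ?_
  simp only [Pi.add_apply, BoundedContinuousFunction.add_apply]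
  calc _ ≤ ν ω y * (‖F ω y‖ₑ + ‖G ω y‖ₑ) := by gcongr; exact enorm_add_le _ _
    _ = _ := mul_add _ _ _
    _ ≤ _ := add_le_add (le_wsup _ _ _ _) (le_wsup _ _ _ _)

theorem wsup_smul (ν : Ω → Sp d → ℝ≥0∞) (c : ℂ) (F : Ω → BF d) : wsup ν (c • F) = ‖c‖ₑ * wsup ν F := by
  simp only [wsup, Pi.smul_apply, BoundedContinuousFunction.smul_apply, enorm_smul, ENNReal.mul_iSup]
  refine iSup_congr fun ω => iSup_congr fun y => by ring

theorem wsup_star (ν : Ω → Sp d → ℝ≥0∞) (F : Ω → BF d) : wsup ν (star F) = wsup ν F := by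
  refine iSup_congr fun ω => iSup_congr fun y => ?_
  congr 1
  rw [← ofReal_norm, ← ofReal_norm, Pi.star_apply, BoundedContinuousFunction.star_apply, norm_star]

theorem wsup_tsum_le {ι : Type*} (ν : Ω → Sp d → ℝ≥0∞) (F : ι → Ω → BF d) (G : Ω → BF d)
    (h : ∀ ω, HasSum (fun i => F i ω) (G ω)) : wsup ν G ≤ ∑' i, wsup ν (F i) := by
  refine iSup_le fun ω => iSup_le fun y => ?_
  have h1 : HasSum (fun i => F i ω y) (G ω y) := (h ω).mapL (evalBF y)
  calc ν ω y * ‖G ω y‖ₑ ≤ ν ω y * ∑' i, ‖F i ω y‖ₑ := by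
        gcongr; rw [← h1.tsum_eq]; exact enorm_tsum_le_tsum_enorm
    _ = ∑' i, ν ω y * ‖F i ω y‖ₑ := ENNReal.tsum_mul_left.symm
    _ ≤ _ := ENNReal.tsum_le_tsum fun i => le_wsup _ _ _ _

theorem enorm_le_wsup_one (F : Ω → BF d) (ω : Ω) : ‖F ω‖ₑ ≤ wsup 1 F := by
  rcases eq_or_ne (wsup 1 F) ∞ with h | h
  · rw [h]; exact le_top
  · rw [← ofReal_norm]
    refine ENNReal.ofReal_le_of_le_toReal ((BoundedContinuousFunction.norm_le ENNReal.toReal_nonneg).2 fun y => ?_)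
    rw [← toReal_enorm]
    refine ENNReal.toReal_mono h ?_
    simpa using le_wsup 1 F ω y

theorem wsup_one_le {F : Ω → BF d} {C : ℝ≥0∞} (h : ∀ ω, ‖F ω‖ₑ ≤ C) : wsup 1 F ≤ C := by
  refine iSup_le fun ω => iSup_le fun y => ?_
  rw [Pi.one_apply, Pi.one_apply, one_mul]
  refine le_trans ?_ (h ω)
  rw [← ofReal_norm, ← ofReal_norm]
  exact ENNReal.ofReal_le_ofReal ((F ω).norm_coe_le_norm y)

end Weighted

/-! ### The frequency-uniform norm of families of bounded functions -/

theorem latticePoint_add (β : ℝ) (k l : Fin d → ℤ) : latticePoint β (k + l) = latticePoint β k + latticePoint β l := by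
  ext i; simp [latticePoint, mul_add]

theorem latticePoint_neg (β : ℝ) (k : Fin d → ℤ) : latticePoint β (-k) = -latticePoint β k := by
  ext i; simp [latticePoint]

theorem latticePoint_sub (β : ℝ) (k l : Fin d → ℤ) : latticePoint β (k - l) = latticePoint β k - latticePoint β l := by
  rw [sub_eq_add_neg, latticePoint_add, latticePoint_neg, sub_eq_add_neg]

theorem latticePoint_zero (β : ℝ) : latticePoint β (0 : Fin d → ℤ) = 0 := by
  ext i; simp [latticePoint]

/-- The weight `⟨βk⟩^s`. -/
noncomputable def wgt (β s : ℝ) (k : Fin d → ℤ) : ℝ≥0∞ := ENNReal.ofReal ((1 + ‖latticePoint β k‖ ^ 2) ^ (s / 2))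

theorem one_le_wgt (β : ℝ) {s : ℝ} (hs : 0 ≤ s) (k : Fin d → ℤ) : 1 ≤ wgt β s k := by
  rw [wgt, ENNReal.one_le_ofReal]
  exact Real.one_le_rpow (by linarith [sq_nonneg ‖latticePoint β k‖]) (by positivity)

theorem wgt_ne_top (β s : ℝ) (k : Fin d → ℤ) : wgt β s k ≠ ∞ := ENNReal.ofReal_ne_top

theorem wgt_neg (β s : ℝ) (k : Fin d → ℤ) : wgt β s (-k) = wgt β s k := by
  rw [wgt, latticePoint_neg, norm_neg, wgt]

/-- The indicator function of the lattice points of norm at most `3`. -/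
noncomputable def near (β : ℝ) (j : Fin d → ℤ) : ℝ≥0∞ :=
  open Classical in if ‖latticePoint β j‖ ≤ 3 then 1 else 0

theorem near_of_le {β : ℝ} {j : Fin d → ℤ} (h : ‖latticePoint β j‖ ≤ 3) : near β j = 1 := if_pos h

theorem near_of_lt {β : ℝ} {j : Fin d → ℤ} (h : 3 < ‖latticePoint β j‖) : near β j = 0 := if_neg h.not_ge

theorem tsum_near_lt_top {β : ℝ} (hβ : 0 < β) : ∑' j : Fin d → ℤ, near β j < ∞ := by
  rw [tsum_eq_sum (s := (finite_lattice (d := d) hβ 3).toFinset)]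
  · refine ENNReal.sum_lt_top.2 fun j _ => ?_
    unfold near; split_ifs <;> simp
  · intro j hj
    exact near_of_lt (by simpa using hj)

/-- The weight is submultiplicative up to a constant when `βk` is within `3` of `βl + βm`; `30` is
ample because `1 + (3 + a + b) ^ 2 ≤ 28 + 3 a ^ 2 + 3 b ^ 2`. Nonnegativity of `s` makes the power
monotone. -/
theorem near_mul_wgt_le (β : ℝ) {s : ℝ} (hs : 0 ≤ s) (k l m : Fin d → ℤ) :
    wgt β s k * near β (k - l - m) ≤ ENNReal.ofReal (30 ^ (s / 2)) * (near β (k - l - m) * (wgt β s l * wgt β s m)) := by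
  rcases le_or_gt ‖latticePoint β (k - l - m)‖ 3 with h | h
  · rw [near_of_le h, mul_one, one_mul, wgt, wgt, wgt, ← ENNReal.ofReal_mul (by positivity),
      ← ENNReal.ofReal_mul (by positivity), ← Real.mul_rpow (by positivity) (by positivity),
      ← Real.mul_rpow (by positivity) (by positivity)]
    refine ENNReal.ofReal_le_ofReal (Real.rpow_le_rpow (by positivity) ?_ (by positivity))
    set a := ‖latticePoint β l‖
    set b := ‖latticePoint β m‖
    have ha : 0 ≤ a := norm_nonneg _
    have hb : 0 ≤ b := norm_nonneg _
    have h1 : ‖latticePoint β k‖ ≤ 3 + a + b := by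
      have : latticePoint β k = latticePoint β (k - l - m) + latticePoint β l + latticePoint β m := by
        rw [← latticePoint_add, ← latticePoint_add]; congr 1; abel
      rw [this]
      refine (norm_add_le _ _).trans (add_le_add ((norm_add_le _ _).trans (add_le_add h le_rfl)) le_rfl)
    have h2 : ‖latticePoint β k‖ ^ 2 ≤ (3 + a + b) ^ 2 := by gcongr
    nlinarith [sq_nonneg (a - b), sq_nonneg (a - 3), sq_nonneg (b - 3), mul_nonneg (sq_nonneg a) (sq_nonneg b)]
  · rw [near_of_lt h]; simp

/-- Young's inequality in `ℓ¹`, an equality because all terms are nonnegative. -/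
theorem tsum_conv {G : Type*} [AddCommGroup G] (κ a b : G → ℝ≥0∞) :
    ∑' k, ∑' l, ∑' m, κ (k - l - m) * (a l * b m) = (∑' j, κ j) * ((∑' l, a l) * ∑' m, b m) := by
  rw [ENNReal.tsum_comm]
  have h1 : ∀ l, ∑' k, ∑' m, κ (k - l - m) * (a l * b m) = a l * ((∑' j, κ j) * ∑' m, b m) := fun l => by
    rw [ENNReal.tsum_comm]
    have h2 : ∀ m, ∑' k, κ (k - l - m) * (a l * b m) = (∑' j, κ j) * (a l * b m) := fun m => by
      rw [ENNReal.tsum_mul_right]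
      congr 1
      have := (Equiv.subRight (l + m)).tsum_eq κ
      simpa [sub_sub] using this
    simp only [h2, ENNReal.tsum_mul_left]
    ring
  simp only [h1, ENNReal.tsum_mul_right]
  ring

section Blocks

variable {Ω : Type*} {β : ℝ} {χ : 𝓢(Sp d, ℂ)} {s : ℝ}

/-- The frequency block at `βk` of a family of bounded functions. -/
noncomputable def blk (β : ℝ) (χ : 𝓢(Sp d, ℂ)) (k : Fin d → ℤ) (F : Ω → BF d) (ω : Ω) : BF d :=
  cv (wav β χ k) (F ω)

theorem blk_add (k : Fin d → ℤ) (F G : Ω → BF d) : blk β χ k (F + G) = blk β χ k F + blk β χ k G := by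
  funext ω; exact map_add _ _ _

theorem blk_smul (k : Fin d → ℤ) (c : ℂ) (F : Ω → BF d) : blk β χ k (c • F) = c • blk β χ k F := by
  funext ω; exact map_smul (cv (wav β χ k)) c (F ω)

theorem IsAdmissibleWindow.fourier_wav_zero (hχ : IsAdmissibleWindow β χ) (k : Fin d → ℤ) (η : Sp d)
    (h : 1 < ‖η - latticePoint β k‖) : (𝓕 (wav β χ k) : 𝓢(Sp d, ℂ)) η = 0 := by
  rw [fourier_modulate, hχ.fourier_zero h]

theorem IsAdmissibleWindow.hasSum_cv (hχ : IsAdmissibleWindow β χ) {g : BF d}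
    (h : Summable fun k => ‖cv (wav β χ k) g‖) : HasSum (fun k => cv (wav β χ k) g) g := by
  have h1 := h.of_norm
  have h2 := h1.hasSum
  rwa [← hχ.eq_tsum_cv g h1] at h2

/-- Both factors are expanded into blocks, and in the absolutely convergent double series only pairs
with `‖β(k - l - m)‖ ≤ 3` survive. Two weights are allowed because the estimate serves the sup norm
as well as the maximal functions, where decay is distributed between the factors. -/
theorem IsAdmissibleWindow.wsup_blk_mul_le (hχ : IsAdmissibleWindow β χ) {N : ℕ} {ν ν' : Ω → Sp d → ℝ≥0∞}
    (hν : SlowWeight N (ν * ν')) {F G : Ω → BF d} (hF : ∀ ω, Summable fun l => ‖cv (wav β χ l) (F ω)‖)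
    (hG : ∀ ω, Summable fun l => ‖cv (wav β χ l) (G ω)‖) (k : Fin d → ℤ) :
    wsup (ν * ν') (blk β χ k (F * G)) ≤
      lw N χ * ∑' l, ∑' m, near β (k - l - m) * (wsup ν (blk β χ l F) * wsup ν' (blk β χ m G)) := by
  have h1 : ∀ ω, HasSum (fun q : (Fin d → ℤ) × (Fin d → ℤ) =>
      cv (wav β χ k) (blk β χ q.1 F ω * blk β χ q.2 G ω)) (blk β χ k (F * G) ω) := fun ω => by
    have h2 : HasSum (fun q : (Fin d → ℤ) × (Fin d → ℤ) => blk β χ q.1 F ω * blk β χ q.2 G ω) (F ω * G ω) := by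
      have h3 := summable_mul_of_summable_norm (hF ω) (hG ω)
      have h4 := (tsum_mul_tsum_of_summable_norm (hF ω) (hG ω))
      rw [(hχ.hasSum_cv (hF ω)).tsum_eq, (hχ.hasSum_cv (hG ω)).tsum_eq] at h4
      rw [h4]
      exact h3.hasSum
    exact h2.mapL (cv (wav β χ k))
  refine (wsup_tsum_le (ν * ν') (fun (q : (Fin d → ℤ) × (Fin d → ℤ)) ω =>
    cv (wav β χ k) (blk β χ q.1 F ω * blk β χ q.2 G ω)) _ h1).trans ?_
  rw [ENNReal.tsum_prod (f := fun l m => wsup (ν * ν') fun ω => cv (wav β χ k) (blk β χ l F ω * blk β χ m G ω)),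
    ← ENNReal.tsum_mul_left]
  refine ENNReal.tsum_le_tsum fun l => ?_
  rw [← ENNReal.tsum_mul_left]
  refine ENNReal.tsum_le_tsum fun m => ?_
  rcases le_or_gt ‖latticePoint β (k - l - m)‖ 3 with h | h
  · rw [near_of_le h, one_mul]
    refine (wsup_cv_le hν (wav β χ k) (blk β χ l F * blk β χ m G)).trans ?_
    rw [lw_modulate]
    gcongr
    exact wsup_mul_le _ _ _ _
  · have h5 : ∀ ω, cv (wav β χ k) (blk β χ l F ω * blk β χ m G ω) = 0 := fun ω => by
      refine cv_cv_mul_cv_eq_zero (hχ.fourier_wav_zero k) (hχ.fourier_wav_zero l) (hχ.fourier_wav_zero m) ?_ _ _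
      rwa [← latticePoint_sub, ← latticePoint_sub]
    simp only [h5]
    refine le_trans (le_of_eq ?_) zero_le
    simp [wsup]

/-- The norm `∑ ⟨βk⟩^s sup_{ω, y} |χ_k ∗ F ω (y)|`. -/
noncomputable def xn (β : ℝ) (χ : 𝓢(Sp d, ℂ)) (s : ℝ) (F : Ω → BF d) : ℝ≥0∞ :=
  ∑' k, wgt β s k * wsup 1 (blk β χ k F)

theorem tsum_enorm_cv_le_xn (hs : 0 ≤ s) (F : Ω → BF d) (ω : Ω) : ∑' k, ‖cv (wav β χ k) (F ω)‖ₑ ≤ xn β χ s F := by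
  refine ENNReal.tsum_le_tsum fun k => ?_
  calc ‖cv (wav β χ k) (F ω)‖ₑ ≤ 1 * wsup 1 (blk β χ k F) := by
        rw [one_mul]; exact enorm_le_wsup_one (blk β χ k F) ω
    _ ≤ _ := by gcongr; exact one_le_wgt β hs k

theorem summable_norm_cv_of_xn (hs : 0 ≤ s) {F : Ω → BF d} (h : xn β χ s F < ∞) (ω : Ω) :
    Summable fun k => ‖cv (wav β χ k) (F ω)‖ := by
  have := ENNReal.summable_toReal ((tsum_enorm_cv_le_xn hs F ω).trans_lt h).ne
  simpa only [toReal_enorm] using this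

theorem IsAdmissibleWindow.enorm_le_xn (hχ : IsAdmissibleWindow β χ) (hs : 0 ≤ s) (F : Ω → BF d) (ω : Ω) :
    ‖F ω‖ₑ ≤ xn β χ s F := by
  rcases eq_or_ne (xn β χ s F) ∞ with h | h
  · rw [h]; exact le_top
  · rw [← (hχ.hasSum_cv (summable_norm_cv_of_xn hs h.lt_top ω)).tsum_eq]
    exact enorm_tsum_le_tsum_enorm.trans (tsum_enorm_cv_le_xn hs F ω)

/-- The constant in the algebra property. -/
noncomputable def mulConst (β : ℝ) (χ : 𝓢(Sp d, ℂ)) (s : ℝ) : ℝ≥0∞ :=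
  lw 0 χ * (ENNReal.ofReal (30 ^ (s / 2)) * ∑' j : Fin d → ℤ, near β j)

theorem IsAdmissibleWindow.mulConst_lt_top (hχ : IsAdmissibleWindow β χ) : mulConst β χ s < ∞ :=
  ENNReal.mul_lt_top (lw_lt_top 0 χ) (ENNReal.mul_lt_top ENNReal.ofReal_lt_top (tsum_near_lt_top hχ.pos))

theorem tsum_wgt_near_le (hs : 0 ≤ s) (a b : (Fin d → ℤ) → ℝ≥0∞) :
    ∑' k, wgt β s k * ∑' l, ∑' m, near β (k - l - m) * (a l * b m) ≤
      ENNReal.ofReal (30 ^ (s / 2)) * ((∑' j : Fin d → ℤ, near β j) *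
        ((∑' l, wgt β s l * a l) * ∑' m, wgt β s m * b m)) := by
  rw [← tsum_conv (near β) (fun l => wgt β s l * a l) (fun m => wgt β s m * b m)]
  simp only [← ENNReal.tsum_mul_left]
  refine ENNReal.tsum_le_tsum fun k => ENNReal.tsum_le_tsum fun l => ENNReal.tsum_le_tsum fun m => ?_
  calc wgt β s k * (near β (k - l - m) * (a l * b m)) = (wgt β s k * near β (k - l - m)) * (a l * b m) := by ring
    _ ≤ (ENNReal.ofReal (30 ^ (s / 2)) * (near β (k - l - m) * (wgt β s l * wgt β s m))) * (a l * b m) := by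
      exact mul_le_mul' (near_mul_wgt_le β hs k l m) le_rfl
    _ = _ := by ring

theorem IsAdmissibleWindow.xn_mul_le (hχ : IsAdmissibleWindow β χ) (hs : 0 ≤ s) {F G : Ω → BF d}
    (hF : xn β χ s F < ∞) (hG : xn β χ s G < ∞) :
    xn β χ s (F * G) ≤ mulConst β χ s * (xn β χ s F * xn β χ s G) := by
  have h1 : SlowWeight 0 ((1 : Ω → Sp d → ℝ≥0∞) * 1) := by rw [mul_one]; exact slowWeight_one
  have h2 := hχ.wsup_blk_mul_le h1 (summable_norm_cv_of_xn hs hF) (summable_norm_cv_of_xn hs hG)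
  rw [mul_one] at h2
  calc xn β χ s (F * G) ≤ ∑' k, wgt β s k * (lw 0 χ * ∑' l, ∑' m, near β (k - l - m) *
        (wsup 1 (blk β χ l F) * wsup 1 (blk β χ m G))) :=
        ENNReal.tsum_le_tsum fun k => mul_le_mul_right (h2 k) _
    _ = lw 0 χ * ∑' k, wgt β s k * ∑' l, ∑' m, near β (k - l - m) *
        (wsup 1 (blk β χ l F) * wsup 1 (blk β χ m G)) := by
        rw [← ENNReal.tsum_mul_left]
        exact tsum_congr fun k => by ring
    _ ≤ lw 0 χ * _ := mul_le_mul_right (tsum_wgt_near_le hs _ _) _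
    _ = _ := by rw [mulConst, xn, xn]; ring

theorem xn_add_le (F G : Ω → BF d) : xn β χ s (F + G) ≤ xn β χ s F + xn β χ s G := by
  rw [xn, xn, xn, ← ENNReal.tsum_add]
  refine ENNReal.tsum_le_tsum fun k => ?_
  rw [blk_add, ← mul_add]
  gcongr
  exact wsup_add_le _ _ _

theorem xn_smul (c : ℂ) (F : Ω → BF d) : xn β χ s (c • F) = ‖c‖ₑ * xn β χ s F := by
  rw [xn, xn, ← ENNReal.tsum_mul_left]
  refine tsum_congr fun k => ?_
  rw [blk_smul, wsup_smul]; ring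

theorem xn_tsum_le {ι : Type*} (F : ι → Ω → BF d) (G : Ω → BF d) (h : ∀ ω, HasSum (fun i => F i ω) (G ω)) :
    xn β χ s G ≤ ∑' i, xn β χ s (F i) := by
  simp only [xn]
  rw [ENNReal.tsum_comm]
  refine ENNReal.tsum_le_tsum fun k => ?_
  rw [ENNReal.tsum_mul_left]
  gcongr
  exact wsup_tsum_le _ (fun i => blk β χ k (F i)) _ fun ω => (h ω).mapL (cv (wav β χ k))

/-- Conjugation carries the frequency ball at `βl` to the one at `-βl`. No symmetry of the window is
assumed, so neighbouring blocks mix, but only those within distance `3`. -/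
theorem IsAdmissibleWindow.xn_star_le (hχ : IsAdmissibleWindow β χ) (hs : 0 ≤ s) {F : Ω → BF d}
    (hF : xn β χ s F < ∞) : xn β χ s (star F) ≤ mulConst β χ s * xn β χ s F := by
  have h1 : ∀ k, wsup 1 (blk β χ k (star F)) ≤ lw 0 χ * ∑' l, near β (k - l) * wsup 1 (blk β χ (-l) F) := fun k => by
    have h2 : ∀ ω, HasSum (fun l => cv (wav β χ k) (star (blk β χ l F ω))) (blk β χ k (star F) ω) := fun ω => by
      have h3 := (hχ.hasSum_cv (summable_norm_cv_of_xn hs hF ω)).star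
      exact h3.mapL (cv (wav β χ k))
    refine (wsup_tsum_le 1 (fun l ω => cv (wav β χ k) (star (blk β χ l F ω))) _ h2).trans ?_
    rw [← (Equiv.neg _).tsum_eq, ← ENNReal.tsum_mul_left]
    refine ENNReal.tsum_le_tsum fun l => ?_
    simp only [Equiv.neg_apply]
    rcases le_or_gt ‖latticePoint β (k - l)‖ 3 with h | h
    · rw [near_of_le h, one_mul, ← lw_modulate 0 (latticePoint β k) χ]
      refine (wsup_cv_le slowWeight_one (wav β χ k) (fun ω => star (blk β χ (-l) F ω))).trans ?_
      gcongr
      exact (wsup_star 1 (blk β χ (-l) F)).le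
    · have h5 : ∀ ω, cv (wav β χ k) (star (blk β χ (-l) F ω)) = 0 := fun ω => by
        rw [blk, ← cv_conjS, cv_cv]
        have : sconv (wav β χ k) (conjS (wav β χ (-l))) = 0 := fourier_injective fun ξ => by
          have h0 : (𝓕 (0 : 𝓢(Sp d, ℂ)) : 𝓢(Sp d, ℂ)) ξ = 0 := by
            rw [FourierTransform.fourier_zero]; rfl
          rw [fourier_sconv_apply, fourier_conjS, h0]
          rcases lt_or_ge 1 ‖ξ - latticePoint β k‖ with h6 | h6
          · rw [hχ.fourier_wav_zero k ξ h6, zero_mul]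
          · rw [hχ.fourier_wav_zero (-l) (-ξ), map_zero, mul_zero]
            rw [latticePoint_neg, ← neg_sub', norm_neg]
            have := norm_sub_le (ξ - latticePoint β l) (ξ - latticePoint β k)
            rw [sub_sub_sub_cancel_left, ← latticePoint_sub] at this
            linarith
        rw [this, cv_zero]
      simp only [h5]
      refine le_trans (le_of_eq ?_) zero_le
      simp [wsup]
  -- The bound for double convolutions is reused with a unit mass at `0` in the second slot.
  have h3 := tsum_wgt_near_le (β := β) hs (fun l => wsup 1 (blk β χ (-l) F)) (Pi.single 0 1)
  have h4 : ∀ k l, ∑' m, near β (k - l - m) * (wsup 1 (blk β χ (-l) F) * (Pi.single 0 1 : (Fin d → ℤ) → ℝ≥0∞) m)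
      = near β (k - l) * wsup 1 (blk β χ (-l) F) := fun k l => by
    rw [tsum_eq_single 0 (fun m hm => by simp [hm])]; simp
  have h5 : ∑' m, wgt β s m * (Pi.single 0 1 : (Fin d → ℤ) → ℝ≥0∞) m = 1 := by
    rw [tsum_eq_single 0 (fun m hm => by simp [hm])]; simp [wgt, latticePoint_zero]
  have h6 : ∑' l, wgt β s l * wsup 1 (blk β χ (-l) F) = xn β χ s F := by
    rw [← (Equiv.neg _).tsum_eq]
    simp only [Equiv.neg_apply, neg_neg, wgt_neg]
    rfl
  simp only [h4, h5, h6, mul_one] at h3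
  calc xn β χ s (star F) ≤ ∑' k, wgt β s k * (lw 0 χ * ∑' l, near β (k - l) * wsup 1 (blk β χ (-l) F)) :=
        ENNReal.tsum_le_tsum fun k => mul_le_mul_right (h1 k) _
    _ = lw 0 χ * ∑' k, wgt β s k * ∑' l, near β (k - l) * wsup 1 (blk β χ (-l) F) := by
        rw [← ENNReal.tsum_mul_left]
        exact tsum_congr fun k => by ring
    _ ≤ lw 0 χ * _ := mul_le_mul_right h3 _
    _ = _ := by rw [mulConst]; ring

/-- Convolving a constant with the window gives the value of the window's transform at `0`. -/
theorem IsAdmissibleWindow.cv_one (hχ : IsAdmissibleWindow β χ) {k : Fin d → ℤ} (hk : 1 < ‖latticePoint β k‖) :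
    cv (wav β χ k) 1 = 0 := by
  ext x
  have h1 : (𝓕 (wav β χ k) : 𝓢(Sp d, ℂ)) 0 = 0 := hχ.fourier_wav_zero k 0 (by rwa [zero_sub, norm_neg])
  rw [SchwartzMap.fourier_coe, Real.fourier_eq] at h1
  simpa [cv_apply] using h1

theorem IsAdmissibleWindow.xn_one_lt_top (hχ : IsAdmissibleWindow β χ) : xn β χ s (1 : Ω → BF d) < ∞ := by
  have h0 : wsup 1 (1 : Ω → BF d) ≤ 1 := wsup_one_le fun ω => by
    rw [Pi.one_apply, ← ofReal_norm]
    refine (ENNReal.ofReal_le_ofReal ((BoundedContinuousFunction.norm_le zero_le_one).2 fun y => ?_)).trans_eq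
      ENNReal.ofReal_one
    simp
  rw [xn, tsum_eq_sum (s := (finite_lattice (d := d) hχ.pos 1).toFinset)]
  · refine ENNReal.sum_lt_top.2 fun k _ => ENNReal.mul_lt_top (wgt_ne_top _ _ _).lt_top ?_
    refine (wsup_cv_le slowWeight_one (wav β χ k) 1).trans_lt ?_
    exact ENNReal.mul_lt_top (lw_lt_top _ _) (h0.trans_lt ENNReal.one_lt_top)
  · intro k hk
    have h5 : ∀ ω : Ω, blk β χ k (1 : Ω → BF d) ω = 0 := fun ω => hχ.cv_one (by simpa using hk)
    simp [wsup, h5]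

end Blocks

/-! ### The Banach algebra of bounded functions with summable frequency blocks -/

/-- The data defining the space: the window and the regularity. -/
structure Par (d : ℕ) where
  /-- The lattice constant. -/
  β : ℝ
  /-- The window. -/
  χ : 𝓢(Sp d, ℂ)
  /-- The regularity. -/
  s : ℝ
  adm : IsAdmissibleWindow β χ
  nonneg : 0 ≤ s

variable (P : Par d)

/-- The norm `∑ ⟨βk⟩^s ‖χ_k ∗ g‖_∞`. -/
noncomputable def an (g : BF d) : ℝ≥0∞ := xn P.β P.χ P.s (fun _ : Unit => g)

theorem an_eq (g : BF d) : an P g = ∑' k, wgt P.β P.s k * ‖cv (wav P.β P.χ k) g‖ₑ := by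
  refine tsum_congr fun k => ?_
  congr 1
  exact le_antisymm (wsup_one_le fun _ => le_rfl) (enorm_le_wsup_one (blk P.β P.χ k fun _ : Unit => g) ())

theorem enorm_le_an (g : BF d) : ‖g‖ₑ ≤ an P g := P.adm.enorm_le_xn P.nonneg (fun _ : Unit => g) ()

theorem an_add_le (f g : BF d) : an P (f + g) ≤ an P f + an P g := xn_add_le (fun _ : Unit => f) (fun _ => g)

theorem an_smul (c : ℂ) (f : BF d) : an P (c • f) = ‖c‖ₑ * an P f := xn_smul c (fun _ : Unit => f)

theorem an_zero : an P 0 = 0 := by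
  have := an_smul P 0 0
  simpa using this

theorem an_neg (f : BF d) : an P (-f) = an P f := by
  have := an_smul P (-1) f
  simpa using this

theorem an_mul_le {f g : BF d} (hf : an P f < ∞) (hg : an P g < ∞) :
    an P (f * g) ≤ mulConst P.β P.χ P.s * (an P f * an P g) := P.adm.xn_mul_le P.nonneg hf hg

theorem an_one_lt_top : an P 1 < ∞ := P.adm.xn_one_lt_top

theorem an_star_le {f : BF d} (hf : an P f < ∞) : an P (star f) ≤ mulConst P.β P.χ P.s * an P f :=
  P.adm.xn_star_le P.nonneg hf

/-- The subalgebra of bounded functions of finite norm. -/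
noncomputable def algSub : Subalgebra ℂ (BF d) where
  carrier := {g | an P g < ∞}
  mul_mem' {f g} hf hg := (an_mul_le P hf hg).trans_lt
    (ENNReal.mul_lt_top P.adm.mulConst_lt_top (ENNReal.mul_lt_top hf hg))
  add_mem' {f g} hf hg := (an_add_le P f g).trans_lt (ENNReal.add_lt_top.2 ⟨hf, hg⟩)
  algebraMap_mem' c := by
    rw [Algebra.algebraMap_eq_smul_one, Set.mem_ofPred_eq, an_smul]
    exact ENNReal.mul_lt_top enorm_lt_top (an_one_lt_top P)

/-- The Banach algebra of bounded functions with summable frequency blocks. -/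
def Alg : Type := algSub P

noncomputable instance : CommRing (Alg P) := inferInstanceAs (CommRing (algSub P))

noncomputable instance : Algebra ℂ (Alg P) := inferInstanceAs (Algebra ℂ (algSub P))

/-- The underlying bounded function. -/
def Alg.val (g : Alg P) : BF d := Subtype.val (p := fun g => g ∈ algSub P) g

/-- An element of the algebra from a bounded function of finite norm. -/
def Alg.mk (g : BF d) (h : an P g < ∞) : Alg P := (⟨g, h⟩ : algSub P)

namespace Alg

variable {P}

theorem an_lt_top (g : Alg P) : an P (g.val P) < ∞ := Subtype.prop (p := fun g => g ∈ algSub P) g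

@[simp] theorem val_mk (g : BF d) (h : an P g < ∞) : (Alg.mk P g h).val P = g := rfl

@[ext] theorem ext {f g : Alg P} (h : f.val P = g.val P) : f = g := Subtype.ext h

@[simp] theorem val_add (f g : Alg P) : (f + g).val P = f.val P + g.val P := rfl
@[simp] theorem val_sub (f g : Alg P) : (f - g).val P = f.val P - g.val P := rfl
@[simp] theorem val_neg (f : Alg P) : (-f).val P = -f.val P := rfl
@[simp] theorem val_zero : (0 : Alg P).val P = 0 := rfl
@[simp] theorem val_one : (1 : Alg P).val P = 1 := rfl
@[simp] theorem val_mul (f g : Alg P) : (f * g).val P = f.val P * g.val P := rfl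
@[simp] theorem val_smul (c : ℂ) (f : Alg P) : (c • f).val P = c • f.val P := rfl

variable (P) in
/-- The scaling which makes the norm submultiplicative. -/
noncomputable def scale : ℝ := (mulConst P.β P.χ P.s).toReal + 1

theorem scale_pos : 0 < scale P := by
  have : 0 ≤ (mulConst P.β P.χ P.s).toReal := ENNReal.toReal_nonneg
  unfold scale; linarith

noncomputable instance : Norm (Alg P) := ⟨fun g => scale P * (an P (g.val P)).toReal⟩

theorem norm_def (g : Alg P) : ‖g‖ = scale P * (an P (g.val P)).toReal := rfl

theorem enorm_val_le (g : Alg P) : ‖g.val P‖ ≤ ‖g‖ := by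
  have h1 : ‖g.val P‖ ≤ (an P (g.val P)).toReal := by
    rw [← toReal_enorm]
    exact ENNReal.toReal_mono g.an_lt_top.ne (enorm_le_an P _)
  refine h1.trans (le_mul_of_one_le_left ENNReal.toReal_nonneg ?_)
  have : 0 ≤ (mulConst P.β P.χ P.s).toReal := ENNReal.toReal_nonneg
  unfold scale; linarith

noncomputable instance : NormedAddCommGroup (Alg P) :=
  AddGroupNorm.toNormedAddCommGroup
    { toFun := fun g => ‖g‖
      map_zero' := by rw [norm_def, val_zero, an_zero]; simp
      add_le' := fun f g => by
        rw [norm_def, norm_def, norm_def, ← mul_add, ← ENNReal.toReal_add f.an_lt_top.ne g.an_lt_top.ne]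
        refine mul_le_mul_of_nonneg_left ?_ scale_pos.le
        exact ENNReal.toReal_mono (ENNReal.add_lt_top.2 ⟨f.an_lt_top, g.an_lt_top⟩).ne (an_add_le P _ _)
      neg' := fun f => by rw [norm_def, norm_def, val_neg, an_neg]
      eq_zero_of_map_eq_zero' := fun f hf => by
        have h := enorm_val_le f
        change ‖f‖ = 0 at hf
        rw [hf] at h
        exact Alg.ext (norm_le_zero_iff.1 h) }

noncomputable instance : NormedCommRing (Alg P) :=
  { (inferInstance : CommRing (Alg P)), (inferInstance : NormedAddCommGroup (Alg P)) with
    norm_mul_le := fun f g => by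
      rw [norm_def, norm_def, norm_def, val_mul]
      have h1 := ENNReal.toReal_mono (ENNReal.mul_lt_top P.adm.mulConst_lt_top
        (ENNReal.mul_lt_top f.an_lt_top g.an_lt_top)).ne (an_mul_le P f.an_lt_top g.an_lt_top)
      rw [ENNReal.toReal_mul, ENNReal.toReal_mul] at h1
      have h2 : (mulConst P.β P.χ P.s).toReal ≤ scale P := by unfold scale; linarith
      have h3 : 0 ≤ (an P (f.val P)).toReal * (an P (g.val P)).toReal :=
        mul_nonneg ENNReal.toReal_nonneg ENNReal.toReal_nonneg
      have h4 := scale_pos (P := P)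
      calc scale P * (an P (f.val P * g.val P)).toReal
          ≤ scale P * (scale P * ((an P (f.val P)).toReal * (an P (g.val P)).toReal)) := by
            gcongr
            exact h1.trans (mul_le_mul_of_nonneg_right h2 h3)
        _ = _ := by ring }

noncomputable instance : NormedAlgebra ℂ (Alg P) where
  norm_smul_le c f := by
    rw [norm_def, norm_def, val_smul, an_smul, ENNReal.toReal_mul, toReal_enorm]
    exact le_of_eq (by ring)

theorem an_eq_ofReal (g : Alg P) : an P (g.val P) = ENNReal.ofReal ((scale P)⁻¹ * ‖g‖) := by
  rw [norm_def, inv_mul_cancel_left₀ scale_pos.ne', ENNReal.ofReal_toReal g.an_lt_top.ne]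

/-- The inclusion into bounded functions. -/
noncomputable def incl : Alg P →L[ℂ] BF d :=
  LinearMap.mkContinuous { toFun := fun g => g.val P, map_add' := fun _ _ => rfl, map_smul' := fun _ _ => rfl } 1
    fun g => by rw [one_mul]; exact enorm_val_le g

@[simp] theorem incl_apply (g : Alg P) : incl g = g.val P := rfl

theorem hasSum_cv (g : Alg P) : HasSum (fun k => cv (wav P.β P.χ k) (g.val P)) (g.val P) :=
  P.adm.hasSum_cv (summable_norm_cv_of_xn (F := fun _ : Unit => g.val P) P.nonneg g.an_lt_top ())

theorem summable_norm_cv (g : Alg P) : Summable fun k => ‖cv (wav P.β P.χ k) (g.val P)‖ :=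
  summable_norm_cv_of_xn (F := fun _ : Unit => g.val P) P.nonneg g.an_lt_top ()

theorem eq_of_cv {f g : Alg P} (h : ∀ k, cv (wav P.β P.χ k) (f.val P) = cv (wav P.β P.χ k) (g.val P)) : f = g := by
  refine Alg.ext (sub_eq_zero.1 (P.adm.eq_zero_of_cv fun k => ?_))
  rw [map_sub, h, sub_self]

instance : CompleteSpace (Alg P) := by
  -- Absolutely convergent series are summed in `BF d`; countable subadditivity of `an` puts the sum
  -- into the algebra and bounds the tails.
  refine NormedAddCommGroup.completeSpace_of_summable_imp_tendsto fun u hu => ?_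
  have hs : Summable fun n => (u n).val P :=
    Summable.of_norm (hu.of_nonneg_of_le (fun _ => norm_nonneg _) fun n => enorm_val_le (u n))
  have htop : ∑' n, an P ((u n).val P) ≠ ∞ := by
    simp only [an_eq_ofReal]
    exact (hu.mul_left _).tsum_ofReal_ne_top
  have htail : ∀ N, an P (∑' n, (u (n + N)).val P) ≤ ∑' n, an P ((u (n + N)).val P) := fun N =>
    xn_tsum_le (fun n (_ : Unit) => (u (n + N)).val P) _ fun _ =>
      ((summable_nat_add_iff N).2 hs).hasSum
  have h0 : an P (∑' n, (u n).val P) < ∞ := by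
    have := htail 0
    simp only [add_zero] at this
    exact this.trans_lt htop.lt_top
  refine ⟨Alg.mk P _ h0, ?_⟩
  rw [tendsto_iff_norm_sub_tendsto_zero]
  have h1 : ∀ N, ‖∑ i ∈ Finset.range N, u i - Alg.mk P _ h0‖ ≤
      scale P * (∑' n, an P ((u (n + N)).val P)).toReal := fun N => by
    rw [← norm_neg, neg_sub, norm_def]
    refine mul_le_mul_of_nonneg_left (ENNReal.toReal_mono ?_ ?_) scale_pos.le
    · refine ne_top_of_le_ne_top htop ?_
      exact ENNReal.tsum_comp_le_tsum_of_injective (add_left_injective N) fun n => an P ((u n).val P)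
    · refine le_trans (le_of_eq ?_) (htail N)
      congr 1
      have h2 : (∑ i ∈ Finset.range N, u i).val P = ∑ i ∈ Finset.range N, (u i).val P := map_sum incl _ _
      have h3 := hs.sum_add_tsum_nat_add N
      rw [val_sub, val_mk, h2, ← h3, add_sub_cancel_left]
  refine squeeze_zero (fun _ => norm_nonneg _) h1 ?_
  have h3 := (ENNReal.tendsto_toReal ENNReal.zero_ne_top).comp
    (ENNReal.tendsto_sum_nat_add (fun n => an P ((u n).val P)) htop)
  simpa using h3.const_mul (scale P)

/-- Complex conjugation. -/
noncomputable def conj : Alg P →L[ℝ] Alg P :=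
  LinearMap.mkContinuous
    { toFun := fun g => Alg.mk P (star (g.val P))
        ((an_star_le P g.an_lt_top).trans_lt (ENNReal.mul_lt_top P.adm.mulConst_lt_top g.an_lt_top))
      map_add' := fun f g => Alg.ext (by simp)
      map_smul' := fun c f => Alg.ext (by
        have h1 : (c • f).val P = c • f.val P := rfl
        ext x
        simp [h1]
        rfl) }
    (mulConst P.β P.χ P.s).toReal fun g => by
      change ‖Alg.mk P _ _‖ ≤ _
      rw [norm_def, norm_def, val_mk]
      have h1 := ENNReal.toReal_mono (ENNReal.mul_lt_top P.adm.mulConst_lt_top g.an_lt_top).ne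
        (an_star_le P g.an_lt_top)
      rw [ENNReal.toReal_mul] at h1
      calc scale P * (an P (star (g.val P))).toReal
          ≤ scale P * ((mulConst P.β P.χ P.s).toReal * (an P (g.val P)).toReal) := by
            have := scale_pos (P := P); gcongr
        _ = _ := by ring

@[simp] theorem val_conj (g : Alg P) : (conj g).val P = star (g.val P) := rfl

/-- Dominated convergence for the sum over blocks reduces convergence in the algebra to uniform
convergence of each block under a summable bound. -/
theorem tendsto_of_dominated {ι : Type*} {l : Filter ι} {f : ι → Alg P} {g : Alg P} {b : (Fin d → ℤ) → ℝ}
    (hb : Summable b)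
    (hle : ∀ᶠ i in l, ∀ k, (wgt P.β P.s k).toReal * ‖cv (wav P.β P.χ k) ((f i).val P - g.val P)‖ ≤ b k)
    (hlim : ∀ k, Tendsto (fun i => cv (wav P.β P.χ k) ((f i).val P)) l (𝓝 (cv (wav P.β P.χ k) (g.val P)))) :
    Tendsto f l (𝓝 g) := by
  rw [tendsto_iff_norm_sub_tendsto_zero]
  have h1 : ∀ i, ‖f i - g‖ = scale P * ∑' k, (wgt P.β P.s k).toReal * ‖cv (wav P.β P.χ k) ((f i).val P - g.val P)‖ := by
    intro i
    rw [norm_def, val_sub, an_eq, ENNReal.tsum_toReal_eq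
      (fun k => (ENNReal.mul_lt_top (wgt_ne_top _ _ _).lt_top enorm_lt_top).ne)]
    simp only [ENNReal.toReal_mul, toReal_enorm]
  simp only [h1]
  have h2 : Tendsto (fun i => ∑' k, (wgt P.β P.s k).toReal * ‖cv (wav P.β P.χ k) ((f i).val P - g.val P)‖) l
      (𝓝 (∑' _ : Fin d → ℤ, (0 : ℝ))) := by
    refine tendsto_tsum_of_dominated_convergence hb (fun k => ?_) ?_
    · have h3 : Tendsto (fun i => ‖cv (wav P.β P.χ k) ((f i).val P - g.val P)‖) l (𝓝 0) := by
        simp only [map_sub]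
        rw [← tendsto_iff_norm_sub_tendsto_zero]
        exact hlim k
      simpa using h3.const_mul (wgt P.β P.s k).toReal
    · filter_upwards [hle] with i hi k
      rw [Real.norm_of_nonneg (by positivity)]
      exact hi k
  simpa using h2.const_mul (scale P)

theorem summable_wgt_norm_cv (g : Alg P) : Summable fun k => (wgt P.β P.s k).toReal * ‖cv (wav P.β P.χ k) (g.val P)‖ := by
  have h := g.an_lt_top.ne
  rw [an_eq] at h
  simpa using ENNReal.summable_toReal h

end Alg

/-! ### The cosine propagator on the algebra -/

/-- Of the `N + (d + 1)` powers of decay, `N` pay for the weight and `d + 1` for integrability.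
Uniformity in `k` comes from `kerConst_modulate`. -/
theorem exists_lw_cosS_le (d N : ℕ) : ∃ C : ℝ, 0 ≤ C ∧ ∀ (t β : ℝ) (k : Fin d → ℤ),
    lw N (cosS t (wav β (fat d) k)) ≤ ENNReal.ofReal (C * Real.exp (2 * Real.pi * |t|)) := by
  obtain ⟨C, hC0, hC⟩ := exists_norm_cosS_le d (N + (d + 1))
  set I := ∫ x : Sp d, ((1 + ‖x‖) ^ (d + 1))⁻¹ with hI
  have hI0 : 0 ≤ I := integral_nonneg fun x => by positivity
  have hk0 := kerConst_nonneg (N + (d + 1)) (fat d)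
  refine ⟨C * kerConst (N + (d + 1)) (fat d) * I, by positivity, fun t β k => ?_⟩
  set E := C * Real.exp (2 * Real.pi * |t|) * kerConst (N + (d + 1)) (fat d) with hE
  have hE0 : 0 ≤ E := by positivity
  have h1 : ∀ x : Sp d, ‖cosS t (wav β (fat d) k) x‖ₑ * ENNReal.ofReal ((1 + ‖x‖) ^ N) ≤
      ENNReal.ofReal (E * ((1 + ‖x‖) ^ (d + 1))⁻¹) := fun x => by
    rw [← ofReal_norm, ← ENNReal.ofReal_mul (norm_nonneg _)]
    refine ENNReal.ofReal_le_ofReal ?_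
    rw [le_mul_inv_iff₀ (by positivity), mul_assoc, ← pow_add, mul_comm]
    refine (hC t _ x).trans_eq ?_
    rw [kerConst_modulate]
  calc lw N (cosS t (wav β (fat d) k)) ≤ ∫⁻ x : Sp d, ENNReal.ofReal (E * ((1 + ‖x‖) ^ (d + 1))⁻¹) :=
        lintegral_mono h1
    _ = ENNReal.ofReal (∫ x : Sp d, E * ((1 + ‖x‖) ^ (d + 1))⁻¹) :=
        (ofReal_integral_eq_lintegral_ofReal ((integrable_one_add_norm_neg_pow d.lt_succ_self).const_mul E)
          (ae_of_all _ fun x => by positivity)).symm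
    _ ≤ _ := by
      rw [integral_const_mul, ← hI, hE]
      exact ENNReal.ofReal_le_ofReal (le_of_eq (by ring))

/-- The growth constant of the cosine propagator. -/
noncomputable def propConst (d N : ℕ) : ℝ := (exists_lw_cosS_le d N).choose

theorem propConst_nonneg (d N : ℕ) : 0 ≤ propConst d N := (exists_lw_cosS_le d N).choose_spec.1

theorem lw_cosS_le (N : ℕ) (t β : ℝ) (k : Fin d → ℤ) :
    lw N (cosS t (wav β (fat d) k)) ≤ ENNReal.ofReal (propConst d N * Real.exp (2 * Real.pi * |t|)) :=
  (exists_lw_cosS_le d N).choose_spec.2 t β k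

theorem lw_zero (a : 𝓢(Sp d, ℂ)) : lw 0 a = ENNReal.ofReal (∫ x, ‖a x‖) := by
  rw [ofReal_integral_norm_eq_lintegral_enorm a.integrable]
  simp [lw]

variable {P}

/-- The propagator is transferred to the wide window, so that the evolved block is an `L¹` kernel
acting on the block itself. -/
theorem cv_cosS_wav (t : ℝ) (k : Fin d → ℤ) (g : BF d) :
    cv (cosS t (wav P.β P.χ k)) g = cv (cosS t (wav P.β (fat d) k)) (cv (wav P.β P.χ k) g) := by
  rw [cv_cv, sconv_cosS, P.adm.sconv_fat]

theorem norm_cv_cosS_wav_le (t : ℝ) (k : Fin d → ℤ) (g : BF d) :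
    ‖cv (cosS t (wav P.β P.χ k)) g‖ ≤ propConst d 0 * Real.exp (2 * Real.pi * |t|) * ‖cv (wav P.β P.χ k) g‖ := by
  rw [cv_cosS_wav]
  refine (norm_cv_apply_le _ _).trans ?_
  gcongr
  have h := lw_cosS_le 0 t P.β k
  rw [lw_zero] at h
  exact (ENNReal.ofReal_le_ofReal_iff (mul_nonneg (propConst_nonneg _ _) (Real.exp_pos _).le)).1 h

namespace Alg

theorem summable_cv_cosS (t : ℝ) (g : Alg P) : Summable fun k => cv (cosS t (wav P.β P.χ k)) (g.val P) :=
  Summable.of_norm ((g.summable_norm_cv.mul_left _).of_nonneg_of_le (fun _ => norm_nonneg _)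
    fun k => norm_cv_cosS_wav_le t k _)

/-- The cosine propagator, as a bounded function. -/
noncomputable def cosB (t : ℝ) (g : Alg P) : BF d := ∑' k, cv (cosS t (wav P.β P.χ k)) (g.val P)

/-- Fourier multipliers commute with convolution. Applied to the windows, it says that the blocks of
the evolved function are the evolved blocks. -/
theorem cv_cosB (h : 𝓢(Sp d, ℂ)) (t : ℝ) (g : Alg P) : cv h (cosB t g) = cv (cosS t h) (g.val P) := by
  rw [cosB, ContinuousLinearMap.map_tsum _ (summable_cv_cosS t g), ← (g.hasSum_cv.mapL (cv (cosS t h))).tsum_eq]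
  refine tsum_congr fun k => ?_
  rw [cv_cv, cv_cv, sconv_comm, sconv_cosS, sconv_cosS, sconv_comm]

theorem an_cosB_le (t : ℝ) (g : Alg P) :
    an P (cosB t g) ≤ ENNReal.ofReal (propConst d 0 * Real.exp (2 * Real.pi * |t|)) * an P (g.val P) := by
  rw [an_eq, an_eq, ← ENNReal.tsum_mul_left]
  refine ENNReal.tsum_le_tsum fun k => ?_
  rw [cv_cosB, mul_left_comm]
  gcongr
  rw [← ofReal_norm, ← ofReal_norm, ← ENNReal.ofReal_mul (mul_nonneg (propConst_nonneg _ _) (Real.exp_pos _).le)]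
  exact ENNReal.ofReal_le_ofReal (norm_cv_cosS_wav_le t k _)

/-- The cosine propagator on the algebra. -/
noncomputable def cosA (t : ℝ) : Alg P →L[ℂ] Alg P :=
  LinearMap.mkContinuous
    { toFun := fun g => Alg.mk P (cosB t g)
        ((an_cosB_le t g).trans_lt (ENNReal.mul_lt_top ENNReal.ofReal_lt_top g.an_lt_top))
      map_add' := fun f g => eq_of_cv fun k => by simp [cv_cosB]
      map_smul' := fun c f => eq_of_cv fun k => by simp [cv_cosB] }
    (propConst d 0 * Real.exp (2 * Real.pi * |t|)) fun g => by
      change ‖Alg.mk P _ _‖ ≤ _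
      rw [norm_def, norm_def, val_mk]
      have h1 := ENNReal.toReal_mono (ENNReal.mul_lt_top ENNReal.ofReal_lt_top g.an_lt_top).ne (an_cosB_le t g)
      rw [ENNReal.toReal_mul, ENNReal.toReal_ofReal (mul_nonneg (propConst_nonneg _ _) (Real.exp_pos _).le)] at h1
      have := scale_pos (P := P)
      calc scale P * (an P (cosB t g)).toReal ≤ scale P * (propConst d 0 * Real.exp (2 * Real.pi * |t|) *
            (an P (g.val P)).toReal) := by gcongr
        _ = _ := by ring

theorem norm_cosA_le (t : ℝ) : ‖cosA (P := P) t‖ ≤ propConst d 0 * Real.exp (2 * Real.pi * |t|) :=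
  LinearMap.mkContinuous_norm_le _ (mul_nonneg (propConst_nonneg _ _) (Real.exp_pos _).le) _

theorem cv_cosA (h : 𝓢(Sp d, ℂ)) (t : ℝ) (g : Alg P) : cv h ((cosA t g).val P) = cv (cosS t h) (g.val P) :=
  cv_cosB h t g

/-- Each block evolves continuously in operator norm, and the uniform bound on blocks supplies the
majorant. Only strong continuity in the algebra results. -/
theorem continuous_cosA (g : Alg P) : Continuous fun t => cosA t g := by
  refine continuous_iff_continuousAt.2 fun t => ?_
  set D := propConst d 0 * Real.exp (2 * Real.pi * (|t| + 1)) with hD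
  have hp := propConst_nonneg d 0
  refine tendsto_of_dominated (b := fun k => 2 * D * ((wgt P.β P.s k).toReal * ‖cv (wav P.β P.χ k) (g.val P)‖))
    (g.summable_wgt_norm_cv.mul_left _) ?_ fun k => ?_
  · filter_upwards [Metric.ball_mem_nhds t one_pos] with τ hτ k
    rw [map_sub, cv_cosA, cv_cosA]
    have h1 : ∀ τ, |τ| ≤ |t| + 1 → ‖cv (cosS τ (wav P.β P.χ k)) (g.val P)‖ ≤ D * ‖cv (wav P.β P.χ k) (g.val P)‖ := by
      intro τ hτ
      refine (norm_cv_cosS_wav_le τ k _).trans ?_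
      have := Real.pi_pos
      rw [hD]; gcongr
    have h2 : |τ| ≤ |t| + 1 := by
      rw [mem_ball_iff_norm, Real.norm_eq_abs] at hτ
      have := abs_add_le (τ - t) t
      rw [sub_add_cancel] at this
      linarith
    calc _ ≤ (wgt P.β P.s k).toReal * (D * ‖cv (wav P.β P.χ k) (g.val P)‖ + D * ‖cv (wav P.β P.χ k) (g.val P)‖) := by
          gcongr
          exact (norm_sub_le _ _).trans (add_le_add (h1 τ h2) (h1 t (by linarith)))
      _ = _ := by ring
  · simp only [cv_cosA]
    have h3 := continuous_cv_cosS (wav P.β P.χ k)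
    exact (h3.clm_apply continuous_const).tendsto t

end Alg

/-! ### Nonlinear Volterra equations in a Banach space -/

section Volterra

section Lipschitz

variable {E : Type*} [NormedAddCommGroup E]

/-- Lipschitz continuity on balls. -/
def LipOnBalls (N : E → E) : Prop :=
  ∀ R : ℝ, ∃ K, 0 ≤ K ∧ ∀ x y, ‖x‖ ≤ R → ‖y‖ ≤ R → ‖N x - N y‖ ≤ K * ‖x - y‖

theorem LipOnBalls.continuous {N : E → E} (hN : LipOnBalls N) : Continuous N := by
  refine continuous_iff_continuousAt.2 fun x => ?_
  obtain ⟨K, hK0, hK⟩ := hN (‖x‖ + 1)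
  rw [ContinuousAt, tendsto_iff_norm_sub_tendsto_zero]
  have h1 : Tendsto (fun y => K * ‖y - x‖) (𝓝 x) (𝓝 0) := by
    have : Continuous fun y => K * ‖y - x‖ := by fun_prop
    simpa using this.tendsto x
  refine squeeze_zero' (Eventually.of_forall fun _ => norm_nonneg _) ?_ h1
  filter_upwards [Metric.ball_mem_nhds x one_pos] with y hy
  refine hK y x ?_ (by linarith)
  rw [mem_ball_iff_norm] at hy
  have := norm_sub_norm_le y x
  linarith

theorem LipOnBalls.bound {N : E → E} (hN : LipOnBalls N) (R : ℝ) : ∃ B, 0 ≤ B ∧ ∀ x, ‖x‖ ≤ R → ‖N x‖ ≤ B := by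
  obtain ⟨K, hK0, hK⟩ := hN |R|
  refine ⟨K * |R| + ‖N 0‖, by positivity, fun x hx => ?_⟩
  have h1 := hK x 0 (hx.trans (le_abs_self R)) (by simp)
  rw [sub_zero] at h1
  have h2 := norm_sub_norm_le (N x) (N 0)
  have h3 : K * ‖x‖ ≤ K * |R| := by gcongr; exact hx.trans (le_abs_self R)
  linarith

theorem lipOnBalls_of_lipschitz {N : E → E} {K : ℝ≥0} (hN : LipschitzWith K N) : LipOnBalls N := fun _ =>
  ⟨K, K.2, fun x y _ _ => by simpa [dist_eq_norm] using hN.dist_le_mul x y⟩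

end Lipschitz

/-- Grönwall's inequality applied to the primitive of `f`. -/
theorem eq_zero_of_le_mul_integral {f : ℝ → ℝ} (hf : Continuous f) (h0 : ∀ t, 0 ≤ f t) {C T : ℝ}
    (h : ∀ t ∈ Set.Icc 0 T, f t ≤ C * ∫ τ in (0 : ℝ)..t, f τ) : ∀ t ∈ Set.Icc 0 T, f t = 0 := by
  have h1 : ∀ t, HasDerivAt (fun t => ∫ τ in (0 : ℝ)..t, f τ) (f t) t := hasDerivAt_primitive hf
  have h2 := norm_le_gronwallBound_of_norm_deriv_right_le (f := fun t => ∫ τ in (0 : ℝ)..t, f τ) (f' := f)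
    (δ := 0) (K := C) (ε := 0) (a := 0) (b := T) (continuous_iff_continuousAt.2 fun t => (h1 t).continuousAt).continuousOn
    (fun t _ => (h1 t).hasDerivWithinAt) (by simp) (fun t ht => by
      rw [add_zero, Real.norm_of_nonneg (h0 t),
        Real.norm_of_nonneg (intervalIntegral.integral_nonneg ht.1 fun τ _ => h0 τ)]
      exact h t ⟨ht.1, ht.2.le⟩)
  intro t ht
  have h3 := h2 t ht
  rw [gronwallBound_ε0_δ0] at h3
  have h4 : ∫ τ in (0 : ℝ)..t, f τ = 0 := norm_le_zero_iff.1 h3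
  have h5 := h t ht
  rw [h4, mul_zero] at h5
  exact le_antisymm h5 (h0 t)

variable {E : Type*} [NormedAddCommGroup E] [NormedSpace ℝ E]

/-- `u` solves `u(t) = L(t) - ∫₀ᵗ S(t - τ) N(u(τ)) dτ` on `[0, T]`. -/
def IsMild (S : ℝ → E →L[ℝ] E) (L : ℝ → E) (N : E → E) (T : ℝ) (u : ℝ → E) : Prop :=
  Continuous u ∧ ∀ t ∈ Set.Icc 0 T, u t = L t - ∫ τ in (0 : ℝ)..t, S (t - τ) (N (u τ))

theorem IsMild.mono {S : ℝ → E →L[ℝ] E} {L : ℝ → E} {N : E → E} {T T' : ℝ} {u : ℝ → E} (h : IsMild S L N T u)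
    (hT : T' ≤ T) : IsMild S L N T' u := ⟨h.1, fun t ht => h.2 t ⟨ht.1, ht.2.trans hT⟩⟩

theorem IsMild.congr {S : ℝ → E →L[ℝ] E} {L : ℝ → E} {N N' : E → E} {T : ℝ} {u : ℝ → E} (h : IsMild S L N T u)
    (hN : ∀ t ∈ Set.Icc 0 T, N (u t) = N' (u t)) : IsMild S L N' T u := ⟨h.1, fun t ht => by
  rw [h.2 t ht]
  congr 1
  refine intervalIntegral.integral_congr fun τ hτ => ?_
  rw [Set.uIcc_of_le ht.1] at hτ
  simp only [hN τ ⟨hτ.1, hτ.2.trans ht.2⟩]⟩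

/-- The radial cut-off factor. -/
noncomputable def truncFactor (R r : ℝ) : ℝ := max 0 (min 1 (R + 1 - r))

theorem truncFactor_nonneg (R r : ℝ) : 0 ≤ truncFactor R r := le_max_left _ _

theorem truncFactor_le_one (R r : ℝ) : truncFactor R r ≤ 1 := max_le zero_le_one (min_le_left _ _)

theorem truncFactor_of_le {R r : ℝ} (h : r ≤ R) : truncFactor R r = 1 := by
  rw [truncFactor, min_eq_left (by linarith), max_eq_right zero_le_one]

theorem truncFactor_of_ge {R r : ℝ} (h : R + 1 ≤ r) : truncFactor R r = 0 :=
  max_eq_left ((min_le_right _ _).trans (by linarith))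

theorem abs_truncFactor_sub_le (R r r' : ℝ) : |truncFactor R r - truncFactor R r'| ≤ |r - r'| := by
  unfold truncFactor
  rw [max_comm 0, max_comm 0]
  refine (abs_max_sub_max_le_abs _ _ _).trans ((abs_min_sub_min_le_max _ _ _ _).trans ?_)
  rw [sub_self, abs_zero, sub_sub_sub_cancel_left, abs_sub_comm]
  exact max_le (abs_nonneg _) le_rfl

/-- The nonlinearity, cut off outside a ball. -/
noncomputable def trunc (R : ℝ) (N : E → E) (x : E) : E := truncFactor R ‖x‖ • N x

theorem trunc_of_le {R : ℝ} (N : E → E) {x : E} (h : ‖x‖ ≤ R) : trunc R N x = N x := by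
  rw [trunc, truncFactor_of_le h, one_smul]

theorem norm_trunc_le {R B : ℝ} {N : E → E} (hB0 : 0 ≤ B) (hB : ∀ x, ‖x‖ ≤ R + 1 → ‖N x‖ ≤ B) (x : E) :
    ‖trunc R N x‖ ≤ B := by
  rw [trunc, norm_smul, Real.norm_of_nonneg (truncFactor_nonneg _ _)]
  rcases le_total ‖x‖ (R + 1) with h | h
  · exact (mul_le_of_le_one_left (norm_nonneg _) (truncFactor_le_one _ _)).trans (hB x h)
  · rw [truncFactor_of_ge h, zero_mul]; exact hB0

/-- The truncation vanishes beyond radius `R + 1`, so one argument may be assumed inside that ball,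
where the cut-off factor and `N` are bounded and Lipschitz. A cut-off equation has solutions on
every interval. -/
theorem LipOnBalls.trunc_lipschitz {N : E → E} (hN : LipOnBalls N) (R : ℝ) :
    ∃ K : ℝ≥0, LipschitzWith K (trunc R N) := by
  obtain ⟨K, hK0, hK⟩ := hN (R + 1)
  obtain ⟨B, hB0, hB⟩ := hN.bound (R + 1)
  have key : ∀ x y, ‖y‖ ≤ R + 1 → ‖trunc R N x - trunc R N y‖ ≤ (K + B) * ‖x - y‖ := by
    intro x y hy
    have h1 : |truncFactor R ‖x‖ - truncFactor R ‖y‖| ≤ ‖x - y‖ :=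
      (abs_truncFactor_sub_le _ _ _).trans (abs_norm_sub_norm_le _ _)
    rcases le_total ‖x‖ (R + 1) with h | h
    · have e : trunc R N x - trunc R N y = truncFactor R ‖x‖ • (N x - N y) +
          (truncFactor R ‖x‖ - truncFactor R ‖y‖) • N y := by
        rw [trunc, trunc, smul_sub, sub_smul]; abel
      rw [e]
      refine (norm_add_le _ _).trans ?_
      rw [norm_smul, norm_smul, Real.norm_of_nonneg (truncFactor_nonneg _ _), Real.norm_eq_abs, add_mul]
      refine add_le_add ((mul_le_of_le_one_left (norm_nonneg _) (truncFactor_le_one _ _)).trans (hK x y h hy)) ?_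
      rw [mul_comm]
      exact mul_le_mul (hB y hy) h1 (abs_nonneg _) hB0
    · have e : trunc R N x - trunc R N y = (truncFactor R ‖x‖ - truncFactor R ‖y‖) • N y := by
        rw [trunc, trunc, truncFactor_of_ge h, zero_smul, sub_smul, zero_smul]
      rw [e, norm_smul, Real.norm_eq_abs, mul_comm]
      refine (mul_le_mul (hB y hy) h1 (abs_nonneg _) hB0).trans ?_
      gcongr; linarith
  refine ⟨Real.toNNReal (K + B), LipschitzWith.of_dist_le_mul fun x y => ?_⟩
  rw [dist_eq_norm, dist_eq_norm, Real.coe_toNNReal _ (by positivity)]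
  rcases le_total ‖y‖ (R + 1) with h | h
  · exact key x y h
  rcases le_total ‖x‖ (R + 1) with h' | h'
  · rw [norm_sub_rev, norm_sub_rev x]; exact key y x h'
  · rw [trunc, trunc, truncFactor_of_ge h, truncFactor_of_ge h', zero_smul, zero_smul, sub_zero, norm_zero]
    positivity

variable {S : ℝ → E →L[ℝ] E} {L : ℝ → E} {N : E → E} {M : ℝ → ℝ}

theorem norm_volterra_sub_le (hM : ∀ T, ∀ t ∈ Set.Icc 0 T, ‖S t‖ ≤ M T) {a b : ℝ → E} {c : ℝ → ℝ} (hc : Continuous c)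
    (hS : Continuous fun q : ℝ × E => S q.1 q.2) (ha : Continuous a) (hb : Continuous b)
    {T t : ℝ} (ht : t ∈ Set.Icc 0 T) (h : ∀ τ ∈ Set.Icc 0 t, ‖a τ - b τ‖ ≤ c τ) :
    ‖(∫ τ in (0 : ℝ)..t, S (t - τ) (a τ)) - ∫ τ in (0 : ℝ)..t, S (t - τ) (b τ)‖ ≤ M T * ∫ τ in (0 : ℝ)..t, c τ := by
  have hi : ∀ {a : ℝ → E}, Continuous a → Continuous fun τ => S (t - τ) (a τ) := fun {a} ha =>
    hS.comp (f := fun τ => (t - τ, a τ)) (by fun_prop)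
  rw [← intervalIntegral.integral_sub ((hi ha).intervalIntegrable _ _) ((hi hb).intervalIntegrable _ _),
    ← intervalIntegral.integral_const_mul]
  refine intervalIntegral.norm_integral_le_of_norm_le ht.1 (ae_of_all _ fun τ hτ => ?_)
    ((hc.const_mul _).intervalIntegrable _ _)
  rw [← map_sub]
  refine (ContinuousLinearMap.le_opNorm _ _).trans ?_
  have h1 := hM T (t - τ) ⟨by linarith [hτ.2], by linarith [hτ.1, ht.2]⟩
  exact mul_le_mul h1 (h τ ⟨hτ.1.le, hτ.2⟩) (norm_nonneg _) ((norm_nonneg _).trans h1)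

/-- On a compact interval both solutions stay in one ball, where `N` is Lipschitz, and Grönwall's
inequality applies to their distance. -/
theorem IsMild.unique (hS : Continuous fun q : ℝ × E => S q.1 q.2) (hM : ∀ T, ∀ t ∈ Set.Icc 0 T, ‖S t‖ ≤ M T)
    (hN : LipOnBalls N) {T : ℝ} {u v : ℝ → E} (hu : IsMild S L N T u) (hv : IsMild S L N T v) :
    ∀ t ∈ Set.Icc 0 T, u t = v t := by
  obtain ⟨R, hR⟩ := (isCompact_Icc (a := (0 : ℝ)) (b := T)).exists_bound_of_continuousOn hu.1.continuousOn
  obtain ⟨R', hR'⟩ := (isCompact_Icc (a := (0 : ℝ)) (b := T)).exists_bound_of_continuousOn hv.1.continuousOn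
  obtain ⟨K, hK0, hK⟩ := hN (max R R')
  have hc : Continuous fun t => ‖u t - v t‖ := (hu.1.sub hv.1).norm
  have h := eq_zero_of_le_mul_integral hc (fun _ => norm_nonneg _) (C := M T * K) (T := T) fun t ht => by
    rw [hu.2 t ht, hv.2 t ht, sub_sub_sub_cancel_left, norm_sub_rev, mul_assoc, ← intervalIntegral.integral_const_mul]
    refine norm_volterra_sub_le hM (hc.const_mul K) hS (hN.continuous.comp hu.1) (hN.continuous.comp hv.1) ht
      fun τ hτ => ?_
    have hτ' : τ ∈ Set.Icc 0 T := ⟨hτ.1, hτ.2.trans ht.2⟩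
    exact hK _ _ ((hR τ hτ').trans (le_max_left _ _)) ((hR' τ hτ').trans (le_max_right _ _))
  exact fun t ht => sub_eq_zero.1 (norm_eq_zero.1 (h t ht))

/-- After multiplication by `exp (-γ t)` the Picard map is a contraction on the whole interval, so
no continuation from short intervals is needed. -/
theorem exists_mild_of_lipschitz [CompleteSpace E] (hS : Continuous fun q : ℝ × E => S q.1 q.2)
    (hM : ∀ T, ∀ t ∈ Set.Icc 0 T, ‖S t‖ ≤ M T) (hL : Continuous L) {K : ℝ≥0} (hN : LipschitzWith K N) {T : ℝ} (hT : 0 ≤ T) :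
    ∃ u, IsMild S L N T u := by
  have hM0 : 0 ≤ M T := (norm_nonneg _).trans (hM T 0 ⟨le_rfl, hT⟩)
  -- The ratio `M K / γ` is at most `1 / 2`; the summand `1` keeps `γ` positive when `M K = 0`.
  set γ : ℝ := 2 * (M T * K) + 1 with hγ
  have hγ0 : 0 < γ := by positivity
  set X := C(Set.Icc (0 : ℝ) T, E)
  set e : X → ℝ → E := fun w τ => w (Set.projIcc 0 T hT τ) with he
  have hec : ∀ w, Continuous (e w) := fun w => w.continuous.comp continuous_projIcc
  set a : X → ℝ → E := fun w τ => N (Real.exp (γ * τ) • e w τ) with ha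
  have hac : ∀ w, Continuous (a w) := fun w =>
    hN.continuous.comp ((by fun_prop : Continuous fun τ => Real.exp (γ * τ)).smul (hec w))
  have hIc : ∀ w, Continuous fun t => ∫ τ in (0 : ℝ)..t, S (t - τ) (a w τ) := fun w => by
    refine intervalIntegral.continuous_parametric_intervalIntegral_of_continuous
      (f := fun (t : ℝ) τ => S (t - τ) (a w τ)) ?_ continuous_id
    have := hac w
    exact hS.comp (f := fun q : ℝ × ℝ => (q.1 - q.2, a w q.2)) (by fun_prop)
  set Ψ : X → X := fun w => ⟨fun t => Real.exp (-(γ * t)) • (L t - ∫ τ in (0 : ℝ)..t, S (t - τ) (a w τ)), by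
    have := hIc w
    fun_prop⟩ with hΨ
  have hcontr : ContractingWith (1 / 2 : ℝ≥0) Ψ := by
    refine ⟨by rw [← NNReal.coe_lt_coe]; norm_num, LipschitzWith.of_dist_le_mul fun w w' => ?_⟩
    rw [ContinuousMap.dist_le (by positivity)]
    intro t
    have ht := t.2
    rw [dist_eq_norm, hΨ]
    simp only [ContinuousMap.coe_mk]
    rw [← smul_sub, sub_sub_sub_cancel_left, norm_smul, Real.norm_of_nonneg (Real.exp_pos _).le, norm_sub_rev]
    have h1 := norm_volterra_sub_le hM (c := fun τ => K * (Real.exp (γ * τ) * dist w w')) (by fun_prop) hS (hac w) (hac w') ht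
      fun τ hτ => by
        have h2 := hN.dist_le_mul (Real.exp (γ * τ) • e w τ) (Real.exp (γ * τ) • e w' τ)
        rw [dist_eq_norm, dist_eq_norm, ← smul_sub, norm_smul, Real.norm_of_nonneg (Real.exp_pos _).le] at h2
        refine h2.trans ?_
        gcongr
        rw [← dist_eq_norm]
        exact ContinuousMap.dist_apply_le_dist _
    have h3 : ∫ τ in (0 : ℝ)..(t : ℝ), (K : ℝ) * (Real.exp (γ * τ) * dist w w') =
        K * ((Real.exp (γ * t) - 1) / γ * dist w w') := by
      rw [intervalIntegral.integral_const_mul, intervalIntegral.integral_mul_const,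
        intervalIntegral.integral_comp_mul_left _ hγ0.ne', integral_exp]
      simp only [mul_zero, Real.exp_zero, smul_eq_mul]
      ring
    rw [h3] at h1
    calc _ ≤ Real.exp (-(γ * t)) * (M T * (K * ((Real.exp (γ * t) - 1) / γ * dist w w'))) := by gcongr
      _ = (M T * K / γ) * (1 - Real.exp (-(γ * t))) * dist w w' := by
        rw [Real.exp_neg]
        have := (Real.exp_pos (γ * t)).ne'
        field_simp
      _ ≤ (1 / 2 : ℝ) * 1 * dist w w' := by
        have h4 : M T * K / γ ≤ 1 / 2 := by
          rw [div_le_iff₀ hγ0, hγ]; linarith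
        have h5 : 0 ≤ 1 - Real.exp (-(γ * t)) := by
          rw [sub_nonneg, Real.exp_le_one_iff]
          have := ht.1
          have : 0 ≤ γ * t := by positivity
          linarith
        have h6 : 1 - Real.exp (-(γ * t)) ≤ 1 := by linarith [Real.exp_pos (-(γ * t))]
        gcongr
      _ = _ := by rw [mul_one]; norm_num
  have hne : Nonempty X := ⟨0⟩
  set w := ContractingWith.fixedPoint Ψ hcontr
  have hw : Ψ w = w := hcontr.fixedPoint_isFixedPt
  -- Projection onto the interval extends the solution by constants, since `IsMild` asks for
  -- continuity on the whole line.
  refine ⟨fun t => Real.exp (γ * (Set.projIcc 0 T hT t : ℝ)) • e w t, ?_, fun t ht => ?_⟩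
  · have := hec w
    have h2 : Continuous fun t => ((Set.projIcc 0 T hT t : Set.Icc (0 : ℝ) T) : ℝ) :=
      continuous_subtype_val.comp continuous_projIcc
    fun_prop
  · have h1 : ((Set.projIcc 0 T hT t : Set.Icc (0 : ℝ) T) : ℝ) = t := by rw [Set.projIcc_of_mem hT ht]
    have h2 : e w t = w ⟨t, ht⟩ := by rw [he]; simp only [Set.projIcc_of_mem hT ht]
    have h3 : w ⟨t, ht⟩ = Real.exp (-(γ * t)) • (L t - ∫ τ in (0 : ℝ)..t, S (t - τ) (a w τ)) := by
      conv_lhs => rw [← hw]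
      rfl
    simp only [h1]
    rw [h2, h3, smul_smul, ← Real.exp_add, add_neg_cancel, Real.exp_zero, one_smul]
    congr 1
    refine intervalIntegral.integral_congr fun τ hτ => ?_
    rw [Set.uIcc_of_le ht.1] at hτ
    have h4 : ((Set.projIcc 0 T hT τ : Set.Icc (0 : ℝ) T) : ℝ) = τ := by
      rw [Set.projIcc_of_mem hT ⟨hτ.1, hτ.2.trans ht.2⟩]
    simp only [ha, h4]

theorem isMild_zero : IsMild S L N 0 fun _ => L 0 :=
  ⟨continuous_const, fun t ht => by
    have : t = 0 := le_antisymm ht.2 ht.1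
    rw [this, intervalIntegral.integral_same, sub_zero]⟩

/-- The equation truncated outside a larger ball has a solution up to `T + 1`. It coincides with `u`
up to `T`, where the truncation is inactive, and by continuity remains in the ball slightly longer.
-/
theorem IsMild.extend [CompleteSpace E] (hS : Continuous fun q : ℝ × E => S q.1 q.2)
    (hM : ∀ T, ∀ t ∈ Set.Icc 0 T, ‖S t‖ ≤ M T) (hL : Continuous L) (hN : LipOnBalls N) {T : ℝ} (hT : 0 ≤ T) {u : ℝ → E}
    (hu : IsMild S L N T u) : ∃ T', T < T' ∧ ∃ v, IsMild S L N T' v := by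
  obtain ⟨R, hR⟩ := (isCompact_Icc (a := (0 : ℝ)) (b := T)).exists_bound_of_continuousOn hu.1.continuousOn
  obtain ⟨K, hK⟩ := hN.trunc_lipschitz (R + 1)
  obtain ⟨v, hv⟩ := exists_mild_of_lipschitz hS hM hL hK (T := T + 1) (by linarith)
  have hu' : IsMild S L (trunc (R + 1) N) T u :=
    hu.congr fun t ht => (trunc_of_le N (by linarith [hR t ht])).symm
  have huv := hu'.unique hS hM (lipOnBalls_of_lipschitz hK) (hv.mono (by linarith))
  have hvT : ‖v T‖ < R + 1 := by
    rw [← huv T ⟨hT, le_rfl⟩]; linarith [hR T ⟨hT, le_rfl⟩]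
  obtain ⟨δ, hδ0, hδ⟩ := Metric.eventually_nhds_iff.1 (hv.1.norm.continuousAt.eventually_lt continuousAt_const hvT)
  refine ⟨T + min (δ / 2) 1, by have : 0 < min (δ / 2) 1 := by positivity
                                linarith, v, (hv.mono (by gcongr; exact min_le_right _ _)).congr fun t ht => ?_⟩
  refine trunc_of_le N ?_
  rcases le_total t T with h | h
  · rw [← huv t ⟨ht.1, h⟩]; linarith [hR t ⟨ht.1, h⟩]
  · refine (hδ ?_).le
    rw [Real.dist_eq, abs_of_nonneg (by linarith)]
    have := min_le_left (δ / 2) 1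
    linarith [ht.2]

/-- Maximal solutions of Volterra equations with a nonlinearity that is Lipschitz on balls. -/
theorem exists_maximal_mild [CompleteSpace E] (hS : Continuous fun q : ℝ × E => S q.1 q.2)
    (hM : ∀ T, ∀ t ∈ Set.Icc 0 T, ‖S t‖ ≤ M T) (hL : Continuous L) (hN : LipOnBalls N) :
    ∃ (T : ℝ≥0∞) (u : ℝ → E), 0 < T ∧
      (∀ t, 0 ≤ t → (ENNReal.ofReal t < T ↔ ∃ v, IsMild S L N t v)) ∧
      (∀ t v, IsMild S L N t v → ∀ τ ∈ Set.Icc 0 t, u τ = v τ) ∧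
      (T < ∞ → ∀ R : ℝ, ∃ t, 0 ≤ t ∧ ENNReal.ofReal t < T ∧ R < ‖u t‖) := by
  classical
  -- A solution on a closed interval can always be continued, so the supremum is not attained; hence
  -- the strict inequality in `hiff`.
  set T : ℝ≥0∞ := sSup {b | ∃ t, 0 ≤ t ∧ b = ENNReal.ofReal t ∧ ∃ v, IsMild S L N t v} with hTdef
  set u : ℝ → E := fun t => if h : ∃ v, IsMild S L N t v then h.choose t else 0 with hu
  have hiff : ∀ t, 0 ≤ t → (ENNReal.ofReal t < T ↔ ∃ v, IsMild S L N t v) := fun t ht => by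
    constructor
    · intro h
      obtain ⟨b, ⟨t', ht', rfl, v, hv⟩, hb⟩ := lt_sSup_iff.1 h
      exact ⟨v, hv.mono ((ENNReal.ofReal_lt_ofReal_iff_of_nonneg ht).1 hb).le⟩
    · rintro ⟨v, hv⟩
      obtain ⟨t', htt', v', hv'⟩ := hv.extend hS hM hL hN ht
      refine lt_of_lt_of_le ((ENNReal.ofReal_lt_ofReal_iff_of_nonneg ht).2 htt')
        (le_sSup ⟨t', ht.trans htt'.le, rfl, v', hv'⟩)
  have huniq : ∀ t v, IsMild S L N t v → ∀ τ ∈ Set.Icc 0 t, u τ = v τ := fun t v hv τ hτ => by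
    have h : ∃ v, IsMild S L N τ v := ⟨v, hv.mono hτ.2⟩
    have h1 : u τ = h.choose τ := dif_pos h
    rw [h1]
    exact h.choose_spec.unique hS hM hN (hv.mono hτ.2) τ ⟨hτ.1, le_rfl⟩
  have hT0 : 0 < T := by
    have := (hiff 0 le_rfl).2 ⟨_, isMild_zero⟩
    rwa [ENNReal.ofReal_zero] at this
  refine ⟨T, u, hT0, hiff, huniq, fun hTtop R => ?_⟩
  -- If `u` stayed in the ball of radius `R`, it would agree before `T` with the solution of the
  -- truncated equation on `[0, T]`. By continuity that solution lies in the ball at `T` too, hence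
  -- solves the original equation on the closed interval.
  by_contra! hR
  set Tm := T.toReal with hTm
  have hTm0 : 0 < Tm := ENNReal.toReal_pos hT0.ne' hTtop.ne
  have hTT : ENNReal.ofReal Tm = T := ENNReal.ofReal_toReal hTtop.ne
  obtain ⟨K, hK⟩ := hN.trunc_lipschitz R
  obtain ⟨w, hw⟩ := exists_mild_of_lipschitz hS hM hL hK (T := Tm) hTm0.le
  have hwR : ∀ t ∈ Set.Ico 0 Tm, ‖w t‖ ≤ R := fun t ht => by
    have hlt : ENNReal.ofReal t < T := by
      rw [← hTT]; exact (ENNReal.ofReal_lt_ofReal_iff_of_nonneg ht.1).2 ht.2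
    obtain ⟨v, hv⟩ := (hiff t ht.1).1 hlt
    have hvR : ∀ τ ∈ Set.Icc 0 t, ‖v τ‖ ≤ R := fun τ hτ => by
      rw [← huniq t v hv τ hτ]
      exact hR τ hτ.1 ((ENNReal.ofReal_le_ofReal hτ.2).trans_lt hlt)
    have hv' : IsMild S L (trunc R N) t v := hv.congr fun τ hτ => (trunc_of_le N (hvR τ hτ)).symm
    rw [← hv'.unique hS hM (lipOnBalls_of_lipschitz hK) (hw.mono ht.2.le) t ⟨ht.1, le_rfl⟩]
    exact hvR t ⟨ht.1, le_rfl⟩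
  have hwT : ‖w Tm‖ ≤ R := by
    have h1 : Tendsto (fun t => ‖w t‖) (𝓝[<] Tm) (𝓝 ‖w Tm‖) := (hw.1.norm.tendsto Tm).mono_left nhdsWithin_le_nhds
    refine le_of_tendsto h1 ?_
    filter_upwards [Ico_mem_nhdsLT hTm0] with t ht
    exact hwR t ht
  have hmild : IsMild S L N Tm w := hw.congr fun t ht => trunc_of_le N (by
    rcases ht.2.lt_or_eq with h | h
    · exact hwR t ⟨ht.1, h⟩
    · rw [h]; exact hwT)
  have := (hiff Tm hTm0.le).2 ⟨w, hmild⟩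
  rw [hTT] at this
  exact lt_irrefl _ this

/-- A lower bound for the time of existence. -/
theorem exists_mild_of_bound [CompleteSpace E] (hS : Continuous fun q : ℝ × E => S q.1 q.2)
    (hM : ∀ T, ∀ t ∈ Set.Icc 0 T, ‖S t‖ ≤ M T) (hL : Continuous L) (hN : LipOnBalls N) {R B T : ℝ}
    (hLR : ∀ t ∈ Set.Icc 0 1, ‖L t‖ + 1 ≤ R) (hB0 : 0 ≤ B) (hB : ∀ x, ‖x‖ ≤ R + 1 → ‖N x‖ ≤ B) (hT0 : 0 ≤ T) (hT1 : T ≤ 1)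
    (hT : M 1 * (B * T) ≤ 1) : ∃ v, IsMild S L N T v := by
  obtain ⟨K, hK⟩ := hN.trunc_lipschitz R
  obtain ⟨w, hw⟩ := exists_mild_of_lipschitz hS hM hL hK (T := T) hT0
  -- The truncated nonlinearity is bounded by `B` everywhere, so Duhamel's formula confines `w` to
  -- the ball of radius `R` directly, without a continuity argument.
  refine ⟨w, hw.congr fun t ht => trunc_of_le N ?_⟩
  rw [hw.2 t ht]
  have h1 := norm_volterra_sub_le hM (c := fun _ => B) continuous_const hS (hK.continuous.comp hw.1)
    (continuous_const (y := (0 : E))) (T := 1) (t := t) ⟨ht.1, ht.2.trans hT1⟩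
    (fun τ _ => by rw [sub_zero]; exact norm_trunc_le hB0 hB _)
  simp only [map_zero, intervalIntegral.integral_zero, sub_zero, intervalIntegral.integral_const, smul_eq_mul] at h1
  have hM0 : 0 ≤ M 1 := (norm_nonneg _).trans (hM 1 0 ⟨le_rfl, zero_le_one⟩)
  have h2 : M 1 * (t * B) ≤ 1 := by
    refine le_trans ?_ hT
    rw [mul_comm t]
    gcongr
    exact ht.2
  have h3 := hLR t ⟨ht.1, ht.2.trans hT1⟩
  exact (norm_sub_le _ _).trans ((add_le_add le_rfl (h1.trans h2)).trans h3)

end Volterra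

/-! ### The sine propagator on the algebra -/

/-- Strong continuity and a continuous bound for the operator norms give joint continuity. -/
theorem continuous_uncurry_of_bound {E : Type*} [NormedAddCommGroup E] [NormedSpace ℝ E] {S : ℝ → E →L[ℝ] E}
    {m : ℝ → ℝ} (hS : ∀ x, Continuous fun t => S t x) (hm : Continuous m) (h : ∀ t, ‖S t‖ ≤ m t) :
    Continuous fun q : ℝ × E => S q.1 q.2 := by
  refine continuous_iff_continuousAt.2 fun q => ?_
  rw [ContinuousAt, tendsto_iff_norm_sub_tendsto_zero]
  have h1 : Tendsto (fun z : ℝ × E => m z.1 * ‖z.2 - q.2‖ + ‖S z.1 q.2 - S q.1 q.2‖) (𝓝 q) (𝓝 0) := by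
    have hc := hS q.2
    have : Continuous fun z : ℝ × E => m z.1 * ‖z.2 - q.2‖ + ‖S z.1 q.2 - S q.1 q.2‖ := by
      have : Continuous fun z : ℝ × E => S z.1 q.2 := hc.comp continuous_fst
      fun_prop
    simpa using this.tendsto q
  refine squeeze_zero (fun _ => norm_nonneg _) (fun z => ?_) h1
  have e : S z.1 z.2 - S q.1 q.2 = S z.1 (z.2 - q.2) + (S z.1 q.2 - S q.1 q.2) := by
    rw [map_sub]; abel
  rw [e]
  refine (norm_add_le _ _).trans (add_le_add_left ((ContinuousLinearMap.le_opNorm _ _).trans ?_) _)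
  exact mul_le_mul_of_nonneg_right (h _) (norm_nonneg _)

variable {P : Par d}

namespace Alg

theorem norm_integral_cosA_le (t : ℝ) (g : Alg P) :
    ‖∫ τ in (0 : ℝ)..t, cosA τ g‖ ≤ (propConst d 0 * Real.exp (2 * Real.pi * |t|) * |t|) * ‖g‖ := by
  have h : ∀ τ ∈ Set.uIoc 0 t, ‖cosA τ g‖ ≤ propConst d 0 * Real.exp (2 * Real.pi * |t|) * ‖g‖ := fun τ hτ => by
    refine (ContinuousLinearMap.le_opNorm _ _).trans ?_
    refine mul_le_mul_of_nonneg_right ((norm_cosA_le τ).trans ?_) (norm_nonneg _)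
    have h1 := propConst_nonneg d 0
    have h2 := Real.pi_pos
    have h3 : |τ| ≤ |t| := by
      have := Set.abs_sub_left_of_mem_uIcc (Set.uIoc_subset_uIcc hτ)
      simpa using this
    gcongr
  have := intervalIntegral.norm_integral_le_of_norm_le_const h
  rw [sub_zero] at this
  exact this.trans_eq (by ring)

/-- The sine propagator on the algebra. -/
noncomputable def sinA (t : ℝ) : Alg P →L[ℂ] Alg P :=
  LinearMap.mkContinuous
    { toFun := fun g => ∫ τ in (0 : ℝ)..t, cosA τ g
      map_add' := fun f g => by
        simp only [map_add]
        exact intervalIntegral.integral_add ((continuous_cosA f).intervalIntegrable _ _)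
          ((continuous_cosA g).intervalIntegrable _ _)
      map_smul' := fun c f => by
        simp only [map_smul]
        exact intervalIntegral.integral_smul c _ }
    (propConst d 0 * Real.exp (2 * Real.pi * |t|) * |t|) fun g => norm_integral_cosA_le t g

theorem sinA_apply (t : ℝ) (g : Alg P) : sinA t g = ∫ τ in (0 : ℝ)..t, cosA τ g := rfl

theorem norm_sinA_le (t : ℝ) : ‖sinA (P := P) t‖ ≤ propConst d 0 * Real.exp (2 * Real.pi * |t|) * |t| :=
  LinearMap.mkContinuous_norm_le _ (by have := propConst_nonneg d 0; positivity) _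

theorem continuous_sinA (g : Alg P) : Continuous fun t => sinA t g :=
  continuous_iff_continuousAt.2 fun t => (hasDerivAt_primitive (continuous_cosA g) t).continuousAt

theorem cv_sinA (h : 𝓢(Sp d, ℂ)) (t : ℝ) (g : Alg P) : cv h ((sinA t g).val P) = sinOp h t (g.val P) := by
  have h1 : cv h ((sinA t g).val P) = ((cv h).comp incl) (∫ τ in (0 : ℝ)..t, cosA τ g) := rfl
  rw [h1, ← ContinuousLinearMap.intervalIntegral_comp_comm _ ((continuous_cosA g).intervalIntegrable _ _),
    sinOp_apply]
  refine intervalIntegral.integral_congr fun τ _ => ?_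
  exact cv_cosA h τ g

/-- The sine propagator as a family of real-linear maps. -/
noncomputable def sinR (t : ℝ) : Alg P →L[ℝ] Alg P := (sinA t).restrictScalars ℝ

theorem norm_sinR_le (T t : ℝ) (ht : t ∈ Set.Icc 0 T) :
    ‖sinR (P := P) t‖ ≤ propConst d 0 * Real.exp (2 * Real.pi * T) * T := by
  rw [sinR, ContinuousLinearMap.norm_restrictScalars]
  refine (norm_sinA_le t).trans ?_
  rw [abs_of_nonneg ht.1]
  have h1 := propConst_nonneg d 0
  have h2 := Real.pi_pos
  have h3 := ht.2
  have h4 := ht.1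
  gcongr

theorem continuous_sinR : Continuous fun q : ℝ × Alg P => sinR q.1 q.2 :=
  continuous_uncurry_of_bound (m := fun t => propConst d 0 * Real.exp (2 * Real.pi * |t|) * |t|) continuous_sinA
    (by fun_prop) fun t => by
      rw [sinR, ContinuousLinearMap.norm_restrictScalars]; exact norm_sinA_le t

/-- The free evolution. -/
noncomputable def free (U₀ U₁ : Alg P) (t : ℝ) : Alg P := cosA t U₀ + sinA t U₁

theorem continuous_free (U₀ U₁ : Alg P) : Continuous (free U₀ U₁) := (continuous_cosA U₀).add (continuous_sinA U₁)

/-- The growth constant of the free evolution on `[0, 1]`. -/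
noncomputable def freeConst (d : ℕ) : ℝ := propConst d 0 * Real.exp (2 * Real.pi)

theorem freeConst_nonneg (d : ℕ) : 0 ≤ freeConst d := by have := propConst_nonneg d 0; unfold freeConst; positivity

theorem norm_free_le (U₀ U₁ : Alg P) (t : ℝ) (ht : t ∈ Set.Icc 0 1) :
    ‖free U₀ U₁ t‖ ≤ freeConst d * (‖U₀‖ + ‖U₁‖) := by
  have h0 := propConst_nonneg d 0
  have h2 := Real.pi_pos
  have h3 := ht.2
  have h4 := ht.1
  have h5 : propConst d 0 * Real.exp (2 * Real.pi * |t|) ≤ freeConst d := by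
    rw [freeConst, abs_of_nonneg ht.1]
    exact mul_le_mul_of_nonneg_left (Real.exp_le_exp.2 (mul_le_of_le_one_right (by positivity) h3)) h0
  rw [mul_add]
  refine (norm_add_le _ _).trans (add_le_add ?_ ?_)
  · refine (ContinuousLinearMap.le_opNorm _ _).trans (mul_le_mul_of_nonneg_right ?_ (norm_nonneg _))
    exact (norm_cosA_le t).trans h5
  · refine (ContinuousLinearMap.le_opNorm _ _).trans (mul_le_mul_of_nonneg_right ?_ (norm_nonneg _))
    refine (norm_sinA_le t).trans ?_
    rw [← mul_one (freeConst d)]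
    refine mul_le_mul h5 ?_ (abs_nonneg _) (freeConst_nonneg d)
    rwa [abs_of_nonneg ht.1]

end Alg

/-! ### Analytic nonlinearities -/

/-- `F(z) = ∑ aₙ |z|^{2n} z` with coefficients of infinite radius of convergence. -/
structure IsSeries (a : ℕ → ℝ) (F : ℂ → ℂ) : Prop where
  summable : ∀ R : ℝ, Summable fun n => |a n| * R ^ n
  hasSum : ∀ z, HasSum (fun n => (a n : ℂ) * (z * (starRingEnd ℂ z)) ^ n) (∑' n, (a n : ℂ) * (z * (starRingEnd ℂ z)) ^ n)
  eq : ∀ z, F z = z * ∑' n, (a n : ℂ) * (z * (starRingEnd ℂ z)) ^ n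

theorem IsSeries.of_hasSum {a : ℕ → ℝ} {F : ℂ → ℂ} {Φ : ℝ → ℝ} (h : ∀ R : ℝ, HasSum (fun n => a n * R ^ n) (Φ R))
    (hs : ∀ R : ℝ, Summable fun n => |a n| * R ^ n)
    (hF : ∀ z, F z = (Φ (‖z‖ ^ 2) : ℂ) * z) : IsSeries a F := by
  have h1 : ∀ z : ℂ, HasSum (fun n => (a n : ℂ) * (z * (starRingEnd ℂ z)) ^ n) ((Φ (‖z‖ ^ 2) : ℝ) : ℂ) := fun z => by
    have h2 := Complex.hasSum_ofReal.2 (h (‖z‖ ^ 2))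
    refine h2.congr_fun ?_
    intro n
    rw [Complex.mul_conj, Complex.normSq_eq_norm_sq]
    push_cast
    rfl
  exact ⟨hs, fun z => (h1 z).summable.hasSum, fun z => by rw [(h1 z).tsum_eq, hF, mul_comm]⟩

theorem isSeries_powerNL (lam : ℝ) (k : ℕ) : IsSeries (fun n => if n = k then lam else 0) (powerNL lam k) := by
  refine IsSeries.of_hasSum (Φ := fun R => lam * R ^ k) (fun R => ?_) (fun R => ?_) fun z => ?_
  · convert hasSum_ite_eq k (lam * R ^ k) using 2 with n
    split_ifs with h
    · rw [h]
    · rw [zero_mul]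
  · refine summable_of_ne_finset_zero (s := {k}) fun n hn => ?_
    rw [if_neg (by simpa using hn), abs_zero, zero_mul]
  · rw [powerNL, pow_mul]
    push_cast
    rfl

theorem isSeries_expNL (lam rho : ℝ) :
    IsSeries (fun n => if n = 0 then 0 else lam * (rho ^ n / n.factorial)) (expNL lam rho) := by
  have key : ∀ l r R : ℝ, HasSum (fun n : ℕ => (if n = 0 then 0 else l * (r ^ n / n.factorial)) * R ^ n)
      (l * (Real.exp (r * R) - 1)) := fun l r R => by
    have h1 := NormedSpace.expSeries_div_hasSum_exp (r * R)
    rw [← Real.exp_eq_exp_ℝ] at h1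
    have h2 : HasSum (fun n : ℕ => if n = 0 then (1 : ℝ) else 0) 1 := hasSum_ite_eq 0 1
    refine ((h1.sub h2).mul_left l).congr_fun fun n => ?_
    split_ifs with h
    · simp [h]
    · rw [mul_pow]; ring
  refine IsSeries.of_hasSum (Φ := fun R => lam * (Real.exp (rho * R) - 1)) (key lam rho) (fun R => ?_) fun z => ?_
  · refine ((key |lam| |rho| |R|).summable).abs.of_norm_bounded fun n => ?_
    rw [Real.norm_eq_abs, abs_mul, abs_abs, abs_pow, abs_mul]
    split_ifs with h
    · simp
    · simp [abs_mul, abs_div, abs_pow]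
  · rw [expNL]
    push_cast
    rfl

namespace Alg

/-- The modulus squared. -/
noncomputable def sq (u : Alg P) : Alg P := u * conj u

/-- The nonlinearity on the algebra. -/
noncomputable def nl (a : ℕ → ℝ) (u : Alg P) : Alg P := ∑' n, (a n : ℂ) • (u * sq u ^ n)

/-- The constant in `‖u * conj u‖ ≤ C ‖u‖²`. -/
noncomputable def sqConst (P : Par d) : ℝ := ‖conj (P := P)‖

theorem sqConst_nonneg : 0 ≤ sqConst P := norm_nonneg _

theorem norm_sq_le {u : Alg P} {R : ℝ} (hu : ‖u‖ ≤ R) : ‖sq u‖ ≤ sqConst P * R ^ 2 := by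
  refine (norm_mul_le _ _).trans ?_
  have h1 := (conj (P := P)).le_opNorm u
  calc ‖u‖ * ‖conj u‖ ≤ R * (sqConst P * R) := by
        have := sqConst_nonneg (P := P)
        have : 0 ≤ R := (norm_nonneg _).trans hu
        refine mul_le_mul hu (h1.trans ?_) (norm_nonneg _) this
        exact mul_le_mul_of_nonneg_left hu sqConst_nonneg
    _ = _ := by ring

theorem norm_sq_sub_le {u v : Alg P} {R : ℝ} (hu : ‖u‖ ≤ R) (hv : ‖v‖ ≤ R) :
    ‖sq u - sq v‖ ≤ 2 * (sqConst P * R) * ‖u - v‖ := by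
  have e : sq u - sq v = (u - v) * conj u + v * conj (u - v) := by
    rw [sq, sq, map_sub]; ring
  have hR : 0 ≤ R := (norm_nonneg _).trans hu
  have h0 := sqConst_nonneg (P := P)
  have h1 := (conj (P := P)).le_opNorm u
  have h2 := (conj (P := P)).le_opNorm (u - v)
  rw [e]
  calc _ ≤ ‖u - v‖ * ‖conj u‖ + ‖v‖ * ‖conj (u - v)‖ :=
        (norm_add_le _ _).trans (add_le_add (norm_mul_le _ _) (norm_mul_le _ _))
    _ ≤ ‖u - v‖ * (sqConst P * R) + R * (sqConst P * ‖u - v‖) := by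
        gcongr
        · exact h1.trans (mul_le_mul_of_nonneg_left hu h0)
        · exact h2
    _ = _ := by ring

theorem norm_mul_pow_le {u : Alg P} {R : ℝ} (hu : ‖u‖ ≤ R) (n : ℕ) : ‖u * sq u ^ n‖ ≤ R * (sqConst P * R ^ 2) ^ n := by
  have hR : 0 ≤ R := (norm_nonneg _).trans hu
  have h0 := sqConst_nonneg (P := P)
  induction n with
  | zero => simpa using hu
  | succ n ih =>
    rw [pow_succ, ← mul_assoc, pow_succ, ← mul_assoc]
    exact (norm_mul_le _ _).trans (mul_le_mul ih (norm_sq_le hu) (norm_nonneg _) (by positivity))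

/-- Telescoping over the factors: each additional `sq` contributes two differences, one from `u` and
one from its conjugate. -/
theorem norm_mul_pow_sub_le {u v : Alg P} {R : ℝ} (hu : ‖u‖ ≤ R) (hv : ‖v‖ ≤ R) (n : ℕ) :
    ‖u * sq u ^ n - v * sq v ^ n‖ ≤ (1 + n * 2) * (sqConst P * R ^ 2) ^ n * ‖u - v‖ := by
  have hR : 0 ≤ R := (norm_nonneg _).trans hu
  have h0 := sqConst_nonneg (P := P)
  induction n with
  | zero => simp
  | succ n ih =>
    have e : u * sq u ^ (n + 1) - v * sq v ^ (n + 1) =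
        (u * sq u ^ n - v * sq v ^ n) * sq u + (v * sq v ^ n) * (sq u - sq v) := by ring
    rw [e]
    calc _ ≤ ‖u * sq u ^ n - v * sq v ^ n‖ * ‖sq u‖ + ‖v * sq v ^ n‖ * ‖sq u - sq v‖ :=
          (norm_add_le _ _).trans (add_le_add (norm_mul_le _ _) (norm_mul_le _ _))
      _ ≤ ((1 + n * 2) * (sqConst P * R ^ 2) ^ n * ‖u - v‖) * (sqConst P * R ^ 2) +
          (R * (sqConst P * R ^ 2) ^ n) * (2 * (sqConst P * R) * ‖u - v‖) := by
          gcongr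
          · exact norm_sq_le hu
          · exact norm_mul_pow_le hv n
          · exact norm_sq_sub_le hu hv
      _ = _ := by push_cast; ring

variable {a : ℕ → ℝ} {F : ℂ → ℂ}

/-- The Lipschitz constant of the nonlinearity on the ball of radius `R`. -/
noncomputable def nlConst (P : Par d) (a : ℕ → ℝ) (R : ℝ) : ℝ := ∑' n, |a n| * (3 * (sqConst P * R ^ 2)) ^ n

theorem nlConst_nonneg (R : ℝ) : 0 ≤ nlConst P a R :=
  tsum_nonneg fun n => by have := sqConst_nonneg (P := P); positivity

theorem nlConst_mono (ha : IsSeries a F) {R R' : ℝ} (h0 : 0 ≤ R) (h : R ≤ R') : nlConst P a R ≤ nlConst P a R' := by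
  have := sqConst_nonneg (P := P)
  exact (ha.summable _).tsum_le_tsum (fun n => by gcongr) (ha.summable _)

theorem summable_nl (ha : IsSeries a F) (u : Alg P) : Summable fun n => (a n : ℂ) • (u * sq u ^ n) := by
  refine Summable.of_norm_bounded ((ha.summable (sqConst P * ‖u‖ ^ 2)).mul_left ‖u‖) fun n => ?_
  rw [norm_smul, Complex.norm_real, Real.norm_eq_abs, mul_left_comm]
  exact mul_le_mul_of_nonneg_left (norm_mul_pow_le le_rfl n) (abs_nonneg _)

theorem norm_nl_sub_le (ha : IsSeries a F) {u v : Alg P} {R : ℝ} (hu : ‖u‖ ≤ R) (hv : ‖v‖ ≤ R) :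
    ‖nl a u - nl a v‖ ≤ nlConst P a R * ‖u - v‖ := by
  have h0 := sqConst_nonneg (P := P)
  rw [nl, nl, ← (summable_nl ha u).tsum_sub (summable_nl ha v), nlConst, ← tsum_mul_right]
  refine tsum_of_norm_bounded (((ha.summable _).mul_right _).hasSum) fun n => ?_
  rw [← smul_sub, norm_smul, Complex.norm_real, Real.norm_eq_abs, mul_assoc]
  refine mul_le_mul_of_nonneg_left ((norm_mul_pow_sub_le hu hv n).trans ?_) (abs_nonneg _)
  rw [mul_pow 3]
  -- Bernoulli's inequality `1 + 2 n ≤ 3 ^ n` explains the factor `3` in `nlConst`.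
  have := one_add_mul_le_pow (a := (2 : ℝ)) (by norm_num) n
  norm_num at this ⊢
  gcongr

theorem nl_zero : nl a (0 : Alg P) = 0 := by simp [nl]

theorem norm_nl_le (ha : IsSeries a F) {u : Alg P} {R : ℝ} (hu : ‖u‖ ≤ R) : ‖nl a u‖ ≤ nlConst P a R * R := by
  have h := norm_nl_sub_le ha hu (v := 0) (by simpa using (norm_nonneg _).trans hu)
  rw [nl_zero, sub_zero, sub_zero] at h
  exact h.trans (mul_le_mul_of_nonneg_left hu (nlConst_nonneg R))

theorem lipOnBalls_nl (ha : IsSeries a F) : LipOnBalls (nl (P := P) a) := fun R =>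
  ⟨nlConst P a R, nlConst_nonneg R, fun _ _ hu hv => norm_nl_sub_le ha hu hv⟩

theorem val_pow (u : Alg P) (n : ℕ) : (u ^ n).val P = u.val P ^ n := by
  induction n with
  | zero => simp
  | succ n ih => rw [pow_succ, pow_succ, val_mul, ih]

/-- Point evaluation is continuous, linear and multiplicative on the algebra, so the series can be
summed pointwise. -/
theorem nl_val (ha : IsSeries a F) (u : Alg P) (x : Sp d) : (nl a u).val P x = F (u.val P x) := by
  have h := (summable_nl ha u).hasSum.mapL ((evalBF x).comp incl)
  rw [ha.eq]
  refine h.unique ?_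
  refine ((ha.hasSum (u.val P x)).mul_left _).congr_fun fun n => ?_
  change ((a n : ℂ) • (u * sq u ^ n)).val P x = _
  rw [val_smul, val_mul, val_pow, sq, val_mul, val_conj]
  simp
  ring

end Alg

/-! ### Second order equations -/

theorem eq_of_second_deriv {E : Type*} [NormedAddCommGroup E] [NormedSpace ℝ E] {f f₁ f₂ g g₁ : ℝ → E}
    (hf : ∀ t, HasDerivAt f (f₁ t) t) (hf₁ : ∀ t, HasDerivAt f₁ (f₂ t) t) (hg : ∀ t, HasDerivAt g (g₁ t) t)
    (hg₁ : ∀ t, HasDerivAt g₁ (f₂ t) t) (h0 : f 0 = g 0) (h1 : f₁ 0 = g₁ 0) : f = g := by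
  have key : ∀ {a b c : ℝ → E}, (∀ t, HasDerivAt a (c t) t) → (∀ t, HasDerivAt b (c t) t) → a 0 = b 0 → a = b := by
    intro a b c ha hb hab
    funext t
    have h : ∀ t, HasDerivAt (fun t => a t - b t) 0 t := fun t => by
      have := (ha t).sub (hb t)
      rwa [sub_self] at this
    have := is_const_of_deriv_eq_zero (fun t => (h t).differentiableAt) (fun t => (h t).deriv) t 0
    rw [hab, sub_self] at this
    exact sub_eq_zero.1 this
  have e := key hf₁ hg₁ h1
  exact key hf (fun t => e ▸ hg t) h0

/-- Two integrations. Derivatives are taken within the interval, hence one-sided at its ends, as in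
the notion of solution. -/
theorem norm_le_of_second_deriv {E : Type*} [NormedAddCommGroup E] [NormedSpace ℝ E] [CompleteSpace E]
    {f f₁ f₂ : ℝ → E} {T : ℝ}
    (hf : ∀ t ∈ Set.Icc 0 T, HasDerivWithinAt f (f₁ t) (Set.Icc 0 T) t)
    (hf₁ : ∀ t ∈ Set.Icc 0 T, HasDerivWithinAt f₁ (f₂ t) (Set.Icc 0 T) t) (hc : Continuous f₂)
    (h0 : f 0 = 0) (h1 : f₁ 0 = 0) : ∀ t ∈ Set.Icc 0 T, ‖f t‖ ≤ T * ∫ τ in (0 : ℝ)..t, ‖f₂ τ‖ := by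
  intro t ht
  have hcf₁ : ContinuousOn f₁ (Set.Icc 0 T) := fun τ hτ => (hf₁ τ hτ).continuousWithinAt
  have hcf : ContinuousOn f (Set.Icc 0 T) := fun τ hτ => (hf τ hτ).continuousWithinAt
  have key : ∀ {a b : ℝ → E}, (∀ t ∈ Set.Icc 0 T, HasDerivWithinAt a (b t) (Set.Icc 0 T) t) →
      ContinuousOn b (Set.Icc 0 T) → a 0 = 0 → ∀ τ ∈ Set.Icc 0 T, a τ = ∫ σ in (0 : ℝ)..τ, b σ := by
    intro a b hab hb ha0 τ hτ
    have hsub : Set.Icc 0 τ ⊆ Set.Icc 0 T := Set.Icc_subset_Icc_right hτ.2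
    rw [intervalIntegral.integral_eq_sub_of_hasDeriv_right_of_le hτ.1
      (fun σ hσ => ((hab σ (hsub hσ)).continuousWithinAt).mono hsub) (fun σ hσ => ?_)
      ((hb.mono hsub).intervalIntegrable_of_Icc hτ.1), ha0, sub_zero]
    have hσ' : Set.Icc 0 T ∈ 𝓝 σ := Icc_mem_nhds hσ.1 (hσ.2.trans_le hτ.2)
    exact ((hab σ (hsub ⟨hσ.1.le, hσ.2.le⟩)).hasDerivAt hσ').hasDerivWithinAt
  have e1 := key hf₁ hc.continuousOn h1
  have e0 := key hf hcf₁ h0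
  have hint : ∀ a b, IntervalIntegrable (fun τ => ‖f₂ τ‖) volume a b := fun a b => hc.norm.intervalIntegrable a b
  have hb : ∀ τ ∈ Set.uIoc 0 t, ‖f₁ τ‖ ≤ ∫ σ in (0 : ℝ)..t, ‖f₂ σ‖ := fun τ hτ => by
    rw [Set.uIoc_of_le ht.1] at hτ
    rw [e1 τ ⟨hτ.1.le, hτ.2.trans ht.2⟩]
    refine (intervalIntegral.norm_integral_le_integral_norm hτ.1.le).trans ?_
    rw [← intervalIntegral.integral_add_adjacent_intervals (hint 0 τ) (hint τ t)]
    exact le_add_of_nonneg_right (intervalIntegral.integral_nonneg hτ.2 fun _ _ => norm_nonneg _)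
  rw [e0 t ht]
  refine (intervalIntegral.norm_integral_le_of_norm_le_const hb).trans ?_
  rw [sub_zero, abs_of_nonneg ht.1, mul_comm]
  exact mul_le_mul_of_nonneg_right ht.2 (intervalIntegral.integral_nonneg ht.1 fun _ _ => norm_nonneg _)

variable {P : Par d}

namespace Alg

/-- The solution of the linear equation with forcing `-G`, by Duhamel's formula. -/
noncomputable def duhamel (U₀ U₁ : Alg P) (G : ℝ → Alg P) (t : ℝ) : Alg P :=
  free U₀ U₁ t - ∫ τ in (0 : ℝ)..t, sinR (t - τ) (G τ)

theorem continuous_duhamel (U₀ U₁ : Alg P) {G : ℝ → Alg P} (hG : Continuous G) : Continuous (duhamel U₀ U₁ G) := by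
  refine (continuous_free U₀ U₁).sub (intervalIntegral.continuous_parametric_intervalIntegral_of_continuous
    (f := fun (t : ℝ) τ => sinR (t - τ) (G τ)) ?_ continuous_id)
  exact continuous_sinR.comp (f := fun z : ℝ × ℝ => (z.1 - z.2, G z.2)) (by fun_prop)

theorem cv_duhamel (U₀ U₁ : Alg P) {G : ℝ → Alg P} (hG : Continuous G) (h : 𝓢(Sp d, ℂ)) (t : ℝ) :
    cv h ((duhamel U₀ U₁ G t).val P) = cv (cosS t h) (U₀.val P) + sinOp h t (U₁.val P) -
      ∫ τ in (0 : ℝ)..t, sinOp h (t - τ) ((G τ).val P) := by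
  have hi : IntervalIntegrable (fun τ => sinR (t - τ) (G τ)) volume 0 t :=
    (continuous_sinR.comp (f := fun τ => (t - τ, G τ)) (by fun_prop)).intervalIntegrable _ _
  have h1 : cv h ((∫ τ in (0 : ℝ)..t, sinR (t - τ) (G τ)).val P) =
      ((cv h).comp incl) (∫ τ in (0 : ℝ)..t, sinR (t - τ) (G τ)) := rfl
  rw [duhamel, val_sub, map_sub, h1, ← ContinuousLinearMap.intervalIntegral_comp_comm _ hi, free, val_add, map_add,
    cv_cosA, cv_sinA]
  congr 1
  exact intervalIntegral.integral_congr fun τ _ => cv_sinA h (t - τ) (G τ)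

/-- The first time derivative of `cv h` of the Duhamel solution. -/
noncomputable def duhamelDeriv (U₀ U₁ : Alg P) (G : ℝ → Alg P) (h : 𝓢(Sp d, ℂ)) (t : ℝ) : BF d :=
  sinOp (Δ h) t (U₀.val P) + cv (cosS t h) (U₁.val P) - ∫ τ in (0 : ℝ)..t, cv (cosS (t - τ) h) ((G τ).val P)

theorem continuous_val {G : ℝ → Alg P} (hG : Continuous G) : Continuous fun τ => (G τ).val P :=
  incl.continuous.comp hG

theorem hasDerivAt_clm_const {K : ℝ → BF d →L[ℂ] BF d} {K' : BF d →L[ℂ] BF d} {t : ℝ} (hK : HasDerivAt K K' t) (g : BF d) :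
    HasDerivAt (fun t => K t g) (K' g) t := by
  exact ((ContinuousLinearMap.apply ℂ (BF d) g).restrictScalars ℝ).hasFDerivAt.comp_hasDerivAt t hK

theorem hasDerivAt_cv_duhamel (U₀ U₁ : Alg P) {G : ℝ → Alg P} (hG : Continuous G) (h : 𝓢(Sp d, ℂ)) (t : ℝ) :
    HasDerivAt (fun t => cv h ((duhamel U₀ U₁ G t).val P)) (duhamelDeriv U₀ U₁ G h t) t := by
  simp only [cv_duhamel U₀ U₁ hG h]
  have h3 := hasDerivAt_volterra (hasDerivAt_sinOp h) (continuous_cv_cosS h) (continuous_val hG) t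
  rw [sinOp_zero, zero_apply, zero_add] at h3
  exact ((hasDerivAt_clm_const (hasDerivAt_cv_cosS h t) _).add (hasDerivAt_clm_const (hasDerivAt_sinOp h t) _)).sub h3

theorem hasDerivAt_duhamelDeriv (U₀ U₁ : Alg P) {G : ℝ → Alg P} (hG : Continuous G) (h : 𝓢(Sp d, ℂ)) (t : ℝ) :
    HasDerivAt (duhamelDeriv U₀ U₁ G h) (cv (Δ h) ((duhamel U₀ U₁ G t).val P) - cv h ((G t).val P)) t := by
  have h3 := hasDerivAt_volterra (hasDerivAt_cv_cosS h) (continuous_sinOp (Δ h)) (continuous_val hG) t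
  rw [cosS_zero] at h3
  have h4 := ((hasDerivAt_clm_const (hasDerivAt_sinOp (Δ h) t) (U₀.val P)).add
    (hasDerivAt_clm_const (hasDerivAt_cv_cosS h t) (U₁.val P))).sub h3
  refine h4.congr_deriv ?_
  rw [cv_duhamel U₀ U₁ hG]
  abel

theorem duhamel_zero (U₀ U₁ : Alg P) (G : ℝ → Alg P) : duhamel U₀ U₁ G 0 = U₀ := by
  rw [duhamel, intervalIntegral.integral_same, sub_zero, free, sinA_apply, intervalIntegral.integral_same, add_zero]
  exact eq_of_cv fun k => by rw [cv_cosA, cosS_zero]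

theorem duhamelDeriv_zero (U₀ U₁ : Alg P) (G : ℝ → Alg P) (h : 𝓢(Sp d, ℂ)) :
    duhamelDeriv U₀ U₁ G h 0 = cv h (U₁.val P) := by
  rw [duhamelDeriv, intervalIntegral.integral_same, sub_zero, sinOp_zero, cosS_zero, zero_apply, zero_add]

/-- Both sides have the same second time derivative and the same initial values. On the right the
Laplacian stands outside the time integrals, a form that makes sense for distributions. -/
theorem cv_duhamel_eq (U₀ U₁ : Alg P) {G : ℝ → Alg P} (hG : Continuous G) (h : 𝓢(Sp d, ℂ)) (t : ℝ) :
    cv h ((duhamel U₀ U₁ G t).val P) = cv h (U₀.val P) + (t : ℂ) • cv h (U₁.val P)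
      + cv (Δ h) (∫ τ in (0 : ℝ)..t, ((t - τ : ℝ) : ℂ) • (duhamel U₀ U₁ G τ).val P)
      - cv h (∫ τ in (0 : ℝ)..t, ((t - τ : ℝ) : ℂ) • (G τ).val P) := by
  have hu := continuous_val (continuous_duhamel U₀ U₁ hG)
  have hg := continuous_val hG
  have clm : ∀ (L : BF d →L[ℂ] BF d) {f : ℝ → BF d} {f' : BF d} {t : ℝ}, HasDerivAt f f' t →
      HasDerivAt (fun t => L (f t)) (L f') t := fun L {f f' t} hf =>
    (L.restrictScalars ℝ).hasFDerivAt.comp_hasDerivAt t hf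
  have e := eq_of_second_deriv (hasDerivAt_cv_duhamel U₀ U₁ hG h) (hasDerivAt_duhamelDeriv U₀ U₁ hG h)
    (g := fun t => cv h (U₀.val P) + (t : ℂ) • cv h (U₁.val P)
      + cv (Δ h) (∫ τ in (0 : ℝ)..t, ((t - τ : ℝ) : ℂ) • (duhamel U₀ U₁ G τ).val P)
      - cv h (∫ τ in (0 : ℝ)..t, ((t - τ : ℝ) : ℂ) • (G τ).val P))
    (g₁ := fun t => cv h (U₁.val P) + cv (Δ h) (∫ τ in (0 : ℝ)..t, (duhamel U₀ U₁ G τ).val P)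
      - cv h (∫ τ in (0 : ℝ)..t, (G τ).val P)) (fun t => ?_) (fun t => ?_) ?_ ?_
  · exact congrFun e t
  · refine HasDerivAt.sub (HasDerivAt.add ?_ (clm _ (hasDerivAt_integral_sub_smul hu t)))
      (clm _ (hasDerivAt_integral_sub_smul hg t))
    have h1 : HasDerivAt (fun t : ℝ => (t : ℂ)) 1 t := Complex.ofRealCLM.hasDerivAt
    simpa using (h1.smul_const (cv h (U₁.val P))).const_add (cv h (U₀.val P))
  · exact ((clm _ (hasDerivAt_primitive hu t)).const_add _).sub (clm _ (hasDerivAt_primitive hg t))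
  · simp [duhamel_zero]
  · simp [duhamelDeriv_zero]

theorem distL_sub (f g : BF d) : distL (f - g) = distL f - distL g := by
  ext φ
  exact map_sub (distEval φ) f g

end Alg

/-! ### The Laplacian and convolution of distributions -/

theorem fourier_tr (z : Sp d) (a : 𝓢(Sp d, ℂ)) (η : Sp d) :
    (𝓕 (tr z a) : 𝓢(Sp d, ℂ)) η = Real.fourierChar (-⟪z, η⟫_ℝ) • (𝓕 a : 𝓢(Sp d, ℂ)) η := by
  rw [SchwartzMap.fourier_coe, SchwartzMap.fourier_coe, Real.fourier_eq, Real.fourier_eq]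
  have h1 := integral_sub_right_eq_self (μ := (volume : Measure (Sp d)))
    (fun v : Sp d => Real.fourierChar (-⟪v + z, η⟫_ℝ) • a v) z
  simp only [sub_add_cancel] at h1
  refine Eq.trans h1 ?_
  simp only [inner_add_left, neg_add, AddChar.map_add_eq_mul, mul_comm _ (Real.fourierChar (-⟪z, η⟫_ℝ)), mul_smul]
  simp only [Circle.smul_def (Real.fourierChar (-⟪z, η⟫_ℝ)), smul_eq_mul]
  rw [integral_const_mul]

theorem laplacian_reflectAt (x : Sp d) (h : 𝓢(Sp d, ℂ)) : Δ (reflectAt x h) = reflectAt x (Δ h) :=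
  fourier_injective fun ξ => by
    rw [fourier_laplacian, reflectAt_eq, reflectAt_eq, fourier_tr, fourier_tr, fourier_refl, fourier_refl,
      fourier_laplacian, norm_neg, Circle.smul_def, Circle.smul_def, smul_eq_mul, smul_eq_mul]
    ring

theorem conv_laplacian (f : 𝓢'(Sp d, ℂ)) (h : 𝓢(Sp d, ℂ)) : conv (Δ f) h = conv f (Δ h) := by
  funext x
  rw [conv, conv, TemperedDistribution.laplacian_apply_apply, laplacian_reflectAt]

theorem conv_sub (f g : 𝓢'(Sp d, ℂ)) (h : 𝓢(Sp d, ℂ)) : conv (f - g) h = conv f h - conv g h := rfl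

theorem conv_add (f g : 𝓢'(Sp d, ℂ)) (h : 𝓢(Sp d, ℂ)) : conv (f + g) h = conv f h + conv g h := rfl

theorem conv_smul (c : ℂ) (f : 𝓢'(Sp d, ℂ)) (h : 𝓢(Sp d, ℂ)) : conv (c • f) h = c • conv f h := rfl

namespace Alg

/-- The equation integrated twice in time. Distributions with equal blocks coincide, and on blocks
the identity is `cv_duhamel_eq`. -/
theorem distL_duhamel (U₀ U₁ : Alg P) {G : ℝ → Alg P} (hG : Continuous G) (t : ℝ) :
    distL ((duhamel U₀ U₁ G t).val P) = distL (U₀.val P) + (t : ℂ) • distL (U₁.val P)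
      + Δ (distL (∫ τ in (0 : ℝ)..t, ((t - τ : ℝ) : ℂ) • (duhamel U₀ U₁ G τ).val P))
      - distL (∫ τ in (0 : ℝ)..t, ((t - τ : ℝ) : ℂ) • (G τ).val P) := by
  refine sub_eq_zero.1 (P.adm.eq_zero_of_conv _ fun k x => ?_)
  rw [conv_sub, conv_sub, conv_add, conv_add, conv_smul, conv_laplacian]
  simp only [Pi.sub_apply, Pi.add_apply, Pi.smul_apply, conv_distL, cv_duhamel_eq U₀ U₁ hG]
  simp

/-- The velocity of the Duhamel solution, a tempered distribution. -/
noncomputable def velocity (U₁ : Alg P) (u G : ℝ → Alg P) (t : ℝ) : 𝓢'(Sp d, ℂ) :=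
  distL (U₁.val P) + Δ (distL (∫ τ in (0 : ℝ)..t, (u τ).val P)) - distL (∫ τ in (0 : ℝ)..t, (G τ).val P)

theorem velocity_apply (U₁ : Alg P) (u G : ℝ → Alg P) (t : ℝ) (φ : 𝓢(Sp d, ℂ)) :
    velocity U₁ u G t φ = distEval φ (U₁.val P) + distEval (Δ φ) (∫ τ in (0 : ℝ)..t, (u τ).val P)
      - distEval φ (∫ τ in (0 : ℝ)..t, (G τ).val P) := by
  rw [velocity, distEval_apply, distEval_apply, distEval_apply, ← TemperedDistribution.laplacian_apply_apply]
  rfl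

theorem hasDerivAt_distEval {f : ℝ → BF d} {f' : BF d} {t : ℝ} (φ : 𝓢(Sp d, ℂ)) (hf : HasDerivAt f f' t) :
    HasDerivAt (fun t => distEval φ (f t)) (distEval φ f') t :=
  ((distEval φ).restrictScalars ℝ).hasFDerivAt.comp_hasDerivAt t hf

theorem hasDerivAt_distL_duhamel (U₀ U₁ : Alg P) {G : ℝ → Alg P} (hG : Continuous G) (φ : 𝓢(Sp d, ℂ)) (t : ℝ) :
    HasDerivAt (fun t => distL ((duhamel U₀ U₁ G t).val P) φ) (velocity U₁ (duhamel U₀ U₁ G) G t φ) t := by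
  have hu := continuous_val (continuous_duhamel U₀ U₁ hG)
  have hg := continuous_val hG
  have e : (fun t => distL ((duhamel U₀ U₁ G t).val P) φ) = fun t : ℝ => distEval φ (U₀.val P) + (t : ℂ) • distEval φ (U₁.val P)
      + distEval (Δ φ) (∫ τ in (0 : ℝ)..t, ((t - τ : ℝ) : ℂ) • (duhamel U₀ U₁ G τ).val P)
      - distEval φ (∫ τ in (0 : ℝ)..t, ((t - τ : ℝ) : ℂ) • (G τ).val P) := by
    funext t
    rw [distL_duhamel U₀ U₁ hG t, distEval_apply, distEval_apply, distEval_apply, distEval_apply,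
      ← TemperedDistribution.laplacian_apply_apply]
    rfl
  rw [e, velocity_apply]
  refine HasDerivAt.sub (HasDerivAt.add ?_ (hasDerivAt_distEval _ (hasDerivAt_integral_sub_smul hu t)))
      (hasDerivAt_distEval _ (hasDerivAt_integral_sub_smul hg t))
  have h1 : HasDerivAt (fun t : ℝ => (t : ℂ)) 1 t := Complex.ofRealCLM.hasDerivAt
  simpa using (h1.smul_const (distEval φ (U₁.val P))).const_add (distEval φ (U₀.val P))

theorem hasDerivAt_velocity (U₁ : Alg P) {u G : ℝ → Alg P} (hu : Continuous u) (hG : Continuous G) (φ : 𝓢(Sp d, ℂ)) (t : ℝ) :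
    HasDerivAt (fun t => velocity U₁ u G t φ) (Δ (distL ((u t).val P)) φ - distL ((G t).val P) φ) t := by
  simp only [velocity_apply]
  rw [TemperedDistribution.laplacian_apply_apply, ← distEval_apply, ← distEval_apply]
  exact ((hasDerivAt_distEval _ (hasDerivAt_primitive (continuous_val hu) t)).const_add _).sub
    (hasDerivAt_distEval _ (hasDerivAt_primitive (continuous_val hG) t))

/-- The Laplacian is bounded on a single block. The constant may depend on `k`, which is harmless
because uniqueness is decided block by block. -/
theorem exists_norm_cv_laplacian_le (P : Par d) (k : Fin d → ℤ) :
    ∃ C, 0 ≤ C ∧ ∀ g, ‖cv (Δ (wav P.β P.χ k)) g‖ ≤ C * ‖cv (wav P.β P.χ k) g‖ := by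
  refine ⟨∫ x, ‖Δ (wav P.β (fat d) k) x‖, by positivity, fun g => ?_⟩
  have e : cv (Δ (wav P.β P.χ k)) g = cv (Δ (wav P.β (fat d) k)) (cv (wav P.β P.χ k) g) := by
    rw [cv_cv, sconv_laplacian, P.adm.sconv_fat]
  rw [e]
  exact norm_cv_apply_le _ _

/-- A continuous curve in the algebra which solves the linear equation tested with the translates of the windows
is given by Duhamel's formula. -/
theorem eq_duhamel {V G : ℝ → Alg P} (hV : Continuous V) (hG : Continuous G) {T : ℝ} {U₁ : Alg P}
    (h : ∀ k x, ∃ q : ℝ → ℂ, q 0 = cv (wav P.β P.χ k) (U₁.val P) x ∧ ∀ t ∈ Set.Icc 0 T,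
      HasDerivWithinAt (fun τ => cv (wav P.β P.χ k) ((V τ).val P) x) (q t) (Set.Icc 0 T) t ∧
      HasDerivWithinAt q (cv (Δ (wav P.β P.χ k)) ((V t).val P) x - cv (wav P.β P.χ k) ((G t).val P) x)
        (Set.Icc 0 T) t) : ∀ t ∈ Set.Icc 0 T, V t = duhamel (V 0) U₁ G t := by
  rcases lt_or_ge T 0 with hT | hT
  · intro t ht; exact absurd (ht.1.trans ht.2) (not_le.2 hT)
  set D := duhamel (V 0) U₁ G with hD
  have hDc : Continuous D := continuous_duhamel _ _ hG
  -- The block of the difference has zero data, and its second derivative at each point is the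
  -- Laplacian of that block, controlled by its sup norm. Integrating at fixed `x` and taking the
  -- supremum over `x` leads to Grönwall's inequality.
  have key : ∀ k, ∀ t ∈ Set.Icc 0 T, ‖cv (wav P.β P.χ k) ((V t).val P - (D t).val P)‖ = 0 := by
    intro k
    obtain ⟨C, hC0, hC⟩ := exists_norm_cv_laplacian_le P k
    have hzc : Continuous fun t => (V t).val P - (D t).val P := (continuous_val hV).sub (continuous_val hDc)
    have hyc : Continuous fun t => ‖cv (wav P.β P.χ k) ((V t).val P - (D t).val P)‖ :=
      ((cv (wav P.β P.χ k)).continuous.comp hzc).norm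
    refine eq_zero_of_le_mul_integral hyc (fun _ => norm_nonneg _) (C := T * C) fun t ht => ?_
    have hI : 0 ≤ ∫ τ in (0 : ℝ)..t, ‖cv (wav P.β P.χ k) ((V τ).val P - (D τ).val P)‖ :=
      intervalIntegral.integral_nonneg ht.1 fun _ _ => norm_nonneg _
    refine (BoundedContinuousFunction.norm_le (by positivity)).2 fun x => ?_
    obtain ⟨q, hq0, hq⟩ := h k x
    have ev : ∀ {f : ℝ → BF d} {f' : BF d} {t : ℝ}, HasDerivAt f f' t → HasDerivAt (fun t => f t x) (f' x) t :=
      fun {f f' t} hf => ((evalBF x).restrictScalars ℝ).hasFDerivAt.comp_hasDerivAt t hf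
    have h1 := norm_le_of_second_deriv (T := T) (f := fun τ => cv (wav P.β P.χ k) ((V τ).val P - (D τ).val P) x)
      (f₁ := fun τ => q τ - duhamelDeriv (V 0) U₁ G (wav P.β P.χ k) τ x)
      (f₂ := fun τ => cv (Δ (wav P.β P.χ k)) ((V τ).val P - (D τ).val P) x)
      (fun t ht => by
        simp only [map_sub, BoundedContinuousFunction.sub_apply]
        exact (hq t ht).1.sub (ev (hasDerivAt_cv_duhamel (V 0) U₁ hG (wav P.β P.χ k) t)).hasDerivWithinAt)
      (fun t ht => by
        have h2 := (hq t ht).2.sub (ev (hasDerivAt_duhamelDeriv (V 0) U₁ hG (wav P.β P.χ k) t)).hasDerivWithinAt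
        refine h2.congr_deriv ?_
        simp only [map_sub, BoundedContinuousFunction.sub_apply, hD]
        ring)
      ((evalBF x).continuous.comp ((cv (Δ (wav P.β P.χ k))).continuous.comp hzc))
      (by simp [hD, duhamel_zero]) (by simp [hq0, duhamelDeriv_zero]) t ht
    refine h1.trans ?_
    rw [mul_assoc]
    refine mul_le_mul_of_nonneg_left ?_ hT
    rw [← intervalIntegral.integral_const_mul]
    refine intervalIntegral.integral_mono_on ht.1 ?_ ((hyc.const_mul C).intervalIntegrable _ _) fun τ _ => ?_
    · exact ((evalBF x).continuous.comp ((cv (Δ (wav P.β P.χ k))).continuous.comp hzc)).norm.intervalIntegrable _ _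
    · exact (BoundedContinuousFunction.norm_coe_le_norm _ x).trans (hC _)
  intro t ht
  refine eq_of_cv fun k => ?_
  rw [← sub_eq_zero, ← map_sub]
  exact norm_eq_zero.1 (key k t ht)

end Alg

/-! ### The Peetre maximal function -/

/-- The weight `(1 + |y|)^{-N}`. -/
noncomputable def kap (N : ℕ) (y : Sp d) : ℝ≥0∞ := (ENNReal.ofReal ((1 + ‖y‖) ^ N))⁻¹

theorem kap_le_one (N : ℕ) (y : Sp d) : kap N y ≤ 1 := by
  rw [kap, ENNReal.inv_le_one, ENNReal.one_le_ofReal]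
  exact one_le_pow₀ (by linarith [norm_nonneg y])

theorem ofReal_pow_ne_zero (N : ℕ) (y : Sp d) : ENNReal.ofReal ((1 + ‖y‖) ^ N) ≠ 0 := by
  rw [ne_eq, ENNReal.ofReal_eq_zero, not_le]
  positivity

theorem kap_zero (N : ℕ) : kap N (0 : Sp d) = 1 := by simp [kap]

theorem kap_add (N M : ℕ) (y : Sp d) : kap (N + M) y = kap N y * kap M y := by
  rw [kap, pow_add, ENNReal.ofReal_mul (by positivity), ENNReal.mul_inv (Or.inl (ofReal_pow_ne_zero N y))
    (Or.inl ENNReal.ofReal_ne_top)]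
  rfl

theorem kap_slow (N : ℕ) (x y z : Sp d) :
    kap N (x - y) ≤ kap N (x - z) * ENNReal.ofReal ((1 + ‖y - z‖) ^ N) := by
  have h1 : ENNReal.ofReal ((1 + ‖x - z‖) ^ N) ≤ ENNReal.ofReal ((1 + ‖x - y‖) ^ N) * ENNReal.ofReal ((1 + ‖y - z‖) ^ N) := by
    rw [← ENNReal.ofReal_mul (by positivity), ← mul_pow]
    refine ENNReal.ofReal_le_ofReal (pow_le_pow_left₀ (by positivity) ?_ _)
    have := norm_sub_le_norm_sub_add_norm_sub x y z
    nlinarith [norm_nonneg (x - y), norm_nonneg (y - z)]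
  calc kap N (x - y) = kap N (x - y) * (kap N (x - z) * ENNReal.ofReal ((1 + ‖x - z‖) ^ N)) := by
        rw [kap, kap, ENNReal.inv_mul_cancel (ofReal_pow_ne_zero _ _) ENNReal.ofReal_ne_top, mul_one]
    _ ≤ kap N (x - y) * (kap N (x - z) * (ENNReal.ofReal ((1 + ‖x - y‖) ^ N) * ENNReal.ofReal ((1 + ‖y - z‖) ^ N))) := by
        gcongr
    _ = (kap N (x - y) * ENNReal.ofReal ((1 + ‖x - y‖) ^ N)) * (kap N (x - z) * ENNReal.ofReal ((1 + ‖y - z‖) ^ N)) := by ring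
    _ = _ := by rw [kap, ENNReal.inv_mul_cancel (ofReal_pow_ne_zero _ _) ENNReal.ofReal_ne_top, one_mul]

theorem continuous_kap (N : ℕ) : Continuous (kap (d := d) N) := by
  exact (ENNReal.continuous_ofReal.comp (by fun_prop)).inv

theorem measurable_kap (N : ℕ) : Measurable (kap (d := d) N) := (continuous_kap N).measurable

theorem lintegral_kap_rpow_lt_top {N : ℕ} {r : ℝ} (hr : 0 ≤ r) (h : (d : ℝ) < N * r) :
    ∫⁻ y : Sp d, kap N y ^ r < ∞ := by
  have h1 := finite_integral_one_add_norm (E := Sp d) (μ := volume) (r := N * r) (by simpa using h)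
  refine lt_of_le_of_lt (lintegral_mono fun y => le_of_eq ?_) h1
  have hy : 0 < 1 + ‖y‖ := by positivity
  rw [kap, ← ENNReal.ofReal_inv_of_pos (by positivity), ENNReal.ofReal_rpow_of_nonneg (by positivity) hr,
    ← Real.rpow_natCast, ← Real.rpow_neg hy.le, ← Real.rpow_mul hy.le, neg_mul]

/-- The Peetre maximal function. -/
noncomputable def pe (N : ℕ) (F : Sp d → ℂ) (x : Sp d) : ℝ≥0∞ := ⨆ y, kap N (x - y) * ‖F y‖ₑ

theorem le_pe (N : ℕ) (F : Sp d → ℂ) (x y : Sp d) : kap N (x - y) * ‖F y‖ₑ ≤ pe N F x :=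
  le_iSup (fun y => kap N (x - y) * ‖F y‖ₑ) y

theorem enorm_le_pe (N : ℕ) (F : Sp d → ℂ) (x : Sp d) : ‖F x‖ₑ ≤ pe N F x := by
  simpa [kap_zero] using le_pe N F x x

theorem pe_le {N : ℕ} {F : Sp d → ℂ} {C : ℝ≥0∞} (h : ∀ y, ‖F y‖ₑ ≤ C) (x : Sp d) : pe N F x ≤ C :=
  iSup_le fun y => (mul_le_of_le_one_left' (kap_le_one _ _)).trans (h y)

/-- An uncountable supremum of continuous functions of `x` is lower semicontinuous. -/
theorem measurable_pe (N : ℕ) (F : Sp d → ℂ) : Measurable (pe N F) :=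
  (lowerSemicontinuous_iSup fun y => (Continuous.lowerSemicontinuous (by
    have := continuous_kap (d := d) N
    exact (ENNReal.continuous_mul_const enorm_ne_top).comp (this.comp (continuous_id.sub continuous_const))))).measurable

/-- A continuous function of polynomial growth reproduced by a window with the absolute value of `fat`. -/
structure IsBand (F : Sp d → ℂ) : Prop where
  continuous : Continuous F
  growth : ∃ (m : ℕ) (C : ℝ), 0 ≤ C ∧ ∀ x, ‖F x‖ ≤ C * (1 + ‖x‖) ^ m
  repr : ∀ x, ‖F x‖ₑ ≤ ∫⁻ y, ‖fat d (x - y)‖ₑ * ‖F y‖ₑ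

theorem IsAdmissibleWindow.isBand {β : ℝ} {χ : 𝓢(Sp d, ℂ)} (hχ : IsAdmissibleWindow β χ) (f : 𝓢'(Sp d, ℂ))
    (k : Fin d → ℤ) : IsBand (conv f (wav β χ k)) where
  continuous := continuous_conv _ _
  growth := exists_norm_conv_le _ _
  repr x := by
    have h := (conv_sconv f (wav β (fat d) k) (wav β χ k) x).2
    rw [hχ.sconv_fat] at h
    calc ‖conv f (wav β χ k) x‖ₑ ≤ ∫⁻ y, ‖wav β (fat d) k (x - y) * conv f (wav β χ k) y‖ₑ := by
          rw [h]; exact enorm_integral_le_lintegral_enorm _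
      _ = _ := lintegral_congr fun y => by
          rw [enorm_mul]; congr 1; rw [← ofReal_norm, norm_modulate, ofReal_norm]

theorem exists_fat_le (d N : ℕ) : ∃ c : ℝ, 0 < c ∧ ∀ x, (1 + ‖x‖) ^ N * ‖fat d x‖ ≤ c := by
  refine ⟨2 ^ N * ((Finset.Iic (N, 0)).sup fun m => SchwartzMap.seminorm ℂ m.1 m.2) (fat d) + 1, by positivity,
    fun x => ?_⟩
  have := SchwartzMap.one_add_le_sup_seminorm_apply (𝕜 := ℂ) (m := (N, 0)) (k := N) (n := 0) le_rfl le_rfl (fat d) x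
  rw [norm_iteratedFDeriv_zero] at this
  exact this.trans (by simp)

/-- The decay constant of `fat`. -/
noncomputable def fatConst (d N : ℕ) : ℝ := (exists_fat_le d N).choose

theorem fat_le (N : ℕ) (x : Sp d) : (1 + ‖x‖) ^ N * ‖fat d x‖ ≤ fatConst d N := (exists_fat_le d N).choose_spec.2 x

namespace IsBand

variable {F : Sp d → ℂ}

theorem measurable (hF : IsBand F) : Measurable F := hF.continuous.measurable

/-- The reproducing inequality is inserted; the decay of `fat` compensates the passage of the weight
from `x - y` to `x - z`. -/
theorem pe_le_lintegral (hF : IsBand F) (N : ℕ) (x : Sp d) :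
    pe N F x ≤ ENNReal.ofReal (fatConst d N) * ∫⁻ z, ‖F z‖ₑ * kap N (x - z) := by
  have hm : Measurable fun z => ‖F z‖ₑ * kap N (x - z) :=
    hF.measurable.enorm.mul ((measurable_kap N).comp (measurable_const.sub measurable_id))
  refine iSup_le fun y => ?_
  calc kap N (x - y) * ‖F y‖ₑ ≤ kap N (x - y) * ∫⁻ z, ‖fat d (y - z)‖ₑ * ‖F z‖ₑ := by gcongr; exact hF.repr y
    _ = ∫⁻ z, kap N (x - y) * (‖fat d (y - z)‖ₑ * ‖F z‖ₑ) := by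
        refine (lintegral_const_mul _ ?_).symm
        exact ((fat d).continuous.measurable.comp (measurable_const.sub measurable_id)).enorm.mul hF.measurable.enorm
    _ ≤ ∫⁻ z, ENNReal.ofReal (fatConst d N) * (‖F z‖ₑ * kap N (x - z)) := by
        refine lintegral_mono fun z => ?_
        have h1 : ENNReal.ofReal ((1 + ‖y - z‖) ^ N) * ‖fat d (y - z)‖ₑ ≤ ENNReal.ofReal (fatConst d N) := by
          rw [← ofReal_norm, ← ENNReal.ofReal_mul (by positivity)]
          exact ENNReal.ofReal_le_ofReal (fat_le N _)
        calc _ ≤ kap N (x - z) * ENNReal.ofReal ((1 + ‖y - z‖) ^ N) * (‖fat d (y - z)‖ₑ * ‖F z‖ₑ) := by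
              gcongr; exact kap_slow N x y z
          _ = (ENNReal.ofReal ((1 + ‖y - z‖) ^ N) * ‖fat d (y - z)‖ₑ) * (‖F z‖ₑ * kap N (x - z)) := by ring
          _ ≤ _ := by gcongr
    _ = _ := lintegral_const_mul _ hm

/-- The constant in the pointwise bound of the Peetre maximal function. -/
noncomputable def _root_.NLW.peConst (d N : ℕ) (p : ℝ) : ℝ≥0∞ :=
  if p ≤ 1 then ENNReal.ofReal (fatConst d N)
  else ENNReal.ofReal (fatConst d N) ^ p * (∫⁻ y : Sp d, kap N y) ^ (p - 1)

theorem _root_.NLW.peConst_lt_top {N : ℕ} {p : ℝ} (hN : (d : ℝ) < N * min 1 p) : peConst d N p < ∞ := by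
  unfold peConst
  split_ifs with h
  · exact ENNReal.ofReal_lt_top
  · push Not at h
    rw [min_eq_left h.le] at hN
    have h1 := lintegral_kap_rpow_lt_top zero_le_one hN
    simp only [ENNReal.rpow_one] at h1
    exact ENNReal.mul_lt_top (ENNReal.rpow_lt_top_of_nonneg (by linarith) ENNReal.ofReal_ne_top)
      (ENNReal.rpow_lt_top_of_nonneg (by linarith) h1.ne)

/-- The integrand is split with exponents `1 - p` and `p`. The first factor is at most a power of
the maximal function itself and is divided out, which requires that function to be finite. -/
theorem pe_rpow_le_of_ne_top (hF : IsBand F) {N : ℕ} {p : ℝ} (hp0 : 0 < p) (hp1 : p ≤ 1) {x : Sp d} (hfin : pe N F x ≠ ∞) :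
    pe N F x ^ p ≤ ENNReal.ofReal (fatConst d N) * ∫⁻ z, ‖F z‖ₑ ^ p * kap N (x - z) ^ p := by
  rcases eq_or_ne (pe N F x) 0 with h0 | h0
  · rw [h0, ENNReal.zero_rpow_of_pos hp0]; exact zero_le
  have hm : Measurable fun z => ‖F z‖ₑ ^ p * kap N (x - z) ^ p :=
    (hF.measurable.enorm.pow_const p).mul (((measurable_kap N).comp (measurable_const.sub measurable_id)).pow_const p)
  have h1 : pe N F x ≤ pe N F x ^ (1 - p) * (ENNReal.ofReal (fatConst d N) * ∫⁻ z, ‖F z‖ₑ ^ p * kap N (x - z) ^ p) := by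
    refine (hF.pe_le_lintegral N x).trans ?_
    rw [mul_left_comm]
    refine mul_le_mul_right (le_trans (lintegral_mono fun z => ?_) (lintegral_const_mul _ hm).le) _
    rw [← ENNReal.mul_rpow_of_nonneg _ _ hp0.le]
    calc ‖F z‖ₑ * kap N (x - z) = (‖F z‖ₑ * kap N (x - z)) ^ ((1 - p) + p) := by rw [sub_add_cancel, ENNReal.rpow_one]
      _ = (‖F z‖ₑ * kap N (x - z)) ^ (1 - p) * (‖F z‖ₑ * kap N (x - z)) ^ p :=
          ENNReal.rpow_add_of_nonneg _ _ (by linarith) hp0.le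
      _ ≤ _ := by
          refine mul_le_mul_left (ENNReal.rpow_le_rpow ?_ (by linarith)) _
          rw [mul_comm]; exact le_pe N F x z
  have h2 : pe N F x ^ (1 - p) ≠ 0 := by simp [h0, hfin]
  have h3 : pe N F x ^ (1 - p) ≠ ∞ := ENNReal.rpow_ne_top_of_nonneg (by linarith) hfin
  refine (ENNReal.mul_le_mul_iff_right h2 h3).1 (le_trans (le_of_eq ?_) h1)
  rw [← ENNReal.rpow_add_of_nonneg _ _ (by linarith) hp0.le, sub_add_cancel, ENNReal.rpow_one]

/-- Polynomial growth is beaten by a weight whose order depends on `F`. -/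
theorem exists_pe_ne_top (hF : IsBand F) : ∃ N, ∀ x, pe N F x ≠ ∞ := by
  obtain ⟨m, C, hC0, hC⟩ := hF.growth
  refine ⟨m, fun x => ne_top_of_le_ne_top (ENNReal.mul_ne_top (ENNReal.ofReal_ne_top (r := C))
    (ENNReal.ofReal_ne_top (r := (1 + ‖x‖) ^ m))) (iSup_le fun y => ?_)⟩
  have h1 : ‖F y‖ₑ ≤ ENNReal.ofReal C * ENNReal.ofReal ((1 + ‖y‖) ^ m) := by
    rw [← ofReal_norm, ← ENNReal.ofReal_mul hC0]
    exact ENNReal.ofReal_le_ofReal (hC y)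
  have h2 : ENNReal.ofReal ((1 + ‖y‖) ^ m) ≤ ENNReal.ofReal ((1 + ‖x‖) ^ m) * ENNReal.ofReal ((1 + ‖x - y‖) ^ m) := by
    rw [← ENNReal.ofReal_mul (by positivity), ← mul_pow]
    refine ENNReal.ofReal_le_ofReal (pow_le_pow_left₀ (by positivity) ?_ _)
    have := norm_sub_norm_le y x
    rw [norm_sub_rev] at this
    nlinarith [norm_nonneg x, norm_nonneg (x - y)]
  calc kap m (x - y) * ‖F y‖ₑ ≤ kap m (x - y) * (ENNReal.ofReal C *
        (ENNReal.ofReal ((1 + ‖x‖) ^ m) * ENNReal.ofReal ((1 + ‖x - y‖) ^ m))) := by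
        gcongr; exact h1.trans (by gcongr)
    _ = (kap m (x - y) * ENNReal.ofReal ((1 + ‖x - y‖) ^ m)) * (ENNReal.ofReal C * ENNReal.ofReal ((1 + ‖x‖) ^ m)) := by ring
    _ = _ := by rw [kap, ENNReal.inv_mul_cancel (ofReal_pow_ne_zero _ _) ENNReal.ofReal_ne_top, one_mul]

/-- A bootstrap: the maximal function of an order depending on `F` is finite, so `F` is bounded; the
maximal functions of all orders are then finite and the uniform estimates apply. -/
theorem exists_bound (hF : IsBand F) {p : ℝ} (hp0 : 0 < p) (hp1 : p ≤ 1) (hfin : ∫⁻ z, ‖F z‖ₑ ^ p ≠ ∞) :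
    ∃ C : ℝ≥0∞, C ≠ ∞ ∧ ∀ x, ‖F x‖ₑ ≤ C := by
  obtain ⟨N, hN⟩ := hF.exists_pe_ne_top
  refine ⟨(ENNReal.ofReal (fatConst d N) * ∫⁻ z, ‖F z‖ₑ ^ p) ^ (1 / p),
    ENNReal.rpow_ne_top_of_nonneg (by positivity) (ENNReal.mul_ne_top ENNReal.ofReal_ne_top hfin), fun x => ?_⟩
  rw [one_div, ENNReal.le_rpow_inv_iff hp0]
  refine (ENNReal.rpow_le_rpow (enorm_le_pe N F x) hp0.le).trans ((hF.pe_rpow_le_of_ne_top hp0 hp1 (hN x)).trans ?_)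
  gcongr with z
  exact mul_le_of_le_one_right' (ENNReal.rpow_le_one (kap_le_one _ _) hp0.le)

/-- For `p ≤ 1` the division argument, legitimate for every `N` once `F` is known to be bounded; for
`p > 1` Hölder's inequality with density `kap`. -/
theorem pe_rpow_le (hF : IsBand F) {N : ℕ} {p : ℝ} (hp0 : 0 < p) (hfin : ∫⁻ z, ‖F z‖ₑ ^ p ≠ ∞) (x : Sp d) :
    pe N F x ^ p ≤ peConst d N p * ∫⁻ z, ‖F z‖ₑ ^ p * kap N (x - z) ^ min 1 p := by
  unfold peConst
  split_ifs with h
  · rw [min_eq_right h]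
    obtain ⟨C, hC, hb⟩ := hF.exists_bound hp0 h hfin
    exact hF.pe_rpow_le_of_ne_top hp0 h (ne_top_of_le_ne_top hC (pe_le hb x))
  · push Not at h
    rw [min_eq_left h.le]
    have hk : Measurable fun z => kap N (x - z) := (measurable_kap N).comp (measurable_const.sub measurable_id)
    set q := p / (p - 1) with hq
    have hpq : p.HolderConjugate q := Real.HolderConjugate.conjExponent h
    have h1 := ENNReal.lintegral_mul_le_Lp_mul_Lq volume hpq (f := fun z => ‖F z‖ₑ * kap N (x - z) ^ (1 / p))
      (g := fun z => kap N (x - z) ^ (1 / q)) (hF.measurable.enorm.mul (hk.pow_const _)).aemeasurable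
      (hk.pow_const _).aemeasurable
    simp only [Pi.mul_apply] at h1
    have e1 : ∀ z, ‖F z‖ₑ * kap N (x - z) ^ (1 / p) * kap N (x - z) ^ (1 / q) = ‖F z‖ₑ * kap N (x - z) := fun z => by
      rw [mul_assoc, ← ENNReal.rpow_add_of_nonneg _ _ hpq.one_div_nonneg hpq.symm.one_div_nonneg, one_div, one_div,
        hpq.inv_add_inv_eq_one, ENNReal.rpow_one]
    simp only [e1] at h1
    have e2 : ∀ z, (‖F z‖ₑ * kap N (x - z) ^ (1 / p)) ^ p = ‖F z‖ₑ ^ p * kap N (x - z) := fun z => by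
      rw [ENNReal.mul_rpow_of_nonneg _ _ hp0.le, ← ENNReal.rpow_mul, one_div_mul_cancel hp0.ne', ENNReal.rpow_one]
    have e3 : ∀ z, (kap N (x - z) ^ (1 / q)) ^ q = kap N (x - z) := fun z => by
      rw [← ENNReal.rpow_mul, one_div_mul_cancel hpq.symm.ne_zero, ENNReal.rpow_one]
    simp only [e2, e3] at h1
    rw [lintegral_sub_left_eq_self (fun z => kap N z) x] at h1
    have h2 := (hF.pe_le_lintegral N x).trans (mul_le_mul_right h1 _)
    refine (ENNReal.rpow_le_rpow h2 hp0.le).trans (le_of_eq ?_)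
    rw [ENNReal.mul_rpow_of_nonneg _ _ hp0.le, ENNReal.mul_rpow_of_nonneg _ _ hp0.le, ← ENNReal.rpow_mul,
      ← ENNReal.rpow_mul, one_div_mul_cancel hp0.ne', ENNReal.rpow_one]
    have e4 : 1 / q * p = p - 1 := by
      rw [hq]; field_simp
    rw [e4]
    simp only [ENNReal.rpow_one]
    ring

theorem enorm_rpow_le (hF : IsBand F) {N : ℕ} {p : ℝ} (hp0 : 0 < p) (hfin : ∫⁻ z, ‖F z‖ₑ ^ p ≠ ∞) (x : Sp d) :
    ‖F x‖ₑ ^ p ≤ peConst d N p * ∫⁻ z, ‖F z‖ₑ ^ p := by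
  refine (ENNReal.rpow_le_rpow (enorm_le_pe N F x) hp0.le).trans ((hF.pe_rpow_le hp0 hfin x).trans ?_)
  gcongr with z
  exact mul_le_of_le_one_right' (ENNReal.rpow_le_one (kap_le_one _ _) (by positivity))

theorem lintegral_pe_rpow_le (hF : IsBand F) {N : ℕ} {p : ℝ} (hp0 : 0 < p) (hfin : ∫⁻ z, ‖F z‖ₑ ^ p ≠ ∞) :
    ∫⁻ x, pe N F x ^ p ≤ (peConst d N p * ∫⁻ y : Sp d, kap N y ^ min 1 p) * ∫⁻ z, ‖F z‖ₑ ^ p := by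
  have hm1 : Measurable fun z => ‖F z‖ₑ ^ p := hF.measurable.enorm.pow_const p
  have hm2 : Measurable fun y : Sp d => kap N y ^ min 1 p := (measurable_kap N).pow_const _
  have hm3 : Measurable (Function.uncurry fun x z => ‖F z‖ₑ ^ p * kap N (x - z) ^ min 1 p) :=
    (hm1.comp measurable_snd).mul (hm2.comp (measurable_fst.sub measurable_snd))
  calc ∫⁻ x, pe N F x ^ p ≤ ∫⁻ x, peConst d N p * ∫⁻ z, ‖F z‖ₑ ^ p * kap N (x - z) ^ min 1 p :=
        lintegral_mono fun x => hF.pe_rpow_le hp0 hfin x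
    _ = peConst d N p * ∫⁻ x, ∫⁻ z, ‖F z‖ₑ ^ p * kap N (x - z) ^ min 1 p :=
        lintegral_const_mul _ hm3.lintegral_prod_right'
    _ = peConst d N p * ∫⁻ z, ∫⁻ x, ‖F z‖ₑ ^ p * kap N (x - z) ^ min 1 p := by
        rw [lintegral_lintegral_swap hm3.aemeasurable]
    _ = peConst d N p * ∫⁻ z, ‖F z‖ₑ ^ p * ∫⁻ y : Sp d, kap N y ^ min 1 p := by
        congr 1
        refine lintegral_congr fun z => ?_
        have hm4 : Measurable fun x => kap N (x - z) ^ min 1 p := hm2.comp (measurable_id.sub measurable_const)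
        rw [lintegral_const_mul _ hm4, lintegral_sub_right_eq_self (fun y => kap N y ^ min 1 p) z]
    _ = _ := by
        rw [lintegral_mul_const _ hm1]; ring

end IsBand

/-- The `L^p` (quasi-)norm of a nonnegative function. -/
noncomputable def lpn (p : ℝ) (μ : Measure (Sp d)) (f : Sp d → ℝ≥0∞) : ℝ≥0∞ := (∫⁻ x, f x ^ p ∂μ) ^ (1 / p)

theorem lpn_mono {p : ℝ} (hp : 0 < p) {μ ν : Measure (Sp d)} (hμ : μ ≤ ν) {f g : Sp d → ℝ≥0∞} (h : ∀ x, f x ≤ g x) :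
    lpn p μ f ≤ lpn p ν g :=
  ENNReal.rpow_le_rpow (lintegral_mono' hμ fun x => ENNReal.rpow_le_rpow (h x) hp.le) (by positivity)

theorem lpn_const_mul {p : ℝ} (hp : 0 < p) (μ : Measure (Sp d)) {f : Sp d → ℝ≥0∞} (hf : Measurable f) (c : ℝ≥0∞) :
    lpn p μ (fun x => c * f x) = c * lpn p μ f := by
  unfold lpn
  simp only [ENNReal.mul_rpow_of_nonneg _ _ hp.le]
  rw [lintegral_const_mul _ (hf.pow_const p), ENNReal.mul_rpow_of_nonneg _ _ (by positivity), ← ENNReal.rpow_mul,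
    mul_one_div_cancel hp.ne', ENNReal.rpow_one]

theorem eLpNorm_eq_lpn {p : ℝ≥0∞} (h0 : p ≠ 0) (h1 : p ≠ ∞) (μ : Measure (Sp d)) (g : Sp d → ℂ) :
    eLpNorm g p μ = lpn p.toReal μ fun x => ‖g x‖ₑ :=
  eLpNorm_eq_lintegral_rpow_enorm_toReal h0 h1

/-- The constant in the `L^p` bound of the Peetre maximal function. -/
noncomputable def bandConst (d N : ℕ) (p : ℝ) : ℝ≥0∞ :=
  (peConst d N p * (1 + ∫⁻ y : Sp d, kap N y ^ min 1 p)) ^ (1 / p) + 1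

theorem bandConst_lt_top {N : ℕ} {p : ℝ} (hp0 : 0 < p) (hN : (d : ℝ) < N * min 1 p) : bandConst d N p < ∞ :=
  ENNReal.add_lt_top.2 ⟨ENNReal.rpow_lt_top_of_nonneg (by positivity) (ENNReal.mul_ne_top (peConst_lt_top hN).ne
    (ENNReal.add_ne_top.2 ⟨ENNReal.one_ne_top, (lintegral_kap_rpow_lt_top (by positivity) hN).ne⟩)), ENNReal.one_lt_top⟩

theorem le_bandConst_mul {N : ℕ} {p : ℝ} (hp0 : 0 < p) {a b : ℝ≥0∞}
    (h : b ≠ ∞ → a ≤ (peConst d N p * (1 + ∫⁻ y : Sp d, kap N y ^ min 1 p)) * b) :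
    a ^ (1 / p) ≤ bandConst d N p * b ^ (1 / p) := by
  rcases eq_or_ne b ∞ with hb | hb
  -- The summand `1` in `bandConst` serves this case: it excludes a product `0 * ∞` on the right.
  · rw [hb, ENNReal.top_rpow_of_pos (by positivity), ENNReal.mul_top (by simp [bandConst])]
    exact le_top
  · refine (ENNReal.rpow_le_rpow (h hb) (by positivity)).trans ?_
    rw [ENNReal.mul_rpow_of_nonneg _ _ (by positivity)]
    exact mul_le_mul_left (le_add_right le_rfl) _

namespace IsBand

variable {F : Sp d → ℂ}

theorem lpn_pe_le (hF : IsBand F) (N : ℕ) {p : ℝ} (hp0 : 0 < p) :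
    lpn p volume (pe N F) ≤ bandConst d N p * lpn p volume fun x => ‖F x‖ₑ :=
  le_bandConst_mul hp0 fun hb => (hF.lintegral_pe_rpow_le hp0 hb).trans (by gcongr; exact le_add_left le_rfl)

theorem enorm_le_lpn (hF : IsBand F) (N : ℕ) {p : ℝ} (hp0 : 0 < p) (x : Sp d) :
    ‖F x‖ₑ ≤ bandConst d N p * lpn p volume fun x => ‖F x‖ₑ := by
  have h := le_bandConst_mul (d := d) (N := N) hp0 (a := ‖F x‖ₑ ^ p) (b := ∫⁻ x, ‖F x‖ₑ ^ p)
    fun hb => (hF.enorm_rpow_le (N := N) hp0 hb x).trans (by gcongr; exact le_mul_of_one_le_right' (le_add_right le_rfl))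
  rwa [← ENNReal.rpow_mul, mul_one_div_cancel hp0.ne', ENNReal.rpow_one] at h

/-- Interpolation with the sup bound: `‖F‖ ≤ (sup ‖F‖) ^ (1 - p) * ‖F‖ ^ p`. -/
theorem lpn_one_le (hF : IsBand F) (N : ℕ) {p : ℝ} (hp0 : 0 < p) (hp1 : p ≤ 1) :
    lpn 1 volume (fun x => ‖F x‖ₑ) ≤ bandConst d N p ^ (1 - p) * lpn p volume fun x => ‖F x‖ₑ := by
  set Λ := lpn p volume fun x => ‖F x‖ₑ with hΛ
  have h1 : ∀ x, ‖F x‖ₑ ≤ (bandConst d N p * Λ) ^ (1 - p) * ‖F x‖ₑ ^ p := fun x => by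
    calc ‖F x‖ₑ = ‖F x‖ₑ ^ (1 - p) * ‖F x‖ₑ ^ p := by
          rw [← ENNReal.rpow_add_of_nonneg _ _ (by linarith) hp0.le, sub_add_cancel, ENNReal.rpow_one]
      _ ≤ _ := mul_le_mul_left (ENNReal.rpow_le_rpow (hF.enorm_le_lpn N hp0 x) (by linarith)) _
  have h2 : ∫⁻ x, ‖F x‖ₑ ^ p = Λ ^ p := by
    rw [hΛ, lpn, ← ENNReal.rpow_mul, one_div_mul_cancel hp0.ne', ENNReal.rpow_one]
  calc lpn 1 volume (fun x => ‖F x‖ₑ) = ∫⁻ x, ‖F x‖ₑ := by simp [lpn]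
    _ ≤ ∫⁻ x, (bandConst d N p * Λ) ^ (1 - p) * ‖F x‖ₑ ^ p := lintegral_mono h1
    _ = (bandConst d N p * Λ) ^ (1 - p) * Λ ^ p := by
        rw [lintegral_const_mul _ (hF.measurable.enorm.pow_const p), h2]
    _ = bandConst d N p ^ (1 - p) * Λ := by
        rw [ENNReal.mul_rpow_of_nonneg _ _ (by linarith), mul_assoc,
          ← ENNReal.rpow_add_of_nonneg _ _ (by linarith) hp0.le, sub_add_cancel, ENNReal.rpow_one]

/-- With weights of order `N = d + 1`, the lower bound on `p` makes `kap N ^ min 1 p` integrable. -/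
theorem _root_.NLW.lt_mul_min_one {p : ℝ≥0∞} (hp : (d : ℝ≥0∞) / ((d : ℝ≥0∞) + 1) < p) (h : p ≠ ∞) :
    0 < p.toReal ∧ (d : ℝ) < ((d + 1 : ℕ) : ℝ) * min 1 p.toReal := by
  have h1 : (d : ℝ) / (d + 1) < p.toReal := by
    have h2 := (ENNReal.toReal_lt_toReal (hp.trans_le le_top).ne h).2 hp
    rw [ENNReal.toReal_div, ENNReal.toReal_add (by simp) (by simp)] at h2
    simpa using h2
  have h0 : (0 : ℝ) ≤ d / (d + 1) := by positivity
  refine ⟨by linarith, ?_⟩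
  rw [div_lt_iff₀ (by positivity)] at h1
  rw [mul_min_of_nonneg _ _ (by positivity), lt_min_iff]
  push_cast
  constructor <;> linarith

theorem enorm_le_essSup {F : Sp d → ℂ} (hF : Continuous F) (x : Sp d) : ‖F x‖ₑ ≤ eLpNormEssSup F volume := by
  have h1 : IsOpen {x | ‖F x‖ₑ ≤ eLpNormEssSup F volume}ᶜ :=
    (isClosed_le hF.enorm continuous_const).isOpen_compl
  have h2 := (h1.measure_eq_zero_iff (μ := volume)).1 (enorm_ae_le_eLpNormEssSup F volume)
  exact Set.eq_univ_iff_forall.1 (Set.compl_empty_iff.1 h2) x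

/-- Bernstein's inequality. -/
theorem exists_enorm_le (d : ℕ) {p : ℝ≥0∞} (hp : (d : ℝ≥0∞) / ((d : ℝ≥0∞) + 1) < p) :
    ∃ C : ℝ≥0∞, C ≠ ∞ ∧ ∀ F : Sp d → ℂ, IsBand F → ∀ x, ‖F x‖ₑ ≤ C * eLpNorm F p volume := by
  rcases eq_or_ne p ∞ with h | h
  · refine ⟨1, ENNReal.one_ne_top, fun F hF x => ?_⟩
    rw [h, eLpNorm_exponent_top, one_mul]
    exact enorm_le_essSup hF.continuous x
  · obtain ⟨hp0, hN⟩ := lt_mul_min_one hp h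
    refine ⟨bandConst d (d + 1) p.toReal, (bandConst_lt_top hp0 hN).ne, fun F hF x => ?_⟩
    rw [eLpNorm_eq_lpn (fun h0 => by simp [h0] at hp0) h]
    exact hF.enorm_le_lpn _ hp0 x

end IsBand

/-! ### Elements of the modulation space as elements of the algebra -/

variable {P : Par d}

theorem modNorm_eq (p : ℝ≥0∞) (f : 𝓢'(Sp d, ℂ)) :
    modNorm P.β P.χ p P.s f = ∑' k, wgt P.β P.s k * eLpNorm (conv f (wav P.β P.χ k)) p volume :=
  tsum_congr fun _ => mul_comm _ _

/-- Bernstein's inequality converts the `L^p` norms of the blocks into sup norms. The blocks then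
sum uniformly to a function representing `f`, whose own blocks they are. -/
theorem exists_alg_of_modNorm {p : ℝ≥0∞} {C : ℝ≥0∞} (hC : C ≠ ∞)
    (hb : ∀ F : Sp d → ℂ, IsBand F → ∀ x, ‖F x‖ₑ ≤ C * eLpNorm F p volume) {f : 𝓢'(Sp d, ℂ)}
    (hf : f ∈ modSpace P.β P.χ p P.s) : ∃ V : Alg P, f = distL (V.val P) := by
  have hf' : modNorm P.β P.χ p P.s f < ∞ := hf
  rw [modNorm_eq] at hf'
  have hband : ∀ k, IsBand (conv f (wav P.β P.χ k)) := fun k => P.adm.isBand f k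
  have htop : ∀ k, C * eLpNorm (conv f (wav P.β P.χ k)) p volume ≠ ∞ := fun k => by
    refine ENNReal.mul_ne_top hC (ne_top_of_le_ne_top hf'.ne ?_)
    exact (le_mul_of_one_le_left' (one_le_wgt P.β P.nonneg k)).trans
      (ENNReal.le_tsum (f := fun k => wgt P.β P.s k * eLpNorm (conv f (wav P.β P.χ k)) p volume) k)
  have hbd : ∀ k x, ‖conv f (wav P.β P.χ k) x‖ ≤ (C * eLpNorm (conv f (wav P.β P.χ k)) p volume).toReal := fun k x => by
    rw [← toReal_enorm]
    exact ENNReal.toReal_mono (htop k) (hb _ (hband k) x)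
  set b : (Fin d → ℤ) → BF d := fun k =>
    BoundedContinuousFunction.ofNormedAddCommGroup (conv f (wav P.β P.χ k)) (hband k).continuous _ (hbd k) with hbdef
  have hbn : ∀ k, ‖b k‖ₑ ≤ C * eLpNorm (conv f (wav P.β P.χ k)) p volume := fun k => by
    rw [← ofReal_norm]
    exact ENNReal.ofReal_le_of_le_toReal (BoundedContinuousFunction.norm_ofNormedAddCommGroup_le _ ENNReal.toReal_nonneg (hbd k))
  have htot : ∑' k, wgt P.β P.s k * ‖b k‖ₑ < ∞ := by
    refine lt_of_le_of_lt (ENNReal.tsum_le_tsum fun k => mul_le_mul_right (hbn k) _) ?_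
    simp only [mul_left_comm _ C]
    rw [ENNReal.tsum_mul_left]
    exact ENNReal.mul_lt_top hC.lt_top hf'
  have hsum : Summable b := by
    refine Summable.of_enorm (ne_top_of_le_ne_top htot.ne (ENNReal.tsum_le_tsum fun k => ?_))
    exact le_mul_of_one_le_left' (one_le_wgt P.β P.nonneg k)
  have hfb := P.adm.eq_distL f b (fun k x => rfl) hsum
  have hcv : ∀ k, cv (wav P.β P.χ k) (∑' k, b k) = b k := fun k => by
    ext x
    rw [← conv_distL, ← hfb]
    rfl
  exact ⟨Alg.mk P (∑' k, b k) (by rw [an_eq]; simpa only [hcv] using htot), hfb⟩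

/-- The embedding in quantitative form; the existence time and the blow-up criterion are transferred
through it. -/
theorem an_le_modNorm {p : ℝ≥0∞} {C : ℝ≥0∞}
    (hb : ∀ F : Sp d → ℂ, IsBand F → ∀ x, ‖F x‖ₑ ≤ C * eLpNorm F p volume) (g : BF d) :
    an P g ≤ C * modNorm P.β P.χ p P.s (distL g) := by
  rw [an_eq, modNorm_eq, ← ENNReal.tsum_mul_left]
  refine ENNReal.tsum_le_tsum fun k => ?_
  rw [mul_left_comm]
  gcongr
  rcases eq_or_ne (C * eLpNorm (conv (distL g) (wav P.β P.χ k)) p volume) ∞ with h | h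
  · rw [h]; exact le_top
  rw [← ofReal_norm]
  refine ENNReal.ofReal_le_of_le_toReal ((BoundedContinuousFunction.norm_le ENNReal.toReal_nonneg).2 fun x => ?_)
  rw [← toReal_enorm, ← conv_distL]
  exact ENNReal.toReal_mono h (hb _ (P.adm.isBand _ k) x)

/-! ### Estimates of the frequency blocks of Duhamel's formula -/

section Blocks

variable {P : Par d} {N : ℕ} {w : Sp d → ℝ≥0∞}

variable (P) in
/-- The weighted supremum of a frequency block. -/
noncomputable def bs (w : Sp d → ℝ≥0∞) (k : Fin d → ℤ) (g : BF d) : ℝ≥0∞ := ⨆ y, w y * ‖cv (wav P.β P.χ k) g y‖ₑ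

theorem bs_eq_wsup (k : Fin d → ℤ) (g : BF d) :
    bs P w k g = wsup (fun _ : Unit => w) (fun _ => cv (wav P.β P.χ k) g) := by
  simp [bs, wsup]

theorem bs_one (k : Fin d → ℤ) (g : BF d) : bs P 1 k g = ‖cv (wav P.β P.χ k) g‖ₑ := by
  rw [bs_eq_wsup]
  exact le_antisymm (wsup_one_le fun _ => le_rfl) (enorm_le_wsup_one (fun _ : Unit => cv (wav P.β P.χ k) g) ())

/-- The growth constant of the propagators on `[0, T]`. -/
noncomputable def growth (d N : ℕ) (T : ℝ) : ℝ≥0∞ := ENNReal.ofReal (propConst d N * Real.exp (2 * Real.pi * T))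

theorem mul_enorm_cosS_le (hw : SlowWeight N fun _ : Unit => w) (k : Fin d → ℤ) (g : BF d) {σ T : ℝ}
    (hσ : σ ∈ Set.Icc 0 T) (y : Sp d) :
    w y * ‖cv (cosS σ (wav P.β P.χ k)) g y‖ₑ ≤ growth d N T * bs P w k g := by
  rw [bs_eq_wsup, cv_cosS_wav]
  have h1 := wsup_cv_le hw (cosS σ (wav P.β (fat d) k)) (fun _ => cv (wav P.β P.χ k) g)
  refine (le_wsup (fun _ : Unit => w) (fun _ => cv (cosS σ (wav P.β (fat d) k)) (cv (wav P.β P.χ k) g)) () y).trans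
    (h1.trans (mul_le_mul_left ((lw_cosS_le N σ P.β k).trans (ENNReal.ofReal_le_ofReal ?_)) _))
  have h2 := propConst_nonneg d N
  have h3 := Real.pi_pos
  rw [abs_of_nonneg hσ.1]
  have h4 := hσ.2
  gcongr

theorem mul_enorm_integral_le {f : ℝ → BF d} (hf : Continuous f) {t : ℝ} (ht : 0 ≤ t) (c : ℝ≥0∞) (y : Sp d) :
    c * ‖(∫ τ in (0 : ℝ)..t, f τ) y‖ₑ ≤ ∫⁻ τ in Set.Ioc 0 t, c * ‖f τ y‖ₑ := by
  have h1 : (∫ τ in (0 : ℝ)..t, f τ) y = ∫ τ in (0 : ℝ)..t, f τ y :=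
    ((evalBF y).intervalIntegral_comp_comm (hf.intervalIntegrable _ _)).symm
  have h2 : Continuous fun τ => f τ y := (evalBF y).continuous.comp hf
  rw [h1, lintegral_const_mul _ h2.measurable.enorm, intervalIntegral.integral_of_le ht]
  gcongr
  exact enorm_integral_le_lintegral_enorm _

theorem mul_enorm_sinOp_le (hw : SlowWeight N fun _ : Unit => w) (k : Fin d → ℤ) (g : BF d) {σ T : ℝ}
    (hσ : σ ∈ Set.Icc 0 T) (y : Sp d) :
    w y * ‖sinOp (wav P.β P.χ k) σ g y‖ₑ ≤ ENNReal.ofReal σ * (growth d N T * bs P w k g) := by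
  rw [sinOp_apply]
  refine (mul_enorm_integral_le ((continuous_cv_cosS _).clm_apply continuous_const) hσ.1 _ y).trans ?_
  refine (setLIntegral_mono' measurableSet_Ioc fun τ hτ =>
    mul_enorm_cosS_le hw k g (T := T) ⟨hτ.1.le, hτ.2.trans hσ.2⟩ y).trans ?_
  rw [setLIntegral_const, Real.volume_Ioc, sub_zero, mul_comm]

/-- The weight is left general so that one estimate covers the sup norm (`w = 1`) and the maximal
functions (`w` a translate of `kap`). The factor `t - τ` is the length of the interval on which the
cosine is integrated. -/
theorem mul_enorm_duhamel_le (hw : SlowWeight N fun _ : Unit => w) (k : Fin d → ℤ) (U₀ U₁ : Alg P) {G : ℝ → Alg P}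
    (hG : Continuous G) {t T : ℝ} (ht : t ∈ Set.Icc 0 T) (y : Sp d) :
    w y * ‖cv (wav P.β P.χ k) ((Alg.duhamel U₀ U₁ G t).val P) y‖ₑ ≤ growth d N T * (bs P w k (U₀.val P) +
      ENNReal.ofReal T * bs P w k (U₁.val P) +
      ∫⁻ τ in Set.Ioc 0 t, ENNReal.ofReal (t - τ) * bs P w k ((G τ).val P)) := by
  have hc : Continuous fun τ => sinOp (wav P.β P.χ k) (t - τ) ((G τ).val P) :=
    ((continuous_sinOp _).comp (by fun_prop)).clm_apply (Alg.continuous_val hG)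
  rw [Alg.cv_duhamel U₀ U₁ hG, BoundedContinuousFunction.sub_apply, BoundedContinuousFunction.add_apply]
  calc _ ≤ w y * ((‖cv (cosS t (wav P.β P.χ k)) (U₀.val P) y‖ₑ + ‖sinOp (wav P.β P.χ k) t (U₁.val P) y‖ₑ) +
        ‖(∫ τ in (0 : ℝ)..t, sinOp (wav P.β P.χ k) (t - τ) ((G τ).val P)) y‖ₑ) := by
        gcongr
        exact enorm_sub_le.trans (by gcongr; exact enorm_add_le _ _)
    _ = w y * ‖cv (cosS t (wav P.β P.χ k)) (U₀.val P) y‖ₑ + w y * ‖sinOp (wav P.β P.χ k) t (U₁.val P) y‖ₑ +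
        w y * ‖(∫ τ in (0 : ℝ)..t, sinOp (wav P.β P.χ k) (t - τ) ((G τ).val P)) y‖ₑ := by ring
    _ ≤ growth d N T * bs P w k (U₀.val P) + ENNReal.ofReal T * (growth d N T * bs P w k (U₁.val P)) +
        ∫⁻ τ in Set.Ioc 0 t, growth d N T * (ENNReal.ofReal (t - τ) * bs P w k ((G τ).val P)) := by
        refine add_le_add (add_le_add (mul_enorm_cosS_le hw k _ ht y) ((mul_enorm_sinOp_le hw k _ ht y).trans
          (by gcongr; exact ht.2))) ((mul_enorm_integral_le hc ht.1 _ y).trans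
          (setLIntegral_mono' measurableSet_Ioc fun τ hτ => ?_))
        refine (mul_enorm_sinOp_le hw k _ (T := T) ⟨by linarith [hτ.2], by linarith [hτ.1, ht.2]⟩ y).trans_eq ?_
        ring
    _ = _ := by
        rw [lintegral_const_mul' _ _ (by simp [growth])]
        ring

/-- The supremum over time is inside the sum over blocks, which is stronger than boundedness in the
algebra. Duhamel's formula bounds that supremum by a time integral, and the integral commutes with
the sum. -/
theorem Alg.xn_duhamel_lt_top (U₀ U₁ : Alg P) {G : ℝ → Alg P} (hG : Continuous G) (T : ℝ) :
    xn P.β P.χ P.s (fun t : Set.Icc 0 T => (duhamel U₀ U₁ G t).val P) < ∞ := by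
  rcases lt_or_ge T 0 with hT | hT
  · have : IsEmpty (Set.Icc 0 T) := Set.isEmpty_coe_sort.2 (Set.Icc_eq_empty (not_le.2 hT))
    simp [xn, wsup]
  set J : (Fin d → ℤ) → ℝ≥0∞ := fun k => ∫⁻ τ in Set.Ioc 0 T, ‖cv (wav P.β P.χ k) ((G τ).val P)‖ₑ with hJ
  have h1 : ∀ k, wsup 1 (blk P.β P.χ k fun t : Set.Icc 0 T => (duhamel U₀ U₁ G t).val P) ≤
      growth d 0 T * (‖cv (wav P.β P.χ k) (U₀.val P)‖ₑ + ENNReal.ofReal T * ‖cv (wav P.β P.χ k) (U₁.val P)‖ₑ +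
        ENNReal.ofReal T * J k) := fun k => by
    refine iSup_le fun t => iSup_le fun y => ?_
    refine (mul_enorm_duhamel_le (w := 1) slowWeight_one k U₀ U₁ hG t.2 y).trans ?_
    simp only [bs_one]
    gcongr
    rw [hJ, ← lintegral_const_mul' _ _ ENNReal.ofReal_ne_top]
    refine (setLIntegral_mono' measurableSet_Ioc fun τ hτ => ?_).trans
      (lintegral_mono_set (Set.Ioc_subset_Ioc_right t.2.2))
    gcongr
    linarith [hτ.1, t.2.2]
  have h2 : ∑' k, wgt P.β P.s k * J k = ∫⁻ τ in Set.Ioc 0 T, an P ((G τ).val P) := by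
    simp only [hJ, an_eq]
    rw [lintegral_tsum fun k => ?_]
    · refine tsum_congr fun k => (lintegral_const_mul' _ _ (wgt_ne_top _ _ _)).symm
    · have : Continuous fun τ => cv (wav P.β P.χ k) ((G τ).val P) := (cv _).continuous.comp (continuous_val hG)
      exact (this.enorm.measurable.const_mul _).aemeasurable
  have h3 : ∫⁻ τ in Set.Ioc 0 T, an P ((G τ).val P) < ∞ := by
    obtain ⟨R, hR⟩ := (isCompact_Icc (a := (0 : ℝ)) (b := T)).exists_bound_of_continuousOn hG.continuousOn
    refine lt_of_le_of_lt (setLIntegral_mono' measurableSet_Ioc (g := fun _ => ENNReal.ofReal ((scale P)⁻¹ * R))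
      fun τ hτ => ?_) ?_
    · rw [an_eq_ofReal]
      have := scale_pos (P := P)
      exact ENNReal.ofReal_le_ofReal (by gcongr; exact hR τ ⟨hτ.1.le, hτ.2⟩)
    · rw [setLIntegral_const]
      exact ENNReal.mul_lt_top ENNReal.ofReal_lt_top (by simp)
  calc xn P.β P.χ P.s _ ≤ ∑' k, wgt P.β P.s k * (growth d 0 T * (‖cv (wav P.β P.χ k) (U₀.val P)‖ₑ +
        ENNReal.ofReal T * ‖cv (wav P.β P.χ k) (U₁.val P)‖ₑ + ENNReal.ofReal T * J k)) :=
        ENNReal.tsum_le_tsum fun k => mul_le_mul_right (h1 k) _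
    _ = growth d 0 T * (an P (U₀.val P) + ENNReal.ofReal T * an P (U₁.val P) +
        ENNReal.ofReal T * ∫⁻ τ in Set.Ioc 0 T, an P ((G τ).val P)) := by
        rw [← h2, an_eq, an_eq, ← ENNReal.tsum_mul_left, ← ENNReal.tsum_mul_left, ← ENNReal.tsum_add, ← ENNReal.tsum_add,
          ← ENNReal.tsum_mul_left]
        refine tsum_congr fun k => by ring
    _ < ∞ := ENNReal.mul_lt_top ENNReal.ofReal_lt_top (ENNReal.add_lt_top.2 ⟨ENNReal.add_lt_top.2
        ⟨U₀.an_lt_top, ENNReal.mul_lt_top ENNReal.ofReal_lt_top U₁.an_lt_top⟩,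
        ENNReal.mul_lt_top ENNReal.ofReal_lt_top h3⟩)

end Blocks

/-! ### Power series of families -/

section Series

variable {P : Par d} {Ω : Type*}

/-- The family `∑ bₙ qⁿ`. -/
noncomputable def ser (b : ℕ → ℝ) (q : Ω → BF d) (ω : Ω) : BF d := ∑' n, (b n : ℂ) • q ω ^ n

/-- Coefficients of infinite radius of convergence. -/
def IsEntire (b : ℕ → ℝ) : Prop := ∀ R : ℝ, Summable fun n => |b n| * R ^ n

/-- Comparison at radius `|R| + 1 ≥ 1`, where one more power only enlarges the terms. -/
theorem IsEntire.shift {b : ℕ → ℝ} (hb : IsEntire b) : IsEntire fun n => b (n + 1) := fun R => by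
  have h1 := ((summable_nat_add_iff 1).2 (hb (|R| + 1)))
  refine Summable.of_norm_bounded h1 fun n => ?_
  rw [norm_mul, norm_pow, Real.norm_eq_abs, abs_abs, Real.norm_eq_abs]
  gcongr
  calc |R| ^ n ≤ (|R| + 1) ^ n := by gcongr; linarith
    _ ≤ _ := pow_le_pow_right₀ (by linarith [abs_nonneg R]) n.le_succ

theorem xn_pow_le {q : Ω → BF d} (hq : xn P.β P.χ P.s q < ∞) (n : ℕ) :
    xn P.β P.χ P.s (q ^ n) ≤ xn P.β P.χ P.s (1 : Ω → BF d) * (mulConst P.β P.χ P.s * xn P.β P.χ P.s q) ^ n := by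
  have hfin : xn P.β P.χ P.s (1 : Ω → BF d) < ∞ := P.adm.xn_one_lt_top
  induction n with
  | zero => simp
  | succ n ih =>
    have h1 : xn P.β P.χ P.s (q ^ n) < ∞ := ih.trans_lt (ENNReal.mul_lt_top hfin
      (ENNReal.pow_lt_top (ENNReal.mul_lt_top P.adm.mulConst_lt_top hq)))
    rw [pow_succ, pow_succ]
    refine (P.adm.xn_mul_le P.nonneg h1 hq).trans ?_
    calc _ ≤ mulConst P.β P.χ P.s * (xn P.β P.χ P.s (1 : Ω → BF d) * (mulConst P.β P.χ P.s * xn P.β P.χ P.s q) ^ n *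
          xn P.β P.χ P.s q) := by gcongr
      _ = _ := by ring

theorem tsum_xn_ser_lt_top {b : ℕ → ℝ} (hb : IsEntire b) {q : Ω → BF d} (hq : xn P.β P.χ P.s q < ∞) :
    ∑' n, xn P.β P.χ P.s ((b n : ℂ) • q ^ n) < ∞ := by
  have hfin : xn P.β P.χ P.s (1 : Ω → BF d) < ∞ := P.adm.xn_one_lt_top
  set m := mulConst P.β P.χ P.s * xn P.β P.χ P.s q with hm
  have hm' : m ≠ ∞ := (ENNReal.mul_lt_top P.adm.mulConst_lt_top hq).ne
  have h1 : ∑' n, ENNReal.ofReal (|b n| * m.toReal ^ n) < ∞ := (hb m.toReal).tsum_ofReal_lt_top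
  have h2 := ENNReal.mul_lt_top hfin h1
  rw [← ENNReal.tsum_mul_left] at h2
  refine lt_of_le_of_lt (ENNReal.tsum_le_tsum fun n => ?_) h2
  rw [xn_smul, ENNReal.ofReal_mul (abs_nonneg _), ENNReal.ofReal_pow ENNReal.toReal_nonneg, ENNReal.ofReal_toReal hm',
    mul_left_comm, ← ofReal_norm, Complex.norm_real, Real.norm_eq_abs]
  gcongr
  exact xn_pow_le hq n

theorem summable_ser {b : ℕ → ℝ} (hb : IsEntire b) {q : Ω → BF d} (hq : xn P.β P.χ P.s q < ∞) (ω : Ω) :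
    Summable fun n => (b n : ℂ) • q ω ^ n := by
  refine Summable.of_enorm (ne_top_of_le_ne_top (tsum_xn_ser_lt_top hb hq).ne (ENNReal.tsum_le_tsum fun n => ?_))
  exact P.adm.enorm_le_xn P.nonneg ((b n : ℂ) • q ^ n) ω

theorem xn_ser_lt_top {b : ℕ → ℝ} (hb : IsEntire b) {q : Ω → BF d} (hq : xn P.β P.χ P.s q < ∞) :
    xn P.β P.χ P.s (ser b q) < ∞ :=
  (xn_tsum_le (fun n => (b n : ℂ) • q ^ n) (ser b q) fun ω => (summable_ser hb hq ω).hasSum).trans_lt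
    (tsum_xn_ser_lt_top hb hq)

/-- Splitting off the constant coefficient isolates the linear part of the nonlinearity, which the
case `p < 1` treats separately. -/
theorem ser_eq {b : ℕ → ℝ} (hb : IsEntire b) {q : Ω → BF d} (hq : xn P.β P.χ P.s q < ∞) :
    ser b q = (b 0 : ℂ) • 1 + q * ser (fun n => b (n + 1)) q := by
  funext ω
  have h := (summable_ser hb hq ω).tsum_eq_zero_add
  simp only [ser, Pi.add_apply, Pi.smul_apply, Pi.one_apply, Pi.mul_apply]
  rw [h, pow_zero, ← (summable_ser hb.shift hq ω).tsum_mul_left]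
  congr 1
  refine tsum_congr fun n => ?_
  rw [pow_succ', mul_smul_comm]

theorem Alg.val_nl {a : ℕ → ℝ} {F : ℂ → ℂ} (ha : IsSeries a F) (u : Ω → Alg P)
    (hq : xn P.β P.χ P.s (fun ω => (u ω).val P * star ((u ω).val P)) < ∞) :
    (fun ω => (nl a (u ω)).val P) = (fun ω => (u ω).val P) * ser a fun ω => (u ω).val P * star ((u ω).val P) := by
  funext ω
  have h1 : (nl a (u ω)).val P = incl (nl a (u ω)) := rfl
  rw [h1, nl, ContinuousLinearMap.map_tsum _ (summable_nl ha (u ω)), Pi.mul_apply, ser,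
    ← (summable_ser ha.summable hq ω).tsum_mul_left]
  refine tsum_congr fun n => ?_
  rw [incl_apply, val_smul, val_mul, val_pow, sq, val_mul, val_conj, mul_smul_comm]

/-- The nonlinearity as a product of families. -/
theorem Alg.exists_factor {a : ℕ → ℝ} {F : ℂ → ℂ} (ha : IsSeries a F) (u : Ω → Alg P)
    (hu : xn P.β P.χ P.s (fun ω => (u ω).val P) < ∞) :
    ∃ h H : Ω → BF d, xn P.β P.χ P.s h < ∞ ∧ xn P.β P.χ P.s H < ∞ ∧
      (fun ω => (nl a (u ω)).val P) = (fun ω => (u ω).val P) * H ∧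
      (fun ω => (nl a (u ω)).val P) = (a 0 : ℂ) • (fun ω => (u ω).val P) +
        (fun ω => (u ω).val P) * ((fun ω => (u ω).val P) * h) := by
  set f : Ω → BF d := fun ω => (u ω).val P with hf
  have hs : xn P.β P.χ P.s (star f) < ∞ := (P.adm.xn_star_le P.nonneg hu).trans_lt
    (ENNReal.mul_lt_top P.adm.mulConst_lt_top hu)
  have hmul : ∀ {f g : Ω → BF d}, xn P.β P.χ P.s f < ∞ → xn P.β P.χ P.s g < ∞ → xn P.β P.χ P.s (f * g) < ∞ :=
    fun hf hg => (P.adm.xn_mul_le P.nonneg hf hg).trans_lt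
      (ENNReal.mul_lt_top P.adm.mulConst_lt_top (ENNReal.mul_lt_top hf hg))
  have hq : xn P.β P.χ P.s (f * star f) < ∞ := hmul hu hs
  have e := val_nl ha u hq
  refine ⟨star f * ser (fun n => a (n + 1)) (f * star f), ser a (f * star f),
    hmul hs (xn_ser_lt_top (IsEntire.shift ha.summable) hq), xn_ser_lt_top ha.summable hq, e, ?_⟩
  refine e.trans ?_
  change f * ser a (f * star f) = _
  rw [ser_eq ha.summable hq, mul_add, mul_smul_comm, mul_one, mul_assoc]

end Series

/-! ### The `L^p` quasi-norm of nonnegative functions -/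

theorem rpow_iSup {ι : Sort*} (f : ι → ℝ≥0∞) {p : ℝ} (hp : 0 < p) : (⨆ i, f i) ^ p = ⨆ i, f i ^ p :=
  (ENNReal.orderIsoRpow p hp).map_iSup f

theorem lpn_add_le {p : ℝ} (hp : 1 ≤ p) (μ : Measure (Sp d)) {f g : Sp d → ℝ≥0∞} (hf : Measurable f) (hg : Measurable g) :
    lpn p μ (fun x => f x + g x) ≤ lpn p μ f + lpn p μ g :=
  ENNReal.lintegral_Lp_add_le hf.aemeasurable hg.aemeasurable hp

theorem lpn_zero {p : ℝ} (hp : 0 < p) (μ : Measure (Sp d)) : lpn p μ (fun _ => 0) = 0 := by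
  simp [lpn, ENNReal.zero_rpow_of_pos hp, hp]

theorem lpn_sum_le {ι : Type*} {p : ℝ} (hp : 1 ≤ p) (μ : Measure (Sp d)) {f : ι → Sp d → ℝ≥0∞}
    (hf : ∀ i, Measurable (f i)) (s : Finset ι) :
    lpn p μ (fun x => ∑ i ∈ s, f i x) ≤ ∑ i ∈ s, lpn p μ (f i) := by
  classical
  induction s using Finset.induction_on with
  | empty => simp [lpn_zero (by linarith : 0 < p)]
  | insert i s hi ih =>
    simp only [Finset.sum_insert hi]
    exact (lpn_add_le hp μ (hf i) (Finset.measurable_sum _ fun i _ => hf i)).trans (by gcongr)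

/-- Minkowski's inequality for finite sums and monotone convergence over finite subsets. -/
theorem lpn_tsum_le {ι : Type*} [Countable ι] {p : ℝ} (hp : 1 ≤ p) (μ : Measure (Sp d)) {f : ι → Sp d → ℝ≥0∞}
    (hf : ∀ i, Measurable (f i)) : lpn p μ (fun x => ∑' i, f i x) ≤ ∑' i, lpn p μ (f i) := by
  have hp0 : 0 < p := by linarith
  have h1 : lpn p μ (fun x => ∑' i, f i x) = ⨆ s : Finset ι, lpn p μ (fun x => ∑ i ∈ s, f i x) := by
    simp only [lpn, ENNReal.tsum_eq_iSup_sum, rpow_iSup _ hp0]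
    rw [lintegral_iSup_directed, rpow_iSup _ (by positivity)]
    · exact fun s => ((Finset.measurable_sum _ fun i _ => hf i).pow_const p).aemeasurable
    · refine Monotone.directed_le fun s t hst x => ENNReal.rpow_le_rpow ?_ hp0.le
      exact Finset.sum_le_sum_of_subset hst
  rw [h1]
  exact iSup_le fun s => (lpn_sum_le hp μ hf s).trans (ENNReal.sum_le_tsum s)

theorem add_rpow_le (a b : ℝ≥0∞) {p : ℝ} (hp : 0 < p) : (a + b) ^ p ≤ 2 ^ p * (a ^ p + b ^ p) := by
  wlog h : a ≤ b generalizing a b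
  · rw [add_comm a, add_comm (a ^ p)]
    exact this b a (le_of_not_ge h)
  calc (a + b) ^ p ≤ (2 * b) ^ p := by rw [two_mul]; gcongr
    _ = 2 ^ p * b ^ p := ENNReal.mul_rpow_of_nonneg _ _ hp.le
    _ ≤ _ := by gcongr; exact le_add_self

/-- A quasi-triangle inequality valid for every `p > 0`, from `a + b ≤ 2 max a b`. -/
theorem lpn_add_le_quasi {p : ℝ} (hp : 0 < p) (μ : Measure (Sp d)) {f g : Sp d → ℝ≥0∞} (hf : Measurable f) :
    lpn p μ (fun x => f x + g x) ≤ 2 * 2 ^ (1 / p) * (lpn p μ f + lpn p μ g) := by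
  have h1 : ∫⁻ x, (f x + g x) ^ p ∂μ ≤ 2 ^ p * (∫⁻ x, f x ^ p ∂μ + ∫⁻ x, g x ^ p ∂μ) := by
    rw [← lintegral_add_left (hf.pow_const p), ← lintegral_const_mul' _ _ (by simp)]
    exact lintegral_mono fun x => add_rpow_le _ _ hp
  refine (ENNReal.rpow_le_rpow h1 (by positivity)).trans ?_
  rw [ENNReal.mul_rpow_of_nonneg _ _ (by positivity), ← ENNReal.rpow_mul, mul_one_div_cancel hp.ne', ENNReal.rpow_one,
    mul_assoc]
  gcongr
  exact add_rpow_le _ _ (by positivity)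

/-- Monotone convergence along an exhaustion by balls. It removes a localisation made only to secure
finiteness before absorbing. -/
theorem tsum_lpn_le_of_restrict {ι : Type*} {p : ℝ} (hp : 0 < p) {f : ι → Sp d → ℝ≥0∞} {c : ι → ℝ≥0∞} {C : ℝ≥0∞}
    (hc : ∀ i, c i ≠ ∞)
    (h : ∀ n : ℕ, ∑' i, c i * lpn p (volume.restrict (Metric.closedBall 0 n)) (f i) ≤ C) :
    ∑' i, c i * lpn p volume (f i) ≤ C := by
  have hmono : Monotone fun n : ℕ => Metric.closedBall (0 : Sp d) n := fun n m hnm =>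
    Metric.closedBall_subset_closedBall (by exact_mod_cast hnm)
  have h1 : ∀ i, lpn p volume (f i) = ⨆ n : ℕ, lpn p (volume.restrict (Metric.closedBall 0 n)) (f i) := fun i => by
    simp only [lpn]
    rw [← rpow_iSup _ (by positivity), ← setLIntegral_iUnion_of_directed _ hmono.directed_le,
      Metric.iUnion_closedBall_nat, Measure.restrict_univ]
  rw [ENNReal.tsum_eq_iSup_sum]
  refine iSup_le fun s => ?_
  have h2 : Tendsto (fun n : ℕ => ∑ i ∈ s, c i * lpn p (volume.restrict (Metric.closedBall 0 n)) (f i)) atTop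
      (𝓝 (∑ i ∈ s, c i * lpn p volume (f i))) := by
    refine tendsto_finsetSum _ fun i _ => ENNReal.Tendsto.const_mul ?_ (Or.inr (hc i))
    rw [h1]
    exact tendsto_atTop_iSup fun n m hnm => lpn_mono hp (Measure.restrict_mono (hmono hnm) le_rfl) fun _ => le_rfl
  exact le_of_tendsto' h2 fun n => (ENNReal.sum_le_tsum s).trans (h n)

/-! ### The maximal function of a family -/

section Majorant

variable {P : Par d}

/-- The weight `e^{-γt} (1 + |x - y|)^{-N}`. -/
noncomputable def ew (γ : ℝ) (N : ℕ) {T : ℝ} (x : Sp d) (ω : Set.Icc 0 T) (y : Sp d) : ℝ≥0∞ :=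
  ENNReal.ofReal (Real.exp (-γ * ω)) * kap N (x - y)

theorem slowWeight_kap (N : ℕ) {Ω : Type*} (x : Sp d) : SlowWeight N fun (_ : Ω) y => kap N (x - y) :=
  fun _ y z => kap_slow N x y z

theorem slowWeight_ew (γ : ℝ) (N : ℕ) {T : ℝ} (x : Sp d) : SlowWeight N (ew (T := T) γ N x) := fun ω y z => by
  rw [ew, ew, mul_assoc]
  gcongr
  exact kap_slow N x y z

theorem ew_zero (N : ℕ) {T : ℝ} (x : Sp d) : ew (T := T) 0 N x = fun _ y => kap N (x - y) := by
  funext ω y; simp [ew]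

theorem ew_add (γ : ℝ) (N M : ℕ) {T : ℝ} (x : Sp d) : ew (T := T) γ (N + M) x = ew γ N x * ew 0 M x := by
  funext ω y
  rw [Pi.mul_apply, Pi.mul_apply, ew, ew, ew_zero, kap_add, mul_assoc]

theorem ew_le (N : ℕ) {γ T : ℝ} (hγ : 0 ≤ γ) (x : Sp d) (ω : Set.Icc 0 T) (y : Sp d) : ew γ N x ω y ≤ ew 0 N x ω y := by
  rw [ew, ew]
  gcongr
  have := ω.2.1
  nlinarith

theorem ew_zero_le (N : ℕ) {γ T : ℝ} (hγ : 0 ≤ γ) (x : Sp d) (ω : Set.Icc 0 T) (y : Sp d) :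
    ew 0 N x ω y ≤ ENNReal.ofReal (Real.exp (γ * T)) * ew γ N x ω y := by
  rw [ew, ew, ← mul_assoc, ← ENNReal.ofReal_mul (Real.exp_pos _).le, ← Real.exp_add]
  gcongr
  have := ω.2.2
  nlinarith

variable (P) in
/-- The maximal function of a frequency block of a family. -/
noncomputable def mx (γ : ℝ) (N : ℕ) {T : ℝ} (k : Fin d → ℤ) (F : Set.Icc 0 T → BF d) (x : Sp d) : ℝ≥0∞ :=
  wsup (ew γ N x) (blk P.β P.χ k F)

theorem mx_mono_weight {T : ℝ} {N : ℕ} {k : Fin d → ℤ} {F : Set.Icc 0 T → BF d} {x : Sp d} {γ γ' : ℝ} {c : ℝ≥0∞}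
    (h : ∀ ω : Set.Icc 0 T, ∀ y, ew γ N x ω y ≤ c * ew γ' N x ω y) : mx P γ N k F x ≤ c * mx P γ' N k F x := by
  refine iSup_le fun ω => iSup_le fun y => ?_
  refine (mul_le_mul_left (h ω y) _).trans ?_
  rw [mul_assoc]
  exact mul_le_mul_right (le_wsup (ew γ' N x) (blk P.β P.χ k F) ω y) _

theorem mx_le_zero {T : ℝ} {N : ℕ} {k : Fin d → ℤ} {F : Set.Icc 0 T → BF d} {x : Sp d} {γ : ℝ} (hγ : 0 ≤ γ) :
    mx P γ N k F x ≤ mx P 0 N k F x := by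
  have := mx_mono_weight (P := P) (k := k) (F := F) (c := 1) (x := x) (N := N) (γ := γ) (γ' := 0)
    fun ω y => by rw [one_mul]; exact ew_le N hγ x ω y
  rwa [one_mul] at this

theorem mx_zero_le {T : ℝ} {N : ℕ} {k : Fin d → ℤ} {F : Set.Icc 0 T → BF d} {x : Sp d} {γ : ℝ} (hγ : 0 ≤ γ) :
    mx P 0 N k F x ≤ ENNReal.ofReal (Real.exp (γ * T)) * mx P γ N k F x :=
  mx_mono_weight fun ω y => ew_zero_le N hγ x ω y

theorem mx_zero_le_wsup {T : ℝ} (N : ℕ) (k : Fin d → ℤ) (F : Set.Icc 0 T → BF d) (x : Sp d) :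
    mx P 0 N k F x ≤ wsup 1 (blk P.β P.χ k F) := by
  refine iSup_le fun ω => iSup_le fun y => ?_
  refine le_trans (mul_le_mul_left ?_ _) (le_wsup 1 (blk P.β P.χ k F) ω y)
  rw [ew_zero]
  exact kap_le_one _ _

theorem enorm_le_mx {T : ℝ} (N : ℕ) (k : Fin d → ℤ) (F : Set.Icc 0 T → BF d) (ω : Set.Icc 0 T) (x : Sp d) :
    ‖cv (wav P.β P.χ k) (F ω) x‖ₑ ≤ mx P 0 N k F x := by
  refine le_trans (le_of_eq ?_) (le_wsup (ew 0 N x) (blk P.β P.χ k F) ω x)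
  simp [ew_zero, kap_zero, blk]

theorem measurable_mx (γ : ℝ) (N : ℕ) {T : ℝ} (k : Fin d → ℤ) (F : Set.Icc 0 T → BF d) : Measurable (mx P γ N k F) := by
  refine (lowerSemicontinuous_iSup fun ω => lowerSemicontinuous_iSup fun y =>
    (Continuous.lowerSemicontinuous ?_)).measurable
  have h := continuous_kap (d := d) N
  refine (ENNReal.continuous_mul_const enorm_ne_top).comp ((ENNReal.continuous_const_mul ENNReal.ofReal_ne_top).comp ?_)
  exact h.comp (continuous_id.sub continuous_const)

theorem lintegral_exp_le {γ : ℝ} (hγ : 0 < γ) {t : ℝ} (ht : 0 ≤ t) :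
    ∫⁻ τ in Set.Ioc 0 t, ENNReal.ofReal (Real.exp (-γ * (t - τ))) ≤ ENNReal.ofReal (1 / γ) := by
  have hc : Continuous fun τ => Real.exp (-γ * (t - τ)) := by fun_prop
  rw [← ofReal_integral_eq_lintegral_ofReal (hc.integrableOn_Ioc) (ae_of_all _ fun τ => (Real.exp_pos _).le),
    ← intervalIntegral.integral_of_le ht]
  refine ENNReal.ofReal_le_ofReal ?_
  have hd : ∀ τ ∈ Set.uIcc 0 t, HasDerivAt (fun τ => γ⁻¹ * Real.exp (-γ * (t - τ))) (Real.exp (-γ * (t - τ))) τ := fun τ _ => by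
    have h1 : HasDerivAt (fun τ => -γ * (t - τ)) γ τ := by
      simpa using ((hasDerivAt_id τ).const_sub t).const_mul (-γ)
    refine (h1.exp.const_mul γ⁻¹).congr_deriv ?_
    field_simp
  rw [intervalIntegral.integral_eq_sub_of_hasDerivAt hd (hc.intervalIntegrable _ _)]
  simp only [sub_self, mul_zero, Real.exp_zero, mul_one, one_div]
  have : 0 ≤ γ⁻¹ * Real.exp (-γ * (t - 0)) := by positivity
  linarith

variable (P) in
/-- The contribution of the data to the maximal function. -/
noncomputable def dataMx (N : ℕ) (T : ℝ) (k : Fin d → ℤ) (g₀ g₁ : BF d) (x : Sp d) : ℝ≥0∞ :=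
  growth d N T * (pe N (cv (wav P.β P.χ k) g₀) x + ENNReal.ofReal T * pe N (cv (wav P.β P.χ k) g₁) x)

theorem measurable_dataMx (N : ℕ) (T : ℝ) (k : Fin d → ℤ) (g₀ g₁ : BF d) : Measurable (dataMx P N T k g₀ g₁) :=
  ((measurable_pe N _).add ((measurable_pe N _).const_mul _)).const_mul _

/-- Against the weight `e^{-γt}` the time integral leaves `∫ e^{-γ(t - τ)} dτ ≤ 1 / γ`, so the
forcing contributes little for large `γ`, while the data are simply bounded. -/
theorem mx_duhamel_le (U₀ U₁ : Alg P) {G : ℝ → Alg P} (hG : Continuous G) (N : ℕ) {T γ : ℝ} (hγ : 0 < γ) (k : Fin d → ℤ)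
    (x : Sp d) : mx P γ N k (fun t : Set.Icc 0 T => (Alg.duhamel U₀ U₁ G t).val P) x ≤
      dataMx P N T k (U₀.val P) (U₁.val P) x +
        growth d N T * ENNReal.ofReal (T / γ) * mx P γ N k (fun t : Set.Icc 0 T => (G t).val P) x := by
  set B := mx P γ N k (fun t : Set.Icc 0 T => (G t).val P) x with hB
  refine iSup_le fun t => iSup_le fun y => ?_
  have ht0 := t.2.1
  have hT0 : 0 ≤ T := ht0.trans t.2.2
  have h1 := mul_enorm_duhamel_le (P := P) (slowWeight_kap N x) k U₀ U₁ hG t.2 y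
  have h2 : ∀ τ ∈ Set.Ioc 0 (t : ℝ), bs P (fun y => kap N (x - y)) k ((G τ).val P) ≤ ENNReal.ofReal (Real.exp (γ * τ)) * B := by
    intro τ hτ
    refine iSup_le fun y => ?_
    have h3 := le_wsup (ew γ N x) (blk P.β P.χ k fun t : Set.Icc 0 T => (G t).val P) ⟨τ, hτ.1.le, hτ.2.trans t.2.2⟩ y
    calc kap N (x - y) * ‖cv (wav P.β P.χ k) ((G τ).val P) y‖ₑ
        = ENNReal.ofReal (Real.exp (γ * τ)) * (ENNReal.ofReal (Real.exp (-γ * τ)) * kap N (x - y) *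
            ‖cv (wav P.β P.χ k) ((G τ).val P) y‖ₑ) := by
          rw [← mul_assoc, ← mul_assoc, ← ENNReal.ofReal_mul (Real.exp_pos _).le, ← Real.exp_add]
          simp
      _ ≤ _ := by gcongr; exact h3
  have h4 : ENNReal.ofReal (Real.exp (-γ * t)) * ∫⁻ τ in Set.Ioc 0 (t : ℝ), ENNReal.ofReal (t - τ) *
      bs P (fun y => kap N (x - y)) k ((G τ).val P) ≤ ENNReal.ofReal (T / γ) * B := by
    rw [← lintegral_const_mul' _ _ ENNReal.ofReal_ne_top]
    calc _ ≤ ∫⁻ τ in Set.Ioc 0 (t : ℝ), ENNReal.ofReal (Real.exp (-γ * (t - τ))) * (ENNReal.ofReal T * B) := by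
          refine setLIntegral_mono' measurableSet_Ioc fun τ hτ => ?_
          calc _ ≤ ENNReal.ofReal (Real.exp (-γ * t)) * (ENNReal.ofReal T * (ENNReal.ofReal (Real.exp (γ * τ)) * B)) := by
                gcongr
                · linarith [hτ.1, t.2.2]
                · exact h2 τ hτ
            _ = (ENNReal.ofReal (Real.exp (-γ * t)) * ENNReal.ofReal (Real.exp (γ * τ))) * (ENNReal.ofReal T * B) := by ring
            _ = _ := by
              rw [← ENNReal.ofReal_mul (Real.exp_pos _).le, ← Real.exp_add]
              congr 3; ring
      _ = (∫⁻ τ in Set.Ioc 0 (t : ℝ), ENNReal.ofReal (Real.exp (-γ * (t - τ)))) * (ENNReal.ofReal T * B) :=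
          lintegral_mul_const _ (by fun_prop)
      _ ≤ ENNReal.ofReal (1 / γ) * (ENNReal.ofReal T * B) := by gcongr; exact lintegral_exp_le hγ ht0
      _ = _ := by
          rw [← mul_assoc, ← ENNReal.ofReal_mul (by positivity), one_div_mul_eq_div]
  have h5 : ENNReal.ofReal (Real.exp (-γ * t)) ≤ 1 := by
    rw [← ENNReal.ofReal_one]
    refine ENNReal.ofReal_le_ofReal (Real.exp_le_one_iff.2 ?_)
    nlinarith
  calc _ = ENNReal.ofReal (Real.exp (-γ * t)) * (kap N (x - y) * ‖cv (wav P.β P.χ k) ((Alg.duhamel U₀ U₁ G t).val P) y‖ₑ) :=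
        mul_assoc _ _ _
    _ ≤ ENNReal.ofReal (Real.exp (-γ * t)) * _ := mul_le_mul_right h1 _
    _ = ENNReal.ofReal (Real.exp (-γ * t)) * dataMx P N T k (U₀.val P) (U₁.val P) x +
        growth d N T * (ENNReal.ofReal (Real.exp (-γ * t)) * ∫⁻ τ in Set.Ioc 0 (t : ℝ), ENNReal.ofReal (t - τ) *
          bs P (fun y => kap N (x - y)) k ((G τ).val P)) := by
        rw [dataMx, pe, pe, bs, bs]; ring
    _ ≤ 1 * dataMx P N T k (U₀.val P) (U₁.val P) x + growth d N T * (ENNReal.ofReal (T / γ) * B) := by gcongr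
    _ = _ := by rw [one_mul, mul_assoc]

theorem isBand_cv (g : BF d) (k : Fin d → ℤ) : IsBand fun x => cv (wav P.β P.χ k) g x := by
  have h := P.adm.isBand (distL g) k
  have e : conv (distL g) (wav P.β P.χ k) = fun x => cv (wav P.β P.χ k) g x := funext fun x => conv_distL _ _ x
  rwa [e] at h

theorem tsum_lpn_dataMx_lt_top {p : ℝ} (hp0 : 0 < p) {N : ℕ} (hN : (d : ℝ) < N * min 1 p) (T : ℝ) {g₀ g₁ : BF d}
    (h₀ : ∑' k, wgt P.β P.s k * lpn p volume (fun x => ‖cv (wav P.β P.χ k) g₀ x‖ₑ) < ∞)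
    (h₁ : ∑' k, wgt P.β P.s k * lpn p volume (fun x => ‖cv (wav P.β P.χ k) g₁ x‖ₑ) < ∞) :
    ∑' k, wgt P.β P.s k * lpn p volume (dataMx P N T k g₀ g₁) < ∞ := by
  set Q : ℝ≥0∞ := growth d N T * (2 * 2 ^ (1 / p)) with hQ
  have hQ' : Q ≠ ∞ := ENNReal.mul_ne_top ENNReal.ofReal_ne_top
    (ENNReal.mul_ne_top (by simp) (ENNReal.rpow_ne_top_of_nonneg (by positivity) (by simp)))
  have hb := bandConst_lt_top hp0 hN
  have key : ∀ k, lpn p volume (dataMx P N T k g₀ g₁) ≤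
      Q * (bandConst d N p * lpn p volume (fun x => ‖cv (wav P.β P.χ k) g₀ x‖ₑ) +
        ENNReal.ofReal T * (bandConst d N p * lpn p volume (fun x => ‖cv (wav P.β P.χ k) g₁ x‖ₑ))) := fun k => by
    have hm0 := measurable_pe N (cv (wav P.β P.χ k) g₀)
    have hm1 := measurable_pe N (cv (wav P.β P.χ k) g₁)
    have e : lpn p volume (dataMx P N T k g₀ g₁) = growth d N T * lpn p volume (fun x =>
        pe N (cv (wav P.β P.χ k) g₀) x + ENNReal.ofReal T * pe N (cv (wav P.β P.χ k) g₁) x) :=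
      lpn_const_mul hp0 _ (hm0.add (hm1.const_mul _)) _
    rw [e, hQ, mul_assoc]
    refine mul_le_mul_right ((lpn_add_le_quasi hp0 _ hm0).trans (mul_le_mul_right ?_ _)) _
    rw [lpn_const_mul hp0 _ hm1]
    exact add_le_add ((isBand_cv g₀ k).lpn_pe_le N hp0) (mul_le_mul_right ((isBand_cv g₁ k).lpn_pe_le N hp0) _)
  have h2 : ∑' k, wgt P.β P.s k * lpn p volume (dataMx P N T k g₀ g₁) ≤
      Q * (bandConst d N p * ∑' k, wgt P.β P.s k * lpn p volume (fun x => ‖cv (wav P.β P.χ k) g₀ x‖ₑ) +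
        ENNReal.ofReal T * (bandConst d N p * ∑' k, wgt P.β P.s k * lpn p volume (fun x => ‖cv (wav P.β P.χ k) g₁ x‖ₑ))) := by
    simp only [← ENNReal.tsum_mul_left, ← ENNReal.tsum_add]
    refine ENNReal.tsum_le_tsum fun k => (mul_le_mul_right (key k) _).trans (le_of_eq (by ring))
  exact h2.trans_lt (ENNReal.mul_lt_top hQ'.lt_top (ENNReal.add_lt_top.2 ⟨ENNReal.mul_lt_top hb h₀,
    ENNReal.mul_lt_top ENNReal.ofReal_lt_top (ENNReal.mul_lt_top hb h₁)⟩))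

end Majorant

/-! ### Persistence of integrability -/

section Persistence

variable {P : Par d}

/-- Absorption of the last term. Subtraction is legitimate only for finite `S`, so each use is
prepared by an a priori finiteness proof. -/
theorem le_two_mul_of_le_add_half {S L : ℝ≥0∞} (hS : S ≠ ∞) {c : ℝ≥0∞} (hc : c ≤ 1 / 2) (h : S ≤ L + c * S) : S ≤ 2 * L := by
  have h1 : S / 2 + S / 2 ≤ L + S / 2 := by
    rw [ENNReal.add_halves]
    refine h.trans ?_
    gcongr
    rw [ENNReal.div_eq_inv_mul]
    gcongr
    simpa using hc
  have h2 := (ENNReal.add_le_add_iff_right (ENNReal.div_ne_top hS (by simp))).1 h1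
  rw [ENNReal.div_le_iff (by simp) (by simp)] at h2
  rwa [mul_comm]

theorem exists_small (T : ℝ) {Q : ℝ≥0∞} (hQ : Q ≠ ∞) : ∃ γ : ℝ, 0 < γ ∧ ENNReal.ofReal (T / γ) * Q ≤ 1 / 2 := by
  refine ⟨2 * |T| * Q.toReal + 1, by positivity, ?_⟩
  set γ := 2 * |T| * Q.toReal + 1 with hγ
  have hγ0 : 0 < γ := by positivity
  rw [← ENNReal.ofReal_toReal hQ, ← ENNReal.ofReal_mul' ENNReal.toReal_nonneg]
  have e : (1 / 2 : ℝ≥0∞) = ENNReal.ofReal (1 / 2) := by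
    rw [ENNReal.ofReal_div_of_pos (by norm_num)]; simp
  rw [e]
  refine ENNReal.ofReal_le_ofReal ?_
  rw [div_mul_eq_mul_div, div_le_iff₀ hγ0]
  have : T * Q.toReal ≤ |T| * Q.toReal := mul_le_mul_of_nonneg_right (le_abs_self T) ENNReal.toReal_nonneg
  linarith

variable {T : ℝ} {U₀ U₁ : Alg P} {G : ℝ → Alg P} {h H f : Set.Icc 0 T → BF d}

/-- The whole weight is placed on `f` and none on `H`, so the estimate is linear in the maximal
function of `f`. -/
theorem mx_zero_mul_le {N : ℕ} (hf : xn P.β P.χ P.s f < ∞) (hH : xn P.β P.χ P.s H < ∞) (k : Fin d → ℤ) (x : Sp d) {γ : ℝ} :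
    mx P γ N k (f * H) x ≤ lw N P.χ * ∑' l, ∑' m, near P.β (k - l - m) * (mx P γ N l f x * wsup 1 (blk P.β P.χ m H)) := by
  have h1 : ew (T := T) γ N x = ew γ N x * 1 := (mul_one _).symm
  have h2 := P.adm.wsup_blk_mul_le (ν := ew (T := T) γ N x) (ν' := 1) (N := N) (by rw [mul_one]; exact slowWeight_ew γ N x)
    (summable_norm_cv_of_xn P.nonneg hf) (summable_norm_cv_of_xn P.nonneg hH) k
  rwa [mul_one] at h2

/-- Persistence of integrability for `p ≥ 1`. -/
theorem persistence_of_one_le {p : ℝ} (hp : 1 ≤ p) {N : ℕ} (hN : d < N) (hG : Continuous G)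
    (hfu : f = fun t : Set.Icc 0 T => (Alg.duhamel U₀ U₁ G t).val P)
    (hf : xn P.β P.χ P.s f < ∞) (hH : xn P.β P.χ P.s H < ∞) (hGf : (fun t : Set.Icc 0 T => (G t).val P) = f * H)
    (h₀ : ∑' k, wgt P.β P.s k * lpn p volume (fun x => ‖cv (wav P.β P.χ k) (U₀.val P) x‖ₑ) < ∞)
    (h₁ : ∑' k, wgt P.β P.s k * lpn p volume (fun x => ‖cv (wav P.β P.χ k) (U₁.val P) x‖ₑ) < ∞) :
    ∑' k, wgt P.β P.s k * lpn p volume (mx P 0 N k f) < ∞ := by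
  have hp0 : 0 < p := by linarith
  have hd := tsum_lpn_dataMx_lt_top (P := P) hp0 (N := N) (by rw [min_eq_left hp, mul_one]; exact_mod_cast hN) T h₀ h₁
  set c30 := ENNReal.ofReal (30 ^ (P.s / 2)) * ∑' j : Fin d → ℤ, near P.β j with hc30
  have hc30' : c30 ≠ ∞ := ENNReal.mul_ne_top ENNReal.ofReal_ne_top (tsum_near_lt_top P.adm.pos).ne
  set Q := growth d N T * lw N P.χ * c30 * xn P.β P.χ P.s H with hQ
  have hQ' : Q ≠ ∞ := ENNReal.mul_ne_top (ENNReal.mul_ne_top (ENNReal.mul_ne_top ENNReal.ofReal_ne_top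
    (lw_lt_top _ _).ne) hc30') hH.ne
  obtain ⟨γ, hγ0, hγ⟩ := exists_small T hQ'
  set ε := growth d N T * ENNReal.ofReal (T / γ) * lw N P.χ with hε
  have hpt : ∀ k x, mx P γ N k f x ≤ dataMx P N T k (U₀.val P) (U₁.val P) x +
      ∑' l, (ε * ∑' m, near P.β (k - l - m) * wsup 1 (blk P.β P.χ m H)) * mx P γ N l f x := fun k x => by
    have h2 := mx_duhamel_le U₀ U₁ hG N (T := T) hγ0 k x
    rw [← hfu, hGf] at h2
    refine h2.trans (add_le_add_right ((mul_le_mul_right (mx_zero_mul_le hf hH k x) _).trans (le_of_eq ?_)) _)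
    rw [← mul_assoc, ← hε, ← ENNReal.tsum_mul_left]
    refine tsum_congr fun l => ?_
    rw [mul_assoc ε, ← ENNReal.tsum_mul_right]
    exact congrArg _ (tsum_congr fun m => by ring)
  -- For a finite measure the left side is finite because the blocks are bounded and summable, so it
  -- can absorb. The resulting bound does not involve `μ`.
  have hmain : ∀ μ : Measure (Sp d), μ ≤ volume → μ Set.univ ≠ ∞ →
      ∑' k, wgt P.β P.s k * lpn p μ (mx P γ N k f) ≤
        2 * ∑' k, wgt P.β P.s k * lpn p volume (dataMx P N T k (U₀.val P) (U₁.val P)) := by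
    intro μ hμ hfin
    have hlp : ∀ k, lpn p μ (mx P γ N k f) ≤ lpn p volume (dataMx P N T k (U₀.val P) (U₁.val P)) +
        ε * ∑' l, ∑' m, near P.β (k - l - m) * (lpn p μ (mx P γ N l f) * wsup 1 (blk P.β P.χ m H)) := fun k => by
      have hm : ∀ l, Measurable fun x => (ε * ∑' m, near P.β (k - l - m) * wsup 1 (blk P.β P.χ m H)) * mx P γ N l f x :=
        fun l => (measurable_mx γ N l f).const_mul _
      refine (lpn_mono hp0 le_rfl (hpt k)).trans ((lpn_add_le hp μ (measurable_dataMx _ _ _ _ _)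
        (Measurable.tsum hm)).trans (add_le_add (lpn_mono hp0 hμ fun _ => le_rfl)
        ((lpn_tsum_le hp μ hm).trans (le_of_eq ?_))))
      rw [← ENNReal.tsum_mul_left]
      refine tsum_congr fun l => ?_
      rw [lpn_const_mul hp0 μ (measurable_mx γ N l f), mul_assoc, ← ENNReal.tsum_mul_right]
      exact congrArg _ (tsum_congr fun m => by ring)
    have hSfin : ∑' k, wgt P.β P.s k * lpn p μ (mx P γ N k f) ≠ ∞ := by
      have h3 : ∀ k, lpn p μ (mx P γ N k f) ≤ wsup 1 (blk P.β P.χ k f) * μ Set.univ ^ (1 / p) := fun k => by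
        calc lpn p μ (mx P γ N k f) ≤ lpn p μ fun _ => wsup 1 (blk P.β P.χ k f) :=
              lpn_mono hp0 le_rfl fun x => (mx_le_zero hγ0.le).trans (mx_zero_le_wsup N k f x)
          _ = _ := by
            rw [lpn, lintegral_const, ENNReal.mul_rpow_of_nonneg _ _ (by positivity), ← ENNReal.rpow_mul,
              mul_one_div_cancel hp0.ne', ENNReal.rpow_one]
      have h4 : ∑' k, wgt P.β P.s k * lpn p μ (mx P γ N k f) ≤ xn P.β P.χ P.s f * μ Set.univ ^ (1 / p) := by
        rw [xn, ← ENNReal.tsum_mul_right]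
        exact ENNReal.tsum_le_tsum fun k => (mul_le_mul_right (h3 k) _).trans_eq (mul_assoc _ _ _).symm
      exact ne_top_of_le_ne_top (ENNReal.mul_ne_top hf.ne (ENNReal.rpow_ne_top_of_nonneg (by positivity) hfin)) h4
    refine le_two_mul_of_le_add_half hSfin hγ ?_
    calc ∑' k, wgt P.β P.s k * lpn p μ (mx P γ N k f)
        ≤ ∑' k, wgt P.β P.s k * (lpn p volume (dataMx P N T k (U₀.val P) (U₁.val P)) +
          ε * ∑' l, ∑' m, near P.β (k - l - m) * (lpn p μ (mx P γ N l f) * wsup 1 (blk P.β P.χ m H))) :=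
          ENNReal.tsum_le_tsum fun k => mul_le_mul_right (hlp k) _
      _ = ∑' k, wgt P.β P.s k * lpn p volume (dataMx P N T k (U₀.val P) (U₁.val P)) +
          ε * ∑' k, wgt P.β P.s k * ∑' l, ∑' m, near P.β (k - l - m) *
            (lpn p μ (mx P γ N l f) * wsup 1 (blk P.β P.χ m H)) := by
          rw [← ENNReal.tsum_mul_left, ← ENNReal.tsum_add]
          exact tsum_congr fun k => by ring
      _ ≤ ∑' k, wgt P.β P.s k * lpn p volume (dataMx P N T k (U₀.val P) (U₁.val P)) +
          ε * (ENNReal.ofReal (30 ^ (P.s / 2)) * ((∑' j : Fin d → ℤ, near P.β j) *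
            ((∑' l, wgt P.β P.s l * lpn p μ (mx P γ N l f)) * xn P.β P.χ P.s H))) := by
          gcongr
          exact tsum_wgt_near_le P.nonneg _ _
      _ = _ := by rw [hQ, hε, hc30]; ring
  have h5 := tsum_lpn_le_of_restrict hp0 (fun k => wgt_ne_top P.β P.s k) (f := fun k => mx P γ N k f) fun n =>
    hmain (volume.restrict (Metric.closedBall 0 n)) Measure.restrict_le_self (by
      rw [Measure.restrict_apply_univ]; exact measure_closedBall_lt_top.ne)
  have h6 : ∑' k, wgt P.β P.s k * lpn p volume (mx P 0 N k f) ≤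
      ENNReal.ofReal (Real.exp (γ * T)) * ∑' k, wgt P.β P.s k * lpn p volume (mx P γ N k f) := by
    rw [← ENNReal.tsum_mul_left]
    refine ENNReal.tsum_le_tsum fun k => ?_
    rw [mul_left_comm, ← lpn_const_mul hp0 _ (measurable_mx γ N k f)]
    gcongr
    exact lpn_mono hp0 le_rfl fun x => mx_zero_le hγ0.le
  exact h6.trans_lt (ENNReal.mul_lt_top ENNReal.ofReal_lt_top (h5.trans_lt (ENNReal.mul_lt_top (by simp) hd)))

theorem lpn_one (μ : Measure (Sp d)) (g : Sp d → ℝ≥0∞) : lpn 1 μ g = ∫⁻ x, g x ∂μ := by simp [lpn]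

/-- Hölder's inequality for `W ^ p = (W * U ^ (-θ)) ^ p * U ^ (1 - p)` with `θ = (1 - p) / p`. Where
`U` vanishes so does `W`, and the value of the negative power is irrelevant. -/
theorem lpn_le_of_factor {p : ℝ} (hp0 : 0 < p) (hp1 : p ≤ 1) {W U : Sp d → ℝ≥0∞} (hW : Measurable W) (hU : Measurable U)
    (hfin : ∀ x, U x ≠ ∞) (h0 : ∀ x, U x = 0 → W x = 0) :
    lpn p volume W ≤ (∫⁻ x, W x * U x ^ (-((1 - p) / p))) * (∫⁻ x, U x) ^ ((1 - p) / p) := by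
  have h1 : ∫⁻ x, W x ^ p ≤ (∫⁻ x, W x * U x ^ (-((1 - p) / p))) ^ p * (∫⁻ x, U x) ^ (1 - p) := by
    refine le_trans (lintegral_mono fun x => ?_) (ENNReal.lintegral_mul_norm_pow_le
      (hW.mul (hU.pow_const _)).aemeasurable hU.aemeasurable hp0.le (by linarith : 0 ≤ 1 - p) (by ring))
    rcases eq_or_ne (U x) 0 with h | h
    · rw [h0 x h, ENNReal.zero_rpow_of_pos hp0]; exact zero_le
    · rw [Pi.mul_apply, ENNReal.mul_rpow_of_nonneg _ _ hp0.le, mul_assoc, ← ENNReal.rpow_mul, ← ENNReal.rpow_add _ _ h (hfin x)]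
      have : -((1 - p) / p) * p + (1 - p) = 0 := by field_simp; ring
      rw [this, ENNReal.rpow_zero, mul_one]
  refine (ENNReal.rpow_le_rpow h1 (by positivity)).trans (le_of_eq ?_)
  rw [ENNReal.mul_rpow_of_nonneg _ _ (by positivity), ← ENNReal.rpow_mul, ← ENNReal.rpow_mul,
    mul_one_div_cancel hp0.ne', ENNReal.rpow_one, mul_one_div]

/-- Persistence of integrability for `1 / 2 ≤ p < 1`. -/
theorem persistence_of_lt_one {p : ℝ} (hp : 1 / 2 ≤ p) (hp1 : p < 1) {N : ℕ} (hN : (d : ℝ) < N * p) (hG : Continuous G)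
    (hfu : f = fun t : Set.Icc 0 T => (Alg.duhamel U₀ U₁ G t).val P)
    (hf : xn P.β P.χ P.s f < ∞) (hH : xn P.β P.χ P.s H < ∞) (hGf : (fun t : Set.Icc 0 T => (G t).val P) = f * H)
    (hh : xn P.β P.χ P.s h < ∞) {c : ℂ} (hGh : (fun t : Set.Icc 0 T => (G t).val P) = c • f + f * (f * h))
    (h₀ : ∑' k, wgt P.β P.s k * lpn p volume (fun x => ‖cv (wav P.β P.χ k) (U₀.val P) x‖ₑ) < ∞)
    (h₁ : ∑' k, wgt P.β P.s k * lpn p volume (fun x => ‖cv (wav P.β P.χ k) (U₁.val P) x‖ₑ) < ∞) :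
    ∑' k, wgt P.β P.s k * lpn p volume (mx P 0 (N + N) k f) < ∞ := by
  have hp0 : 0 < p := by linarith
  have hNp : (d : ℝ) < N * min 1 p := by rwa [min_eq_right hp1.le]
  have hdN : d < N := by
    have : (N : ℝ) * p ≤ N := mul_le_of_le_one_right (by positivity) hp1.le
    exact_mod_cast hN.trans_le this
  have hone : ∀ g : BF d, ∑' k, wgt P.β P.s k * lpn p volume (fun x => ‖cv (wav P.β P.χ k) g x‖ₑ) < ∞ →
      ∑' k, wgt P.β P.s k * lpn 1 volume (fun x => ‖cv (wav P.β P.χ k) g x‖ₑ) < ∞ := fun g hg => by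
    refine lt_of_le_of_lt (ENNReal.tsum_le_tsum fun k => mul_le_mul_right ((isBand_cv g k).lpn_one_le N hp0 hp1.le) _) ?_
    simp only [mul_left_comm _ (bandConst d N p ^ (1 - p))]
    rw [ENNReal.tsum_mul_left]
    exact ENNReal.mul_lt_top (ENNReal.rpow_lt_top_of_nonneg (by linarith) (bandConst_lt_top hp0 hNp).ne) hg
  -- The data also lie in the space with exponent `1`, so that case provides an integrable majorant
  -- of the blocks.
  have hU1 := persistence_of_one_le le_rfl hdN hG hfu hf hH hGf (hone _ h₀) (hone _ h₁)
  have hdata := tsum_lpn_dataMx_lt_top (P := P) hp0 (N := N + N) (hNp.trans_le (by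
    have : (0 : ℝ) ≤ N * min 1 p := by positivity
    push_cast; linarith)) T h₀ h₁
  set c30 := ENNReal.ofReal (30 ^ (P.s / 2)) * ∑' j : Fin d → ℤ, near P.β j with hc30
  have hc30' : c30 < ∞ := ENNReal.mul_lt_top ENNReal.ofReal_lt_top (tsum_near_lt_top P.adm.pos)
  have hconv : ∀ a b : (Fin d → ℤ) → ℝ≥0∞, ∑' k, wgt P.β P.s k * ∑' l, ∑' m, near P.β (k - l - m) * (a l * b m) ≤
      c30 * ((∑' l, wgt P.β P.s l * a l) * ∑' m, wgt P.β P.s m * b m) := fun a b =>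
    (tsum_wgt_near_le P.nonneg a b).trans_eq (by rw [hc30, mul_assoc])
  set U : Sp d → ℝ≥0∞ := fun x => ∑' l, wgt P.β P.s l * mx P 0 N l f x with hU
  have hUm : Measurable U := Measurable.tsum fun l => (measurable_mx 0 N l f).const_mul _
  have hUint : ∫⁻ x, U x < ∞ := by
    rw [hU, lintegral_tsum fun l => ((measurable_mx 0 N l f).const_mul _).aemeasurable]
    simp only [lpn_one] at hU1
    refine lt_of_le_of_lt (le_of_eq (tsum_congr fun l => ?_)) hU1
    exact lintegral_const_mul _ (measurable_mx 0 N l f)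
  have hUle : ∀ x, U x ≤ xn P.β P.χ P.s f := fun x =>
    ENNReal.tsum_le_tsum fun l => mul_le_mul_right (mx_zero_le_wsup N l f x) _
  have hfh : xn P.β P.χ P.s (f * h) < ∞ := (P.adm.xn_mul_le P.nonneg hf hh).trans_lt
    (ENNReal.mul_lt_top P.adm.mulConst_lt_top (ENNReal.mul_lt_top hf hh))
  set V : (Fin d → ℤ) → Sp d → ℝ≥0∞ := fun m x => mx P 0 N m (f * h) x with hV
  have hVsum : ∀ x, ∑' m, wgt P.β P.s m * V m x ≤ lw N P.χ * (c30 * (U x * xn P.β P.χ P.s h)) := fun x => by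
    refine (ENNReal.tsum_le_tsum fun m => mul_le_mul_right (mx_zero_mul_le hf hh m x) _).trans ?_
    simp only [mul_left_comm _ (lw N P.χ)]
    rw [ENNReal.tsum_mul_left]
    gcongr
    exact hconv _ _
  set W : (Fin d → ℤ) → Sp d → ℝ≥0∞ := fun k x => ∑' l, ∑' m, near P.β (k - l - m) * (mx P 0 N l f x * V m x) with hW
  have hWm : ∀ k, Measurable (W k) := fun k => Measurable.tsum fun l => Measurable.tsum fun m =>
    ((measurable_mx 0 N l f).mul (measurable_mx 0 N m (f * h))).const_mul _
  set K := c30 * (lw N P.χ * (c30 * xn P.β P.χ P.s h)) with hK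
  have hK' : K < ∞ := ENNReal.mul_lt_top hc30' (ENNReal.mul_lt_top (lw_lt_top _ _) (ENNReal.mul_lt_top hc30' hh))
  -- The nonlinear remainder is quadratic: its blocks sum pointwise to at most a multiple of `U ^
  -- 2`, with `U` both integrable and bounded.
  have hWsum : ∀ x, ∑' k, wgt P.β P.s k * W k x ≤ K * (U x * U x) := fun x => by
    refine (hconv _ _).trans ?_
    calc c30 * (U x * ∑' m, wgt P.β P.s m * V m x) ≤ c30 * (U x * (lw N P.χ * (c30 * (U x * xn P.β P.χ P.s h)))) := by
          gcongr; exact hVsum x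
      _ = _ := by rw [hK]; ring
  have hW0 : ∀ k x, U x = 0 → W k x = 0 := fun k x hx => by
    have h2 := hWsum x
    rw [hx, mul_zero, mul_zero, nonpos_iff_eq_zero, ENNReal.tsum_eq_zero] at h2
    refine (mul_eq_zero.1 (h2 k)).resolve_left fun h3 => ?_
    have := one_le_wgt P.β P.nonneg k
    rw [h3] at this
    exact absurd this (by simp)
  set θ := (1 - p) / p with hθ
  have hθ0 : 0 ≤ θ := div_nonneg (by linarith) hp0.le
  -- Here `p ≥ 1 / 2` is essential: `U ^ 2 * U ^ (-θ)` is a bounded multiple of the integrable `U`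
  -- only because `1 - θ ≥ 0`.
  have hθ1 : θ ≤ 1 := by rw [hθ, div_le_one hp0]; linarith
  have hUfin : ∀ x, U x ≠ ∞ := fun x => ne_top_of_le_ne_top hf.ne (hUle x)
  have hlpW : ∑' k, wgt P.β P.s k * lpn p volume (W k) < ∞ := by
    have h2 : ∑' k, wgt P.β P.s k * ∫⁻ x, W k x * U x ^ (-θ) ≤ K * (xn P.β P.χ P.s f ^ (1 - θ) * ∫⁻ x, U x) := by
      calc ∑' k, wgt P.β P.s k * ∫⁻ x, W k x * U x ^ (-θ) = ∫⁻ x, ∑' k, wgt P.β P.s k * (W k x * U x ^ (-θ)) := by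
            have hm : ∀ k, Measurable fun x => W k x * U x ^ (-θ) := fun k => (hWm k).mul (hUm.pow_const _)
            rw [lintegral_tsum fun k => ((hm k).const_mul _).aemeasurable]
            exact tsum_congr fun k => (lintegral_const_mul _ (hm k)).symm
        _ ≤ ∫⁻ x, K * (xn P.β P.χ P.s f ^ (1 - θ) * U x) := by
            refine lintegral_mono fun x => ?_
            simp only [← mul_assoc]
            rw [ENNReal.tsum_mul_right]
            refine (mul_le_mul_left (hWsum x) _).trans ?_
            rcases eq_or_ne (U x) 0 with hx | hx
            · simp [hx]
            · have h3 : U x * U x ^ (-θ) ≤ xn P.β P.χ P.s f ^ (1 - θ) := by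
                calc U x * U x ^ (-θ) = U x ^ (1 - θ) := by
                      rw [sub_eq_add_neg, ENNReal.rpow_add _ _ hx (hUfin x), ENNReal.rpow_one]
                  _ ≤ _ := ENNReal.rpow_le_rpow (hUle x) (by linarith)
              calc K * (U x * U x) * U x ^ (-θ) = K * ((U x * U x ^ (-θ)) * U x) := by ring
                _ ≤ K * (xn P.β P.χ P.s f ^ (1 - θ) * U x) := by gcongr
                _ = _ := (mul_assoc _ _ _).symm
        _ = _ := by
            rw [lintegral_const_mul _ (hUm.const_mul _), lintegral_const_mul _ hUm]
    have h3 : ∑' k, wgt P.β P.s k * lpn p volume (W k) ≤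
        (∑' k, wgt P.β P.s k * ∫⁻ x, W k x * U x ^ (-θ)) * (∫⁻ x, U x) ^ θ := by
      rw [← ENNReal.tsum_mul_right]
      refine ENNReal.tsum_le_tsum fun k => ?_
      rw [mul_assoc]
      gcongr
      exact lpn_le_of_factor hp0 hp1.le (hWm k) hUm hUfin (hW0 k)
    exact h3.trans_lt (ENNReal.mul_lt_top (h2.trans_lt (ENNReal.mul_lt_top hK' (ENNReal.mul_lt_top
      (ENNReal.rpow_lt_top_of_nonneg (by linarith) hf.ne) hUint))) (ENNReal.rpow_lt_top_of_nonneg hθ0 hUint.ne))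
  -- Only the linear part `c • f` is left to absorb. It does not mix blocks, so absorption takes
  -- place at each `k` and `x`, and the failing triangle inequality of `L^p` never meets an infinite
  -- sum.
  obtain ⟨γ, hγ0, hγ⟩ := exists_small T (Q := growth d (N + N) T * ‖c‖ₑ)
    (ENNReal.mul_ne_top ENNReal.ofReal_ne_top enorm_ne_top)
  set ε := growth d (N + N) T * ENNReal.ofReal (T / γ) with hε
  have hε' : ε * lw (N + N) P.χ < ∞ := ENNReal.mul_lt_top (ENNReal.mul_lt_top ENNReal.ofReal_lt_top
    ENNReal.ofReal_lt_top) (lw_lt_top _ _)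
  have hpt : ∀ k x, mx P γ (N + N) k f x ≤
      2 * (dataMx P (N + N) T k (U₀.val P) (U₁.val P) x + ε * lw (N + N) P.χ * W k x) := fun k x => by
    have hfin : mx P γ (N + N) k f x ≠ ∞ := by
      refine ne_top_of_le_ne_top hf.ne (((mx_le_zero hγ0.le).trans (mx_zero_le_wsup _ k f x)).trans ?_)
      exact (le_mul_of_one_le_left' (one_le_wgt P.β P.nonneg k)).trans
        (ENNReal.le_tsum (f := fun k => wgt P.β P.s k * wsup 1 (blk P.β P.χ k f)) k)
    have h2 := mx_duhamel_le U₀ U₁ hG (N + N) (T := T) hγ0 k x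
    rw [← hfu, hGh] at h2
    have h3 : mx P γ (N + N) k (c • f + f * (f * h)) x ≤ ‖c‖ₑ * mx P γ (N + N) k f x + lw (N + N) P.χ * W k x := by
      rw [mx, blk_add, blk_smul]
      refine (wsup_add_le _ _ _).trans (add_le_add (wsup_smul _ _ _).le ?_)
      -- The decay of order `N + N` is shared equally, since both factors of the quadratic term need
      -- a maximal function of order `N`.
      rw [ew_add]
      refine (P.adm.wsup_blk_mul_le (N := N + N) (by rw [← ew_add]; exact slowWeight_ew γ _ x)
        (summable_norm_cv_of_xn P.nonneg hf) (summable_norm_cv_of_xn P.nonneg hfh) k).trans ?_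
      gcongr _ * ?_
      refine ENNReal.tsum_le_tsum fun l => ENNReal.tsum_le_tsum fun m => ?_
      exact mul_le_mul_right (mul_le_mul_left (mx_le_zero hγ0.le) _) _
    refine le_two_mul_of_le_add_half hfin hγ (h2.trans ?_)
    calc _ ≤ dataMx P (N + N) T k (U₀.val P) (U₁.val P) x +
          ε * (‖c‖ₑ * mx P γ (N + N) k f x + lw (N + N) P.χ * W k x) := by gcongr
      _ = _ := by rw [hε]; ring
  set Cq : ℝ≥0∞ := 2 * 2 ^ (1 / p) with hCq
  have hCq' : Cq < ∞ := ENNReal.mul_lt_top (by simp) (ENNReal.rpow_lt_top_of_nonneg (by positivity) (by simp))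
  have hfinal : ∑' k, wgt P.β P.s k * lpn p volume (mx P 0 (N + N) k f) ≤ ENNReal.ofReal (Real.exp (γ * T)) *
      (2 * (Cq * (∑' k, wgt P.β P.s k * lpn p volume (dataMx P (N + N) T k (U₀.val P) (U₁.val P)) +
        ε * lw (N + N) P.χ * ∑' k, wgt P.β P.s k * lpn p volume (W k)))) := by
    simp only [← ENNReal.tsum_mul_left, ← ENNReal.tsum_add]
    refine ENNReal.tsum_le_tsum fun k => ?_
    have hdm := measurable_dataMx (P := P) (N + N) T k (U₀.val P) (U₁.val P)
    have h2 : lpn p volume (mx P 0 (N + N) k f) ≤ ENNReal.ofReal (Real.exp (γ * T)) * (2 * (Cq *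
        (lpn p volume (dataMx P (N + N) T k (U₀.val P) (U₁.val P)) + ε * lw (N + N) P.χ * lpn p volume (W k)))) := by
      rw [← lpn_const_mul hp0 _ (hWm k)]
      refine le_trans ?_ (mul_le_mul_right (mul_le_mul_right (lpn_add_le_quasi hp0 volume hdm) _) _)
      have hm : Measurable fun x => dataMx P (N + N) T k (U₀.val P) (U₁.val P) x + ε * lw (N + N) P.χ * W k x :=
        hdm.add ((hWm k).const_mul _)
      rw [← lpn_const_mul hp0 _ hm, ← lpn_const_mul hp0 _ (hm.const_mul _)]
      exact lpn_mono hp0 le_rfl fun x => (mx_zero_le hγ0.le).trans (mul_le_mul_right (hpt k x) _)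
    exact (mul_le_mul_right h2 _).trans (le_of_eq (by ring))
  exact hfinal.trans_lt (ENNReal.mul_lt_top ENNReal.ofReal_lt_top (ENNReal.mul_lt_top (by simp) (ENNReal.mul_lt_top hCq'
    (ENNReal.add_lt_top.2 ⟨hdata, ENNReal.mul_lt_top hε' hlpW⟩))))

end Persistence

/-! ### Continuity in the modulation space -/

section Continuity

variable {P : Par d} {a : ℕ → ℝ} {F : ℂ → ℂ}

theorem conv_distL_eq (g : BF d) (h : 𝓢(Sp d, ℂ)) : conv (distL g) h = fun x => cv h g x :=
  funext fun x => conv_distL g h x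

theorem modNorm_distL {p : ℝ≥0∞} (h0 : p ≠ 0) (h1 : p ≠ ∞) (g : BF d) :
    modNorm P.β P.χ p P.s (distL g) =
      ∑' k, wgt P.β P.s k * lpn p.toReal volume fun x => ‖cv (wav P.β P.χ k) g x‖ₑ := by
  rw [modNorm_eq]
  refine tsum_congr fun k => ?_
  rw [conv_distL_eq, eLpNorm_eq_lpn h0 h1]

theorem modNorm_top_distL_le (g : BF d) : modNorm P.β P.χ ∞ P.s (distL g) ≤ an P g := by
  rw [modNorm_eq, an_eq]
  refine ENNReal.tsum_le_tsum fun k => mul_le_mul_right ?_ _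
  rw [conv_distL_eq, eLpNorm_exponent_top]
  refine essSup_le_of_ae_le _ (ae_of_all _ fun x => ?_)
  change ‖cv (wav P.β P.χ k) g x‖ₑ ≤ ‖cv (wav P.β P.χ k) g‖ₑ
  rw [← ofReal_norm, ← ofReal_norm]
  exact ENNReal.ofReal_le_ofReal (BoundedContinuousFunction.norm_coe_le_norm _ x)

/-- A bound for all blocks uniform in time and summable in `L^p`. It gives membership at once and
continuity by dominated convergence. The hypothesis `d ≥ 1` enters here, giving `p ≥ 1 / 2`. -/
theorem exists_majorant (hd : 1 ≤ d) {p : ℝ≥0∞} (hp : (d : ℝ≥0∞) / ((d : ℝ≥0∞) + 1) < p) (hp1 : p ≠ ∞)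
    (ha : IsSeries a F) {U₀ U₁ : Alg P} {T : ℝ} {u : ℝ → Alg P} (hu : IsMild Alg.sinR (Alg.free U₀ U₁) (Alg.nl a) T u)
    (h₀ : modNorm P.β P.χ p P.s (distL (U₀.val P)) < ∞) (h₁ : modNorm P.β P.χ p P.s (distL (U₁.val P)) < ∞) :
    ∃ b : (Fin d → ℤ) → Sp d → ℝ≥0∞, (∀ k, Measurable (b k)) ∧
      (∀ k, ∀ t ∈ Set.Icc 0 T, ∀ x, ‖cv (wav P.β P.χ k) ((u t).val P) x‖ₑ ≤ b k x) ∧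
      ∑' k, wgt P.β P.s k * lpn p.toReal volume (b k) < ∞ := by
  obtain ⟨hp0, hN⟩ := lt_mul_min_one hp hp1
  have hpz : p ≠ 0 := fun h0 => by simp [h0] at hp0
  rw [modNorm_distL hpz hp1] at h₀ h₁
  have hG : Continuous fun t => Alg.nl a (u t) := (Alg.lipOnBalls_nl ha).continuous.comp hu.1
  set f : Set.Icc 0 T → BF d := fun t => (u t).val P with hf
  have hfu : f = fun t : Set.Icc 0 T => (Alg.duhamel U₀ U₁ (fun t => Alg.nl a (u t)) t).val P := by
    funext t
    rw [hf]
    simp only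
    rw [hu.2 t t.2]
    rfl
  have hfx : xn P.β P.χ P.s f < ∞ := hfu ▸ Alg.xn_duhamel_lt_top U₀ U₁ hG T
  obtain ⟨h, H, hh, hH, e1, e2⟩ := Alg.exists_factor ha (fun t : Set.Icc 0 T => u t) hfx
  have key : ∃ N, ∑' k, wgt P.β P.s k * lpn p.toReal volume (mx P 0 N k f) < ∞ := by
    rcases le_or_gt 1 p.toReal with h1 | h1
    · exact ⟨d + 1, persistence_of_one_le h1 d.lt_succ_self hG hfu hfx hH e1 h₀ h₁⟩
    · rw [min_eq_right h1.le] at hN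
      have hhalf : 1 / 2 ≤ p.toReal := by
        have h2 : (1 : ℝ) ≤ d := by exact_mod_cast hd
        push_cast at hN
        by_contra hlt
        push Not at hlt
        nlinarith
      exact ⟨_, persistence_of_lt_one hhalf h1 hN hG hfu hfx hH e1 hh e2 h₀ h₁⟩
  obtain ⟨N, hNfin⟩ := key
  exact ⟨fun k => mx P 0 N k f, fun k => measurable_mx 0 N k f, fun k t ht x => enorm_le_mx N k f ⟨t, ht⟩ x, hNfin⟩

/-- Dominated convergence twice: in `x` for each block, and over the lattice with counting measure.
-/
theorem tendsto_modNorm_of_majorant {p : ℝ≥0∞} (h0 : p ≠ 0) (h1 : p ≠ ∞) {T : ℝ} {u : ℝ → Alg P} (hu : Continuous u)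
    {b : (Fin d → ℤ) → Sp d → ℝ≥0∞} (hbm : ∀ k, Measurable (b k))
    (hb : ∀ k, ∀ t ∈ Set.Icc 0 T, ∀ x, ‖cv (wav P.β P.χ k) ((u t).val P) x‖ₑ ≤ b k x)
    (hs : ∑' k, wgt P.β P.s k * lpn p.toReal volume (b k) < ∞) {t : ℝ} (ht : t ∈ Set.Icc 0 T) :
    Tendsto (fun τ => modNorm P.β P.χ p P.s (distL ((u τ).val P) - distL ((u t).val P))) (𝓝[Set.Icc 0 T] t) (𝓝 0) := by
  have hp0 : 0 < p.toReal := ENNReal.toReal_pos h0 h1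
  set z : (Fin d → ℤ) → ℝ → Sp d → ℝ≥0∞ := fun k τ x => ‖cv (wav P.β P.χ k) ((u τ).val P - (u t).val P) x‖ₑ with hz
  have hzm : ∀ k τ, Measurable (z k τ) := fun k τ => (cv (wav P.β P.χ k) _).continuous.measurable.enorm
  have hzb : ∀ k, ∀ τ ∈ Set.Icc 0 T, ∀ x, z k τ x ≤ 2 * b k x := fun k τ hτ x => by
    simp only [hz, map_sub, BoundedContinuousFunction.sub_apply]
    rw [two_mul]
    exact enorm_sub_le.trans (add_le_add (hb k τ hτ x) (hb k t ht x))
  have hbfin : ∀ k, lpn p.toReal volume (b k) ≠ ∞ := fun k => ne_top_of_le_ne_top hs.ne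
    ((le_mul_of_one_le_left' (one_le_wgt P.β P.nonneg k)).trans
      (ENNReal.le_tsum (f := fun k => wgt P.β P.s k * lpn p.toReal volume (b k)) k))
  have hmem : ∀ᶠ τ in 𝓝[Set.Icc 0 T] t, τ ∈ Set.Icc 0 T := self_mem_nhdsWithin
  have hterm : ∀ k, Tendsto (fun τ => lpn p.toReal volume (z k τ)) (𝓝[Set.Icc 0 T] t) (𝓝 0) := fun k => by
    have hbi : ∫⁻ x, (2 * b k x) ^ p.toReal ≠ ∞ := by
      have h2 : lpn p.toReal volume (fun x => 2 * b k x) ≠ ∞ := by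
        rw [lpn_const_mul hp0 _ (hbm k)]
        exact ENNReal.mul_ne_top (by simp) (hbfin k)
      intro h3
      rw [lpn, h3, ENNReal.top_rpow_of_pos (by positivity)] at h2
      exact h2 rfl
    have h2 : Tendsto (fun τ => ∫⁻ x, z k τ x ^ p.toReal) (𝓝[Set.Icc 0 T] t) (𝓝 (∫⁻ _ : Sp d, 0)) := by
      refine tendsto_lintegral_filter_of_dominated_convergence (fun x => (2 * b k x) ^ p.toReal)
        (Eventually.of_forall fun τ => (hzm k τ).pow_const _) ?_ hbi (ae_of_all _ fun x => ?_)
      · filter_upwards [hmem] with τ hτ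
        exact ae_of_all _ fun x => ENNReal.rpow_le_rpow (hzb k τ hτ x) hp0.le
      · have h3 : Continuous fun τ => z k τ x ^ p.toReal := by
          have h4 : Continuous fun τ => cv (wav P.β P.χ k) ((u τ).val P - (u t).val P) x :=
            (evalBF x).continuous.comp ((cv _).continuous.comp ((Alg.continuous_val hu).sub continuous_const))
          exact (ENNReal.continuous_rpow_const).comp h4.enorm
        have h5 : Tendsto (fun τ => z k τ x ^ p.toReal) (𝓝 t) (𝓝 (z k t x ^ p.toReal)) := h3.tendsto t
        have h6 : z k t x ^ p.toReal = 0 := by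
          simp [hz, ENNReal.zero_rpow_of_pos hp0]
        rw [h6] at h5
        exact h5.mono_left nhdsWithin_le_nhds
    rw [lintegral_zero] at h2
    have h3 := (ENNReal.continuous_rpow_const (y := 1 / p.toReal)).tendsto 0 |>.comp h2
    rwa [ENNReal.zero_rpow_of_pos (by positivity)] at h3
  have hsum : Tendsto (fun τ => ∫⁻ k, wgt P.β P.s k * lpn p.toReal volume (z k τ) ∂Measure.count)
      (𝓝[Set.Icc 0 T] t) (𝓝 (∫⁻ _ : Fin d → ℤ, 0 ∂Measure.count)) := by
    refine tendsto_lintegral_filter_of_dominated_convergence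
      (fun k => wgt P.β P.s k * (2 * lpn p.toReal volume (b k)))
      (Eventually.of_forall fun τ => measurable_of_countable _) ?_ ?_ (ae_of_all _ fun k => ?_)
    · filter_upwards [hmem] with τ hτ
      refine ae_of_all _ fun k => mul_le_mul_right ?_ _
      rw [← lpn_const_mul hp0 _ (hbm k)]
      exact lpn_mono hp0 le_rfl (hzb k τ hτ)
    · rw [lintegral_count]
      simp only [mul_left_comm _ (2 : ℝ≥0∞)]
      rw [ENNReal.tsum_mul_left]
      exact ENNReal.mul_ne_top (by simp) hs.ne
    · have := ENNReal.Tendsto.const_mul (hterm k) (Or.inr (wgt_ne_top P.β P.s k))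
      rwa [mul_zero] at this
  simp only [lintegral_count, tsum_zero] at hsum
  refine hsum.congr fun τ => ?_
  rw [← Alg.distL_sub, modNorm_distL h0 h1]

theorem continuous_into_modSpace (hd : 1 ≤ d) {p : ℝ≥0∞} (hp : (d : ℝ≥0∞) / ((d : ℝ≥0∞) + 1) < p)
    (ha : IsSeries a F) {U₀ U₁ : Alg P} {T : ℝ} {u : ℝ → Alg P} (hu : IsMild Alg.sinR (Alg.free U₀ U₁) (Alg.nl a) T u)
    (h₀ : modNorm P.β P.χ p P.s (distL (U₀.val P)) < ∞) (h₁ : modNorm P.β P.χ p P.s (distL (U₁.val P)) < ∞)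
    {t : ℝ} (ht : t ∈ Set.Icc 0 T) : distL ((u t).val P) ∈ modSpace P.β P.χ p P.s ∧
      Tendsto (fun τ => modNorm P.β P.χ p P.s (distL ((u τ).val P) - distL ((u t).val P))) (𝓝[Set.Icc 0 T] t) (𝓝 0) := by
  rcases eq_or_ne p ∞ with h | h
  · subst h
    refine ⟨(modNorm_top_distL_le _).trans_lt (u t).an_lt_top, ?_⟩
    have h2 : Tendsto (fun τ => ENNReal.ofReal ((Alg.scale P)⁻¹ * ‖u τ - u t‖)) (𝓝 t) (𝓝 0) := by
      have hc := hu.1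
      have : Continuous fun τ => ENNReal.ofReal ((Alg.scale P)⁻¹ * ‖u τ - u t‖) :=
        ENNReal.continuous_ofReal.comp (by fun_prop)
      simpa using this.tendsto t
    refine tendsto_of_tendsto_of_tendsto_of_le_of_le tendsto_const_nhds (h2.mono_left nhdsWithin_le_nhds)
      (fun _ => zero_le) fun τ => ?_
    simp only
    rw [← Alg.distL_sub, ← Alg.val_sub, ← Alg.an_eq_ofReal]
    exact modNorm_top_distL_le _
  · have hp0 := (lt_mul_min_one hp h).1
    have hpz : p ≠ 0 := fun h0 => by simp [h0] at hp0
    obtain ⟨b, hbm, hb, hs⟩ := exists_majorant hd hp h ha hu h₀ h₁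
    refine ⟨?_, tendsto_modNorm_of_majorant hpz h hu.1 hbm hb hs ht⟩
    change modNorm _ _ _ _ _ < ∞
    rw [modNorm_distL hpz h]
    exact lt_of_le_of_lt (ENNReal.tsum_le_tsum fun k => mul_le_mul_right (lpn_mono hp0 le_rfl (hb k t ht)) _) hs

end Continuity

/-! ### Solutions and mild solutions -/

section Solutions

variable {P : Par d} {a : ℕ → ℝ} {F : ℂ → ℂ} {p C : ℝ≥0∞}

theorem Alg.norm_le_modNorm (hC : C ≠ ∞) (hb : ∀ F : Sp d → ℂ, IsBand F → ∀ x, ‖F x‖ₑ ≤ C * eLpNorm F p volume)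
    (V : Alg P) (hV : distL (V.val P) ∈ modSpace P.β P.χ p P.s) :
    ‖V‖ ≤ scale P * C.toReal * (modNorm P.β P.χ p P.s (distL (V.val P))).toReal := by
  rw [norm_def, mul_assoc, ← ENNReal.toReal_mul]
  exact mul_le_mul_of_nonneg_left (ENNReal.toReal_mono (ENNReal.mul_ne_top hC (ne_of_lt hV)) (an_le_modNorm hb _))
    scale_pos.le

/-- The representing function is determined almost everywhere, so whichever representative a
solution uses, `F(u)` is the power series of the algebra. -/
theorem eq_distL_nl (ha : IsSeries a F) (V : Alg P) {g : Sp d → ℂ} {w : 𝓢'(Sp d, ℂ)} (hg : Represents g (distL (V.val P)))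
    (hw : Represents (fun x => F (g x)) w) : w = distL ((Alg.nl a V).val P) := by
  have h1 := ae_eq_of_represents hg (represents_distL (V.val P))
  ext φ
  rw [(hw φ).2, (represents_distL _ φ).2]
  refine integral_congr_ae ?_
  filter_upwards [h1] with x hx
  rw [hx, Alg.nl_val ha]

/-- Bernstein's inequality lifts the curve continuously to the algebra. Testing with reflected
translates of the windows turns the distributional equation into the pointwise equations for blocks
that `Alg.eq_duhamel` requires. -/
theorem IsSolution.exists_mild (hC : C ≠ ∞) (hb : ∀ F : Sp d → ℂ, IsBand F → ∀ x, ‖F x‖ₑ ≤ C * eLpNorm F p volume)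
    (ha : IsSeries a F) {U₀ U₁ : Alg P} {T' : ℝ≥0∞} {v : ℝ → 𝓢'(Sp d, ℂ)}
    (h : IsSolution P.β P.χ p P.s F (distL (U₀.val P)) (distL (U₁.val P)) T' v) {t₁ : ℝ} (h0 : 0 ≤ t₁)
    (h1 : ENNReal.ofReal t₁ < T') :
    ∃ W, IsMild Alg.sinR (Alg.free U₀ U₁) (Alg.nl a) t₁ W ∧ ∀ τ ∈ Set.Icc 0 t₁, v τ = distL ((W τ).val P) := by
  obtain ⟨hc, e0, v', w, g, e1, hsol⟩ := h
  have hI : Set.Icc 0 t₁ ⊆ timeInterval T' := fun t ht => ⟨ht.1, (ENNReal.ofReal_le_ofReal ht.2).trans_lt h1⟩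
  choose V hV using fun t : Set.Icc 0 t₁ => exists_alg_of_modNorm hC hb (hc t (hI t.2)).1
  have hVc : Continuous V := by
    refine continuous_iff_continuousAt.2 fun t => ?_
    rw [ContinuousAt, tendsto_iff_norm_sub_tendsto_zero]
    have h2 : Tendsto (fun τ : Set.Icc 0 t₁ => modNorm P.β P.χ p P.s (distL ((V τ - V t).val P))) (𝓝 t) (𝓝 0) := by
      refine (((hc t (hI t.2)).2.mono_left (nhdsWithin_mono _ hI)).comp
        (tendsto_nhdsWithin_iff.2 ⟨continuous_subtype_val.tendsto t, Eventually.of_forall fun τ => τ.2⟩)).congr fun τ => ?_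
      rw [Alg.val_sub, Alg.distL_sub, ← hV, ← hV]
      rfl
    have h3 := ((ENNReal.tendsto_toReal ENNReal.zero_ne_top).comp h2).const_mul (Alg.scale P * C.toReal)
    rw [ENNReal.toReal_zero, mul_zero] at h3
    refine squeeze_zero' (Eventually.of_forall fun _ => norm_nonneg _) ?_ h3
    filter_upwards [h2.eventually_lt_const ENNReal.zero_lt_top] with τ hτ
    exact Alg.norm_le_modNorm hC hb _ hτ
  set W := Set.IccExtend h0 V with hW
  have hWc : Continuous W := hVc.Icc_extend'
  have hvW : ∀ τ ∈ Set.Icc 0 t₁, v τ = distL ((W τ).val P) := fun τ hτ => by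
    rw [hW, Set.IccExtend_of_mem _ _ hτ, ← hV]
  have hW0 : W 0 = U₀ := Alg.ext (distL_injective (by rw [← hvW 0 ⟨le_rfl, h0⟩, e0]))
  refine ⟨W, ⟨hWc, ?_⟩, hvW⟩
  have key := Alg.eq_duhamel hWc ((Alg.lipOnBalls_nl ha).continuous.comp hWc) (T := t₁) (U₁ := U₁) fun k x =>
    ⟨fun τ => v' τ (reflectAt x (wav P.β P.χ k)), ?_, fun t ht => ?_⟩
  · intro t ht
    rw [key t ht, hW0]
    rfl
  · change v' 0 _ = _
    rw [e1]
    exact conv_distL _ _ _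
  · obtain ⟨hg, hw, hd⟩ := hsol t (hI ht)
    obtain ⟨d1, d2⟩ := hd (reflectAt x (wav P.β P.χ k))
    rw [hvW t ht] at hg d2
    rw [eq_distL_nl ha _ hg hw] at d2
    refine ⟨(d1.mono hI).congr (fun τ hτ => ?_) ?_, ?_⟩
    · rw [hvW τ hτ]; exact (conv_distL _ _ _).symm
    · rw [hvW t ht]; exact (conv_distL _ _ _).symm
    · have e2 := congrFun (conv_laplacian (distL ((W t).val P)) (wav P.β P.χ k)) x
      rw [conv_distL] at e2
      have e3 := conv_distL ((Alg.nl a (W t)).val P) (wav P.β P.χ k) x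
      rw [conv] at e2 e3
      rw [e2, e3] at d2
      exact d2.mono hI

theorem Alg.velocity_congr {U₁ : Alg P} {u u' G G' : ℝ → Alg P} {t : ℝ} (ht : 0 ≤ t)
    (hu : ∀ τ ∈ Set.Icc 0 t, u τ = u' τ) (hG : ∀ τ ∈ Set.Icc 0 t, G τ = G' τ) :
    velocity U₁ u G t = velocity U₁ u' G' t := by
  have key : ∀ {f f' : ℝ → Alg P}, (∀ τ ∈ Set.Icc 0 t, f τ = f' τ) →
      ∫ τ in (0 : ℝ)..t, (f τ).val P = ∫ τ in (0 : ℝ)..t, (f' τ).val P := fun {f f'} h => by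
    refine intervalIntegral.integral_congr fun τ hτ => ?_
    rw [Set.uIcc_of_le ht] at hτ
    simp only [h τ hτ]
  rw [velocity, velocity, key hu, key hG]

theorem isSolution_of_mild (hd : 1 ≤ d) (hp : (d : ℝ≥0∞) / ((d : ℝ≥0∞) + 1) < p) (ha : IsSeries a F) {U₀ U₁ : Alg P}
    (h₀ : modNorm P.β P.χ p P.s (distL (U₀.val P)) < ∞) (h₁ : modNorm P.β P.χ p P.s (distL (U₁.val P)) < ∞)
    {T : ℝ≥0∞} (hT : 0 < T) {u : ℝ → Alg P}
    (hu : ∀ t, 0 ≤ t → ENNReal.ofReal t < T →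
      ∃ v, IsMild Alg.sinR (Alg.free U₀ U₁) (Alg.nl a) t v ∧ ∀ τ ∈ Set.Icc 0 t, u τ = v τ) :
    IsSolution P.β P.χ p P.s F (distL (U₀.val P)) (distL (U₁.val P)) T fun t => distL ((u t).val P) := by
  -- Any time strictly between `t` and `T` gives a closed interval that is a neighbourhood of `t`
  -- relative to `[0, T)`, also at `t = 0`; all properties to be checked are local in this sense.
  have hloc : ∀ t ∈ timeInterval T, ∃ t', t < t' ∧ Set.Icc 0 t' ∈ 𝓝[timeInterval T] t ∧
      ∃ v, IsMild Alg.sinR (Alg.free U₀ U₁) (Alg.nl a) t' v ∧ ∀ τ ∈ Set.Icc 0 t', u τ = v τ := by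
    intro t ht
    obtain ⟨r, hr, hr'⟩ := ENNReal.lt_iff_exists_nnreal_btwn.1 ht.2
    have htr : t < r := by
      rw [← ENNReal.ofReal_coe_nnreal, ENNReal.ofReal_lt_ofReal_iff'] at hr
      exact hr.1
    refine ⟨r, htr, ?_, hu r r.2 (by rwa [ENNReal.ofReal_coe_nnreal])⟩
    filter_upwards [self_mem_nhdsWithin, mem_nhdsWithin_of_mem_nhds (Iio_mem_nhds htr)] with τ h2 h3
    exact ⟨h2.1, h3.le⟩
  have hz : u 0 = U₀ := by
    obtain ⟨v, hv, huv⟩ := hu 0 le_rfl (by simpa using hT)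
    rw [huv 0 ⟨le_rfl, le_rfl⟩, hv.2 0 ⟨le_rfl, le_rfl⟩]
    exact Alg.duhamel_zero U₀ U₁ fun τ => Alg.nl a (v τ)
  refine ⟨fun t ht => ?_, congrArg (fun V : Alg P => distL (V.val P)) hz, Alg.velocity U₁ u fun t => Alg.nl a (u t),
    fun t => distL ((Alg.nl a (u t)).val P), fun t => (u t).val P, ?_, fun t ht => ⟨represents_distL _, ?_, fun φ => ?_⟩⟩
  · obtain ⟨t', htt', hmem, v, hv, huv⟩ := hloc t ht
    obtain ⟨h2, h3⟩ := continuous_into_modSpace hd hp ha hv h₀ h₁ ⟨ht.1, htt'.le⟩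
    rw [← huv t ⟨ht.1, htt'.le⟩] at h2 h3
    refine ⟨h2, (h3.mono_left (nhdsWithin_le_iff.2 hmem)).congr' ?_⟩
    filter_upwards [hmem] with τ hτ
    rw [huv τ hτ]
  · ext φ
    rw [Alg.velocity_apply, intervalIntegral.integral_same, intervalIntegral.integral_same, map_zero, map_zero, add_zero,
      sub_zero, distEval_apply]
  · convert represents_distL ((Alg.nl a (u t)).val P) using 2 with x
    exact (Alg.nl_val ha _ _).symm
  · obtain ⟨t', htt', hmem, v, hv, huv⟩ := hloc t ht
    set G : ℝ → Alg P := fun τ => Alg.nl a (v τ) with hG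
    have hGc : Continuous G := (Alg.lipOnBalls_nl ha).continuous.comp hv.1
    have huD : ∀ τ ∈ Set.Icc 0 t', u τ = Alg.duhamel U₀ U₁ G τ := fun τ hτ => (huv τ hτ).trans (hv.2 τ hτ)
    have huG : ∀ τ ∈ Set.Icc 0 t', Alg.nl a (u τ) = G τ := fun τ hτ => by rw [huv τ hτ]
    have hvel : ∀ τ ∈ Set.Icc 0 t', Alg.velocity U₁ u (fun t => Alg.nl a (u t)) τ =
        Alg.velocity U₁ (Alg.duhamel U₀ U₁ G) G τ := fun τ hτ =>
      Alg.velocity_congr hτ.1 (fun σ hσ => huD σ ⟨hσ.1, hσ.2.trans hτ.2⟩) fun σ hσ => huG σ ⟨hσ.1, hσ.2.trans hτ.2⟩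
    have htI : t ∈ Set.Icc 0 t' := ⟨ht.1, htt'.le⟩
    have e1 : ∀ᶠ τ in 𝓝[timeInterval T] t, τ ∈ Set.Icc 0 t' := hmem
    beta_reduce
    rw [hvel t htI, huG t htI, huD t htI]
    constructor
    · refine (Alg.hasDerivAt_distL_duhamel U₀ U₁ hGc φ t).hasDerivWithinAt.congr_of_eventuallyEq ?_ ?_
      · filter_upwards [e1] with τ hτ
        rw [huD τ hτ]
      · rw [huD t htI]
    · refine (Alg.hasDerivAt_velocity U₁ (Alg.continuous_duhamel U₀ U₁ hGc) hGc φ t).hasDerivWithinAt.congr_of_eventuallyEq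
        ?_ ?_
      · filter_upwards [e1] with τ hτ
        rw [hvel τ hτ]
      · rw [hvel t htI]

/-- The free evolution on `[0, 1]` has norm at most `R - 1`, and on the ball of radius `R + 1` the
nonlinearity is bounded by `B`; the time `1 / (M B + 1)` then suffices. It is nonincreasing since
`R` and `B` increase with the data. -/
theorem exists_local_time (P : Par d) (ha : IsSeries a F) {D : ℝ} (hD : 0 ≤ D) :
    ∃ T₀ : ℝ≥0 → ℝ≥0 → ℝ, (∀ x y, 0 < T₀ x y) ∧ (∀ x x' y y', x ≤ x' → y ≤ y' → T₀ x' y' ≤ T₀ x y) ∧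
      ∀ (U₀ U₁ : Alg P) (x y : ℝ≥0), ‖U₀‖ ≤ D * x → ‖U₁‖ ≤ D * y →
        ∃ v, IsMild Alg.sinR (Alg.free U₀ U₁) (Alg.nl a) (T₀ x y) v := by
  set M : ℝ → ℝ := fun T => propConst d 0 * Real.exp (2 * Real.pi * T) * T with hM
  have hM0 : 0 ≤ M 1 := by have := propConst_nonneg d 0; simp only [hM]; positivity
  have hf := Alg.freeConst_nonneg d
  set R : ℝ≥0 → ℝ≥0 → ℝ := fun x y => Alg.freeConst d * (D * x + D * y) + 1 with hR
  have hR0 : ∀ x y, 0 ≤ R x y + 1 := fun x y => by simp only [hR]; positivity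
  have hRm : ∀ x x' y y', x ≤ x' → y ≤ y' → R x y ≤ R x' y' := fun x x' y y' hx hy => by
    simp only [hR]; gcongr
  set B : ℝ≥0 → ℝ≥0 → ℝ := fun x y => Alg.nlConst P a (R x y + 1) * (R x y + 1) with hB
  have hB0 : ∀ x y, 0 ≤ B x y := fun x y => mul_nonneg (Alg.nlConst_nonneg _) (hR0 x y)
  have hpos : ∀ x y, 0 < M 1 * B x y + 1 := fun x y => by have := mul_nonneg hM0 (hB0 x y); linarith
  refine ⟨fun x y => (M 1 * B x y + 1)⁻¹, fun x y => inv_pos.2 (hpos x y), fun x x' y y' hx hy => ?_,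
    fun U₀ U₁ x y hx hy => ?_⟩
  · refine inv_anti₀ (hpos x y) ?_
    have h1 := hRm x x' y y' hx hy
    have h2 : B x y ≤ B x' y' := by
      refine mul_le_mul (Alg.nlConst_mono ha (hR0 x y) ?_) ?_ (hR0 x y) (Alg.nlConst_nonneg _) <;> linarith
    gcongr
  · refine exists_mild_of_bound (M := M) (R := R x y) (B := B x y) Alg.continuous_sinR (fun T t ht => Alg.norm_sinR_le T t ht)
      (Alg.continuous_free U₀ U₁) (Alg.lipOnBalls_nl ha) (fun t ht => ?_) (hB0 x y) (fun z hz => Alg.norm_nl_le ha hz)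
      (inv_pos.2 (hpos x y)).le (inv_le_one_of_one_le₀ ?_) ?_
    · have h1 := Alg.norm_free_le U₀ U₁ t ht
      have h2 : Alg.freeConst d * (‖U₀‖ + ‖U₁‖) ≤ Alg.freeConst d * (D * x + D * y) := by gcongr
      simp only [hR]; linarith
    · have := mul_nonneg hM0 (hB0 x y); linarith
    · rw [← mul_assoc, mul_inv_le_iff₀ (hpos x y)]; linarith

theorem exists_maximal_solution (hd : 1 ≤ d) (hp : (d : ℝ≥0∞) / ((d : ℝ≥0∞) + 1) < p) (P : Par d) (ha : IsSeries a F) :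
    ∃ T₀ : ℝ≥0 → ℝ≥0 → ℝ,
      (∀ x y, 0 < T₀ x y) ∧
      (∀ x x' y y', x ≤ x' → y ≤ y' → T₀ x' y' ≤ T₀ x y) ∧
      ∀ u₀ ∈ modSpace P.β P.χ p P.s, ∀ u₁ ∈ modSpace P.β P.χ p P.s,
        ∃ (T : ℝ≥0∞) (u : ℝ → 𝓢'(Sp d, ℂ)),
          ENNReal.ofReal (T₀ (modNorm P.β P.χ p P.s u₀).toNNReal (modNorm P.β P.χ p P.s u₁).toNNReal) < T ∧
          IsSolution P.β P.χ p P.s F u₀ u₁ T u ∧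
          (∀ (T' : ℝ≥0∞) (v : ℝ → 𝓢'(Sp d, ℂ)), IsSolution P.β P.χ p P.s F u₀ u₁ T' v →
            T' ≤ T ∧ ∀ t ∈ timeInterval T', v t = u t) ∧
          (T < ∞ → limsup (fun t : ℝ => modNorm P.β P.χ p P.s (u t)) (𝓝[<] T.toReal) = ∞) := by
  obtain ⟨C, hC, hb⟩ := IsBand.exists_enorm_le d hp
  have hD : 0 ≤ Alg.scale P * C.toReal := mul_nonneg Alg.scale_pos.le ENNReal.toReal_nonneg
  obtain ⟨T₀, hpos, hmono, hloc⟩ := exists_local_time P ha hD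
  refine ⟨T₀, hpos, hmono, fun u₀ h₀ u₁ h₁ => ?_⟩
  obtain ⟨U₀, rfl⟩ := exists_alg_of_modNorm hC hb h₀
  obtain ⟨U₁, rfl⟩ := exists_alg_of_modNorm hC hb h₁
  obtain ⟨T, u, hT, hiff, huv, hblow⟩ := exists_maximal_mild Alg.continuous_sinR (fun T t ht => Alg.norm_sinR_le T t ht)
    (Alg.continuous_free U₀ U₁) (Alg.lipOnBalls_nl ha)
  have hsol := isSolution_of_mild hd hp ha h₀ h₁ hT (u := u) fun t ht htT =>
    let ⟨v, hv⟩ := (hiff t ht).1 htT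
    ⟨v, hv, huv t v hv⟩
  refine ⟨T, fun t => distL ((u t).val P), ?_, hsol, fun T' v hv => ⟨?_, fun t ht => ?_⟩, fun hTt => ?_⟩
  -- A solution exists on the closed interval up to `T₀`, whence the strict inequality.
  · exact (hiff _ (hpos _ _).le).2 (hloc U₀ U₁ _ _ (Alg.norm_le_modNorm hC hb _ h₀) (Alg.norm_le_modNorm hC hb _ h₁))
  -- A solution living beyond `T` would restrict to a mild solution on the closed interval `[0, T]`,
  -- which maximality excludes.
  · by_contra! hlt
    have e := ENNReal.ofReal_toReal (ne_top_of_lt hlt)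
    obtain ⟨W, hW, -⟩ := hv.exists_mild hC hb ha ENNReal.toReal_nonneg (e.trans_lt hlt)
    exact lt_irrefl T (e.symm.trans_lt ((hiff _ ENNReal.toReal_nonneg).2 ⟨W, hW⟩))
  · obtain ⟨W, hW, hvW⟩ := hv.exists_mild hC hb ha ht.1 ht.2
    beta_reduce
    rw [hvW t ⟨ht.1, le_rfl⟩, huv t W hW t ⟨ht.1, le_rfl⟩]
  -- With a finite limsup the modulation norm, and by the embedding the algebra norm, would be
  -- bounded near `T`; on the remaining compact interval continuity bounds it. Together they
  -- contradict blow-up in the algebra.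
  · by_contra hne
    obtain ⟨K, hK, hK'⟩ := ENNReal.lt_iff_exists_nnreal_btwn.1 (lt_top_iff_ne_top.2 hne)
    have hev := eventually_lt_of_limsup_lt hK
    have hT0 : 0 < T.toReal := ENNReal.toReal_pos hT.ne' hTt.ne
    obtain ⟨m, hm, hm'⟩ := (mem_nhdsLT_iff_exists_mem_Ico_Ioo_subset hT0).1 hev
    obtain ⟨v, hv⟩ := (hiff m hm.1).1 ((ENNReal.ofReal_lt_iff_lt_toReal hm.1 hTt.ne).2 hm.2)
    obtain ⟨R, hR⟩ := (isCompact_Icc (a := (0 : ℝ)) (b := m)).exists_bound_of_continuousOn hv.1.continuousOn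
    obtain ⟨t, ht0, htT, ht⟩ := hblow hTt (max R (Alg.scale P * C.toReal * K))
    rcases le_or_gt t m with h | h
    · have h2 := hR t ⟨ht0, h⟩
      rw [← huv m v hv t ⟨ht0, h⟩] at h2
      exact absurd (ht.trans_le h2) (le_max_left _ _).not_gt
    · have h2 : modNorm P.β P.χ p P.s (distL ((u t).val P)) < K :=
        hm' ⟨h, (ENNReal.ofReal_lt_iff_lt_toReal ht0 hTt.ne).1 htT⟩
      have h3 := Alg.norm_le_modNorm hC hb (u t) (h2.trans hK')
      have h4 : (modNorm P.β P.χ p P.s (distL ((u t).val P))).toReal ≤ K := ENNReal.toReal_le_coe_of_le_coe h2.le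
      exact absurd (ht.trans_le (h3.trans (mul_le_mul_of_nonneg_left h4 hD))) (le_max_right _ _).not_gt

end Solutions

end NLW

theorem theorem1p2 (d : ℕ) (hd : 1 ≤ d) (p : ℝ≥0∞) (hp : (d : ℝ≥0∞) / ((d : ℝ≥0∞) + 1) < p)
    (s : ℝ) (hs : 0 ≤ s) (β : ℝ) (χ : 𝓢(NLW.Sp d, ℂ)) (hχ : NLW.IsAdmissibleWindow β χ)
    (lam rho : ℝ) (k : ℕ) (F : ℂ → ℂ) (hF : F = NLW.powerNL lam k ∨ F = NLW.expNL lam rho) :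
    ∃ T₀ : ℝ≥0 → ℝ≥0 → ℝ,
      (∀ a b, 0 < T₀ a b) ∧
      (∀ a a' b b', a ≤ a' → b ≤ b' → T₀ a' b' ≤ T₀ a b) ∧
      ∀ u₀ ∈ NLW.modSpace β χ p s, ∀ u₁ ∈ NLW.modSpace β χ p s,
        ∃ (T : ℝ≥0∞) (u : ℝ → 𝓢'(NLW.Sp d, ℂ)),
          ENNReal.ofReal (T₀ (NLW.modNorm β χ p s u₀).toNNReal
            (NLW.modNorm β χ p s u₁).toNNReal) < T ∧
          NLW.IsSolution β χ p s F u₀ u₁ T u ∧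
          (∀ (T' : ℝ≥0∞) (v : ℝ → 𝓢'(NLW.Sp d, ℂ)), NLW.IsSolution β χ p s F u₀ u₁ T' v →
            T' ≤ T ∧ ∀ t ∈ NLW.timeInterval T', v t = u t) ∧
          (T < ∞ → limsup (fun t : ℝ => NLW.modNorm β χ p s (u t)) (𝓝[<] T.toReal) = ∞) := by
  have ha : ∃ a, NLW.IsSeries a F := by
    rcases hF with rfl | rfl
    · exact ⟨_, NLW.isSeries_powerNL lam k⟩
    · exact ⟨_, NLW.isSeries_expNL lam rho⟩
  obtain ⟨a, ha⟩ := ha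
  exact NLW.exists_maximal_solution hd hp ⟨β, χ, s, hχ, hs⟩ ha
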